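/- Let $d\ge 2$, $\sigma_1,\sigma_2\in\mathbb{R}$ with $\sigma_1\neq 0$, let $\rho_0\in L^1\cap L^\infty(\mathbb{R}^d)$, and let $T>0$. Let $\|\cdot\|$ be the norm of $L^2(\mathbb{R}^d)$ and $\Phi$ the fundamental solution of the Laplacian on $\mathbb{R}^d$ ($\Delta\Phi=\delta$). For $\nu\ge 0$, a weak solution on $[0,T]$ with viscosity $\nu$ and initial density $\rho_0$ of $$\partial_t\rho^\nu+v^\nu\cdot\nabla\rho^\nu=\sigma_2(\rho^\nu)^2+\nu\Delta\rho^\nu,\qquad v^\nu=\sigma_1\nabla\Phi*\rho^\nu,\qquad \rho^\nu(0)=\rho_0,$$ is a function $\rho^\nu\in L^\infty(0,T;L^1\cap L^\infty)\cap C([0,T];L^2)$ with $\rho^\nu(0)=\rho_0$, $\partial_t\rho^\nu\in L^2(0,T;H^{-1})$ and, if $\nu>0$, $\rho^\nu\in L^2(0,T;H^1)$, such that for all $\varphi\in C_c^\infty([0,T)\times\mathbb{R}^d)$ $$\int_{\mathbb{R}^d}\rho_0\,\varphi(0)+\int_0^T\!\!\int_{\mathbb{R}^d}\Big(\rho^\nu\partial_t\varphi+\rho^\nu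 v^\nu\cdot\nabla\varphi+(\sigma_1+\sigma_2)(\rho^\nu)^2\varphi-\nu\nabla\rho^\nu\cdot\nabla\varphi\Big)=0 .$$ Let $a\in C^\infty(\mathbb{R}^d)$ be radially symmetric, supported in $B_2(0)$, with $a\equiv 1$ on $B_1(0)$ and $a(x)$ nonincreasing in $|x|$; for $R>0$ put $a_R=a(\cdot/R)$ and $b_R=1-a_R$. Let $K\in\mathbb{R}$, and consider the weak solutions on $[0,T]$ (for all $\nu\ge0$) which satisfy $\|\rho^\nu\|_{L^\infty((0,T)\times\mathbb{R}^d)}\le \max(K,0)$; if $|\sigma_2|\,\|\rho_0\|_{L^\infty}T<1$, consider all weak solutions on $[0,T]$, without this bound. (Each weak solution is considered for a suitable $K$; the distinction concerns only what the constants depend on.) (1) There is a positive, continuous, nondecreasing function $C_0$ on $[0,\infty)$, depending only on $d,\sigma_1,\sigma_2,a,\rho_0,T,K$ (in particular not on $\nu$, $R$ or the solution), such that for all $\nu\ge 0$, all such weak solutions $\rho^\nu$, all $R>0$ and all $t\in[0,T]$ $$\|b_R\rho^\nu(t)\|^2+\nu\int_0^t\|b_R\nabla\rho^\nu\|^2\le\big(\|b_R\rho_0\|^2+C_0(t)\,t\,(\nu+1)R^{-2}\big)e^{C_0(t)t}.$$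 (2) Suppose that for some integer $N\ge2$ and some constant $C$ we have $\|b_R\rho_0\|^2\le CR^{-N}$ for all sufficiently large $R$. Then there is a positive, continuous, nondecreasing function $C_0$ on $[0,\infty)$, depending only on $d,\sigma_1,\sigma_2,a,\rho_0,T,K,N,C$, such that for every $M$ and for all sufficiently large $R$ (depending on $M$), for all $\nu\in[0,M]$, all such weak solutions $\rho^\nu$ and all $t\in[0,T]$ $$\|b_R\rho^\nu(t)\|^2+\nu\int_0^t\|b_R\nabla\rho^\nu\|^2\le\big(C+C_0(t)\,t\,(\nu+1)^2\big)R^{-N}e^{C_0(t)t}.$$ -/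

import Mathlib

open MeasureTheory Set Filter
open scoped ENNReal NNReal ContDiff

noncomputable section

/-- The Euclidean space `ℝ^d`. -/
abbrev RSpace (d : ℕ) : Type := EuclideanSpace ℝ (Fin d)

/-- The real Hilbert space `L²(ℝ^d)`. -/
abbrev L2Scalar (d : ℕ) : Type := Lp ℝ 2 (volume : Measure (RSpace d))

/-- The real Hilbert space `L²(ℝ^d; ℝ^d)`. -/
abbrev L2Vector (d : ℕ) : Type := Lp (RSpace d) 2 (volume : Measure (RSpace d))

/-- The square of the `L²(ℝ^d)`-norm, `∫ |f|²` (for functions that lie in `L²`). -/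
def l2NormSq {d : ℕ} {F : Type} [NormedAddCommGroup F] (f : RSpace d → F) : ℝ :=
  ∫ x, ‖f x‖ ^ 2

/-! ### Sobolev spaces -/

/-- `g` is the weak (distributional) gradient of `u`. -/
def HasWeakGradient {d : ℕ} (u : L2Scalar d) (g : L2Vector d) : Prop :=
  ∀ ψ : RSpace d → ℝ, ContDiff ℝ ∞ ψ → HasCompactSupport ψ → ∀ e : RSpace d,
    ∫ x, u x * fderiv ℝ ψ x e = -∫ x, inner ℝ (g x) e * ψ x

open Classical in
/-- The weak gradient of `u` where it exists in `L²` (it is then unique), and `0` otherwise. -/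
def weakGradient {d : ℕ} (u : L2Scalar d) : L2Vector d :=
  if h : ∃ g, HasWeakGradient u g then h.choose else 0

theorem integrable_mul_test {d : ℕ} (u : L2Scalar d) {ψ : RSpace d → ℝ} (h : Continuous ψ)
    (hc : HasCompactSupport ψ) : Integrable (fun x => u x * ψ x) :=
  MemLp.integrable_mul (p := 2) (q := 2) (Lp.memLp u) (h.memLp_of_hasCompactSupport hc)

theorem integrable_inner_mul_test {d : ℕ} (g : L2Vector d) (e : RSpace d) {ψ : RSpace d → ℝ}
    (h : Continuous ψ) (hc : HasCompactSupport ψ) :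
    Integrable (fun x => inner ℝ (g x) e * ψ x) :=
  MemLp.integrable_mul (p := 2) (q := 2) ((Lp.memLp g).inner_const e)
    (h.memLp_of_hasCompactSupport hc)

theorem integrable_mul_fderiv_test {d : ℕ} (u : L2Scalar d) {ψ : RSpace d → ℝ}
    (h : ContDiff ℝ ∞ ψ) (hc : HasCompactSupport ψ) (e : RSpace d) :
    Integrable (fun x => u x * fderiv ℝ ψ x e) :=
  integrable_mul_test u ((h.continuous_fderiv (by simp)).clm_apply continuous_const)
    (hc.fderiv_apply (𝕜 := ℝ) e)

theorem HasWeakGradient.zero {d : ℕ} : HasWeakGradient (0 : L2Scalar d) 0 := by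
  intro ψ _ _ e
  have h1 : ∫ x, (0 : L2Scalar d) x * fderiv ℝ ψ x e = 0 := by
    rw [← integral_zero (RSpace d) ℝ]
    refine integral_congr_ae ?_
    filter_upwards [Lp.coeFn_zero ℝ 2 (volume : Measure (RSpace d))] with x hx
    rw [hx, Pi.zero_apply, zero_mul]
  have h2 : ∫ x, inner ℝ ((0 : L2Vector d) x) e * ψ x = 0 := by
    rw [← integral_zero (RSpace d) ℝ]
    refine integral_congr_ae ?_
    filter_upwards [Lp.coeFn_zero (RSpace d) 2 (volume : Measure (RSpace d))] with x hx
    rw [hx, Pi.zero_apply, inner_zero_left, zero_mul]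
  rw [h1, h2, neg_zero]

theorem HasWeakGradient.add {d : ℕ} {u u' : L2Scalar d} {g g' : L2Vector d}
    (h : HasWeakGradient u g) (h' : HasWeakGradient u' g') :
    HasWeakGradient (u + u') (g + g') := by
  intro ψ hψ hc e
  have h1 : ∫ x, (u + u') x * fderiv ℝ ψ x e
      = (∫ x, u x * fderiv ℝ ψ x e) + ∫ x, u' x * fderiv ℝ ψ x e := by
    rw [← integral_add (integrable_mul_fderiv_test u hψ hc e)
      (integrable_mul_fderiv_test u' hψ hc e)]
    refine integral_congr_ae ?_
    filter_upwards [Lp.coeFn_add u u'] with x hx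
    rw [hx, Pi.add_apply, add_mul]
  have h2 : ∫ x, inner ℝ ((g + g') x) e * ψ x
      = (∫ x, inner ℝ (g x) e * ψ x) + ∫ x, inner ℝ (g' x) e * ψ x := by
    rw [← integral_add (integrable_inner_mul_test g e hψ.continuous hc)
      (integrable_inner_mul_test g' e hψ.continuous hc)]
    refine integral_congr_ae ?_
    filter_upwards [Lp.coeFn_add g g'] with x hx
    rw [hx, Pi.add_apply, inner_add_left, add_mul]
  rw [h1, h2, h ψ hψ hc e, h' ψ hψ hc e, neg_add]

theorem HasWeakGradient.smul {d : ℕ} (c : ℝ) {u : L2Scalar d} {g : L2Vector d}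
    (h : HasWeakGradient u g) : HasWeakGradient (c • u) (c • g) := by
  intro ψ hψ hc e
  have h1 : ∫ x, (c • u) x * fderiv ℝ ψ x e = c * ∫ x, u x * fderiv ℝ ψ x e := by
    rw [← integral_const_mul]
    refine integral_congr_ae ?_
    filter_upwards [Lp.coeFn_smul c u] with x hx
    simp [hx, mul_assoc]
  have h2 : ∫ x, inner ℝ ((c • g) x) e * ψ x = c * ∫ x, inner ℝ (g x) e * ψ x := by
    rw [← integral_const_mul]
    refine integral_congr_ae ?_
    filter_upwards [Lp.coeFn_smul c g] with x hx
    simp [hx, inner_smul_left, mul_assoc]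
  rw [h1, h2, h ψ hψ hc e, mul_neg]

/-- The pairs `(u, ∇u)` with `u ∈ H¹(ℝ^d)`, as a subspace of `L² × L²`. -/
def sobolevPairs (d : ℕ) : Submodule ℝ (WithLp 2 (L2Scalar d × L2Vector d)) where
  carrier := {p | HasWeakGradient p.fst p.snd}
  zero_mem' := HasWeakGradient.zero
  add_mem' h h' := HasWeakGradient.add h h'
  smul_mem' c _ h := HasWeakGradient.smul c h

/-- The Sobolev space `H¹(ℝ^d)`, realized as the space of pairs `(u, ∇u)`, with the norm
`(‖u‖² + ‖∇u‖²)^{1/2}`. -/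
def SobolevH1 (d : ℕ) : Type := sobolevPairs d

instance (d : ℕ) : NormedAddCommGroup (SobolevH1 d) :=
  inferInstanceAs (NormedAddCommGroup (sobolevPairs d))

instance (d : ℕ) : InnerProductSpace ℝ (SobolevH1 d) :=
  inferInstanceAs (InnerProductSpace ℝ (sobolevPairs d))

/-- The inclusion of `H¹(ℝ^d)` into `L²(ℝ^d)`. -/
def SobolevH1.toL2 {d : ℕ} (w : SobolevH1 d) : L2Scalar d := w.1.fst

/-- The Sobolev space `H⁻¹(ℝ^d)`, the dual of `H¹(ℝ^d)`. -/
abbrev SobolevHneg1 (d : ℕ) : Type := StrongDual ℝ (SobolevH1 d)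

/-- `∂_t ρ ∈ L²(0, T; H⁻¹)`: the distributional time derivative of `ρ` on `(0, T)` is
(represented by) a square integrable function with values in `H⁻¹`. -/
def TimeDerivInL2Hneg1 {d : ℕ} (T : ℝ) (ρ : ℝ → L2Scalar d) : Prop :=
  ∃ G : ℝ → SobolevHneg1 d, MemLp G 2 (volume.restrict (Icc 0 T)) ∧
    ∀ θ : ℝ → ℝ, ContDiff ℝ ∞ θ → HasCompactSupport θ → tsupport θ ⊆ Ioo 0 T →
      ∀ w : SobolevH1 d,
        ∫ t in (0 : ℝ)..T, deriv θ t * inner ℝ (ρ t) w.toL2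
          = -∫ t in (0 : ℝ)..T, θ t * G t w

/-! ### The equations -/

/-- The Newtonian potential, that is, the fundamental solution `Φ` of the Laplacian
(`ΔΦ = δ`) on `ℝ^d`, `d ≥ 2`. -/
def newtonPotential (d : ℕ) (x : RSpace d) : ℝ :=
  if d = 2 then (2 * Real.pi)⁻¹ * Real.log ‖x‖
  else -(d * (d - 2) * volume.real (Metric.ball (0 : RSpace d) 1))⁻¹ * (‖x‖ ^ (d - 2))⁻¹

/-- The velocity `v = σ₁ ∇Φ * ρ`. -/
def velocity {d : ℕ} (σ₁ : ℝ) (ρ : RSpace d → ℝ) (x : RSpace d) : RSpace d :=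
  σ₁ • ∫ y, ρ y • gradient (newtonPotential d) (x - y)

/-- `ρ` is a weak solution on `[0, T]`, with viscosity `ν` and initial density `ρ₀`, of
`∂_t ρ + v · ∇ρ = σ₂ ρ² + ν Δρ`, `v = σ₁ ∇Φ * ρ`, `ρ(0) = ρ₀`. -/
structure IsWeakSolution {d : ℕ} (σ₁ σ₂ ν : ℝ) (ρ₀ : RSpace d → ℝ) (T : ℝ)
    (ρ : ℝ → L2Scalar d) : Prop where
  /-- `ρ(0) = ρ₀`. -/
  initial : ρ 0 =ᵐ[volume] ρ₀
  /-- `ρ ∈ C([0, T]; L²)`. -/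
  continuousOn : ContinuousOn ρ (Icc 0 T)
  /-- `ρ ∈ L^∞(0, T; L¹ ∩ L^∞)`. -/
  bounded : ∃ B : ℝ≥0, ∀ᵐ t ∂(volume.restrict (Icc 0 T)),
    eLpNorm (ρ t) 1 volume ≤ B ∧ eLpNorm (ρ t) ∞ volume ≤ B
  /-- `∂_t ρ ∈ L²(0, T; H⁻¹)`. -/
  timeDeriv : TimeDerivInL2Hneg1 T ρ
  /-- `ρ ∈ L²(0, T; H¹)` if `ν > 0`. -/
  sobolev : 0 < ν → (∀ᵐ t ∂(volume.restrict (Icc 0 T)), ∃ g, HasWeakGradient (ρ t) g) ∧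
    MemLp (fun t => weakGradient (ρ t)) 2 (volume.restrict (Icc 0 T))
  /-- The equation, tested with `φ ∈ C_c^∞([0, T) × ℝ^d)`. -/
  weakForm : ∀ φ : ℝ → RSpace d → ℝ, ContDiff ℝ ∞ (Function.uncurry φ) →
    HasCompactSupport (Function.uncurry φ) →
    tsupport (Function.uncurry φ) ⊆ Iio T ×ˢ (univ : Set (RSpace d)) →
    (∫ x, ρ₀ x * φ 0 x)
      + ∫ t in (0 : ℝ)..T, ∫ x,
        (ρ t x * deriv (fun s => φ s x) t
          + ρ t x * inner ℝ (velocity σ₁ (ρ t) x) (gradient (φ t) x)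
          + (σ₁ + σ₂) * (ρ t x) ^ 2 * φ t x
          - ν * inner ℝ (weakGradient (ρ t) x) (gradient (φ t) x)) = 0

/-! ### Cutoffs and tails -/

/-- A smooth radial cutoff function, supported in `B_2(0)`, equal to `1` on `B_1(0)`, and
nonincreasing in `|x|`. -/
structure IsRadialCutoff {d : ℕ} (a : RSpace d → ℝ) : Prop where
  smooth : ContDiff ℝ ∞ a
  radial : ∀ x y, ‖x‖ = ‖y‖ → a x = a y
  support_subset : Function.support a ⊆ Metric.ball 0 2
  eq_one : ∀ x ∈ Metric.ball (0 : RSpace d) 1, a x = 1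
  nonincreasing : ∀ x y, ‖x‖ ≤ ‖y‖ → a y ≤ a x

/-- `b_R = 1 - a_R`, where `a_R = a(· / R)`. -/
def tailCutoff {d : ℕ} (a : RSpace d → ℝ) (R : ℝ) (x : RSpace d) : ℝ :=
  1 - a (R⁻¹ • x)

/-- `‖b_R ρ(t)‖² + ν ∫_0^t ‖b_R ∇ρ(s)‖² ds`. -/
def tailEnergy {d : ℕ} (a : RSpace d → ℝ) (ν R : ℝ) (ρ : ℝ → L2Scalar d) (t : ℝ) : ℝ :=
  l2NormSq (fun x => tailCutoff a R x * ρ t x)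
    + ν * ∫ s in (0 : ℝ)..t, l2NormSq (fun x => tailCutoff a R x • weakGradient (ρ s) x)

/-- A positive, continuous, nondecreasing function of `t ∈ [0, ∞)`. -/
structure IsTimeConstant (C₀ : ℝ → ℝ) : Prop where
  pos : ∀ t, 0 ≤ t → 0 < C₀ t
  continuousOn : ContinuousOn C₀ (Ici 0)
  monotoneOn : MonotoneOn C₀ (Ici 0)

/-- The bounds on the solution that the constants may depend on: either `[0, T]` lies within
the guaranteed time of existence, `|σ₂| ‖ρ₀‖_{L^∞} T < 1`, or
`‖ρ‖_{L^∞(0, T; L^∞)} ≤ K`. For a given weak solution the latter holds for some `K`. -/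
def IsControlled {d : ℕ} (σ₂ : ℝ) (ρ₀ : RSpace d → ℝ) (T K : ℝ) (ρ : ℝ → L2Scalar d) : Prop :=
  |σ₂| * (eLpNorm ρ₀ ∞ volume).toReal * T < 1 ∨
    ∀ᵐ t ∂(volume.restrict (Icc 0 T)), eLpNorm (ρ t) ∞ volume ≤ ENNReal.ofReal K

end

noncomputable section
open scoped Topology

/-! ### The gradient of the Newtonian potential -/

/-! Write `V = ∇Φ * ρ`, so that `v = σ₁ V` and `div v = σ₁ ρ`. Multiplying the equation formally by
`2 ρ ψ`, with a cutoff `ψ` in space, gives `d/dt ∫ ψ ρ² + 2ν ∫ ψ |∇ρ|² = ∫ ρ² (v · ∇ψ + ν Δψ) + (σ₁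
+ 2σ₂) ∫ ψ ρ³`. Take `ψ = b_R²`. The cubic term is at most a constant times the tail itself, so
Grönwall's inequality applies and only the derivatives of the cutoff produce a source.

For (1), `∇ψ = -2 b_R ∇a_R` and `v` is bounded, so by Young's inequality `|v · ∇ψ|` is at most a
constant times `b_R² + |∇a_R|²`. Both `|∇a_R|²` and `Δψ` are of order `R⁻²`
(`exists_tailEnergy_le`).

For (2), the derivatives of `ψ` vanish on `B_R`, and outside `B_R` one has `b_{R/2} = 1`. The source
is therefore at most a constant times `R⁻¹ ‖b_{R/2} ρ‖²`; here `ν R⁻² ≤ R⁻¹` as soon as `R ≥ ν`,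
which is why `R` must be large depending on the bound for `ν`. Decay of order `R⁻ᵏ` thus improves to
`R⁻ᵏ⁻¹` (`exists_tailEnergy_le_of_decay`), and induction from the trivial case `k = 0` reaches `N`
(`exists_tail_decay`).

The constants involve the norms of `ρ` in `L¹` and `L^∞`, which have to be bounded by the data
(`exists_uniform_bounds`): in `L^∞` by comparison with `y' = |σ₂| y²` unless the bound `K` is given,
and then in `L¹` by Grönwall's inequality.

The formal computation has to be justified for weak solutions, which for `ν = 0` have no derivatives
in space. This is done by renormalization in the manner of DiPerna and Lions. The mollified density
satisfies the equation up to a commutator, which tends to `0` in `L¹_loc`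
(`tendsto_lintegral_commutator`) because `∇V` is in `L²`; for smooth densities the latter is the
bound `‖∇V‖ ≤ ‖ρ‖` obtained by integrating by parts (`integral_ball_hessian_le`). For convex `h` the
limit is an inequality for `∫ ψ h(q ρ)` with a scalar factor `q(t)`
(`IsBoundedCurve.renormalized_inequality`), the viscous term being kept by Fatou's lemma. The `L^∞`
bound, the `L¹` bound and the tail estimate are three choices of `h`, `q` and `ψ` in it. -/

/-- The normalization `1 / (d |B₁|)` of the gradient of the Newtonian potential. -/
def newtonConst (d : ℕ) : ℝ := (d * volume.real (Metric.ball (0 : RSpace d) 1))⁻¹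

theorem newtonConst_pos {d : ℕ} (hd : 2 ≤ d) : 0 < newtonConst d := by
  have h1 : 0 < volume.real (Metric.ball (0 : RSpace d) 1) :=
    ENNReal.toReal_pos (Metric.measure_ball_pos _ _ one_pos).ne' measure_ball_lt_top.ne
  have h2 : (0 : ℝ) < d := by positivity
  unfold newtonConst; positivity

/-- The kernel `x / (d |B₁| |x|^d)`. -/
def newtonKernel (d : ℕ) (x : RSpace d) : RSpace d := (newtonConst d * (‖x‖ ^ d)⁻¹) • x

theorem hasFDerivAt_norm_sq_apply {d : ℕ} (x : RSpace d) :
    HasFDerivAt (fun y : RSpace d => ‖y‖ ^ 2) (2 • innerSL ℝ x) x :=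
  (hasStrictFDerivAt_norm_sq x).hasFDerivAt

theorem gradient_newtonPotential {d : ℕ} (hd : 2 ≤ d) {x : RSpace d} (hx : x ≠ 0) :
    gradient (newtonPotential d) x = newtonKernel d x := by
  have hn : 0 < ‖x‖ := norm_pos_iff.2 hx
  have hnorm : HasFDerivAt (fun y : RSpace d => ‖y‖) (‖x‖⁻¹ • innerSL ℝ x) x := by
    have h := (hasFDerivAt_norm_sq_apply x).sqrt (by positivity)
    have h2 : (fun y : RSpace d => √(‖y‖ ^ 2)) = fun y => ‖y‖ := by
      funext y; exact Real.sqrt_sq (norm_nonneg y)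
    rw [h2, Real.sqrt_sq hn.le] at h
    refine h.congr_fderiv ?_
    ext y
    simp
    field_simp
  apply HasGradientAt.gradient
  rw [hasGradientAt_iff_hasFDerivAt]
  by_cases h2 : d = 2
  · subst h2
    have hF : newtonPotential 2 = fun y : RSpace 2 => (2 * Real.pi)⁻¹ * Real.log ‖y‖ := by
      funext y; simp [newtonPotential]
    rw [hF]
    have := (hnorm.log hn.ne').const_mul (2 * Real.pi)⁻¹
    refine this.congr_fderiv ?_
    ext y
    have hv : volume.real (Metric.ball (0 : RSpace 2) 1) = Real.pi := by
      rw [Measure.real, EuclideanSpace.volume_ball_fin_two]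
      simp [Real.pi_pos.le]
    simp [newtonKernel, newtonConst, hv]
    field_simp
  · have hF : newtonPotential d = fun y : RSpace d =>
        -(d * (d - 2) * volume.real (Metric.ball (0 : RSpace d) 1))⁻¹ * (‖y‖ ^ (d - 2))⁻¹ := by
      funext y; simp [newtonPotential, h2]
    rw [hF]
    have hp : HasFDerivAt (fun y : RSpace d => ‖y‖ ^ (d - 2)) _ x :=
      (HasDerivAt.pow (hasDerivAt_id ‖x‖) (d - 2)).comp_hasFDerivAt x hnorm
    have hne : (‖x‖ ^ (d - 2)) ≠ 0 := by positivity
    have hi : HasFDerivAt (fun y : RSpace d => (‖y‖ ^ (d - 2))⁻¹) _ x :=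
      (hasDerivAt_inv hne).comp_hasFDerivAt x hp
    refine (hi.const_mul (-(d * (d - 2) * volume.real (Metric.ball (0 : RSpace d) 1))⁻¹)).congr_fderiv ?_
    ext y
    have hv : 0 < volume.real (Metric.ball (0 : RSpace d) 1) :=
      ENNReal.toReal_pos (Metric.measure_ball_pos _ _ one_pos).ne' measure_ball_lt_top.ne
    obtain ⟨m, rfl⟩ : ∃ m, d = m + 3 := ⟨d - 3, by omega⟩
    have e1 : m + 3 - 2 = m + 1 := by omega
    simp only [e1, newtonKernel, newtonConst]
    generalize volume.real (Metric.ball (0 : RSpace (m + 3)) 1) = V at hv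
    simp
    have h3 : (m : ℝ) + 3 - 2 ≠ 0 := by
      have : (0 : ℝ) ≤ m := by positivity
      linarith
    have h4 : (m : ℝ) + 3 ≠ 0 := by positivity
    field_simp
    ring

theorem ae_ne_zero {d : ℕ} (hd : 2 ≤ d) : ∀ᵐ x : RSpace d, x ≠ 0 := by
  have : Nonempty (Fin d) := ⟨⟨0, by omega⟩⟩
  have : ({0}ᶜ : Set (RSpace d)) ∈ ae (volume : Measure (RSpace d)) :=
    compl_mem_ae_iff.2 (measure_singleton _)
  exact this

theorem norm_newtonKernel {d : ℕ} (hd : 2 ≤ d) (x : RSpace d) :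
    ‖newtonKernel d x‖ = newtonConst d * (‖x‖ ^ (d - 1))⁻¹ := by
  have hc := newtonConst_pos hd
  rw [newtonKernel, norm_smul, Real.norm_of_nonneg (by positivity)]
  obtain ⟨m, rfl⟩ : ∃ m, d = m + 2 := ⟨d - 2, by omega⟩
  rcases eq_or_ne x 0 with rfl | hx
  · simp
  · have : 0 < ‖x‖ := norm_pos_iff.2 hx
    simp
    field_simp
    ring

theorem norm_newtonKernel_le_of_one_le {d : ℕ} (hd : 2 ≤ d) {r : ℝ} (hr : 1 ≤ r) {x : RSpace d}
    (hx : r ≤ ‖x‖) : ‖newtonKernel d x‖ ≤ newtonConst d * r⁻¹ := by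
  rw [norm_newtonKernel hd]
  have := newtonConst_pos hd
  have h1 : r ≤ ‖x‖ ^ (d - 1) :=
    hx.trans (le_self_pow₀ (hr.trans hx) (by omega))
  gcongr

theorem measurable_newtonKernel (d : ℕ) : Measurable (newtonKernel d) := by
  unfold newtonKernel
  exact (measurable_const.mul ((measurable_norm.pow_const d).inv)).smul measurable_id

/-- The kernel has size `|x|^(1 - d)`, an exponent above the critical `-d`. -/
theorem locallyIntegrable_newtonKernel {d : ℕ} (hd : 2 ≤ d) :
    LocallyIntegrable (newtonKernel d) := by
  have hf : Module.finrank ℝ (RSpace d) = d := finrank_euclideanSpace_fin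
  refine locallyIntegrable_of_norm_le_rpow (C := newtonConst d) (α := (d : ℝ) - 1) ?_ ?_
    ?_ (measurable_newtonKernel d).aestronglyMeasurable
  · rw [hf]; omega
  · rw [hf]; linarith
  · refine Eventually.of_forall fun x => ?_
    rw [norm_newtonKernel hd]
    rw [Real.rpow_neg (norm_nonneg _)]
    have : ((d : ℝ) - 1) = ((d - 1 : ℕ) : ℝ) := by
      rw [Nat.cast_sub (by omega)]; simp
    rw [this, Real.rpow_natCast]

/-! ### Regularized kernel -/

/-- The regularization `x / (d |B₁| (|x|² + δ²)^{d/2})` of the kernel. -/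
def regKernel (d : ℕ) (δ : ℝ) (x : RSpace d) : RSpace d :=
  (newtonConst d * (‖x‖ ^ 2 + δ ^ 2) ^ (-(d : ℝ) / 2)) • x

/-- The divergence of the regularized kernel. -/
def regDiv (d : ℕ) (δ : ℝ) (x : RSpace d) : ℝ :=
  newtonConst d * d * δ ^ 2 * (‖x‖ ^ 2 + δ ^ 2) ^ (-(d : ℝ) / 2 - 1)

theorem hasFDerivAt_regKernel_inner {d : ℕ} {δ : ℝ} (hδ : 0 < δ) (e x : RSpace d) :
    HasFDerivAt (fun y => inner ℝ (regKernel d δ y) e)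
      (newtonConst d • ((‖x‖ ^ 2 + δ ^ 2) ^ (-(d : ℝ) / 2) • innerSL ℝ e
        - (d * (‖x‖ ^ 2 + δ ^ 2) ^ (-(d : ℝ) / 2 - 1) * inner ℝ x e) • innerSL ℝ x)) x := by
  have h1 : HasFDerivAt (fun y : RSpace d => ‖y‖ ^ 2 + δ ^ 2) (2 • innerSL ℝ x) x :=
    (hasFDerivAt_norm_sq_apply x).add_const _
  have h2 := (h1.rpow_const (p := -(d : ℝ) / 2) (Or.inl (by positivity))).const_mul (newtonConst d)
  have h3 : HasFDerivAt (fun y : RSpace d => inner ℝ y e) (innerSL ℝ e) x := by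
    have := (innerSL ℝ e).hasFDerivAt (x := x)
    refine this.congr_of_eventuallyEq (Eventually.of_forall fun y => ?_)
    simp [real_inner_comm]
  have h4 := h2.mul h3
  have h5 : (fun y => inner ℝ (regKernel d δ y) e)
      = fun y : RSpace d => newtonConst d * (‖y‖ ^ 2 + δ ^ 2) ^ (-(d : ℝ) / 2) * inner ℝ y e := by
    funext y; simp [regKernel, inner_smul_left]
  rw [h5]
  refine h4.congr_fderiv ?_
  ext y
  simp
  ring

theorem continuous_regKernel {d : ℕ} {δ : ℝ} (hδ : 0 < δ) : Continuous (regKernel d δ) := by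
  unfold regKernel
  have : Continuous fun x : RSpace d => (‖x‖ ^ 2 + δ ^ 2) ^ (-(d : ℝ) / 2) :=
    Continuous.rpow_const (by fun_prop) fun x => Or.inl (by positivity)
  fun_prop

theorem continuous_regKernel_deriv {d : ℕ} {δ : ℝ} (hδ : 0 < δ) (e e' : RSpace d) :
    Continuous fun x => fderiv ℝ (fun y => inner ℝ (regKernel d δ y) e) x e' := by
  have : (fun x => fderiv ℝ (fun y => inner ℝ (regKernel d δ y) e) x e')
    = fun x : RSpace d => newtonConst d * ((‖x‖ ^ 2 + δ ^ 2) ^ (-(d : ℝ) / 2) * inner ℝ e e'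
        - (d * (‖x‖ ^ 2 + δ ^ 2) ^ (-(d : ℝ) / 2 - 1) * inner ℝ x e) * inner ℝ x e') := by
    funext x
    rw [(hasFDerivAt_regKernel_inner hδ e x).fderiv]
    simp
  rw [this]
  have hh : ∀ p : ℝ, Continuous fun x : RSpace d => (‖x‖ ^ 2 + δ ^ 2) ^ p := fun p =>
    Continuous.rpow_const (by fun_prop) fun x => Or.inl (by positivity)
  have := hh (-(d : ℝ) / 2)
  have := hh (-(d : ℝ) / 2 - 1)
  fun_prop

theorem integral_regKernel_fderiv {d : ℕ} {δ : ℝ} (hδ : 0 < δ) {ζ : RSpace d → ℝ}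
    (hζ : ContDiff ℝ 1 ζ) (hc : HasCompactSupport ζ) (e e' : RSpace d) :
    ∫ x, inner ℝ (regKernel d δ x) e * fderiv ℝ ζ x e'
      = -∫ x, fderiv ℝ (fun y => inner ℝ (regKernel d δ y) e) x e' * ζ x := by
  have hk : Continuous fun x => inner ℝ (regKernel d δ x) e :=
    (continuous_regKernel hδ).inner continuous_const
  have hfc : HasCompactSupport fun x => fderiv ℝ ζ x e' := hc.fderiv_apply (𝕜 := ℝ) e'
  have hfd : Continuous fun x => fderiv ℝ ζ x e' :=
    (hζ.continuous_fderiv (by simp)).clm_apply continuous_const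
  refine integral_mul_fderiv_eq_neg_fderiv_mul_of_integrable ?_ ?_ ?_ ?_ ?_
  · exact ((continuous_regKernel_deriv hδ e e').mul hζ.continuous).integrable_of_hasCompactSupport
      hc.mul_left
  · exact (hk.mul hfd).integrable_of_hasCompactSupport hfc.mul_left
  · exact (hk.mul hζ.continuous).integrable_of_hasCompactSupport hc.mul_left
  · exact fun x _ => (hasFDerivAt_regKernel_inner hδ e x).differentiableAt
  · exact fun x _ => hζ.differentiable (by simp) x

/-- A dominating function independent of `δ`, for the passage `δ → 0` in integrals against test
functions. -/
theorem norm_regKernel_le {d : ℕ} (hd : 2 ≤ d) (δ : ℝ) (x : RSpace d) :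
    ‖regKernel d δ x‖ ≤ ‖newtonKernel d x‖ := by
  have hc := newtonConst_pos hd
  rcases eq_or_ne x 0 with rfl | hx
  · simp [regKernel, newtonKernel]
  have hn : 0 < ‖x‖ := norm_pos_iff.2 hx
  rw [regKernel, newtonKernel, norm_smul, norm_smul, Real.norm_of_nonneg (by positivity),
    Real.norm_of_nonneg (by positivity)]
  have : (‖x‖ ^ d)⁻¹ = (‖x‖ ^ 2) ^ (-(d : ℝ) / 2) := by
    rw [← Real.rpow_natCast ‖x‖ 2, ← Real.rpow_mul hn.le, ← Real.rpow_natCast, ← Real.rpow_neg hn.le]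
    congr 1; push_cast; ring
  rw [this]
  gcongr ?_ * ?_
  gcongr ?_ * ?_
  refine Real.rpow_le_rpow_of_nonpos (by positivity) (by nlinarith [sq_nonneg δ]) ?_
  have : (0 : ℝ) ≤ d := by positivity
  linarith

theorem tendsto_regKernel {d : ℕ} {x : RSpace d} (hx : x ≠ 0) :
    Tendsto (fun δ => regKernel d δ x) (𝓝[>] 0) (𝓝 (newtonKernel d x)) := by
  have hn : 0 < ‖x‖ := norm_pos_iff.2 hx
  have : (‖x‖ ^ d)⁻¹ = (‖x‖ ^ 2 + 0 ^ 2) ^ (-(d : ℝ) / 2) := by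
    rw [zero_pow two_ne_zero, add_zero, ← Real.rpow_natCast ‖x‖ 2, ← Real.rpow_mul hn.le,
      ← Real.rpow_natCast, ← Real.rpow_neg hn.le]
    congr 1; push_cast; ring
  unfold regKernel newtonKernel
  rw [this]
  refine Tendsto.smul_const (Tendsto.const_mul _ ?_) _
  have hcont : ContinuousAt (fun δ : ℝ => (‖x‖ ^ 2 + δ ^ 2) ^ (-(d : ℝ) / 2)) 0 :=
    ContinuousAt.rpow_const (by fun_prop) (Or.inl (by positivity))
  exact hcont.tendsto.mono_left nhdsWithin_le_nhds

theorem tendsto_integral_regKernel {d : ℕ} (hd : 2 ≤ d) {θ : RSpace d → ℝ}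
    (hθ : Continuous θ) (hc : HasCompactSupport θ) (e : RSpace d) :
    Tendsto (fun δ => ∫ x, inner ℝ (regKernel d δ x) e * θ x) (𝓝[>] 0)
      (𝓝 (∫ x, inner ℝ (newtonKernel d x) e * θ x)) := by
  have hdom : Integrable fun x => ‖newtonKernel d x‖ * (‖e‖ * ‖θ x‖) := by
    have := ((locallyIntegrable_newtonKernel hd).integrable_smul_left_of_hasCompactSupport
      hθ hc).norm.const_mul ‖e‖
    refine this.congr (Eventually.of_forall fun x => ?_)
    simp only [norm_smul]
    ring
  refine tendsto_integral_filter_of_dominated_convergence _ ?_ ?_ hdom ?_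
  · filter_upwards [self_mem_nhdsWithin] with δ hδ
    exact (((continuous_regKernel hδ).inner continuous_const).mul hθ).aestronglyMeasurable
  · refine Eventually.of_forall fun δ => Eventually.of_forall fun x => ?_
    rw [norm_mul, ← mul_assoc]
    gcongr
    exact (norm_inner_le_norm _ _).trans (by gcongr; exact norm_regKernel_le hd δ x)
  · filter_upwards [ae_ne_zero hd] with x hx
    exact ((tendsto_regKernel hx).inner tendsto_const_nhds).mul_const _

/-- The regularized kernel has a symmetric Jacobian, so integrating by parts makes both sides agree
for every `δ`; the limit removes the regularization. This is the weak form of the kernel being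
curl-free. -/
theorem integral_newtonKernel_fderiv_symm {d : ℕ} (hd : 2 ≤ d) {ζ : RSpace d → ℝ}
    (hζ : ContDiff ℝ 1 ζ) (hc : HasCompactSupport ζ) (e e' : RSpace d) :
    ∫ x, inner ℝ (newtonKernel d x) e * fderiv ℝ ζ x e'
      = ∫ x, inner ℝ (newtonKernel d x) e' * fderiv ℝ ζ x e := by
  have hfd : ∀ e, Continuous fun x => fderiv ℝ ζ x e := fun e =>
    (hζ.continuous_fderiv (by simp)).clm_apply continuous_const
  have h1 := tendsto_integral_regKernel hd (hfd e') (hc.fderiv_apply (𝕜 := ℝ) e') e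
  have h2 := tendsto_integral_regKernel hd (hfd e) (hc.fderiv_apply (𝕜 := ℝ) e) e'
  refine tendsto_nhds_unique h1 (h2.congr' ?_)
  filter_upwards [self_mem_nhdsWithin] with δ hδ
  rw [integral_regKernel_fderiv hδ hζ hc, integral_regKernel_fderiv hδ hζ hc]
  congr 2
  funext x
  rw [(hasFDerivAt_regKernel_inner hδ e x).fderiv, (hasFDerivAt_regKernel_inner hδ e' x).fderiv]
  simp only [_root_.smul_apply, _root_.sub_apply, innerSL_apply_apply,
    smul_eq_mul]
  rw [real_inner_comm e e']
  ring

/-- In polar coordinates the integrand is, up to constants, the derivative of `y ^ d * (y ^ 2 + 1) ^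
(-d / 2)`, which rises from `0` to `1`; `newtonConst` cancels the area `d |B₁|` of the unit sphere.
-/
theorem integral_regDiv_one {d : ℕ} (hd : 2 ≤ d) : ∫ x, regDiv d 1 x = 1 := by
  have : Nontrivial (RSpace d) := by
    have : Nonempty (Fin d) := ⟨⟨0, by omega⟩⟩
    infer_instance
  have hf : Module.finrank ℝ (RSpace d) = d := finrank_euclideanSpace_fin
  have hd0 : (0 : ℝ) < d := by positivity
  have hv : 0 < volume.real (Metric.ball (0 : RSpace d) 1) :=
    ENNReal.toReal_pos (Metric.measure_ball_pos _ _ one_pos).ne' measure_ball_lt_top.ne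
  have h := integral_fun_norm_addHaar (volume : Measure (RSpace d))
    (fun r : ℝ => newtonConst d * d * 1 ^ 2 * (r ^ 2 + 1 ^ 2) ^ (-(d : ℝ) / 2 - 1))
  unfold regDiv
  rw [h, hf]
  have key : ∫ y in Ioi (0 : ℝ), (d : ℝ) * y ^ (d - 1) * (y ^ 2 + 1) ^ (-(d : ℝ) / 2 - 1)
      = 1 - (0 : ℝ) ^ d * (0 ^ 2 + 1) ^ (-(d : ℝ) / 2) := by
    refine integral_Ioi_of_hasDerivAt_of_nonneg'
      (g := fun y : ℝ => y ^ d * (y ^ 2 + 1) ^ (-(d : ℝ) / 2)) ?_ ?_ ?_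
    · intro y hy
      have hy2 : (0 : ℝ) < y ^ 2 + 1 := by positivity
      have h1 : HasDerivAt (fun y : ℝ => y ^ 2 + 1) (2 * y) y := by
        simpa using (hasDerivAt_pow 2 y).add_const (1 : ℝ)
      have h2 := (hasDerivAt_pow d y).mul (h1.rpow_const (p := -(d : ℝ) / 2) (Or.inl hy2.ne'))
      refine h2.congr_deriv ?_
      have e1 : (y ^ 2 + 1) ^ (-(d : ℝ) / 2) = (y ^ 2 + 1) ^ (-(d : ℝ) / 2 - 1) * (y ^ 2 + 1) := by
        rw [← Real.rpow_add_one hy2.ne']; congr 1; ring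
      rw [e1]
      obtain ⟨m, rfl⟩ : ∃ m, d = m + 1 := ⟨d - 1, by omega⟩
      simp only [Nat.add_sub_cancel]
      ring
    · intro y hy
      have : (0 : ℝ) < y := hy
      positivity
    · have : Tendsto (fun y : ℝ => (1 + (y ^ 2)⁻¹) ^ (-(d : ℝ) / 2)) atTop (𝓝 ((1 + 0) ^ (-(d : ℝ) / 2))) := by
        refine Tendsto.rpow_const ?_ (Or.inl (by norm_num))
        exact tendsto_const_nhds.add (tendsto_inv_atTop_zero.comp (tendsto_pow_atTop two_ne_zero))
      simp only [add_zero, Real.one_rpow] at this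
      refine this.congr' ?_
      filter_upwards [eventually_gt_atTop 0] with y hy
      have e2 : y ^ d = (y ^ 2) ^ ((d : ℝ) / 2) := by
        rw [← Real.rpow_natCast y 2, ← Real.rpow_mul hy.le, ← Real.rpow_natCast]
        congr 1; push_cast; ring
      rw [e2, neg_div, Real.rpow_neg (by positivity), Real.rpow_neg (by positivity),
        ← div_eq_mul_inv, ← Real.div_rpow (by positivity) (by positivity),
        ← Real.inv_rpow (by positivity)]
      congr 1
      field_simp
  have e3 : ∀ y : ℝ, y ^ (d - 1) • (newtonConst d * d * 1 ^ 2 * (y ^ 2 + 1 ^ 2) ^ (-(d : ℝ) / 2 - 1))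
      = newtonConst d * ((d : ℝ) * y ^ (d - 1) * (y ^ 2 + 1) ^ (-(d : ℝ) / 2 - 1)) := by
    intro y; simp only [one_pow, smul_eq_mul]; ring
  simp_rw [e3]
  rw [integral_const_mul, key, zero_pow (by omega)]
  simp [newtonConst]
  field_simp

theorem integrable_regDiv_one {d : ℕ} (hd : 2 ≤ d) : Integrable (regDiv d 1) := by
  -- The Bochner integral of a non-integrable function is `0`, but this one equals `1`.
  by_contra h
  have := integral_regDiv_one hd
  rw [integral_undef h] at this
  norm_num at this

/-- `regDiv d δ` is the rescaling of `regDiv d 1` that preserves the integral, so these functions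
form an approximate identity as `δ → 0`. -/
theorem integral_regDiv_mul {d : ℕ} {δ : ℝ} (hδ : 0 < δ) (ζ : RSpace d → ℝ) :
    ∫ x, regDiv d δ x * ζ x = ∫ x, regDiv d 1 x * ζ (δ • x) := by
  have h := Measure.integral_comp_smul (volume : Measure (RSpace d))
    (fun x => regDiv d δ x * ζ x) δ
  have hf : Module.finrank ℝ (RSpace d) = d := finrank_euclideanSpace_fin
  rw [hf, abs_of_pos (by positivity)] at h
  have h2 : ∀ x : RSpace d, regDiv d δ (δ • x) = (δ ^ d)⁻¹ * regDiv d 1 x := by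
    intro x
    unfold regDiv
    rw [norm_smul, Real.norm_of_nonneg hδ.le]
    have e1 : (δ * ‖x‖) ^ 2 + δ ^ 2 = δ ^ 2 * (‖x‖ ^ 2 + 1 ^ 2) := by ring
    rw [e1, Real.mul_rpow (by positivity) (by positivity)]
    have e2 : (δ ^ 2) ^ (-(d : ℝ) / 2 - 1) = (δ ^ d)⁻¹ * (δ ^ 2)⁻¹ := by
      rw [← Real.rpow_natCast δ 2, ← Real.rpow_mul hδ.le, ← Real.rpow_natCast δ d,
        ← Real.rpow_neg hδ.le, ← Real.rpow_neg hδ.le, ← Real.rpow_add hδ]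
      congr 1; push_cast; ring
    rw [e2]
    field_simp
  simp_rw [h2] at h
  simp_rw [mul_assoc] at h
  rw [integral_const_mul, smul_eq_mul] at h
  exact (mul_left_cancel₀ (by positivity) h).symm

/-- This is `ΔΦ = δ` tested with `ζ`. For the regularized kernel one integrates by parts, and its
divergence is an approximate identity. -/
theorem integral_fderiv_newtonKernel {d : ℕ} (hd : 2 ≤ d) {ζ : RSpace d → ℝ}
    (hζ : ContDiff ℝ 1 ζ) (hc : HasCompactSupport ζ) :
    ∑ i, ∫ x, inner ℝ (newtonKernel d x) (EuclideanSpace.single i (1 : ℝ))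
        * fderiv ℝ ζ x (EuclideanSpace.single i 1) = -ζ 0 := by
  have hfd : ∀ e, Continuous fun x => fderiv ℝ ζ x e := fun e =>
    (hζ.continuous_fderiv (by simp)).clm_apply continuous_const
  have h1 : Tendsto (fun δ => ∑ i, ∫ x, inner ℝ (regKernel d δ x) (EuclideanSpace.single i (1 : ℝ))
        * fderiv ℝ ζ x (EuclideanSpace.single i 1)) (𝓝[>] 0) _ :=
    tendsto_finsetSum _ fun i _ => tendsto_integral_regKernel hd (hfd _)
      (hc.fderiv_apply (𝕜 := ℝ) (EuclideanSpace.single i 1)) (EuclideanSpace.single i 1)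
  refine tendsto_nhds_unique h1 ?_
  have h2 : Tendsto (fun δ : ℝ => -∫ x, regDiv d 1 x * ζ (δ • x)) (𝓝[>] 0) (𝓝 (-ζ 0)) := by
    obtain ⟨B, hB⟩ := hc.exists_bound_of_continuous hζ.continuous
    have : Tendsto (fun δ : ℝ => ∫ x, regDiv d 1 x * ζ (δ • x)) (𝓝[>] 0)
        (𝓝 (∫ x, regDiv d 1 x * ζ 0)) := by
      refine tendsto_integral_filter_of_dominated_convergence (fun x => ‖regDiv d 1 x‖ * B) ?_ ?_
        ((integrable_regDiv_one hd).norm.mul_const B) ?_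
      · refine Eventually.of_forall fun δ => ?_
        exact (integrable_regDiv_one hd).aestronglyMeasurable.mul
          (hζ.continuous.comp (continuous_const_smul δ)).aestronglyMeasurable
      · refine Eventually.of_forall fun δ => Eventually.of_forall fun x => ?_
        rw [norm_mul]; gcongr; exact hB _
      · refine Eventually.of_forall fun x => Tendsto.const_mul _ ?_
        have : Continuous fun δ : ℝ => ζ (δ • x) := hζ.continuous.comp (by fun_prop)
        have h := this.tendsto 0
        rw [zero_smul] at h
        exact h.mono_left nhdsWithin_le_nhds
    rw [integral_mul_const, integral_regDiv_one hd, one_mul] at this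
    exact this.neg
  refine h2.congr' ?_
  filter_upwards [self_mem_nhdsWithin] with δ hδ
  have hδ : 0 < δ := hδ
  rw [← integral_regDiv_mul hδ]
  simp_rw [integral_regKernel_fderiv hδ hζ hc]
  rw [Finset.sum_neg_distrib, ← integral_finsetSum]
  · congr 2
    funext x
    rw [← Finset.sum_mul]
    congr 1
    have e1 : ∀ i : Fin d, fderiv ℝ (fun y => inner ℝ (regKernel d δ y) (EuclideanSpace.single i (1 : ℝ))) x
        (EuclideanSpace.single i 1) = newtonConst d * ((‖x‖ ^ 2 + δ ^ 2) ^ (-(d : ℝ) / 2)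
          - d * (‖x‖ ^ 2 + δ ^ 2) ^ (-(d : ℝ) / 2 - 1) * x i ^ 2) := by
      intro i
      rw [(hasFDerivAt_regKernel_inner hδ _ x).fderiv]
      simp [EuclideanSpace.inner_single_right]
      left; ring
    simp_rw [e1]
    rw [← Finset.mul_sum, Finset.sum_sub_distrib, ← Finset.mul_sum,
      ← EuclideanSpace.real_norm_sq_eq]
    have hp : 0 < ‖x‖ ^ 2 + δ ^ 2 := by positivity
    have e2 : (‖x‖ ^ 2 + δ ^ 2) ^ (-(d : ℝ) / 2)
        = (‖x‖ ^ 2 + δ ^ 2) ^ (-(d : ℝ) / 2 - 1) * (‖x‖ ^ 2 + δ ^ 2) := by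
      rw [← Real.rpow_add_one hp.ne']; congr 1; ring
    rw [e2]
    simp [regDiv]
    ring
  · intro i _
    exact ((continuous_regKernel_deriv hδ _ _).mul hζ.continuous).integrable_of_hasCompactSupport
      hc.mul_left

/-! ### The field generated by a density -/

/-- The field `∇Φ * f`. -/
def newtonField {d : ℕ} (f : RSpace d → ℝ) (x : RSpace d) : RSpace d :=
  ∫ y, f y • newtonKernel d (x - y)

/-- The mass of the kernel near its singularity. -/
def newtonMass (d : ℕ) : ℝ := ∫ x in Metric.ball (0 : RSpace d) 1, ‖newtonKernel d x‖

theorem newtonMass_nonneg (d : ℕ) : 0 ≤ newtonMass d := integral_nonneg fun _ => norm_nonneg _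

theorem velocity_eq_smul_newtonField {d : ℕ} (hd : 2 ≤ d) (σ₁ : ℝ) (f : RSpace d → ℝ)
    (x : RSpace d) : velocity σ₁ f x = σ₁ • newtonField f x := by
  unfold velocity newtonField
  congr 1
  refine integral_congr_ae ?_
  have h : ∀ᵐ y : RSpace d, x - y ≠ 0 := by
    have := (Measure.measurePreserving_sub_left (volume : Measure (RSpace d)) x).quasiMeasurePreserving.ae
      (ae_ne_zero hd)
    exact this
  filter_upwards [h] with y hy
  rw [gradient_newtonPotential hd hy]

theorem integrable_nearKernel {d : ℕ} (hd : 2 ≤ d) (r : ℝ) (x : RSpace d) :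
    Integrable fun y => (Metric.ball (0 : RSpace d) r).indicator
      (fun z => ‖newtonKernel d z‖) (x - y) := by
  have h : IntegrableOn (fun z => ‖newtonKernel d z‖) (Metric.ball (0 : RSpace d) r) :=
    (((locallyIntegrable_newtonKernel hd).integrableOn_isCompact
      (isCompact_closedBall (0 : RSpace d) r)).mono_set Metric.ball_subset_closedBall).norm
  exact ((integrable_indicator_iff measurableSet_ball).2 h).comp_sub_left x

theorem integral_nearKernel {d : ℕ} (x : RSpace d) :
    ∫ y, (Metric.ball (0 : RSpace d) 1).indicator (fun z => ‖newtonKernel d z‖) (x - y)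
      = newtonMass d := by
  rw [integral_sub_left_eq_self (fun z => (Metric.ball (0 : RSpace d) 1).indicator
    (fun z => ‖newtonKernel d z‖) z) volume x, integral_indicator measurableSet_ball]
  rfl

/-- Near the singularity the bound `B` of the density is used, away from it the bound `newtonConst
d` of the kernel. Integration then bounds the field by the norms in `L^∞` and `L¹`. -/
theorem norm_smul_newtonKernel_le {d : ℕ} (hd : 2 ≤ d) {c B : ℝ} (hc : |c| ≤ B) (z : RSpace d) :
    ‖c • newtonKernel d z‖ ≤ B * (Metric.ball (0 : RSpace d) 1).indicator
      (fun z => ‖newtonKernel d z‖) z + newtonConst d * |c| := by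
  rw [norm_smul, Real.norm_eq_abs]
  have hk := (newtonConst_pos hd).le
  by_cases hz : z ∈ Metric.ball (0 : RSpace d) 1
  · rw [indicator_of_mem hz]
    have : |c| * ‖newtonKernel d z‖ ≤ B * ‖newtonKernel d z‖ := by gcongr
    have : 0 ≤ newtonConst d * |c| := by positivity
    linarith
  · rw [indicator_of_notMem hz]
    have h1 : 1 ≤ ‖z‖ := by simpa using hz
    have := norm_newtonKernel_le_of_one_le hd le_rfl h1
    rw [inv_one, mul_one] at this
    nlinarith [abs_nonneg c]

theorem aestronglyMeasurable_newtonIntegrand {d : ℕ} {f : RSpace d → ℝ}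
    (hf : AEStronglyMeasurable f volume) (x : RSpace d) :
    AEStronglyMeasurable (fun y => f y • newtonKernel d (x - y)) volume :=
  hf.smul ((measurable_newtonKernel d).comp (measurable_const.sub measurable_id)).aestronglyMeasurable

theorem integrable_newtonIntegrand {d : ℕ} (hd : 2 ≤ d) {f : RSpace d → ℝ} {B : ℝ}
    (hf : Integrable f) (hB : ∀ᵐ y, |f y| ≤ B) (x : RSpace d) :
    Integrable fun y => f y • newtonKernel d (x - y) := by
  refine Integrable.mono' (((integrable_nearKernel hd 1 x).const_mul B).add
    (hf.norm.const_mul (newtonConst d)))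
    (aestronglyMeasurable_newtonIntegrand hf.aestronglyMeasurable x) ?_
  filter_upwards [hB] with y hy
  simpa using norm_smul_newtonKernel_le hd hy (x - y)

theorem integral_norm_newtonIntegrand_le {d : ℕ} (hd : 2 ≤ d) {f : RSpace d → ℝ} {B : ℝ}
    (hf : Integrable f) (hB : ∀ᵐ y, |f y| ≤ B) (x : RSpace d) :
    ∫ y, ‖f y • newtonKernel d (x - y)‖ ≤ B * newtonMass d + newtonConst d * ∫ y, |f y| := by
  calc _ ≤ ∫ y, (B * (Metric.ball (0 : RSpace d) 1).indicator
        (fun z => ‖newtonKernel d z‖) (x - y) + newtonConst d * |f y|) := by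
        refine integral_mono_ae (integrable_newtonIntegrand hd hf hB x).norm
          (((integrable_nearKernel hd 1 x).const_mul B).add (hf.abs.const_mul (newtonConst d))) ?_
        filter_upwards [hB] with y hy
        exact norm_smul_newtonKernel_le hd hy (x - y)
    _ = _ := by
        rw [integral_add ((integrable_nearKernel hd 1 x).const_mul B)
          (hf.abs.const_mul (newtonConst d)), integral_const_mul, integral_const_mul,
          integral_nearKernel]

theorem norm_newtonField_le {d : ℕ} (hd : 2 ≤ d) {f : RSpace d → ℝ} {B : ℝ}
    (hf : Integrable f) (hB : ∀ᵐ y, |f y| ≤ B) (x : RSpace d) :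
    ‖newtonField f x‖ ≤ B * newtonMass d + newtonConst d * ∫ y, |f y| :=
  (norm_integral_le_integral_norm _).trans (integral_norm_newtonIntegrand_le hd hf hB x)

theorem aestronglyMeasurable_newtonIntegrand_prod {d : ℕ} {f : RSpace d → ℝ}
    (hf : AEStronglyMeasurable f volume) :
    AEStronglyMeasurable (fun p : RSpace d × RSpace d => f p.2 • newtonKernel d (p.1 - p.2))
      (volume.prod volume) :=
  hf.comp_snd.smul ((measurable_newtonKernel d).comp
    (measurable_fst.sub measurable_snd)).aestronglyMeasurable

theorem aestronglyMeasurable_newtonField {d : ℕ} {f : RSpace d → ℝ}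
    (hf : AEStronglyMeasurable f volume) : AEStronglyMeasurable (newtonField f) volume :=
  (aestronglyMeasurable_newtonIntegrand_prod hf).integral_prod_right'

theorem newtonField_sub {d : ℕ} (hd : 2 ≤ d) {f g : RSpace d → ℝ} {B B' : ℝ}
    (hf : Integrable f) (hB : ∀ᵐ y, |f y| ≤ B) (hg : Integrable g) (hB' : ∀ᵐ y, |g y| ≤ B')
    (x : RSpace d) : newtonField (fun y => f y - g y) x = newtonField f x - newtonField g x := by
  unfold newtonField
  simp_rw [sub_smul]
  exact integral_sub (integrable_newtonIntegrand hd hf hB x) (integrable_newtonIntegrand hd hg hB' x)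

theorem fderiv_apply_eq_sum {d : ℕ} (L : RSpace d →L[ℝ] ℝ) (v : RSpace d) :
    L v = ∑ i, inner ℝ v (EuclideanSpace.single i (1 : ℝ)) * L (EuclideanSpace.single i 1) := by
  conv_lhs => rw [← (EuclideanSpace.basisFun (Fin d) ℝ).sum_repr v]
  rw [map_sum]
  refine Finset.sum_congr rfl fun i _ => ?_
  simp [EuclideanSpace.inner_single_right]

theorem integrable_inner_newtonKernel_mul {d : ℕ} (hd : 2 ≤ d) {θ : RSpace d → ℝ}
    (hθ : Continuous θ) (hc : HasCompactSupport θ) (e : RSpace d) :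
    Integrable fun x => inner ℝ (newtonKernel d x) e * θ x := by
  have := (((locallyIntegrable_newtonKernel hd).integrable_smul_left_of_hasCompactSupport
      hθ hc)).inner_const (𝕜 := ℝ) e
  refine this.congr (Eventually.of_forall fun x => ?_)
  simp only [inner_smul_left]
  simp [mul_comm]

theorem integral_fderiv_apply_newtonKernel {d : ℕ} (hd : 2 ≤ d) {ζ : RSpace d → ℝ}
    (hζ : ContDiff ℝ 1 ζ) (hc : HasCompactSupport ζ) (y : RSpace d) :
    ∫ x, fderiv ℝ ζ x (newtonKernel d (x - y)) = -ζ y := by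
  rw [← integral_add_right_eq_self _ y]
  simp only [add_sub_cancel_right]
  have hζ' : ContDiff ℝ 1 (fun x => ζ (x + y)) := hζ.comp (by fun_prop)
  have hc' : HasCompactSupport (fun x => ζ (x + y)) := hc.comp_homeomorph (Homeomorph.addRight y)
  have h := integral_fderiv_newtonKernel hd hζ' hc'
  simp only [zero_add] at h
  rw [← h, ← integral_finsetSum]
  · congr 1
    funext x
    rw [fderiv_apply_eq_sum, fderiv_comp_add_right]
  · intro i _
    exact integrable_inner_newtonKernel_mul hd ((hζ'.continuous_fderiv (by simp)).clm_apply
      continuous_const) (hc'.fderiv_apply (𝕜 := ℝ) (EuclideanSpace.single i 1)) _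

/-- The distributional divergence of `∇Φ * f` is `f`. -/
theorem integral_fderiv_newtonField {d : ℕ} (hd : 2 ≤ d) {f : RSpace d → ℝ} {B : ℝ}
    (hf : Integrable f) (hB : ∀ᵐ y, |f y| ≤ B) {ζ : RSpace d → ℝ}
    (hζ : ContDiff ℝ 1 ζ) (hc : HasCompactSupport ζ) :
    ∫ x, fderiv ℝ ζ x (newtonField f x) = -∫ x, f x * ζ x := by
  have hDc : Continuous (fderiv ℝ ζ) := hζ.continuous_fderiv (by simp)
  have hDs : HasCompactSupport (fderiv ℝ ζ) := hc.fderiv (𝕜 := ℝ)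
  obtain ⟨A, hA⟩ := hDs.exists_bound_of_continuous hDc
  have hg : Integrable fun x => ‖fderiv ℝ ζ x‖ := (hDc.integrable_of_hasCompactSupport hDs).norm
  have hmeas : AEStronglyMeasurable (fun p : RSpace d × RSpace d =>
      fderiv ℝ ζ p.1 (f p.2 • newtonKernel d (p.1 - p.2))) (volume.prod volume) := by
    have h1 : AEStronglyMeasurable (fun p : RSpace d × RSpace d => fderiv ℝ ζ p.1)
      (volume.prod volume) := (hDc.comp continuous_fst).aestronglyMeasurable
    exact (ContinuousLinearMap.apply ℝ ℝ).flip.aestronglyMeasurable_comp₂ h1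
      (aestronglyMeasurable_newtonIntegrand_prod hf.aestronglyMeasurable)
  -- Up to reflection of the kernel, whose norm is even, the inner integral for Fubini's theorem is
  -- the integral bounding the field generated by the density `‖fderiv ℝ ζ x‖`.
  have hbd : ∀ y, Integrable (fun x => ‖fderiv ℝ ζ x‖ • newtonKernel d (y - x)) := fun y =>
    integrable_newtonIntegrand hd hg (B := A) (Eventually.of_forall fun x => by simpa using hA x) y
  have hneg : ∀ z : RSpace d, ‖newtonKernel d (-z)‖ = ‖newtonKernel d z‖ := by
    intro z; simp [newtonKernel]
  have hle : ∀ x y : RSpace d, ‖fderiv ℝ ζ x (f y • newtonKernel d (x - y))‖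
      ≤ |f y| * ‖‖fderiv ℝ ζ x‖ • newtonKernel d (y - x)‖ := by
    intro x y
    refine ((fderiv ℝ ζ x).le_opNorm _).trans_eq ?_
    rw [norm_smul, norm_smul, ← neg_sub y x, hneg, Real.norm_eq_abs, norm_norm]
    ring
  have hint : Integrable (fun p : RSpace d × RSpace d =>
      fderiv ℝ ζ p.1 (f p.2 • newtonKernel d (p.1 - p.2))) (volume.prod volume) := by
    rw [integrable_prod_iff' hmeas]
    have hsec : ∀ y, Integrable (fun x => fderiv ℝ ζ x (f y • newtonKernel d (x - y))) := by
      intro y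
      refine Integrable.mono' ((hbd y).norm.const_mul |f y|) ?_ (Eventually.of_forall fun x => hle x y)
      exact (ContinuousLinearMap.apply ℝ ℝ).flip.aestronglyMeasurable_comp₂
        hDc.aestronglyMeasurable (((measurable_newtonKernel d).comp
          (measurable_id.sub measurable_const)).aestronglyMeasurable.const_smul (f y))
    refine ⟨Eventually.of_forall hsec, ?_⟩
    refine Integrable.mono' (hf.abs.mul_const (A * newtonMass d
      + newtonConst d * ∫ x, |‖fderiv ℝ ζ x‖|)) hmeas.norm.prod_swap.integral_prod_right' ?_
    refine Eventually.of_forall fun y => ?_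
    rw [Real.norm_of_nonneg (integral_nonneg fun _ => norm_nonneg _)]
    calc _ ≤ ∫ x, |f y| * ‖‖fderiv ℝ ζ x‖ • newtonKernel d (y - x)‖ :=
          integral_mono (hsec y).norm ((hbd y).norm.const_mul _) fun x => hle x y
      _ ≤ _ := by
          rw [integral_const_mul]
          gcongr
          exact integral_norm_newtonIntegrand_le hd hg
            (Eventually.of_forall fun x => by simpa using hA x) y
  calc ∫ x, fderiv ℝ ζ x (newtonField f x)
      = ∫ x, ∫ y, fderiv ℝ ζ x (f y • newtonKernel d (x - y)) := by
        congr 1; funext x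
        exact ((fderiv ℝ ζ x).integral_comp_comm (integrable_newtonIntegrand hd hf hB x)).symm
    _ = ∫ y, ∫ x, fderiv ℝ ζ x (f y • newtonKernel d (x - y)) := integral_integral_swap hint
    _ = ∫ y, -(f y * ζ y) := by
        congr 1; funext y
        simp_rw [map_smul, smul_eq_mul]
        rw [integral_const_mul, integral_fderiv_apply_newtonKernel hd hζ hc]
        ring
    _ = _ := integral_neg _

/-! ### Smooth densities -/

section Smooth

variable {d : ℕ} {f : RSpace d → ℝ}

theorem newtonField_eq_convolution (f : RSpace d → ℝ) :
    newtonField f = convolution f (newtonKernel d) (ContinuousLinearMap.lsmul ℝ ℝ) volume := by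
  funext x; rfl

theorem contDiff_newtonField (hd : 2 ≤ d) (hf : ContDiff ℝ ∞ f) (hc : HasCompactSupport f) :
    ContDiff ℝ ∞ (newtonField f) := by
  rw [newtonField_eq_convolution]
  exact hc.contDiff_convolution_left _ hf (locallyIntegrable_newtonKernel hd)

theorem integrable_newtonIntegrand_of_smooth (hd : 2 ≤ d) {F : Type*} [NormedAddCommGroup F]
    [NormedSpace ℝ F] {g : RSpace d → F} (hf : Continuous g) (hc : HasCompactSupport g)
    (x : RSpace d) : Integrable fun y => ‖g y‖ * ‖newtonKernel d (x - y)‖ := by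
  obtain ⟨B, hB⟩ := hc.exists_bound_of_continuous hf
  have := (integrable_newtonIntegrand hd (hf.integrable_of_hasCompactSupport hc).norm (B := B)
    (Eventually.of_forall fun x => by simpa using hB x) x).norm
  simpa [norm_smul] using this

/-- The derivative falls on the density, so `∂V` is itself a field of the same kind and the
estimates for fields apply to it. -/
theorem fderiv_newtonField (hd : 2 ≤ d) (hf : ContDiff ℝ ∞ f) (hc : HasCompactSupport f)
    (x e : RSpace d) :
    fderiv ℝ (newtonField f) x e = newtonField (fun y => fderiv ℝ f y e) x := by
  have h := hc.hasFDerivAt_convolution_left (ContinuousLinearMap.lsmul ℝ ℝ : ℝ →L[ℝ] RSpace d →L[ℝ] RSpace d)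
    (hf.of_le (by simp)) (locallyIntegrable_newtonKernel hd) x
  rw [newtonField_eq_convolution, h.fderiv, convolution_def,
    ContinuousLinearMap.integral_apply]
  · rfl
  · have hDc : Continuous (fderiv ℝ f) := hf.continuous_fderiv (by simp)
    refine Integrable.mono' (integrable_newtonIntegrand_of_smooth hd hDc (hc.fderiv (𝕜 := ℝ)) x) ?_ ?_
    · exact ContinuousLinearMap.aestronglyMeasurable_comp₂ _ hDc.aestronglyMeasurable
        ((measurable_newtonKernel d).comp (measurable_const.sub measurable_id)).aestronglyMeasurable
    · refine Eventually.of_forall fun y => ?_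
      refine ContinuousLinearMap.opNorm_le_bound _ (by positivity) fun v => ?_
      simp only [ContinuousLinearMap.precompL_apply, ContinuousLinearMap.lsmul_apply, norm_smul]
      calc _ ≤ (‖fderiv ℝ f y‖ * ‖v‖) * ‖newtonKernel d (x - y)‖ := by
            gcongr; exact (fderiv ℝ f y).le_opNorm v
        _ = _ := by ring

theorem contDiff_fderiv_apply (hf : ContDiff ℝ ∞ f) (e : RSpace d) :
    ContDiff ℝ ∞ fun y => fderiv ℝ f y e :=
  (hf.fderiv_right (by simp)).clm_apply contDiff_const

theorem inner_newtonField (hd : 2 ≤ d) (hf : Continuous f) (hc : HasCompactSupport f)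
    (x e : RSpace d) :
    inner ℝ (newtonField f x) e = ∫ y, inner ℝ (newtonKernel d y) e * f (x - y) := by
  obtain ⟨B, hB⟩ := hc.exists_bound_of_continuous hf
  have hi := integrable_newtonIntegrand hd (hf.integrable_of_hasCompactSupport hc) (B := B)
    (Eventually.of_forall fun x => by simpa using hB x) x
  rw [newtonField, real_inner_comm, ← integral_inner hi, ← integral_sub_left_eq_self _ volume x]
  congr 1
  funext y
  simp [inner_smul_right, real_inner_comm, mul_comm]

theorem inner_fderiv_newtonField (hd : 2 ≤ d) (hf : ContDiff ℝ ∞ f) (hc : HasCompactSupport f)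
    (x e e' : RSpace d) : inner ℝ (fderiv ℝ (newtonField f) x e') e
      = -∫ y, inner ℝ (newtonKernel d y) e * fderiv ℝ (fun z => f (x - z)) y e' := by
  rw [fderiv_newtonField hd hf hc, inner_newtonField hd (contDiff_fderiv_apply hf e').continuous
    (hc.fderiv_apply (𝕜 := ℝ) e'), ← integral_neg]
  congr 1
  funext y
  have : fderiv ℝ (fun z => f (x - z)) y e' = -fderiv ℝ f (x - y) e' := by
    have h1 : HasFDerivAt (fun z => x - z) (-ContinuousLinearMap.id ℝ (RSpace d)) y :=
      (hasFDerivAt_id y).const_sub x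
    have h2 := ((hf.differentiable (by simp)) (x - y)).hasFDerivAt.comp y h1
    have h3 : fderiv ℝ (fun z => f (x - z)) y = _ := h2.fderiv
    rw [h3]; simp
  rw [this]; ring

/-- `V` is a gradient, so its Jacobian is a Hessian. The symmetry turns `∂ᵢVⱼ ∂ⱼVᵢ` into a square in
the `L²` estimate. -/
theorem inner_fderiv_newtonField_symm (hd : 2 ≤ d) (hf : ContDiff ℝ ∞ f)
    (hc : HasCompactSupport f) (x e e' : RSpace d) :
    inner ℝ (fderiv ℝ (newtonField f) x e') e = inner ℝ (fderiv ℝ (newtonField f) x e) e' := by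
  have hc' : HasCompactSupport fun z => f (x - z) := hc.comp_homeomorph (Homeomorph.subLeft x)
  have hf' : ContDiff ℝ 1 fun z => f (x - z) :=
    (hf.of_le (by simp)).comp (contDiff_const.sub contDiff_id)
  rw [inner_fderiv_newtonField hd hf hc, inner_fderiv_newtonField hd hf hc,
    integral_newtonKernel_fderiv_symm hd hf' hc']

theorem sum_inner_fderiv_newtonField (hd : 2 ≤ d) (hf : ContDiff ℝ ∞ f)
    (hc : HasCompactSupport f) (x : RSpace d) :
    ∑ i, inner ℝ (fderiv ℝ (newtonField f) x (EuclideanSpace.single i 1))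
      (EuclideanSpace.single i (1 : ℝ)) = f x := by
  have hc' : HasCompactSupport fun z => f (x - z) := hc.comp_homeomorph (Homeomorph.subLeft x)
  have hf' : ContDiff ℝ 1 fun z => f (x - z) :=
    (hf.of_le (by simp)).comp (contDiff_const.sub contDiff_id)
  simp_rw [inner_fderiv_newtonField hd hf hc]
  rw [Finset.sum_neg_distrib, integral_fderiv_newtonKernel hd hf' hc']
  simp

/-- If `|y| ≤ r` and `|x| ≥ 2r`, then `|x - y| ≥ |x| / 2`, whence the factor `2 ^ (d - 1)`. -/
theorem norm_newtonField_le_decay (hd : 2 ≤ d) {r : ℝ} (hr : 0 < r) (hf : Continuous f)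
    (hc : tsupport f ⊆ Metric.closedBall 0 r) {x : RSpace d} (hx : 2 * r ≤ ‖x‖) :
    ‖newtonField f x‖ ≤ (newtonConst d * 2 ^ (d - 1) * ∫ y, ‖f y‖) * (‖x‖ ^ (d - 1))⁻¹ := by
  have hcs : HasCompactSupport f := (isCompact_closedBall _ _).of_isClosed_subset (isClosed_tsupport f) hc
  have hi : Integrable fun y => ‖f y‖ := (hf.integrable_of_hasCompactSupport hcs).norm
  have hk := newtonConst_pos hd
  calc _ ≤ ∫ y, (newtonConst d * 2 ^ (d - 1) * (‖x‖ ^ (d - 1))⁻¹) * ‖f y‖ := by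
        refine norm_integral_le_of_norm_le (hi.const_mul _) (Eventually.of_forall fun y => ?_)
        rw [norm_smul]
        by_cases hy : f y = 0
        · simp [hy]
        have hy2 : ‖y‖ ≤ r := by simpa using hc (subset_tsupport f hy)
        have h1 : ‖x‖ / 2 ≤ ‖x - y‖ := by
          have := norm_sub_norm_le x y
          linarith
        rw [norm_newtonKernel hd, mul_comm]
        have hx0 : 0 < ‖x‖ := by linarith
        have h2 : (‖x‖ / 2) ^ (d - 1) ≤ ‖x - y‖ ^ (d - 1) := by gcongr
        have h3 : (‖x - y‖ ^ (d - 1))⁻¹ ≤ 2 ^ (d - 1) * (‖x‖ ^ (d - 1))⁻¹ := by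
          calc (‖x - y‖ ^ (d - 1))⁻¹ ≤ ((‖x‖ / 2) ^ (d - 1))⁻¹ := by gcongr
            _ = _ := by rw [div_pow]; field_simp
        calc _ ≤ newtonConst d * (2 ^ (d - 1) * (‖x‖ ^ (d - 1))⁻¹) * ‖f y‖ := by gcongr
          _ = _ := by ring
    _ = _ := by rw [integral_const_mul]; ring

end Smooth

/-! ### Cutoff functions -/

section Cutoff

variable {d : ℕ} {a : RSpace d → ℝ}

theorem IsRadialCutoff.le_one (ha : IsRadialCutoff a) (x : RSpace d) : a x ≤ 1 := by
  have h := ha.nonincreasing 0 x (by simp)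
  rwa [ha.eq_one 0 (by simp)] at h

theorem IsRadialCutoff.eq_zero (ha : IsRadialCutoff a) {x : RSpace d} (hx : 2 ≤ ‖x‖) : a x = 0 := by
  by_contra h
  have := ha.support_subset h
  simp at this
  linarith

theorem IsRadialCutoff.nonneg (ha : IsRadialCutoff a) (x : RSpace d) : 0 ≤ a x := by
  rcases le_or_gt 2 ‖x‖ with hx | hx
  · exact (ha.eq_zero hx).ge
  · rcases eq_or_ne x 0 with rfl | h0
    · rw [ha.eq_one 0 (by simp)]; norm_num
    · have hn : 0 < ‖x‖ := norm_pos_iff.2 h0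
      have hz : ‖(2 / ‖x‖) • x‖ = 2 := by
        rw [norm_smul, Real.norm_of_nonneg (by positivity)]; field_simp
      have := ha.nonincreasing x ((2 / ‖x‖) • x) (by rw [hz]; exact hx.le)
      rwa [ha.eq_zero hz.ge] at this

theorem IsRadialCutoff.hasCompactSupport (ha : IsRadialCutoff a) : HasCompactSupport a :=
  HasCompactSupport.of_support_subset_isCompact (isCompact_closedBall (0 : RSpace d) 2)
    (ha.support_subset.trans Metric.ball_subset_closedBall)

/-- Dilation of a function. -/
def dilate (g : RSpace d → ℝ) (S : ℝ) (x : RSpace d) : ℝ := g (S⁻¹ • x)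

theorem ContDiff.dilate {g : RSpace d → ℝ} (hg : ContDiff ℝ ∞ g) (S : ℝ) :
    ContDiff ℝ ∞ (dilate g S) := hg.comp (contDiff_const_smul _)

theorem HasCompactSupport.dilate {g : RSpace d → ℝ} (hg : HasCompactSupport g) {S : ℝ}
    (hS : 0 < S) : HasCompactSupport (dilate g S) :=
  hg.comp_homeomorph (Homeomorph.smulOfNeZero S⁻¹ (inv_ne_zero hS.ne'))

theorem fderiv_dilate (g : RSpace d → ℝ) (S : ℝ) (x : RSpace d) :
    fderiv ℝ (dilate g S) x = S⁻¹ • fderiv ℝ g (S⁻¹ • x) := fderiv_comp_smul _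

theorem IsRadialCutoff.dilate_eq_one (ha : IsRadialCutoff a) {S : ℝ} (hS : 0 < S) {x : RSpace d}
    (hx : ‖x‖ < S) : dilate a S x = 1 := by
  refine ha.eq_one _ ?_
  rw [mem_ball_zero_iff, norm_smul, norm_inv, Real.norm_of_nonneg hS.le]
  rwa [inv_mul_lt_iff₀ hS, mul_one]

theorem IsRadialCutoff.dilate_eq_zero (ha : IsRadialCutoff a) {S : ℝ} (hS : 0 < S) {x : RSpace d}
    (hx : 2 * S ≤ ‖x‖) : dilate a S x = 0 := by
  refine ha.eq_zero ?_
  rw [norm_smul, norm_inv, Real.norm_of_nonneg hS.le]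
  rwa [le_inv_mul_iff₀ hS, mul_comm]

theorem fderiv_eq_zero_of_eqOn_ball {g : RSpace d → ℝ} {c r : ℝ}
    (h : ∀ x, ‖x‖ < r → g x = c) {x : RSpace d} (hx : ‖x‖ < r) : fderiv ℝ g x = 0 := by
  have : g =ᶠ[𝓝 x] fun _ => c := by
    filter_upwards [Metric.isOpen_ball.mem_nhds (show x ∈ Metric.ball (0 : RSpace d) r by simpa using hx)]
      with y hy
    exact h y (by simpa using hy)
  rw [this.fderiv_eq]; simp

theorem fderiv_eq_zero_of_eqOn_compl {g : RSpace d → ℝ} {c r : ℝ}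
    (h : ∀ x, r ≤ ‖x‖ → g x = c) {x : RSpace d} (hx : r < ‖x‖) : fderiv ℝ g x = 0 := by
  have : g =ᶠ[𝓝 x] fun _ => c := by
    filter_upwards [(isOpen_lt continuous_const continuous_norm).mem_nhds (show r < ‖x‖ from hx)]
      with y hy
    exact h y (le_of_lt hy)
  rw [this.fderiv_eq]; simp

theorem IsRadialCutoff.exists_fderiv_bound (ha : IsRadialCutoff a) :
    ∃ A, 0 ≤ A ∧ ∀ x, ‖fderiv ℝ a x‖ ≤ A := by
  obtain ⟨A, hA⟩ := (ha.hasCompactSupport.fderiv (𝕜 := ℝ)).exists_bound_of_continuous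
    (ha.smooth.continuous_fderiv (by simp))
  exact ⟨A, (norm_nonneg _).trans (hA 0), hA⟩

end Cutoff

/-! ### Integration by parts -/

theorem integral_fderiv_apply_eq_zero {d : ℕ} {w : RSpace d → ℝ} (hw : ContDiff ℝ 1 w)
    (hc : HasCompactSupport w) (e : RSpace d) : ∫ x, fderiv ℝ w x e = 0 := by
  have hi : Integrable fun x => fderiv ℝ w x e :=
    ((hw.continuous_fderiv (by simp)).clm_apply continuous_const).integrable_of_hasCompactSupport
      (hc.fderiv_apply (𝕜 := ℝ) e)
  have h := integral_mul_fderiv_eq_neg_fderiv_mul_of_integrable (μ := (volume : Measure (RSpace d)))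
    (f := fun _ => (1 : ℝ)) (g := w) (v := e) (by simp) (by simpa using hi)
    (by simpa using hw.continuous.integrable_of_hasCompactSupport hc)
    (fun x _ => differentiableAt_const _) (fun x _ => hw.differentiable (by simp) x)
  simpa using h

theorem integral_leibniz {d : ℕ} {χ u w : RSpace d → ℝ} (hχ : ContDiff ℝ 1 χ)
    (hc : HasCompactSupport χ) (hu : ContDiff ℝ 1 u) (hw : ContDiff ℝ 1 w) (e : RSpace d) :
    ∫ x, (fderiv ℝ χ x e * (u x * w x) + χ x * (fderiv ℝ u x e * w x + u x * fderiv ℝ w x e)) = 0 := by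
  rw [← integral_fderiv_apply_eq_zero (hχ.mul (hu.mul hw)) (hc.mul_right) e]
  congr 1
  funext x
  have h1 := (hχ.differentiable (by simp) x).hasFDerivAt
  have h2 := (hu.differentiable (by simp) x).hasFDerivAt
  have h3 := (hw.differentiable (by simp) x).hasFDerivAt
  have h4 : fderiv ℝ (fun x => χ x * (u x * w x)) x = _ := (h1.mul (h2.mul h3)).fderiv
  change _ = fderiv ℝ (fun x => χ x * (u x * w x)) x e
  rw [h4]
  simp
  ring

theorem cauchy_schwarz_integral {α : Type*} [MeasurableSpace α] {μ : Measure α} {f g : α → ℝ}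
    (hf : MemLp f 2 μ) (hg : MemLp g 2 μ) :
    ∫ x, |f x| * |g x| ∂μ ≤ √(∫ x, f x ^ 2 ∂μ) * √(∫ x, g x ^ 2 ∂μ) := by
  have h := integral_mul_norm_le_Lp_mul_Lq (μ := μ) (f := f) (g := g) (p := 2) (q := 2)
    (by constructor <;> norm_num) (by simpa using hf) (by simpa using hg)
  simpa [Real.sqrt_eq_rpow] using h

/-! ### The `L²` estimate for the derivative of the field -/

section Energy

variable {d : ℕ} {f : RSpace d → ℝ}

theorem hasFDerivAt_inner_newtonField (hd : 2 ≤ d) (hf : ContDiff ℝ ∞ f)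
    (hc : HasCompactSupport f) (x e e' : RSpace d) :
    fderiv ℝ (fun y => inner ℝ (newtonField f y) e) x e'
      = inner ℝ (fderiv ℝ (newtonField f) x e') e := by
  have h := ((contDiff_newtonField hd hf hc).differentiable (by simp) x).hasFDerivAt
  have h2 := h.inner ℝ (hasFDerivAt_const e x)
  rw [h2.fderiv]
  simp

/-- The localized form of `∫ |∇V|² = ∫ (div V)² = ∫ f²`: integrating by parts twice moves both
derivatives through the symmetric Jacobian, and the terms with derivatives of `χ` are kept exactly.
-/
theorem integral_cutoff_mul_hessian (hd : 2 ≤ d) (hf : ContDiff ℝ ∞ f) (hc : HasCompactSupport f)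
    {χ : RSpace d → ℝ} (hχ : ContDiff ℝ ∞ χ) (hχc : HasCompactSupport χ) :
    ∫ x, (χ x * ∑ j, ‖fderiv ℝ (newtonField f) x (EuclideanSpace.single j 1)‖ ^ 2
      + ∑ j, inner ℝ (newtonField f x) (EuclideanSpace.single j (1 : ℝ)) *
          fderiv ℝ χ x (fderiv ℝ (newtonField f) x (EuclideanSpace.single j 1))
      - (χ x * f x ^ 2 + fderiv ℝ χ x (newtonField f x) * f x)) = 0 := by
  set E : Fin d → RSpace d := fun j => EuclideanSpace.single j 1 with hE
  have hV := contDiff_newtonField hd hf hc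
  have hp : ∀ j, ContDiff ℝ ∞ fun x => inner ℝ (newtonField f x) (E j) := fun j =>
    hV.inner ℝ contDiff_const
  have hVj : ∀ j, ContDiff ℝ ∞ (newtonField fun y => fderiv ℝ f y (E j)) := fun j =>
    contDiff_newtonField hd (contDiff_fderiv_apply hf _) (hc.fderiv_apply (𝕜 := ℝ) _)
  have hq : ∀ j i, ContDiff ℝ ∞ fun x => inner ℝ (newtonField (fun y => fderiv ℝ f y (E j)) x) (E i) :=
    fun j i => (hVj j).inner ℝ contDiff_const
  have hDχ : ∀ e, Continuous fun x => fderiv ℝ χ x e := fun e =>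
    (contDiff_fderiv_apply hχ e).continuous
  -- The divergence theorem for `χ Vⱼ ∂ⱼVᵢ` in the direction `i`. By the symmetry of the Jacobian
  -- `∂ᵢVⱼ ∂ⱼVᵢ` is a square, and the sum over `i` of the second derivatives is `∂ⱼ(div V) = ∂ⱼf`.
  have h1 : ∀ j i, ∫ x, (fderiv ℝ χ x (E i) * (inner ℝ (newtonField f x) (E j)
      * inner ℝ (fderiv ℝ (newtonField f) x (E j)) (E i))
      + χ x * (inner ℝ (fderiv ℝ (newtonField f) x (E j)) (E i) ^ 2
        + inner ℝ (newtonField f x) (E j) *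
          inner ℝ (fderiv ℝ (newtonField fun y => fderiv ℝ f y (E j)) x (E i)) (E i))) = 0 := by
    intro j i
    rw [← integral_leibniz (hχ.of_le (by simp)) hχc ((hp j).of_le (by simp))
      ((hq j i).of_le (by simp)) (E i)]
    congr 1
    funext x
    rw [hasFDerivAt_inner_newtonField hd hf hc, hasFDerivAt_inner_newtonField hd
      (contDiff_fderiv_apply hf _) (hc.fderiv_apply (𝕜 := ℝ) _), ← fderiv_newtonField hd hf hc,
      inner_fderiv_newtonField_symm hd hf hc x (E j) (E i)]
    ring
  -- The divergence theorem for `χ Vⱼ f` in the direction `j`; subtracting it removes the term with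
  -- `Vⱼ ∂ⱼf`.
  have h2 : ∀ j, ∫ x, (fderiv ℝ χ x (E j) * (inner ℝ (newtonField f x) (E j) * f x)
      + χ x * (inner ℝ (fderiv ℝ (newtonField f) x (E j)) (E j) * f x
        + inner ℝ (newtonField f x) (E j) * fderiv ℝ f x (E j))) = 0 := by
    intro j
    rw [← integral_leibniz (hχ.of_le (by simp)) hχc ((hp j).of_le (by simp))
      (hf.of_le (by simp)) (E j)]
    congr 1
    funext x
    rw [hasFDerivAt_inner_newtonField hd hf hc]
  have hDV : ∀ e, Continuous fun x => fderiv ℝ (newtonField f) x e := fun e =>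
    (hV.continuous_fderiv (by simp)).clm_apply continuous_const
  have hDVj : ∀ j e, Continuous fun x => fderiv ℝ (newtonField fun y => fderiv ℝ f y (E j)) x e :=
    fun j e => ((hVj j).continuous_fderiv (by simp)).clm_apply continuous_const
  have hDf : ∀ e, Continuous fun x => fderiv ℝ f x e := fun e =>
    (contDiff_fderiv_apply hf e).continuous
  have hVc := hV.continuous
  have hfc := hf.continuous
  have hχcc := hχ.continuous
  have i1 : ∀ j i, Integrable fun x => (fderiv ℝ χ x (E i) * (inner ℝ (newtonField f x) (E j)
      * inner ℝ (fderiv ℝ (newtonField f) x (E j)) (E i))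
      + χ x * (inner ℝ (fderiv ℝ (newtonField f) x (E j)) (E i) ^ 2
        + inner ℝ (newtonField f x) (E j) *
          inner ℝ (fderiv ℝ (newtonField fun y => fderiv ℝ f y (E j)) x (E i)) (E i))) := by
    intro j i
    have := hDV (E j)
    have := hDVj j (E i)
    have := hDχ (E i)
    refine Continuous.integrable_of_hasCompactSupport (by fun_prop) ?_
    exact ((hχc.fderiv_apply (𝕜 := ℝ) (E i)).mul_right).add hχc.mul_right
  have i2 : ∀ j, Integrable fun x => (fderiv ℝ χ x (E j) * (inner ℝ (newtonField f x) (E j) * f x)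
      + χ x * (inner ℝ (fderiv ℝ (newtonField f) x (E j)) (E j) * f x
        + inner ℝ (newtonField f x) (E j) * fderiv ℝ f x (E j))) := by
    intro j
    have := hDV (E j)
    have := hDf (E j)
    have := hDχ (E j)
    refine Continuous.integrable_of_hasCompactSupport (by fun_prop) ?_
    exact ((hχc.fderiv_apply (𝕜 := ℝ) (E j)).mul_right).add hχc.mul_right
  have h3 : (∑ j, ∑ i, ∫ x, (fderiv ℝ χ x (E i) *
      (inner ℝ (newtonField f x) (E j) * inner ℝ (fderiv ℝ (newtonField f) x (E j)) (E i))
      + χ x * (inner ℝ (fderiv ℝ (newtonField f) x (E j)) (E i) ^ 2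
        + inner ℝ (newtonField f x) (E j) *
          inner ℝ (fderiv ℝ (newtonField fun y => fderiv ℝ f y (E j)) x (E i)) (E i))))
      - ∑ j, ∫ x, (fderiv ℝ χ x (E j) * (inner ℝ (newtonField f x) (E j) * f x)
      + χ x * (inner ℝ (fderiv ℝ (newtonField f) x (E j)) (E j) * f x
        + inner ℝ (newtonField f x) (E j) * fderiv ℝ f x (E j))) = 0 := by
    simp only [h1, h2, Finset.sum_const_zero, sub_zero]
  rw [← h3]
  simp_rw [← integral_finsetSum _ fun i _ => i1 _ i]
  rw [← integral_finsetSum _ fun j _ => integrable_finsetSum _ fun i _ => i1 j i,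
    ← integral_finsetSum _ fun j _ => i2 j, ← integral_sub
    (integrable_finsetSum _ fun j _ => integrable_finsetSum _ fun i _ => i1 j i)
    (integrable_finsetSum _ fun j _ => i2 j)]
  congr 1
  funext x
  simp_rw [Finset.sum_add_distrib, ← Finset.mul_sum, Finset.sum_add_distrib, ← Finset.mul_sum]
  have e1 : ∀ j, ∑ i, inner ℝ (fderiv ℝ (newtonField fun y => fderiv ℝ f y (E j)) x (E i)) (E i)
      = fderiv ℝ f x (E j) := fun j =>
    sum_inner_fderiv_newtonField hd (contDiff_fderiv_apply hf _) (hc.fderiv_apply (𝕜 := ℝ) _) x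
  have e2 : ∑ j, inner ℝ (fderiv ℝ (newtonField f) x (E j)) (E j) * f x = f x ^ 2 := by
    rw [← Finset.sum_mul, sum_inner_fderiv_newtonField hd hf hc]; ring
  have e3 : ∀ v : RSpace d, ∑ i, inner ℝ v (E i) ^ 2 = ‖v‖ ^ 2 := by
    intro v
    simp [hE, EuclideanSpace.inner_single_right, EuclideanSpace.real_norm_sq_eq]
  simp_rw [e1, e2, e3]
  have e4 : ∀ j, ∑ i, fderiv ℝ χ x (E i) * (inner ℝ (newtonField f x) (E j) *
      inner ℝ (fderiv ℝ (newtonField f) x (E j)) (E i))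
      = inner ℝ (newtonField f x) (E j) * fderiv ℝ χ x (fderiv ℝ (newtonField f) x (E j)) := by
    intro j
    rw [fderiv_apply_eq_sum (fderiv ℝ χ x) (fderiv ℝ (newtonField f) x (E j)), Finset.mul_sum]
    refine Finset.sum_congr rfl fun i _ => by ring
  simp_rw [e4]
  have e5 : ∑ j, fderiv ℝ χ x (E j) * (inner ℝ (newtonField f x) (E j) * f x)
      = fderiv ℝ χ x (newtonField f x) * f x := by
    rw [fderiv_apply_eq_sum (fderiv ℝ χ x) (newtonField f x), Finset.sum_mul]
    refine Finset.sum_congr rfl fun i _ => by ring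
  rw [e5]
  ring

end Energy

section Energy

variable {d : ℕ} {f a : RSpace d → ℝ}

theorem norm_newtonKernel_neg (z : RSpace d) : ‖newtonKernel d (-z)‖ = ‖newtonKernel d z‖ := by
  simp [newtonKernel]

-- The identity with the cutoff `a(· / S)` has its error on the annulus `S ≤ |x| ≤ 2S`, where `V`
-- and `∇V` are both `O(S^(1 - d))`. The error is therefore `O(S^(-1) S^(2 - 2d) S^d) = O(S^(1 -
-- d))`, which vanishes as `S → ∞` since `d ≥ 2`.
set_option maxHeartbeats 400000 in
theorem integral_ball_hessian_le (hd : 2 ≤ d) (ha : IsRadialCutoff a) (hf : ContDiff ℝ ∞ f)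
    (hc : HasCompactSupport f) (S₀ : ℝ) :
    ∫ x in Metric.ball 0 S₀, ∑ j, ‖fderiv ℝ (newtonField f) x (EuclideanSpace.single j 1)‖ ^ 2
      ≤ ∫ x, f x ^ 2 := by
  obtain ⟨A, hA0, hA⟩ := ha.exists_fderiv_bound
  obtain ⟨r, hr0, hr⟩ : ∃ r, 0 < r ∧ tsupport f ⊆ Metric.closedBall 0 r :=
    hc.isCompact.isBounded.subset_closedBall_lt 0 0
  set E : Fin d → RSpace d := fun j => EuclideanSpace.single j 1 with hE
  have hV := contDiff_newtonField hd hf hc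
  have hVc := hV.continuous
  have hfc := hf.continuous
  have hDV : ∀ e, Continuous fun x => fderiv ℝ (newtonField f) x e := fun e =>
    (hV.continuous_fderiv (by simp)).clm_apply continuous_const
  set H : RSpace d → ℝ := fun x => ∑ j, ‖fderiv ℝ (newtonField f) x (E j)‖ ^ 2 with hH
  have hHc : Continuous H := continuous_finsetSum _ fun j _ => ((hDV _).norm.pow 2)
  have hH0 : ∀ x, 0 ≤ H x := fun x => Finset.sum_nonneg fun j _ => by positivity
  obtain ⟨A₁, hA₁0, hA₁⟩ : ∃ A₁, 0 ≤ A₁ ∧ ∀ x, 2 * r ≤ ‖x‖ →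
      ‖newtonField f x‖ ≤ A₁ * (‖x‖ ^ (d - 1))⁻¹ :=
    ⟨_, by have := newtonConst_pos hd; positivity,
      fun x hx => norm_newtonField_le_decay hd hr0 hfc hr hx⟩
  obtain ⟨A₂, hA₂0, hA₂⟩ : ∃ A₂ : Fin d → ℝ, (∀ j, 0 ≤ A₂ j) ∧ ∀ j x, 2 * r ≤ ‖x‖ →
      ‖fderiv ℝ (newtonField f) x (E j)‖ ≤ A₂ j * (‖x‖ ^ (d - 1))⁻¹ := by
    refine ⟨fun j => newtonConst d * 2 ^ (d - 1) * ∫ y, ‖fderiv ℝ f y (E j)‖,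
      fun j => by have := newtonConst_pos hd; positivity, fun j x hx => ?_⟩
    rw [fderiv_newtonField hd hf hc]
    exact norm_newtonField_le_decay hd hr0 (contDiff_fderiv_apply hf _).continuous
      ((tsupport_fderiv_apply_subset ℝ (E j)).trans hr) hx
  -- The factor `2 ^ d` times the volume of the unit ball comes from the ball of radius `2S` that
  -- contains the annulus.
  set C : ℝ := A * A₁ * (∑ j, A₂ j) * 2 ^ d * volume.real (Metric.ball (0 : RSpace d) 1) with hC
  have hC0 : 0 ≤ C := by
    have := Finset.sum_nonneg fun j (_ : j ∈ Finset.univ) => hA₂0 j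
    positivity
  have key : ∀ S, 2 * r ≤ S → S₀ ≤ S → 1 ≤ S →
      ∫ x in Metric.ball 0 S₀, H x ≤ (∫ x, f x ^ 2) + C * S⁻¹ := by
    intro S hS1 hS2 hS3
    have hS0 : 0 < S := by linarith
    set χ := dilate a S with hχd
    have hχ : ContDiff ℝ ∞ χ := ha.smooth.dilate S
    have hχc : HasCompactSupport χ := ha.hasCompactSupport.dilate hS0
    have hχ0 : ∀ x, 0 ≤ χ x := fun x => ha.nonneg _
    have hχ1 : ∀ x, χ x ≤ 1 := fun x => ha.le_one _
    have hDχ : Continuous (fderiv ℝ χ) := hχ.continuous_fderiv (by simp)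
    have hDχc : HasCompactSupport (fderiv ℝ χ) := hχc.fderiv (𝕜 := ℝ)
    have hχcc := hχ.continuous
    have hDχb : ∀ x, ‖fderiv ℝ χ x‖ ≤ S⁻¹ * A := by
      intro x
      rw [hχd, fderiv_dilate, norm_smul, norm_inv, Real.norm_of_nonneg hS0.le]
      gcongr
      exact hA _
    have hDχ0 : ∀ x, ‖x‖ < S → fderiv ℝ χ x = 0 := fun x hx =>
      fderiv_eq_zero_of_eqOn_ball (fun y hy => ha.dilate_eq_one hS0 hy) hx
    have hDχ2 : ∀ x, 2 * S < ‖x‖ → fderiv ℝ χ x = 0 := fun x hx =>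
      fderiv_eq_zero_of_eqOn_compl (fun y hy => ha.dilate_eq_zero hS0 hy) hx
    set err : RSpace d → ℝ := fun x => ∑ j, inner ℝ (newtonField f x) (E j) *
          fderiv ℝ χ x (fderiv ℝ (newtonField f) x (E j)) with herr
    have hid := integral_cutoff_mul_hessian hd hf hc hχ hχc
    -- The supports are disjoint: `f` lives in the ball of radius `r`, and the cutoff is constant on
    -- the ball of radius `S ≥ 2r`.
    have hz : ∀ x, fderiv ℝ χ x (newtonField f x) * f x = 0 := by
      intro x
      by_cases hx : f x = 0
      · simp [hx]
      · have : ‖x‖ ≤ r := by simpa using hr (subset_tsupport f hx)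
        rw [hDχ0 x (by linarith)]; simp
    have i1 : Integrable fun x => χ x * H x :=
      (hχcc.mul hHc).integrable_of_hasCompactSupport hχc.mul_right
    have hec : Continuous err := continuous_finsetSum _ fun j _ =>
      (hVc.inner continuous_const).mul (hDχ.clm_apply (hDV _))
    have hebd : ∀ x, ‖err x‖ ≤ (Metric.closedBall (0 : RSpace d) (2 * S)).indicator
        (fun _ => S⁻¹ * A * A₁ * (∑ j, A₂ j) * (S ^ (d - 1))⁻¹ * (S ^ (d - 1))⁻¹) x := by
      intro x
      rcases lt_or_ge ‖x‖ S with hx | hx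
      · have : err x = 0 := by simp [herr, hDχ0 x hx]
        rw [this, norm_zero]
        refine indicator_nonneg (fun _ _ => ?_) _
        have := Finset.sum_nonneg fun j (_ : j ∈ Finset.univ) => hA₂0 j
        positivity
      rcases lt_or_ge (2 * S) ‖x‖ with hx2 | hx2
      · have : err x = 0 := by simp [herr, hDχ2 x hx2]
        rw [this, norm_zero]
        refine indicator_nonneg (fun _ _ => ?_) _
        have := Finset.sum_nonneg fun j (_ : j ∈ Finset.univ) => hA₂0 j
        positivity
      rw [indicator_of_mem (by simpa using hx2)]
      have hle : (‖x‖ ^ (d - 1))⁻¹ ≤ (S ^ (d - 1))⁻¹ := by gcongr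
      calc ‖err x‖ ≤ ∑ j, ‖inner ℝ (newtonField f x) (E j) *
          fderiv ℝ χ x (fderiv ℝ (newtonField f) x (E j))‖ := norm_sum_le _ _
        _ ≤ ∑ j, (A₁ * (S ^ (d - 1))⁻¹) * (S⁻¹ * A * (A₂ j * (S ^ (d - 1))⁻¹)) := by
          refine Finset.sum_le_sum fun j _ => ?_
          rw [norm_mul]
          have hj := hA₂0 j
          have hEj : ‖E j‖ = 1 := by simp [hE]
          have b1 : ‖inner ℝ (newtonField f x) (E j)‖ ≤ A₁ * (S ^ (d - 1))⁻¹ := by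
            refine (norm_inner_le_norm _ _).trans ?_
            rw [hEj, mul_one]
            exact (hA₁ x (by linarith)).trans (by gcongr)
          have b2 : ‖fderiv ℝ χ x (fderiv ℝ (newtonField f) x (E j))‖
              ≤ S⁻¹ * A * (A₂ j * (S ^ (d - 1))⁻¹) := by
            refine ((fderiv ℝ χ x).le_opNorm _).trans ?_
            have := (hA₂ j x (by linarith)).trans
              (mul_le_mul_of_nonneg_left hle hj)
            have := hDχb x
            gcongr
          gcongr
        _ = _ := by
          simp_rw [Finset.mul_sum, Finset.sum_mul]
          exact Finset.sum_congr rfl fun j _ => by ring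
    have hind : Integrable ((Metric.closedBall (0 : RSpace d) (2 * S)).indicator
        (fun _ => S⁻¹ * A * A₁ * (∑ j, A₂ j) * (S ^ (d - 1))⁻¹ * (S ^ (d - 1))⁻¹)) :=
      (integrable_indicator_iff measurableSet_closedBall).2
        (integrableOn_const measure_closedBall_lt_top.ne)
    have i2 : Integrable err :=
      hind.mono' hec.aestronglyMeasurable (Eventually.of_forall hebd)
    have i3 : Integrable fun x => χ x * f x ^ 2 :=
      (hχcc.mul (hfc.pow 2)).integrable_of_hasCompactSupport hχc.mul_right
    have i4 : Integrable fun x => f x ^ 2 := by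
      simp_rw [sq]
      exact (hfc.mul hfc).integrable_of_hasCompactSupport hc.mul_right
    simp_rw [hz, add_zero] at hid
    have hid' : (∫ x, χ x * H x) + (∫ x, err x) - ∫ x, χ x * f x ^ 2 = 0 := by
      have i12 : Integrable fun x => χ x * H x + err x := i1.add i2
      rw [← integral_add i1 i2, ← integral_sub i12 i3]
      exact hid
    have s1 : ∫ x in Metric.ball 0 S₀, H x ≤ ∫ x, χ x * H x := by
      rw [← integral_indicator measurableSet_ball]
      refine integral_mono ((integrable_indicator_iff measurableSet_ball).2
        ((hHc.locallyIntegrable.integrableOn_isCompact (isCompact_closedBall 0 S₀)).mono_set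
          Metric.ball_subset_closedBall)) i1 fun x => ?_
      by_cases hx : x ∈ Metric.ball (0 : RSpace d) S₀
      · rw [indicator_of_mem hx]
        have : χ x = 1 := ha.dilate_eq_one hS0 (by
          have : ‖x‖ < S₀ := by simpa using hx
          linarith)
        simp [this]
      · rw [indicator_of_notMem hx]
        exact mul_nonneg (hχ0 x) (hH0 x)
    have s2 : ∫ x, χ x * f x ^ 2 ≤ ∫ x, f x ^ 2 := by
      refine integral_mono i3 i4 fun x => ?_
      have := hχ1 x
      have := sq_nonneg (f x)
      simp only
      nlinarith
    have s3 : |∫ x, err x| ≤ C * S⁻¹ := by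
      rw [← Real.norm_eq_abs]
      calc ‖∫ x, err x‖ ≤ ∫ x, ‖err x‖ := norm_integral_le_integral_norm err
        _ ≤ _ := integral_mono i2.norm hind hebd
        _ = C * (S ^ (d - 1))⁻¹ := by
          rw [integral_indicator measurableSet_closedBall, setIntegral_const, Measure.real,
            Measure.addHaar_closedBall _ _ (by positivity), finrank_euclideanSpace_fin,
            ENNReal.toReal_mul, ENNReal.toReal_ofReal (by positivity), hC, Measure.real]
          obtain ⟨m, rfl⟩ : ∃ m, d = m + 1 := ⟨d - 1, by omega⟩
          simp only [Nat.add_sub_cancel, smul_eq_mul]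
          field_simp
          ring
        _ ≤ C * S⁻¹ := by
          gcongr
          exact le_self_pow₀ hS3 (by omega)
    have := neg_abs_le (∫ x, err x)
    linarith
  refine le_of_forall_pos_le_add fun ε hε => ?_
  have hS := key (max (max (2 * r) S₀) (max 1 (C / ε)))
    ((le_max_left _ _).trans (le_max_left _ _)) ((le_max_right _ _).trans (le_max_left _ _))
    ((le_max_left _ _).trans (le_max_right _ _))
  refine hS.trans ?_
  gcongr
  set S := max (max (2 * r) S₀) (max 1 (C / ε))
  have h1 : 1 ≤ S := (le_max_left _ _).trans (le_max_right _ _)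
  have h2 : C / ε ≤ S := (le_max_right _ _).trans (le_max_right _ _)
  rw [div_le_iff₀ hε] at h2
  rw [← div_eq_mul_inv, div_le_iff₀ (by linarith)]
  linarith

theorem setIntegral_ball_comp_sub_le {H : RSpace d → ℝ} (hH : LocallyIntegrable H)
    (h0 : ∀ x, 0 ≤ H x) (S : ℝ) {r : ℝ} {w : RSpace d} (hw : ‖w‖ ≤ r) :
    ∫ x in Metric.ball 0 S, H (x - w) ≤ ∫ x in Metric.ball 0 (S + r), H x := by
  rw [← integral_indicator measurableSet_ball, ← integral_indicator measurableSet_ball,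
    ← integral_add_right_eq_self _ w]
  have hi : Integrable ((Metric.ball (0 : RSpace d) (S + r)).indicator H) :=
    (integrable_indicator_iff measurableSet_ball).2
      ((hH.integrableOn_isCompact (isCompact_closedBall 0 (S + r))).mono_set
        Metric.ball_subset_closedBall)
  refine integral_mono_of_nonneg (Eventually.of_forall fun x =>
    indicator_nonneg (fun _ _ => h0 _) _) hi (Eventually.of_forall fun x => ?_)
  by_cases hx : x + w ∈ Metric.ball (0 : RSpace d) S
  · have hx2 : x ∈ Metric.ball (0 : RSpace d) (S + r) := by
      rw [mem_ball_zero_iff] at hx ⊢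
      have := norm_sub_le (x + w) w
      simp at this
      linarith
    simp only [indicator_of_mem hx, indicator_of_mem hx2, add_sub_cancel_right, le_refl]
  · simp only [indicator_of_notMem hx]
    exact indicator_nonneg (fun _ _ => h0 _) _

/-- The increment is the integral of the derivative along the segment from `x` to `x - z`. Fubini's
theorem, the Cauchy–Schwarz inequality on the enlarged ball and the `L²` bound for `∇V` conclude.
The bound contains only the `L²` norm of `f`, so it survives approximation. -/
theorem integral_newtonField_sub_le_of_smooth (hd : 2 ≤ d) (ha : IsRadialCutoff a)
    (hf : ContDiff ℝ ∞ f) (hc : HasCompactSupport f) (z : RSpace d) (S : ℝ) :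
    ∫ x in Metric.ball 0 S, ‖newtonField f (x - z) - newtonField f x‖
      ≤ ‖z‖ * √(volume.real (Metric.ball (0 : RSpace d) (S + ‖z‖))) * √(∫ x, f x ^ 2) := by
  set E : Fin d → RSpace d := fun j => EuclideanSpace.single j 1 with hE
  have hV := contDiff_newtonField hd hf hc
  have hDV : ∀ e, Continuous fun x => fderiv ℝ (newtonField f) x e := fun e =>
    (hV.continuous_fderiv (by simp)).clm_apply continuous_const
  set H : RSpace d → ℝ := fun x => √(∑ j, ‖fderiv ℝ (newtonField f) x (E j)‖ ^ 2) with hH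
  have hHc : Continuous H := (continuous_finsetSum _ fun j _ => ((hDV _).norm.pow 2)).sqrt
  have hH0 : ∀ x, 0 ≤ H x := fun x => Real.sqrt_nonneg _
  have hHsq : ∀ x, H x ^ 2 = ∑ j, ‖fderiv ℝ (newtonField f) x (E j)‖ ^ 2 := fun x =>
    Real.sq_sqrt (Finset.sum_nonneg fun j _ => by positivity)
  have hDz : ∀ x v, ‖fderiv ℝ (newtonField f) x v‖ ≤ ‖v‖ * H x := by
    intro x v
    have h1 : fderiv ℝ (newtonField f) x v = ∑ j, v j • fderiv ℝ (newtonField f) x (E j) := by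
      conv_lhs => rw [← (EuclideanSpace.basisFun (Fin d) ℝ).sum_repr v]
      rw [map_sum]
      refine Finset.sum_congr rfl fun i _ => ?_
      simp [hE]
    rw [h1]
    have h2 : ‖∑ j, v j • fderiv ℝ (newtonField f) x (E j)‖
        ≤ ∑ j, |v j| * ‖fderiv ℝ (newtonField f) x (E j)‖ :=
      (norm_sum_le _ _).trans_eq (Finset.sum_congr rfl fun j _ => by rw [norm_smul, Real.norm_eq_abs])
    refine h2.trans (abs_le_of_sq_le_sq' ?_ (by have := hH0 x; positivity)).2
    refine (Finset.sum_mul_sq_le_sq_mul_sq _ _ _).trans_eq ?_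
    rw [mul_pow, hHsq, EuclideanSpace.real_norm_sq_eq]
    simp
  have hpt : ∀ x, ‖newtonField f (x - z) - newtonField f x‖
      ≤ ∫ τ in (0 : ℝ)..1, ‖z‖ * H (x - τ • z) := by
    intro x
    have hder : ∀ τ ∈ uIcc (0 : ℝ) 1, HasDerivAt (fun τ : ℝ => newtonField f (x - τ • z))
        (fderiv ℝ (newtonField f) (x - τ • z) (-z)) τ := by
      intro τ _
      have h1 : HasDerivAt (fun τ : ℝ => x - τ • z) (-z) τ := by
        simpa using ((hasDerivAt_id τ).smul_const z).const_sub x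
      exact ((hV.differentiable (by simp) _).hasFDerivAt).comp_hasDerivAt τ h1
    have hcont : Continuous fun τ : ℝ => fderiv ℝ (newtonField f) (x - τ • z) (-z) :=
      (hDV (-z)).comp (by fun_prop)
    have h := intervalIntegral.integral_eq_sub_of_hasDerivAt hder (hcont.intervalIntegrable _ _)
    simp only [one_smul, zero_smul, sub_zero] at h
    rw [← h]
    refine intervalIntegral.norm_integral_le_of_norm_le zero_le_one
      (Eventually.of_forall fun τ _ => ?_) ?_
    · simpa using hDz (x - τ • z) (-z)
    · have : Continuous fun τ : ℝ => ‖z‖ * H (x - τ • z) := by fun_prop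
      exact this.intervalIntegrable _ _
  have hVc := hV.continuous
  have hunc : Continuous (Function.uncurry fun (τ : ℝ) (x : RSpace d) => ‖z‖ * H (x - τ • z)) := by
    change Continuous fun p : ℝ × RSpace d => ‖z‖ * H (p.2 - p.1 • z)
    fun_prop
  have hpi : Integrable (Function.uncurry fun (τ : ℝ) (x : RSpace d) => ‖z‖ * H (x - τ • z))
      ((volume.restrict (uIoc 0 1)).prod (volume.restrict (Metric.ball (0 : RSpace d) S))) := by
    rw [Measure.prod_restrict]
    refine (hunc.locallyIntegrable.integrableOn_isCompact
      ((isCompact_Icc (a := (0 : ℝ)) (b := 1)).prod (isCompact_closedBall (0 : RSpace d) S))).mono_set ?_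
    exact prod_mono (by rw [uIoc_of_le zero_le_one]; exact Ioc_subset_Icc_self)
      Metric.ball_subset_closedBall
  have hballI : ∀ {F : Type} [NormedAddCommGroup F] {g : RSpace d → F}, Continuous g → ∀ S,
      IntegrableOn g (Metric.ball (0 : RSpace d) S) := fun hg S =>
    (hg.locallyIntegrable.integrableOn_isCompact (isCompact_closedBall (0 : RSpace d) S)).mono_set
      Metric.ball_subset_closedBall
  have hI : ∀ S, ∫ x in Metric.ball 0 S, H x
      ≤ √(volume.real (Metric.ball (0 : RSpace d) S)) * √(∫ x, f x ^ 2) := by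
    intro S
    have hm1 : MemLp (fun _ : RSpace d => (1 : ℝ)) 2 (volume.restrict (Metric.ball (0 : RSpace d) S)) := by
      have : IsFiniteMeasure (volume.restrict (Metric.ball (0 : RSpace d) S)) :=
        ⟨by rw [Measure.restrict_apply_univ]; exact measure_ball_lt_top⟩
      exact memLp_const 1
    have hm2 : MemLp H 2 (volume.restrict (Metric.ball (0 : RSpace d) S)) := by
      rw [memLp_two_iff_integrable_sq hHc.aestronglyMeasurable]
      exact hballI (hHc.pow 2) S
    have h := cauchy_schwarz_integral hm1 hm2
    simp only [abs_one, one_mul, one_pow, integral_const, smul_eq_mul, mul_one,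
      measureReal_restrict_apply_univ, abs_of_nonneg (hH0 _)] at h
    refine h.trans ?_
    gcongr
    simp_rw [hHsq]
    exact integral_ball_hessian_le hd ha hf hc S
  calc ∫ x in Metric.ball 0 S, ‖newtonField f (x - z) - newtonField f x‖
      ≤ ∫ x in Metric.ball 0 S, ∫ τ in (0 : ℝ)..1, ‖z‖ * H (x - τ • z) := by
        refine integral_mono (hballI (by fun_prop) S) ?_ hpt
        have := hpi.integral_prod_right
        simp_rw [intervalIntegral.integral_of_le zero_le_one]
        rw [uIoc_of_le zero_le_one] at this
        exact this
    _ = ∫ τ in (0 : ℝ)..1, ∫ x in Metric.ball 0 S, ‖z‖ * H (x - τ • z) :=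
        (intervalIntegral_integral_swap hpi).symm
    _ ≤ ∫ τ in (0 : ℝ)..1, ‖z‖ * (√(volume.real (Metric.ball (0 : RSpace d) (S + ‖z‖)))
          * √(∫ x, f x ^ 2)) := by
        refine intervalIntegral.integral_mono_on zero_le_one ?_ (by simp) fun τ hτ => ?_
        · rw [intervalIntegrable_iff_integrableOn_Ioc_of_le zero_le_one]
          have := hpi.integral_prod_left
          rw [uIoc_of_le zero_le_one] at this
          exact this
        · rw [integral_const_mul]
          gcongr
          refine (setIntegral_ball_comp_sub_le hHc.locallyIntegrable hH0 S (r := ‖z‖) ?_).trans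
            (hI _)
          rw [norm_smul, Real.norm_of_nonneg hτ.1]
          exact mul_le_of_le_one_left (norm_nonneg _) hτ.2
    _ = _ := by simp; ring

/-! ### Approximation by smooth densities -/

/-- Smooth approximations in `L¹` are composed with a smooth truncation that fixes the values of
`f`. The truncation is Lipschitz, so convergence in `L¹` persists, and the uniform bound upgrades it
to convergence in `L²`. -/
theorem exists_smooth_approx {B : ℝ} (hf : Integrable f)
    (hB : ∀ᵐ y, |f y| ≤ B) : ∃ (B' : ℝ) (g : ℕ → RSpace d → ℝ), (∀ n, ContDiff ℝ ∞ (g n)) ∧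
      (∀ n, HasCompactSupport (g n)) ∧ (∀ n x, |g n x| ≤ B') ∧
      Tendsto (fun n => ∫ x, |f x - g n x|) atTop (𝓝 0) := by
  -- The bump equals `1` on `[-|B| - 1, |B| + 1]`, so `s * φ s` is the identity on the range of `f`.
  let φ : ContDiffBump (0 : ℝ) := ⟨|B| + 1, |B| + 2, by positivity, by linarith⟩
  set θ : ℝ → ℝ := fun s => s * φ s with hθ
  have hθs : ContDiff ℝ ∞ θ := contDiff_id.mul φ.contDiff
  have hθc : HasCompactSupport θ := φ.hasCompactSupport.mul_left
  obtain ⟨L, hL⟩ := ContDiff.lipschitzWith_of_hasCompactSupport hθc hθs (by simp)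
  obtain ⟨B', hB'⟩ := hθc.exists_bound_of_continuous hθs.continuous
  have hex : ∀ n : ℕ, ∃ g : RSpace d → ℝ, HasCompactSupport g ∧ ContDiff ℝ ∞ g ∧
      eLpNorm (f - g) 1 volume ≤ ENNReal.ofReal (1 / ((n : ℝ) + 1)) := fun n =>
    (memLp_one_iff_integrable.2 hf).exist_eLpNorm_sub_le (by simp) le_rfl (by positivity)
  choose g hg1 hg2 hg3 using hex
  have hgi : ∀ n, Integrable (g n) := fun n =>
    (hg2 n).continuous.integrable_of_hasCompactSupport (hg1 n)
  have hfθ : ∀ᵐ y, θ (f y) = f y := by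
    filter_upwards [hB] with y hy
    have : φ (f y) = 1 := φ.one_of_mem_closedBall (by
      rw [mem_closedBall_zero_iff, Real.norm_eq_abs]
      exact hy.trans ((le_abs_self B).trans (by linarith)))
    simp [hθ, this]
  have hθ0 : θ 0 = 0 := by simp [hθ]
  refine ⟨B', fun n x => θ (g n x), fun n => hθs.comp (hg2 n),
    fun n => (hg1 n).comp_left hθ0, fun n x => hB' _, ?_⟩
  have hle : ∀ n : ℕ, ∫ x, |f x - θ (g n x)| ≤ L * (1 / ((n : ℝ) + 1)) := by
    intro n
    have h1 : ∫ x, |f x - g n x| ≤ 1 / ((n : ℝ) + 1) := by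
      have h := hg3 n
      rw [eLpNorm_one_eq_lintegral_enorm, ← ofReal_integral_norm_eq_lintegral_enorm
        (hf.sub (hgi n)), ENNReal.ofReal_le_ofReal_iff (by positivity)] at h
      exact h
    calc ∫ x, |f x - θ (g n x)| ≤ ∫ x, L * |f x - g n x| := by
          refine integral_mono_of_nonneg (Eventually.of_forall fun x => abs_nonneg _)
            ((hf.sub (hgi n)).abs.const_mul _) ?_
          filter_upwards [hfθ] with x hx
          conv_lhs => rw [← hx]
          simpa [Real.dist_eq] using hL.dist_le_mul (f x) (g n x)
      _ ≤ _ := by rw [integral_const_mul]; gcongr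
  refine squeeze_zero (fun n => integral_nonneg fun x => abs_nonneg _) hle ?_
  simpa using (tendsto_one_div_add_atTop_nhds_zero_nat (𝕜 := ℝ)).const_mul (L : ℝ)

end Energy

/-! ### Estimates for the field of a bounded integrable density -/

section FieldEstimates

variable {d : ℕ} {f a : RSpace d → ℝ} {B : ℝ}

theorem integrableOn_newtonField (hd : 2 ≤ d) (hf : Integrable f) (hB : ∀ᵐ y, |f y| ≤ B)
    {s : Set (RSpace d)} (hs : volume s ≠ ⊤) : IntegrableOn (newtonField f) s := by
  have : IsFiniteMeasure (volume.restrict s) :=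
    ⟨by rw [Measure.restrict_apply_univ]; exact hs.lt_top⟩
  exact Integrable.of_bound (aestronglyMeasurable_newtonField hf.aestronglyMeasurable).restrict _
    (Eventually.of_forall fun x => norm_newtonField_le hd hf hB x)

/-- Exchanging the integrals reduces the claim to a bound for the kernel integrated over the ball,
which is the bound for the field generated by the indicator of the ball. Linear dependence on the
`L¹` norm of `f` makes the field continuous in the density. -/
theorem integral_ball_newtonField_le (hd : 2 ≤ d) (hf : Integrable f) (hB : ∀ᵐ y, |f y| ≤ B)
    (S : ℝ) : ∫ x in Metric.ball 0 S, ‖newtonField f x‖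
      ≤ (newtonMass d + newtonConst d * volume.real (Metric.ball (0 : RSpace d) S)) * ∫ y, |f y| := by
  have hk := newtonConst_pos hd
  have hm := newtonMass_nonneg d
  set C := newtonMass d + newtonConst d * volume.real (Metric.ball (0 : RSpace d) S)
  have hC : 0 ≤ C := by positivity
  have h1 : ∀ y : RSpace d, ∫⁻ x in Metric.ball 0 S, ‖newtonKernel d (x - y)‖ₑ
      ≤ ENNReal.ofReal C := by
    intro y
    set g : RSpace d → ℝ := (Metric.ball (0 : RSpace d) S).indicator fun _ => 1
    have hg : Integrable g := (integrable_indicator_iff measurableSet_ball).2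
      (integrableOn_const measure_ball_lt_top.ne)
    have hg1 : ∀ x, |g x| ≤ 1 := by
      intro x
      by_cases hx : x ∈ Metric.ball (0 : RSpace d) S <;> simp [g, hx]
    have hg2 : ∫ x, |g x| = volume.real (Metric.ball (0 : RSpace d) S) := by
      have : ∀ x, |g x| = g x := fun x => abs_of_nonneg (indicator_nonneg (fun _ _ => zero_le_one) _)
      simp_rw [this]
      rw [integral_indicator measurableSet_ball]
      simp
    have h := integral_norm_newtonIntegrand_le hd hg (Eventually.of_forall hg1) y
    rw [hg2, one_mul] at h
    refine le_trans ?_ (ENNReal.ofReal_le_ofReal h)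
    rw [ofReal_integral_norm_eq_lintegral_enorm
      (integrable_newtonIntegrand hd hg (Eventually.of_forall hg1) y),
      ← lintegral_indicator measurableSet_ball]
    refine lintegral_mono fun x => ?_
    by_cases hx : x ∈ Metric.ball (0 : RSpace d) S
    · rw [indicator_of_mem hx]
      have e : g x = 1 := indicator_of_mem hx _
      rw [e, one_smul, ← neg_sub x y, ← ofReal_norm, ← ofReal_norm, norm_newtonKernel_neg]
    · simp [indicator_of_notMem hx]
  have hVi : Integrable (newtonField f) (volume.restrict (Metric.ball (0 : RSpace d) S)) :=
    integrableOn_newtonField hd hf hB measure_ball_lt_top.ne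
  rw [← ENNReal.ofReal_le_ofReal_iff (by positivity), ofReal_integral_norm_eq_lintegral_enorm hVi]
  calc ∫⁻ x in Metric.ball 0 S, ‖newtonField f x‖ₑ
      ≤ ∫⁻ x in Metric.ball 0 S, ∫⁻ y, ‖f y • newtonKernel d (x - y)‖ₑ :=
        lintegral_mono fun x => enorm_integral_le_lintegral_enorm _
    _ = ∫⁻ y, ∫⁻ x in Metric.ball 0 S, ‖f y • newtonKernel d (x - y)‖ₑ := by
        refine lintegral_lintegral_swap ?_
        have := aestronglyMeasurable_newtonIntegrand_prod hf.aestronglyMeasurable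
        refine (AEStronglyMeasurable.enorm (this.mono_ac ?_) :)
        exact Measure.AbsolutelyContinuous.prod Measure.restrict_le_self.absolutelyContinuous
          Measure.AbsolutelyContinuous.rfl
    _ ≤ ∫⁻ y, ‖f y‖ₑ * ENNReal.ofReal C := by
        refine lintegral_mono fun y => ?_
        simp_rw [enorm_smul]
        rw [lintegral_const_mul _ (by
          exact ((measurable_newtonKernel d).comp (measurable_id.sub measurable_const)).enorm)]
        gcongr
        exact h1 y
    _ = ENNReal.ofReal (C * ∫ y, |f y|) := by
        rw [lintegral_mul_const'' _ hf.aestronglyMeasurable.enorm,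
          ← ofReal_integral_norm_eq_lintegral_enorm hf, mul_comm, ENNReal.ofReal_mul hC]
        rfl

theorem integrable_sq_of_bounded (hf : Integrable f) (hB : ∀ᵐ y, |f y| ≤ B) :
    Integrable fun y => f y ^ 2 := by
  refine Integrable.mono' (hf.abs.const_mul B) (hf.aestronglyMeasurable.pow 2) ?_
  filter_upwards [hB] with y hy
  rw [norm_pow, Real.norm_eq_abs, sq]
  gcongr

/-- Approximation by smooth densities, bounded and convergent in `L¹`: the fields converge in `L¹`
of balls, and the right-hand sides converge because the densities converge in `L²`. -/
theorem integral_newtonField_sub_le (hd : 2 ≤ d) (ha : IsRadialCutoff a)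
    (hf : Integrable f) (hB : ∀ᵐ y, |f y| ≤ B) (z : RSpace d) (S : ℝ) :
    ∫ x in Metric.ball 0 S, ‖newtonField f (x - z) - newtonField f x‖
      ≤ ‖z‖ * √(volume.real (Metric.ball (0 : RSpace d) (S + ‖z‖))) * √(∫ x, f x ^ 2) := by
  obtain ⟨B', g, hg1, hg2, hg3, hg4⟩ := exists_smooth_approx hf hB
  have hgi : ∀ n, Integrable (g n) := fun n =>
    (hg1 n).continuous.integrable_of_hasCompactSupport (hg2 n)
  have hB0 : ∀ n, ∀ᵐ y, |f y - g n y| ≤ B + B' := by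
    intro n
    filter_upwards [hB] with y hy
    exact (abs_sub _ _).trans (add_le_add hy (hg3 n y))
  have hfg : ∀ n, Integrable fun y => f y - g n y := fun n => hf.sub (hgi n)
  have hsq : Tendsto (fun n => ∫ x, g n x ^ 2) atTop (𝓝 (∫ x, f x ^ 2)) := by
    rw [tendsto_iff_norm_sub_tendsto_zero]
    refine squeeze_zero (fun _ => norm_nonneg _) (g := fun n => (B + B') * ∫ x, |f x - g n x|) ?_ ?_
    · intro n
      have i1 := integrable_sq_of_bounded hf hB
      have i2 := integrable_sq_of_bounded (hgi n) (Eventually.of_forall (hg3 n))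
      rw [← integral_sub i2 i1, ← integral_const_mul]
      refine norm_integral_le_of_norm_le ((hfg n).abs.const_mul _) ?_
      filter_upwards [hB] with y hy
      have e : g n y ^ 2 - f y ^ 2 = -((f y + g n y) * (f y - g n y)) := by ring
      rw [e, norm_neg, norm_mul, Real.norm_eq_abs, Real.norm_eq_abs]
      gcongr
      exact (abs_add_le _ _).trans (add_le_add hy (hg3 n y))
    · simpa using hg4.const_mul (B + B')
  have hS : ∀ (h : RSpace d → ℝ) (B : ℝ), Integrable h → (∀ᵐ y, |h y| ≤ B) → ∀ z,
      IntegrableOn (fun x => newtonField h (x - z)) (Metric.ball 0 S) := by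
    intro h B hh hhB z
    have : IsFiniteMeasure (volume.restrict (Metric.ball (0 : RSpace d) S)) :=
      ⟨by rw [Measure.restrict_apply_univ]; exact measure_ball_lt_top⟩
    refine Integrable.of_bound ?_ _ (Eventually.of_forall fun x => norm_newtonField_le hd hh hhB _)
    exact ((aestronglyMeasurable_newtonField hh.aestronglyMeasurable).comp_measurePreserving
      (measurePreserving_sub_right volume z)).restrict
  have hS0 : ∀ (h : RSpace d → ℝ) (B : ℝ), Integrable h → (∀ᵐ y, |h y| ≤ B) →
      IntegrableOn (newtonField h) (Metric.ball 0 S) := fun h B hh hhB =>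
    integrableOn_newtonField hd hh hhB measure_ball_lt_top.ne
  set K : ℝ → ℝ := fun S => newtonMass d + newtonConst d * volume.real (Metric.ball (0 : RSpace d) S)
  have hle : ∀ n, ∫ x in Metric.ball 0 S, ‖newtonField f (x - z) - newtonField f x‖
      ≤ ‖z‖ * √(volume.real (Metric.ball (0 : RSpace d) (S + ‖z‖))) * √(∫ x, g n x ^ 2)
        -- The translated field on the ball of radius `S` is controlled on the ball of radius `S +
        -- ‖z‖`.
        + (K (S + ‖z‖) * (∫ y, |f y - g n y|) + K S * ∫ y, |f y - g n y|) := by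
    intro n
    have b1 := integral_newtonField_sub_le_of_smooth hd ha (hg1 n) (hg2 n) z S
    have b2 := integral_ball_newtonField_le hd (hfg n) (hB0 n) S
    have b3 := integral_ball_newtonField_le hd (hfg n) (hB0 n) (S + ‖z‖)
    have b4 : ∫ x in Metric.ball 0 S, ‖newtonField (fun y => f y - g n y) (x - z)‖
        ≤ ∫ x in Metric.ball 0 (S + ‖z‖), ‖newtonField (fun y => f y - g n y) x‖ := by
      refine setIntegral_ball_comp_sub_le (H := fun x => ‖newtonField (fun y => f y - g n y) x‖) ?_
        (fun x => norm_nonneg _) S le_rfl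
      rw [locallyIntegrable_iff]
      intro k hk
      exact (integrableOn_newtonField hd (hfg n) (hB0 n) hk.measure_lt_top.ne).norm
    have j1 : Integrable (fun x => ‖newtonField (g n) (x - z) - newtonField (g n) x‖)
        (volume.restrict (Metric.ball 0 S)) :=
      ((hS _ _ (hgi n) (Eventually.of_forall (hg3 n)) z).sub
        (hS0 _ _ (hgi n) (Eventually.of_forall (hg3 n)))).norm
    have j2 : Integrable (fun x => ‖newtonField (fun y => f y - g n y) (x - z)‖)
        (volume.restrict (Metric.ball 0 S)) := (hS _ _ (hfg n) (hB0 n) z).norm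
    have j3 : Integrable (fun x => ‖newtonField (fun y => f y - g n y) x‖)
        (volume.restrict (Metric.ball 0 S)) := (hS0 _ _ (hfg n) (hB0 n)).norm
    have j0 : Integrable (fun x => ‖newtonField f (x - z) - newtonField f x‖)
        (volume.restrict (Metric.ball 0 S)) := ((hS _ _ hf hB z).sub (hS0 _ _ hf hB)).norm
    have j23 : Integrable (fun x => ‖newtonField (fun y => f y - g n y) (x - z)‖
        + ‖newtonField (fun y => f y - g n y) x‖) (volume.restrict (Metric.ball 0 S)) := j2.add j3
    calc _ ≤ ∫ x in Metric.ball 0 S, (‖newtonField (g n) (x - z) - newtonField (g n) x‖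
          + (‖newtonField (fun y => f y - g n y) (x - z)‖ + ‖newtonField (fun y => f y - g n y) x‖)) := by
          refine integral_mono j0 (j1.add j23) fun x => ?_
          simp only
          rw [newtonField_sub hd hf hB (hgi n) (Eventually.of_forall (hg3 n)),
            newtonField_sub hd hf hB (hgi n) (Eventually.of_forall (hg3 n))]
          have e : newtonField f (x - z) - newtonField f x
            = (newtonField (g n) (x - z) - newtonField (g n) x)
              + ((newtonField f (x - z) - newtonField (g n) (x - z))
                - (newtonField f x - newtonField (g n) x)) := by abel
          conv_lhs => rw [e]
          exact (norm_add_le _ _).trans (by gcongr; exact norm_sub_le _ _)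
      _ ≤ _ := by
          rw [integral_add j1 j23, integral_add j2 j3]
          gcongr
          exact b4.trans b3
  have hlim : Tendsto (fun n => ‖z‖ * √(volume.real (Metric.ball (0 : RSpace d) (S + ‖z‖)))
      * √(∫ x, g n x ^ 2) + (K (S + ‖z‖) * (∫ y, |f y - g n y|) + K S * ∫ y, |f y - g n y|)) atTop
      (𝓝 (‖z‖ * √(volume.real (Metric.ball (0 : RSpace d) (S + ‖z‖))) * √(∫ x, f x ^ 2)
        + (K (S + ‖z‖) * 0 + K S * 0))) :=
    (((Real.continuous_sqrt.tendsto _).comp hsq).const_mul _).add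
      ((hg4.const_mul _).add (hg4.const_mul _))
  have := ge_of_tendsto' hlim hle
  simpa using this

theorem exists_lipschitz_newtonField (hd : 2 ≤ d) (hf : ContDiff ℝ ∞ f)
    (hc : HasCompactSupport f) :
    ∃ L, 0 ≤ L ∧ ∀ x y, ‖newtonField f x - newtonField f y‖ ≤ L * ‖x - y‖ := by
  have hDc : Continuous (fderiv ℝ f) := hf.continuous_fderiv (by simp)
  have hDs : HasCompactSupport (fderiv ℝ f) := hc.fderiv (𝕜 := ℝ)
  obtain ⟨A, hA⟩ := hDs.exists_bound_of_continuous hDc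
  have hA0 : 0 ≤ A := (norm_nonneg _).trans (hA 0)
  have hk := newtonConst_pos hd
  have hm := newtonMass_nonneg d
  have hi : Integrable fun x => ‖fderiv ℝ f x‖ := (hDc.integrable_of_hasCompactSupport hDs).norm
  refine ⟨A * newtonMass d + newtonConst d * ∫ x, ‖fderiv ℝ f x‖, by positivity, fun x y => ?_⟩
  refine (convex_univ).norm_image_sub_le_of_norm_fderiv_le (𝕜 := ℝ)
    (fun z _ => (contDiff_newtonField hd hf hc).differentiable (by simp) z) (fun z _ => ?_)
    (mem_univ y) (mem_univ x)
  refine ContinuousLinearMap.opNorm_le_bound _ (by positivity) fun v => ?_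
  rw [fderiv_newtonField hd hf hc]
  have hi2 : Integrable fun y => fderiv ℝ f y v :=
    (contDiff_fderiv_apply hf v).continuous.integrable_of_hasCompactSupport
      (hc.fderiv_apply (𝕜 := ℝ) v)
  refine (norm_newtonField_le hd hi2 (B := A * ‖v‖) (Eventually.of_forall fun y => ?_) z).trans ?_
  · exact ((fderiv ℝ f y).le_opNorm v).trans (by gcongr; exact hA y)
  · have : ∫ y, |fderiv ℝ f y v| ≤ (∫ y, ‖fderiv ℝ f y‖) * ‖v‖ := by
      rw [← integral_mul_const]
      exact integral_mono hi2.abs (hi.mul_const _) fun y => (fderiv ℝ f y).le_opNorm v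
    calc _ ≤ A * ‖v‖ * newtonMass d + newtonConst d * ((∫ y, ‖fderiv ℝ f y‖) * ‖v‖) := by gcongr
      _ = _ := by ring

end FieldEstimates

/-! ### Mollifiers -/

/-- A sequence of bump functions of radii `1 / (n + 1)` and `2 / (n + 1)`. -/
def mollifierBump (d n : ℕ) : ContDiffBump (0 : RSpace d) where
  rIn := ((n : ℝ) + 1)⁻¹
  rOut := 2 * ((n : ℝ) + 1)⁻¹
  rIn_pos := by positivity
  rIn_lt_rOut := by
    have : 0 < ((n : ℝ) + 1)⁻¹ := by positivity
    linarith

/-- A sequence of smooth mollifiers. -/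
def mollifier (d n : ℕ) : RSpace d → ℝ := (mollifierBump d n).normed volume

section Mollifier

variable {d : ℕ} (n : ℕ)

theorem contDiff_mollifier : ContDiff ℝ ∞ (mollifier d n) :=
  (mollifierBump d n).contDiff_normed

theorem hasCompactSupport_mollifier : HasCompactSupport (mollifier d n) :=
  (mollifierBump d n).hasCompactSupport_normed

theorem mollifier_nonneg (x : RSpace d) : 0 ≤ mollifier d n x :=
  (mollifierBump d n).nonneg_normed x

theorem integral_mollifier : ∫ x, mollifier d n x = 1 := (mollifierBump d n).integral_normed

theorem tsupport_mollifier :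
    tsupport (mollifier d n) = Metric.closedBall 0 (2 * ((n : ℝ) + 1)⁻¹) :=
  (mollifierBump d n).tsupport_normed_eq

theorem mollifier_eq_zero {x : RSpace d} (hx : 2 * ((n : ℝ) + 1)⁻¹ < ‖x‖) : mollifier d n x = 0 := by
  refine image_eq_zero_of_notMem_tsupport ?_
  rw [tsupport_mollifier]
  simpa using hx

theorem fderiv_mollifier_eq_zero {x : RSpace d} (hx : 2 < ‖x‖) : fderiv ℝ (mollifier d n) x = 0 := by
  have h : x ∉ tsupport (fderiv ℝ (mollifier d n)) := by
    intro h
    have := tsupport_fderiv_subset ℝ h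
    rw [tsupport_mollifier, mem_closedBall_zero_iff] at this
    have h1 : ((n : ℝ) + 1)⁻¹ ≤ 1 := by
      rw [inv_le_one₀ (by positivity)]
      have : (0 : ℝ) ≤ n := by positivity
      linarith
    linarith
  exact image_eq_zero_of_notMem_tsupport h

theorem mollifierBump_eq (x : RSpace d) :
    mollifierBump d n x = mollifierBump d 0 (((n : ℝ) + 1) • x) := by
  have h0 : (n : ℝ) + 1 ≠ 0 := by positivity
  rw [ContDiffBump.apply, ContDiffBump.apply]
  simp only [mollifierBump, sub_zero, inv_inv]
  have e1 : 2 * ((n : ℝ) + 1)⁻¹ / ((n : ℝ) + 1)⁻¹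
      = 2 * (((0 : ℕ) : ℝ) + 1)⁻¹ / (((0 : ℕ) : ℝ) + 1)⁻¹ := by
    rw [mul_div_assoc, div_self (inv_ne_zero h0)]; simp
  rw [e1]
  simp

theorem mollifier_eq (x : RSpace d) :
    mollifier d n x = ((n : ℝ) + 1) ^ d * mollifier d 0 (((n : ℝ) + 1) • x) := by
  have h0 : 0 < (n : ℝ) + 1 := by positivity
  have h1 : ∫ x, mollifierBump d n x = (((n : ℝ) + 1) ^ d)⁻¹ * ∫ x, mollifierBump d 0 x := by
    simp_rw [mollifierBump_eq n]
    rw [Measure.integral_comp_smul, finrank_euclideanSpace_fin, abs_of_pos (by positivity), smul_eq_mul]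
  unfold mollifier
  rw [ContDiffBump.normed_def, ContDiffBump.normed_def, h1, mollifierBump_eq]
  have := (mollifierBump d 0).integral_pos (μ := volume)
  field_simp

/-- The first moment of the gradient of the mollifiers. -/
def mollifierMoment (d : ℕ) : ℝ := ∫ z, ‖fderiv ℝ (mollifier d 0) z‖ * ‖z‖

theorem mollifierMoment_nonneg (d : ℕ) : 0 ≤ mollifierMoment d :=
  integral_nonneg fun _ => by positivity

/-- Scale invariance: `|∇η|` gains a factor `(n + 1) ^ (d + 1)`, the volume loses `(n + 1) ^ d` and
`|z|` loses one more power. This makes the commutator bounds uniform in `n`. -/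
theorem integral_norm_fderiv_mollifier_mul :
    ∫ z, ‖fderiv ℝ (mollifier d n) z‖ * ‖z‖ = mollifierMoment d := by
  have h0 : 0 < (n : ℝ) + 1 := by positivity
  have h1 : ∀ z, fderiv ℝ (mollifier d n) z
      = (((n : ℝ) + 1) ^ d * ((n : ℝ) + 1)) • fderiv ℝ (mollifier d 0) (((n : ℝ) + 1) • z) := by
    intro z
    have : mollifier d n = fun x => ((n : ℝ) + 1) ^ d • mollifier d 0 (((n : ℝ) + 1) • x) := by
      funext x; exact mollifier_eq n x
    rw [this, fderiv_fun_const_smul, fderiv_comp_smul, smul_smul]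
    exact ((contDiff_mollifier 0).comp (contDiff_const_smul ((n : ℝ) + 1))).differentiable (by simp) z
  have h2 : ∀ z : RSpace d, ‖fderiv ℝ (mollifier d n) z‖ * ‖z‖ = ((n : ℝ) + 1) ^ d *
      (‖fderiv ℝ (mollifier d 0) (((n : ℝ) + 1) • z)‖ * ‖((n : ℝ) + 1) • z‖) := by
    intro z
    rw [h1, norm_smul, norm_smul, Real.norm_of_nonneg (by positivity), Real.norm_of_nonneg h0.le]
    ring
  simp_rw [h2]
  rw [integral_const_mul, Measure.integral_comp_smul volume (fun z : RSpace d =>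
    ‖fderiv ℝ (mollifier d 0) z‖ * ‖z‖), finrank_euclideanSpace_fin, abs_of_pos (by positivity), smul_eq_mul,
    mollifierMoment]
  field_simp

theorem integrable_norm_fderiv_mollifier_mul :
    Integrable fun z : RSpace d => ‖fderiv ℝ (mollifier d n) z‖ * ‖z‖ := by
  have h1 : Continuous (fderiv ℝ (mollifier d n)) := (contDiff_mollifier n).continuous_fderiv (by simp)
  exact (h1.norm.mul continuous_norm).integrable_of_hasCompactSupport
    ((hasCompactSupport_mollifier n).fderiv (𝕜 := ℝ)).norm.mul_right

/-- Lebesgue's differentiation theorem. It requires a bounded ratio of the outer to the inner radii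
of the bumps, here `2`. -/
theorem ae_tendsto_mollify {g : RSpace d → ℝ} (hg : LocallyIntegrable g) :
    ∀ᵐ x, Tendsto (fun n => ∫ y, g y * mollifier d n (x - y)) atTop (𝓝 (g x)) := by
  have h1 : Tendsto (fun n : ℕ => (mollifierBump d n).rOut) atTop (𝓝 0) := by
    have := (tendsto_one_div_add_atTop_nhds_zero_nat (𝕜 := ℝ)).const_mul 2
    simpa [mollifierBump] using this
  have h2 : ∀ᶠ n in atTop, (mollifierBump d n).rOut ≤ 2 * (mollifierBump d n).rIn :=
    Eventually.of_forall fun n => le_rfl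
  filter_upwards [ContDiffBump.ae_convolution_tendsto_right_of_locallyIntegrable h1 h2 hg] with x hx
  refine hx.congr fun n => ?_
  rw [convolution_lsmul_swap]
  congr 1
  funext y
  simp [mollifier, mul_comm]

end Mollifier

/-! ### The commutator estimate -/

/-- The commutator of the convolution with `η` and the transport by `∇Φ * f`, applied to `w`. -/
def transportCommutator {d : ℕ} (η f w : RSpace d → ℝ) (x : RSpace d) : ℝ :=
  (∫ y, w y * fderiv ℝ η (x - y) (newtonField f y - newtonField f x))
    - ∫ y, f y * w y * η (x - y)

section Commutator

variable {d : ℕ} {f w a η : RSpace d → ℝ} {B B' : ℝ}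

theorem integrable_commutator_transport (hd : 2 ≤ d) (hη : ContDiff ℝ ∞ η) (hηc : HasCompactSupport η)
    (hf : Integrable f) (hB : ∀ᵐ y, |f y| ≤ B) (hw : Integrable w) (x v : RSpace d) :
    Integrable fun y => w y * fderiv ℝ η (x - y) (newtonField f y - v) := by
  have hDc : Continuous (fderiv ℝ η) := hη.continuous_fderiv (by simp)
  obtain ⟨A, hA⟩ := (hηc.fderiv (𝕜 := ℝ)).exists_bound_of_continuous hDc
  have hm : AEStronglyMeasurable (fun y => fderiv ℝ η (x - y) (newtonField f y - v)) volume := by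
    have h1 : AEStronglyMeasurable (fun y => fderiv ℝ η (x - y)) volume :=
      (hDc.comp (continuous_const.sub continuous_id)).aestronglyMeasurable
    exact (ContinuousLinearMap.apply ℝ ℝ).flip.aestronglyMeasurable_comp₂ h1
      ((aestronglyMeasurable_newtonField hf.aestronglyMeasurable).sub aestronglyMeasurable_const)
  refine hw.mul_bdd (c := A * ((B * newtonMass d + newtonConst d * ∫ y, |f y|) + ‖v‖)) hm
    (Eventually.of_forall fun y => ?_)
  refine ((fderiv ℝ η (x - y)).le_opNorm _).trans ?_
  have hA0 : 0 ≤ A := (norm_nonneg _).trans (hA 0)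
  gcongr
  · exact hA _
  · exact (norm_sub_le _ _).trans (by gcongr; exact norm_newtonField_le hd hf hB y)

theorem integrable_mul_of_bounded (hf : Integrable f) (hw : AEStronglyMeasurable w volume)
    (hB : ∀ᵐ y, |w y| ≤ B) : Integrable fun y => f y * w y :=
  hf.mul_bdd (c := B) hw hB

theorem integrable_mul_mollifier {g : RSpace d → ℝ} (hg : Integrable g) (hη : Continuous η)
    (hηc : HasCompactSupport η) (x : RSpace d) : Integrable fun y => g y * η (x - y) := by
  obtain ⟨A, hA⟩ := hηc.exists_bound_of_continuous hη
  exact hg.mul_bdd (c := A) (hη.comp (continuous_const.sub continuous_id)).aestronglyMeasurable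
    (Eventually.of_forall fun y => hA _)

theorem commutator_sub_left (hd : 2 ≤ d) (hη : ContDiff ℝ ∞ η) (hηc : HasCompactSupport η)
    {g : RSpace d → ℝ} {C : ℝ} (hf : Integrable f) (hB : ∀ᵐ y, |f y| ≤ B)
    (hg : Integrable g) (hC : ∀ᵐ y, |g y| ≤ C) (hw : Integrable w) (hB' : ∀ᵐ y, |w y| ≤ B')
    (x : RSpace d) :
    transportCommutator η (fun y => f y - g y) w x = transportCommutator η f w x - transportCommutator η g w x := by
  unfold transportCommutator
  have i1 := integrable_commutator_transport hd hη hηc hf hB hw x (newtonField f x)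
  have i2 := integrable_commutator_transport hd hη hηc hg hC hw x (newtonField g x)
  have i3 := integrable_mul_mollifier (integrable_mul_of_bounded hf hw.aestronglyMeasurable hB')
    hη.continuous hηc x
  have i4 := integrable_mul_mollifier (integrable_mul_of_bounded hg hw.aestronglyMeasurable hB')
    hη.continuous hηc x
  have e1 : ∫ y, w y * fderiv ℝ η (x - y) (newtonField (fun y => f y - g y) y
      - newtonField (fun y => f y - g y) x)
      = (∫ y, w y * fderiv ℝ η (x - y) (newtonField f y - newtonField f x))
        - ∫ y, w y * fderiv ℝ η (x - y) (newtonField g y - newtonField g x) := by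
    rw [← integral_sub i1 i2]
    congr 1
    funext y
    rw [newtonField_sub hd hf hB hg hC, newtonField_sub hd hf hB hg hC, ← mul_sub, ← map_sub]
    congr 2
    abel
  have e2 : ∫ y, (f y - g y) * w y * η (x - y) = (∫ y, f y * w y * η (x - y))
      - ∫ y, g y * w y * η (x - y) := by
    rw [← integral_sub i3 i4]
    congr 1
    funext y
    ring
  rw [e1, e2]
  ring

theorem commutator_sub_right (hd : 2 ≤ d) (hη : ContDiff ℝ ∞ η) (hηc : HasCompactSupport η)
    {g : RSpace d → ℝ} {C : ℝ} (hf : Integrable f) (hB : ∀ᵐ y, |f y| ≤ B)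
    (hg : Integrable g) (hC : ∀ᵐ y, |g y| ≤ C) (hw : Integrable w) (hB' : ∀ᵐ y, |w y| ≤ B')
    (x : RSpace d) :
    transportCommutator η f (fun y => w y - g y) x = transportCommutator η f w x - transportCommutator η f g x := by
  unfold transportCommutator
  have i1 := integrable_commutator_transport hd hη hηc hf hB hw x (newtonField f x)
  have i2 := integrable_commutator_transport hd hη hηc hf hB hg x (newtonField f x)
  have i3 := integrable_mul_mollifier (integrable_mul_of_bounded hf hw.aestronglyMeasurable hB')
    hη.continuous hηc x
  have i4 := integrable_mul_mollifier (integrable_mul_of_bounded hf hg.aestronglyMeasurable hC)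
    hη.continuous hηc x
  simp_rw [sub_mul, mul_sub, sub_mul]
  rw [integral_sub i1 i2, integral_sub i3 i4]
  ring

theorem aestronglyMeasurable_comp_sub {g : RSpace d → ℝ} (hg : AEStronglyMeasurable g volume) :
    AEStronglyMeasurable (fun p : RSpace d × RSpace d => g (p.1 - p.2)) (volume.prod volume) :=
  hg.comp_quasiMeasurePreserving (quasiMeasurePreserving_sub volume volume)

theorem lintegral_convolution_le {g : RSpace d → ℝ} (hg : AEStronglyMeasurable g volume)
    (n : ℕ) (s : Set (RSpace d)) :
    ∫⁻ x in s, ‖∫ y, g y * mollifier d n (x - y)‖ₑ ≤ ∫⁻ y, ‖g y‖ₑ := by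
  have hη := (contDiff_mollifier (d := d) n).continuous
  calc _ ≤ ∫⁻ x, ‖∫ y, g y * mollifier d n (x - y)‖ₑ := setLIntegral_le_lintegral _ _
    _ ≤ ∫⁻ x, ∫⁻ y, ‖g y‖ₑ * ‖mollifier d n (x - y)‖ₑ := by
        refine lintegral_mono fun x => (enorm_integral_le_lintegral_enorm _).trans_eq ?_
        simp_rw [enorm_mul]
    _ = ∫⁻ y, ∫⁻ x, ‖g y‖ₑ * ‖mollifier d n (x - y)‖ₑ := by
        refine lintegral_lintegral_swap ?_
        exact hg.comp_snd.enorm.mul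
          (hη.comp (continuous_fst.sub continuous_snd)).aestronglyMeasurable.enorm
    _ = ∫⁻ y, ‖g y‖ₑ := by
        refine lintegral_congr fun y => ?_
        rw [lintegral_const_mul' _ _ enorm_ne_top,
          lintegral_sub_right_eq_self (fun z => ‖mollifier d n z‖ₑ) y]
        rw [← ofReal_integral_norm_eq_lintegral_enorm
          (hη.integrable_of_hasCompactSupport (hasCompactSupport_mollifier n))]
        simp_rw [Real.norm_of_nonneg (mollifier_nonneg n _)]
        rw [integral_mollifier]
        simp

/-- After the substitution `z = x - y` the first term is at most the integral of `|∇η(z)| · M |z|`,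
which is `M` times the first moment, independent of `n`. The second term is a convolution with a
function of mass `1`. Only `‖z‖ ≤ 2` matters, since all the mollifiers are supported there. -/
theorem lintegral_commutator_le (hf : AEStronglyMeasurable f volume)
    (hw : AEStronglyMeasurable w volume) (n : ℕ) (S : ℝ) {M : ℝ} (hM0 : 0 ≤ M)
    (hM : ∀ z, ‖z‖ ≤ 2 → ∫⁻ x in Metric.ball 0 S, ‖w (x - z)‖ₑ
      * ‖newtonField f (x - z) - newtonField f x‖ₑ ≤ ENNReal.ofReal (M * ‖z‖)) :
    ∫⁻ x in Metric.ball 0 S, ‖transportCommutator (mollifier d n) f w x‖ₑ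
      ≤ ENNReal.ofReal (M * mollifierMoment d) + ∫⁻ y, ‖f y * w y‖ₑ := by
  have hη := (contDiff_mollifier (d := d) n)
  have hDc : Continuous (fderiv ℝ (mollifier d n)) := hη.continuous_fderiv (by simp)
  have hVm := aestronglyMeasurable_newtonField hf
  set V := newtonField f
  have hacd : ∀ (s : Set (RSpace d)), ((volume.restrict s).prod volume :
      Measure (RSpace d × RSpace d)) ≪ volume.prod volume := fun s =>
    Measure.AbsolutelyContinuous.prod Measure.restrict_le_self.absolutelyContinuous
      Measure.AbsolutelyContinuous.rfl
  have hVsub : AEStronglyMeasurable (fun p : RSpace d × RSpace d => V (p.1 - p.2))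
      (volume.prod volume) := hVm.comp_quasiMeasurePreserving (quasiMeasurePreserving_sub volume volume)
  have hwsub := aestronglyMeasurable_comp_sub hw
  have hT : ∫⁻ x in Metric.ball 0 S, ‖∫ y, w y * fderiv ℝ (mollifier d n) (x - y) (V y - V x)‖ₑ
      ≤ ENNReal.ofReal (M * mollifierMoment d) := by
    calc _ ≤ ∫⁻ x in Metric.ball 0 S, ∫⁻ z, ‖fderiv ℝ (mollifier d n) z‖ₑ *
            (‖w (x - z)‖ₑ * ‖V (x - z) - V x‖ₑ) := by
          refine lintegral_mono fun x => ?_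
          rw [← integral_sub_left_eq_self _ volume x]
          refine (enorm_integral_le_lintegral_enorm _).trans (lintegral_mono fun z => ?_)
          rw [sub_sub_cancel, enorm_mul, mul_left_comm]
          gcongr
          rw [← ofReal_norm, ← ofReal_norm, ← ofReal_norm, ← ENNReal.ofReal_mul (norm_nonneg _)]
          exact ENNReal.ofReal_le_ofReal ((fderiv ℝ (mollifier d n) z).le_opNorm _)
      _ = ∫⁻ z, ∫⁻ x in Metric.ball 0 S, ‖fderiv ℝ (mollifier d n) z‖ₑ *
            (‖w (x - z)‖ₑ * ‖V (x - z) - V x‖ₑ) := by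
          refine lintegral_lintegral_swap ?_
          refine AEMeasurable.mul (hDc.comp continuous_snd).aestronglyMeasurable.enorm
            (AEMeasurable.mul (hwsub.mono_ac (hacd _)).enorm ?_)
          exact ((hVsub.sub hVm.comp_fst).mono_ac (hacd _)).enorm
      _ ≤ ∫⁻ z, ENNReal.ofReal (M * (‖fderiv ℝ (mollifier d n) z‖ * ‖z‖)) := by
          refine lintegral_mono fun z => ?_
          rw [lintegral_const_mul' _ _ (by finiteness)]
          rcases le_or_gt ‖z‖ 2 with hz | hz
          · calc _ ≤ ‖fderiv ℝ (mollifier d n) z‖ₑ * ENNReal.ofReal (M * ‖z‖) := by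
                  gcongr; exact hM z hz
              _ = _ := by
                  rw [← ofReal_norm, ← ENNReal.ofReal_mul (norm_nonneg _)]
                  congr 1; ring
          · rw [fderiv_mollifier_eq_zero n hz, ← ofReal_norm, norm_zero]; simp
      _ = _ := by
          rw [← ofReal_integral_eq_lintegral_ofReal
            ((integrable_norm_fderiv_mollifier_mul n).const_mul M)
            (Eventually.of_forall fun z => by positivity), integral_const_mul,
            integral_norm_fderiv_mollifier_mul]
  have hmeas2 : AEMeasurable (fun x => ‖∫ y, f y * w y * mollifier d n (x - y)‖ₑ)
      (volume.restrict (Metric.ball (0 : RSpace d) S)) := by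
    have h1 : AEStronglyMeasurable (fun p : RSpace d × RSpace d => f p.2 * w p.2
        * mollifier d n (p.1 - p.2)) (volume.prod volume) :=
      (hf.mul hw).comp_snd.mul (hη.continuous.comp (continuous_fst.sub continuous_snd)).aestronglyMeasurable
    exact h1.integral_prod_right'.restrict.enorm
  calc _ ≤ ∫⁻ x in Metric.ball 0 S, (‖∫ y, w y * fderiv ℝ (mollifier d n) (x - y) (V y - V x)‖ₑ
        + ‖∫ y, f y * w y * mollifier d n (x - y)‖ₑ) := lintegral_mono fun x => enorm_sub_le
    _ ≤ _ := by
        rw [lintegral_add_right' _ hmeas2]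
        exact add_le_add hT (lintegral_convolution_le (hf.mul hw) n _)

theorem lintegral_enorm_mul_le (hf : Integrable f)
    (hB' : ∀ᵐ y, |w y| ≤ B') : ∫⁻ y, ‖f y * w y‖ₑ ≤ ENNReal.ofReal ((∫ y, |f y|) * B') := by
  rw [← integral_mul_const]
  have hB0 : ∀ y, |w y| ≤ B' → 0 ≤ B' := fun y hy => (abs_nonneg _).trans hy
  rw [ofReal_integral_eq_lintegral_ofReal (hf.abs.mul_const B')]
  · refine lintegral_mono_ae ?_
    filter_upwards [hB'] with y hy
    rw [← ofReal_norm, norm_mul, Real.norm_eq_abs, Real.norm_eq_abs]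
    refine ENNReal.ofReal_le_ofReal ?_
    gcongr
  · filter_upwards [hB'] with y hy
    have := hB0 y hy
    positivity

/-- The constant in the estimate of the commutator on the ball of radius `S`. -/
def commutatorConst (d : ℕ) (S : ℝ) : ℝ :=
  √(volume.real (Metric.ball (0 : RSpace d) (S + 2))) * mollifierMoment d

theorem commutatorConst_nonneg (d : ℕ) (S : ℝ) : 0 ≤ commutatorConst d S :=
  mul_nonneg (Real.sqrt_nonneg _) (mollifierMoment_nonneg d)

/-- With `w` bounded, the `L¹` increments of the field suffice. The bound is uniform in `n` and
small with `f` in `L¹ ∩ L²`, which permits replacing `f` by a smooth density. The radius `S + 2` in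
`commutatorConst` accounts for the shifts `‖z‖ ≤ 2`. -/
theorem lintegral_commutator_le_left (hd : 2 ≤ d) (ha : IsRadialCutoff a)
    (hf : Integrable f) (hB : ∀ᵐ y, |f y| ≤ B)
    (hw : AEStronglyMeasurable w volume) (hB' : ∀ᵐ y, |w y| ≤ B') (hB0 : 0 ≤ B') (n : ℕ) (S : ℝ) :
    ∫⁻ x in Metric.ball 0 S, ‖transportCommutator (mollifier d n) f w x‖ₑ
      ≤ ENNReal.ofReal (B' * (commutatorConst d S * √(∫ x, f x ^ 2) + ∫ x, |f x|)) := by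
  set M := B' * (√(volume.real (Metric.ball (0 : RSpace d) (S + 2))) * √(∫ x, f x ^ 2))
  have hM0 : 0 ≤ M := by positivity
  refine (lintegral_commutator_le hf.aestronglyMeasurable hw n S hM0 ?_).trans ?_
  · intro z hz
    have hi : IntegrableOn (fun x => newtonField f (x - z) - newtonField f x) (Metric.ball 0 S) := by
      have : IsFiniteMeasure (volume.restrict (Metric.ball (0 : RSpace d) S)) :=
        ⟨by rw [Measure.restrict_apply_univ]; exact measure_ball_lt_top⟩
      refine Integrable.sub ?_ (integrableOn_newtonField hd hf hB measure_ball_lt_top.ne)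
      refine Integrable.of_bound ?_ _ (Eventually.of_forall fun x => norm_newtonField_le hd hf hB _)
      exact ((aestronglyMeasurable_newtonField hf.aestronglyMeasurable).comp_measurePreserving
        (measurePreserving_sub_right volume z)).restrict
    have hwz : ∀ᵐ x, |w (x - z)| ≤ B' :=
      (measurePreserving_sub_right volume z).quasiMeasurePreserving.ae hB'
    calc _ ≤ ∫⁻ x in Metric.ball 0 S, ENNReal.ofReal B'
          * ‖newtonField f (x - z) - newtonField f x‖ₑ := by
          refine lintegral_mono_ae (ae_restrict_of_ae ?_)
          filter_upwards [hwz] with x hx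
          gcongr
          rw [← ofReal_norm]
          exact ENNReal.ofReal_le_ofReal hx
      _ = ENNReal.ofReal (B' * ∫ x in Metric.ball 0 S, ‖newtonField f (x - z) - newtonField f x‖) := by
          rw [lintegral_const_mul' _ _ (by finiteness), ENNReal.ofReal_mul hB0,
            ofReal_integral_norm_eq_lintegral_enorm hi]
      _ ≤ _ := by
          refine ENNReal.ofReal_le_ofReal ?_
          rw [mul_assoc]
          refine mul_le_mul_of_nonneg_left ?_ hB0
          refine (integral_newtonField_sub_le hd ha hf hB z S).trans ?_
          have : volume.real (Metric.ball (0 : RSpace d) (S + ‖z‖))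
              ≤ volume.real (Metric.ball (0 : RSpace d) (S + 2)) :=
            measureReal_mono (Metric.ball_subset_ball (by linarith)) measure_ball_lt_top.ne
          calc _ ≤ ‖z‖ * √(volume.real (Metric.ball (0 : RSpace d) (S + 2))) * √(∫ x, f x ^ 2) := by
                gcongr
            _ = _ := by ring
  · refine (add_le_add_right (lintegral_enorm_mul_le hf hB') _).trans_eq ?_
    rw [← ENNReal.ofReal_add (mul_nonneg hM0 (mollifierMoment_nonneg d)) (by positivity)]
    congr 1
    simp only [M, commutatorConst]
    ring

/-- With a Lipschitz field, `w` enters only through its `L¹` norm. This permits replacing `w` by a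
smooth function once `f` has become smooth. -/
theorem lintegral_commutator_le_right {L : ℝ} (hL0 : 0 ≤ L)
    (hL : ∀ x y, ‖newtonField f x - newtonField f y‖ ≤ L * ‖x - y‖)
    (hf : AEStronglyMeasurable f volume) (hB : ∀ᵐ y, |f y| ≤ B) (hB0 : 0 ≤ B)
    (hw : Integrable w) (n : ℕ) (S : ℝ) :
    ∫⁻ x in Metric.ball 0 S, ‖transportCommutator (mollifier d n) f w x‖ₑ
      ≤ ENNReal.ofReal ((L * mollifierMoment d + B) * ∫ x, |w x|) := by
  set M := L * ∫ x, |w x|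
  have hM0 : 0 ≤ M := by positivity
  refine (lintegral_commutator_le hf hw.aestronglyMeasurable n S hM0 ?_).trans ?_
  · intro z hz
    calc _ ≤ ∫⁻ x, ‖w (x - z)‖ₑ * ENNReal.ofReal (L * ‖z‖) := by
          refine (setLIntegral_le_lintegral _ _).trans (lintegral_mono fun x => ?_)
          gcongr
          rw [← ofReal_norm]
          refine ENNReal.ofReal_le_ofReal ((hL _ _).trans_eq ?_)
          simp
      _ = _ := by
          rw [lintegral_mul_const' _ _ (by finiteness), lintegral_sub_right_eq_self (fun x => ‖w x‖ₑ) z,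
            ← ofReal_integral_norm_eq_lintegral_enorm hw, ← ENNReal.ofReal_mul (by positivity)]
          congr 1
          simp only [M, Real.norm_eq_abs]
          ring
  · have h := lintegral_enorm_mul_le (f := w) (w := f) hw hB
    simp_rw [mul_comm (w _)] at h
    refine (add_le_add_right h _).trans_eq ?_
    rw [← ENNReal.ofReal_add (mul_nonneg hM0 (mollifierMoment_nonneg d)) (by positivity)]
    congr 1
    simp only [M]
    ring

/-- Integrating by parts moves the derivative from `η` to `w`. The term where it falls on the field
contains `div V = f` and is the one subtracted in `transportCommutator`. -/
theorem commutator_eq_of_smooth (hd : 2 ≤ d) (hη : ContDiff ℝ ∞ η) (hηc : HasCompactSupport η)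
    (hf : ContDiff ℝ ∞ f) (hc : HasCompactSupport f)
    (hw : ContDiff ℝ ∞ w) (hwc : HasCompactSupport w) (x : RSpace d) :
    transportCommutator η f w x
      = ∫ y, fderiv ℝ w y (newtonField f y - newtonField f x) * η (x - y) := by
  set E : Fin d → RSpace d := fun j => EuclideanSpace.single j 1 with hE
  have hV := contDiff_newtonField hd hf hc
  have hηx : ContDiff ℝ ∞ fun y => η (x - y) := hη.comp (contDiff_const.sub contDiff_id)
  have hDη : ∀ y e, fderiv ℝ (fun y => η (x - y)) y e = -fderiv ℝ η (x - y) e := by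
    intro y e
    have h1 : HasFDerivAt (fun z => x - z) (-ContinuousLinearMap.id ℝ (RSpace d)) y :=
      (hasFDerivAt_id y).const_sub x
    have h2 := ((hη.differentiable (by simp)) (x - y)).hasFDerivAt.comp y h1
    have h3 : fderiv ℝ (fun z => η (x - z)) y = _ := h2.fderiv
    rw [h3]; simp
  have hp : ∀ j, ContDiff ℝ ∞ fun y => inner ℝ (newtonField f y - newtonField f x) (E j) := fun j =>
    (hV.sub contDiff_const).inner ℝ contDiff_const
  have hDp : ∀ j y, fderiv ℝ (fun y => inner ℝ (newtonField f y - newtonField f x) (E j)) y (E j)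
      = inner ℝ (fderiv ℝ (newtonField f) y (E j)) (E j) := by
    intro j y
    have h := (((hV.differentiable (by simp) y).hasFDerivAt).sub_const (newtonField f x)).inner ℝ
      (hasFDerivAt_const (E j) y)
    rw [h.fderiv]
    simp
  have h1 : ∀ j, ∫ y, (fderiv ℝ w y (E j) * (inner ℝ (newtonField f y - newtonField f x) (E j)
      * η (x - y)) + w y * (inner ℝ (fderiv ℝ (newtonField f) y (E j)) (E j) * η (x - y)
        - inner ℝ (newtonField f y - newtonField f x) (E j) * fderiv ℝ η (x - y) (E j))) = 0 := by
    intro j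
    rw [← integral_leibniz (hw.of_le (by simp)) hwc ((hp j).of_le (by simp))
      (hηx.of_le (by simp)) (E j)]
    congr 1
    funext y
    rw [hDp, hDη]
    ring
  have hDV : ∀ e, Continuous fun x => fderiv ℝ (newtonField f) x e := fun e =>
    (hV.continuous_fderiv (by simp)).clm_apply continuous_const
  have hDwc : ∀ e, Continuous fun x => fderiv ℝ w x e := fun e =>
    (contDiff_fderiv_apply hw e).continuous
  have hDηc : ∀ e, Continuous fun y => fderiv ℝ η (x - y) e := fun e =>
    (contDiff_fderiv_apply hη e).continuous.comp (continuous_const.sub continuous_id)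
  have hVc := hV.continuous
  have hwcc := hw.continuous
  have hηcc := hηx.continuous
  have i1 : ∀ j, Integrable fun y => (fderiv ℝ w y (E j) *
      (inner ℝ (newtonField f y - newtonField f x) (E j)
      * η (x - y)) + w y * (inner ℝ (fderiv ℝ (newtonField f) y (E j)) (E j) * η (x - y)
        - inner ℝ (newtonField f y - newtonField f x) (E j) * fderiv ℝ η (x - y) (E j))) := by
    intro j
    have := hDV (E j)
    have := hDwc (E j)
    have := hDηc (E j)
    refine Continuous.integrable_of_hasCompactSupport (by fun_prop) ?_
    exact ((hwc.fderiv_apply (𝕜 := ℝ) (E j)).mul_right).add hwc.mul_right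
  have h3 : (∑ j, ∫ y, (fderiv ℝ w y (E j) *
      (inner ℝ (newtonField f y - newtonField f x) (E j)
      * η (x - y)) + w y * (inner ℝ (fderiv ℝ (newtonField f) y (E j)) (E j) * η (x - y)
        - inner ℝ (newtonField f y - newtonField f x) (E j) * fderiv ℝ η (x - y) (E j)))) = 0 := by
    simp only [h1, Finset.sum_const_zero]
  rw [← integral_finsetSum _ fun j _ => i1 j] at h3
  have h4 : ∀ y, ∑ j, (fderiv ℝ w y (E j) *
      (inner ℝ (newtonField f y - newtonField f x) (E j)
      * η (x - y)) + w y * (inner ℝ (fderiv ℝ (newtonField f) y (E j)) (E j) * η (x - y)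
        - inner ℝ (newtonField f y - newtonField f x) (E j) * fderiv ℝ η (x - y) (E j)))
      = fderiv ℝ w y (newtonField f y - newtonField f x) * η (x - y)
        - (w y * fderiv ℝ η (x - y) (newtonField f y - newtonField f x)
          - f y * w y * η (x - y)) := by
    intro y
    rw [← sum_inner_fderiv_newtonField hd hf hc y,
      fderiv_apply_eq_sum (fderiv ℝ w y), fderiv_apply_eq_sum (fderiv ℝ η (x - y))]
    simp only [Finset.sum_mul, Finset.mul_sum, ← Finset.sum_sub_distrib]
    refine Finset.sum_congr rfl fun j _ => ?_
    ring
  simp_rw [h4] at h3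
  have hB : ∃ B, ∀ y, |f y| ≤ B := hc.exists_bound_of_continuous hf.continuous
  obtain ⟨B, hB⟩ := hB
  have hwi : Integrable w := hwcc.integrable_of_hasCompactSupport hwc
  have hfi : Integrable f := hf.continuous.integrable_of_hasCompactSupport hc
  have j1 := integrable_commutator_transport hd hη hηc hfi (Eventually.of_forall hB) hwi x (newtonField f x)
  have j2 : Integrable fun y => f y * w y * η (x - y) := by
    refine ((hf.continuous.mul hwcc).mul hηcc).integrable_of_hasCompactSupport ?_
    exact (hc.mul_right).mul_right
  have j3 : Integrable fun y => fderiv ℝ w y (newtonField f y - newtonField f x) * η (x - y) := by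
    refine Continuous.integrable_of_hasCompactSupport ?_ ?_
    · exact ((hw.continuous_fderiv (by simp)).clm_apply (hVc.sub continuous_const)).mul hηcc
    · refine HasCompactSupport.mul_right ?_
      refine (hwc.fderiv (𝕜 := ℝ)).mono fun y hy => ?_
      contrapose! hy
      simp at hy
      simp [hy]
  have j12 : Integrable fun y => w y * fderiv ℝ η (x - y) (newtonField f y - newtonField f x)
      - f y * w y * η (x - y) := j1.sub j2
  rw [integral_sub j3 j12, integral_sub j1 j2] at h3
  rw [transportCommutator]
  linarith

/-- On the support of the mollifier `|y - x| ≤ 2 / (n + 1)`, so the increment of the Lipschitz field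
is small; no derivative of the mollifier is left. -/
theorem norm_commutator_le_of_smooth (hd : 2 ≤ d) (n : ℕ)
    (hf : ContDiff ℝ ∞ f) (hc : HasCompactSupport f)
    (hw : ContDiff ℝ ∞ w) (hwc : HasCompactSupport w) {A L : ℝ} (hA : ∀ y, ‖fderiv ℝ w y‖ ≤ A)
    (hL0 : 0 ≤ L) (hL : ∀ x y, ‖newtonField f x - newtonField f y‖ ≤ L * ‖x - y‖) (x : RSpace d) :
    ‖transportCommutator (mollifier d n) f w x‖ ≤ A * L * 2 * ((n : ℝ) + 1)⁻¹ := by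
  have hA0 : 0 ≤ A := (norm_nonneg _).trans (hA 0)
  rw [commutator_eq_of_smooth hd (contDiff_mollifier n) (hasCompactSupport_mollifier n) hf hc hw hwc]
  have hi : Integrable fun y => A * L * 2 * ((n : ℝ) + 1)⁻¹ * mollifier d n (x - y) :=
    (((contDiff_mollifier n).continuous.integrable_of_hasCompactSupport
      (hasCompactSupport_mollifier n)).comp_sub_left x).const_mul _
  refine (norm_integral_le_of_norm_le hi (Eventually.of_forall fun y => ?_)).trans_eq ?_
  · rw [norm_mul, Real.norm_of_nonneg (mollifier_nonneg n _)]
    rcases le_or_gt ‖x - y‖ (2 * ((n : ℝ) + 1)⁻¹) with h | h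
    · refine mul_le_mul_of_nonneg_right ?_ (mollifier_nonneg n _)
      calc _ ≤ ‖fderiv ℝ w y‖ * ‖newtonField f y - newtonField f x‖ := (fderiv ℝ w y).le_opNorm _
        _ ≤ A * (L * (2 * ((n : ℝ) + 1)⁻¹)) := by
          gcongr
          · exact hA y
          · exact (hL y x).trans (by rw [norm_sub_rev]; gcongr)
        _ = _ := by ring
    · rw [mollifier_eq_zero n h]; simp
  · rw [integral_const_mul, integral_sub_left_eq_self (fun y => mollifier d n y) volume x,
      integral_mollifier, mul_one]

theorem tendsto_lintegral_commutator_of_smooth (hd : 2 ≤ d)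
    (hf : ContDiff ℝ ∞ f) (hc : HasCompactSupport f)
    (hw : ContDiff ℝ ∞ w) (hwc : HasCompactSupport w) (S : ℝ) :
    Tendsto (fun n => ∫⁻ x in Metric.ball 0 S, ‖transportCommutator (mollifier d n) f w x‖ₑ) atTop (𝓝 0) := by
  obtain ⟨L, hL0, hL⟩ := exists_lipschitz_newtonField hd hf hc
  obtain ⟨A, hA⟩ := (hwc.fderiv (𝕜 := ℝ)).exists_bound_of_continuous
    (hw.continuous_fderiv (by simp))
  have hA0 : 0 ≤ A := (norm_nonneg _).trans (hA 0)
  have hle : ∀ n : ℕ, ∫⁻ x in Metric.ball 0 S, ‖transportCommutator (mollifier d n) f w x‖ₑ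
      ≤ ENNReal.ofReal (A * L * 2 * ((n : ℝ) + 1)⁻¹ * volume.real (Metric.ball (0 : RSpace d) S)) := by
    intro n
    rw [ENNReal.ofReal_mul (by positivity), Measure.real, ENNReal.ofReal_toReal measure_ball_lt_top.ne]
    rw [← setLIntegral_const]
    refine lintegral_mono fun x => ?_
    rw [← ofReal_norm]
    exact ENNReal.ofReal_le_ofReal (norm_commutator_le_of_smooth hd n hf hc hw hwc hA hL0 hL x)
  refine tendsto_of_tendsto_of_tendsto_of_le_of_le tendsto_const_nhds ?_ (fun _ => zero_le) hle
  rw [← ENNReal.ofReal_zero]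
  refine (ENNReal.continuous_ofReal.tendsto _).comp ?_
  have := ((tendsto_one_div_add_atTop_nhds_zero_nat (𝕜 := ℝ)).const_mul (A * L * 2)).mul_const
    (volume.real (Metric.ball (0 : RSpace d) S))
  simpa using this

theorem aestronglyMeasurable_commutator (hf : AEStronglyMeasurable f volume)
    (hw : AEStronglyMeasurable w volume) (hη : ContDiff ℝ ∞ η) :
    AEStronglyMeasurable (transportCommutator η f w) volume := by
  have hDc : Continuous (fderiv ℝ η) := hη.continuous_fderiv (by simp)
  have hVm := aestronglyMeasurable_newtonField hf
  have h1 : AEStronglyMeasurable (fun p : RSpace d × RSpace d => w p.2 *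
      fderiv ℝ η (p.1 - p.2) (newtonField f p.2 - newtonField f p.1)) (volume.prod volume) := by
    refine hw.comp_snd.mul ?_
    exact (ContinuousLinearMap.apply ℝ ℝ).flip.aestronglyMeasurable_comp₂
      (hDc.comp (continuous_fst.sub continuous_snd)).aestronglyMeasurable
      (hVm.comp_snd.sub hVm.comp_fst)
  have h2 : AEStronglyMeasurable (fun p : RSpace d × RSpace d => f p.2 * w p.2
      * η (p.1 - p.2)) (volume.prod volume) :=
    (hf.mul hw).comp_snd.mul (hη.continuous.comp (continuous_fst.sub continuous_snd)).aestronglyMeasurable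
  exact h1.integral_prod_right'.sub h2.integral_prod_right'

/-- The commutator tends to `0` in `L¹_loc`. -/
theorem tendsto_lintegral_commutator (hd : 2 ≤ d) (ha : IsRadialCutoff a)
    (hf : Integrable f) (hB : ∀ᵐ y, |f y| ≤ B) (hw : Integrable w) (hB' : ∀ᵐ y, |w y| ≤ B')
    (S : ℝ) :
    Tendsto (fun n => ∫⁻ x in Metric.ball 0 S, ‖transportCommutator (mollifier d n) f w x‖ₑ) atTop (𝓝 0) := by
  rw [ENNReal.tendsto_nhds_zero]
  intro ε hε
  obtain ⟨C, g, hg1, hg2, hg3, hg4⟩ := exists_smooth_approx hf hB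
  obtain ⟨C', k, hk1, hk2, hk3, hk4⟩ := exists_smooth_approx hw hB'
  have hgi : ∀ n, Integrable (g n) := fun n =>
    (hg1 n).continuous.integrable_of_hasCompactSupport (hg2 n)
  have hki : ∀ n, Integrable (k n) := fun n =>
    (hk1 n).continuous.integrable_of_hasCompactSupport (hk2 n)
  have hB0 : 0 ≤ max B' 0 := le_max_right _ _
  have hBm : ∀ᵐ y, |w y| ≤ max B' 0 := hB'.mono fun y hy => hy.trans (le_max_left _ _)
  have hC0 : 0 ≤ C := (abs_nonneg _).trans (hg3 0 0)
  have hbd : ∀ n, ∀ᵐ y, |f y - g n y| ≤ B + C := by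
    intro n
    filter_upwards [hB] with y hy
    exact (abs_sub _ _).trans (add_le_add hy (hg3 n y))
  have hbd' : ∀ n, ∀ᵐ y, |w y - k n y| ≤ B' + C' := by
    intro n
    filter_upwards [hB'] with y hy
    exact (abs_sub _ _).trans (add_le_add hy (hk3 n y))
  have hε3 : 0 < ε / 3 := ENNReal.div_pos hε.ne' (by simp)
  -- The density generating the field is approximated first: here `w` need only be bounded, and the
  -- choice of `m` serves all `n`.
  obtain ⟨m, hm⟩ : ∃ m, ∀ n, ∫⁻ x in Metric.ball 0 S,
      ‖transportCommutator (mollifier d n) (fun y => f y - g m y) w x‖ₑ ≤ ε / 3 := by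
    have hsq : Tendsto (fun m => ∫ x, (f x - g m x) ^ 2) atTop (𝓝 0) := by
      refine squeeze_zero (fun m => integral_nonneg fun x => sq_nonneg _)
        (g := fun m => (B + C) * ∫ x, |f x - g m x|) (fun m => ?_) (by simpa using hg4.const_mul (B + C))
      rw [← integral_const_mul]
      refine integral_mono_ae (integrable_sq_of_bounded (hf.sub (hgi m)) (hbd m))
        ((hf.sub (hgi m)).abs.const_mul _) ?_
      filter_upwards [hbd m] with y hy
      rw [← sq_abs, sq]
      exact mul_le_mul_of_nonneg_right hy (abs_nonneg _)
    have h1 : Tendsto (fun m => ENNReal.ofReal (max B' 0 * (commutatorConst d S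
        * √(∫ x, (f x - g m x) ^ 2) + ∫ x, |f x - g m x|))) atTop (𝓝 (ENNReal.ofReal 0)) := by
      refine (ENNReal.continuous_ofReal.tendsto _).comp ?_
      have := ((((Real.continuous_sqrt.tendsto _).comp hsq).const_mul (commutatorConst d S)).add
        hg4).const_mul (max B' 0)
      simpa using this
    rw [ENNReal.ofReal_zero] at h1
    obtain ⟨m, hm⟩ := ((ENNReal.tendsto_nhds_zero.1 h1) (ε / 3) hε3).exists
    exact ⟨m, fun n => (lintegral_commutator_le_left hd ha (hf.sub (hgi m)) (hbd m)
      hw.aestronglyMeasurable hBm hB0 n S).trans hm⟩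
  obtain ⟨L, hL0, hL⟩ := exists_lipschitz_newtonField hd (hg1 m) (hg2 m)
  -- With `m` fixed, the Lipschitz constant `L` of the field is fixed too, and `w` can be
  -- approximated in `L¹`.
  obtain ⟨j, hj⟩ : ∃ j, ∀ n, ∫⁻ x in Metric.ball 0 S,
      ‖transportCommutator (mollifier d n) (g m) (fun y => w y - k j y) x‖ₑ ≤ ε / 3 := by
    have h1 : Tendsto (fun j => ENNReal.ofReal ((L * mollifierMoment d + C)
        * ∫ x, |w x - k j x|)) atTop (𝓝 (ENNReal.ofReal 0)) := by
      refine (ENNReal.continuous_ofReal.tendsto _).comp ?_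
      simpa using hk4.const_mul (L * mollifierMoment d + C)
    rw [ENNReal.ofReal_zero] at h1
    obtain ⟨j, hj⟩ := ((ENNReal.tendsto_nhds_zero.1 h1) (ε / 3) hε3).exists
    exact ⟨j, fun n => (lintegral_commutator_le_right hL0 hL (hg1 m).continuous.aestronglyMeasurable
      (Eventually.of_forall (hg3 m)) hC0 (hw.sub (hki j)) n S).trans hj⟩
  filter_upwards [(ENNReal.tendsto_nhds_zero.1 (tendsto_lintegral_commutator_of_smooth hd (hg1 m)
    (hg2 m) (hk1 j) (hk2 j) S)) (ε / 3) hε3] with n hn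
  have hη := contDiff_mollifier (d := d) n
  have hηc := hasCompactSupport_mollifier (d := d) n
  have e : ∀ x, transportCommutator (mollifier d n) f w x
      = transportCommutator (mollifier d n) (fun y => f y - g m y) w x
        + (transportCommutator (mollifier d n) (g m) (fun y => w y - k j y) x
          + transportCommutator (mollifier d n) (g m) (k j) x) := by
    intro x
    rw [commutator_sub_left hd hη hηc hf hB (hgi m) (Eventually.of_forall (hg3 m)) hw hB',
      commutator_sub_right hd hη hηc (hgi m) (Eventually.of_forall (hg3 m)) (hki j)
        (Eventually.of_forall (hk3 j)) hw hB']
    ring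
  have hmeas : ∀ f w : RSpace d → ℝ, Integrable f → Integrable w →
      AEMeasurable (fun x => ‖transportCommutator (mollifier d n) f w x‖ₑ)
        (volume.restrict (Metric.ball (0 : RSpace d) S)) := fun f w hf hw =>
    (aestronglyMeasurable_commutator hf.aestronglyMeasurable hw.aestronglyMeasurable hη).restrict.enorm
  calc _ ≤ ∫⁻ x in Metric.ball 0 S, (‖transportCommutator (mollifier d n) (fun y => f y - g m y) w x‖ₑ
        + (‖transportCommutator (mollifier d n) (g m) (fun y => w y - k j y) x‖ₑ
          + ‖transportCommutator (mollifier d n) (g m) (k j) x‖ₑ)) := by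
        refine lintegral_mono fun x => ?_
        rw [e]
        exact (enorm_add_le _ _).trans (by gcongr; exact enorm_add_le _ _)
    _ ≤ ε / 3 + (ε / 3 + ε / 3) := by
        rw [lintegral_add_left' (hmeas (fun y => f y - g m y) _ (hf.sub (hgi m)) hw),
          lintegral_add_left' (hmeas _ (fun y => w y - k j y) (hgi m) (hw.sub (hki j)))]
        exact add_le_add (hm n) (add_le_add (hj n) hn)
    _ = ε := by rw [← add_assoc]; exact ENNReal.add_thirds ε

end Commutator

/-! ### Continuity in time of integrals along curves in `L²` -/

/-- A continuous curve in `L²(ℝ^d)` with uniform bounds in `L¹ ∩ L^∞`. -/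
structure IsBoundedCurve {d : ℕ} (L B : ℝ) (u : ℝ → L2Scalar d) : Prop where
  continuous : Continuous u
  integrable : ∀ s, Integrable (u s)
  integral_le : ∀ s, ∫ x, |u s x| ≤ L
  bound : ∀ s, ∀ᵐ x, |u s x| ≤ B

/-- The extension of a curve on `[0, T]` by constants. -/
def extendCurve {d : ℕ} {T : ℝ} (hT : 0 < T) (ρ : ℝ → L2Scalar d) (s : ℝ) : L2Scalar d :=
  ρ (projIcc 0 T hT.le s)

section Curve

variable {d : ℕ}

theorem extendCurve_eq {T : ℝ} (hT : 0 < T) (ρ : ℝ → L2Scalar d) {s : ℝ} (hs : s ∈ Icc 0 T) :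
    extendCurve hT ρ s = ρ s := by
  rw [extendCurve, projIcc_of_mem hT.le hs]

theorem continuous_extendCurve {T : ℝ} (hT : 0 < T) {ρ : ℝ → L2Scalar d}
    (h : ContinuousOn ρ (Icc 0 T)) : Continuous (extendCurve hT ρ) :=
  h.comp_continuous (continuous_subtype_val.comp continuous_projIcc) fun s => (projIcc 0 T hT.le s).2

/-- Fatou's lemma along a subsequence converging almost everywhere. -/
theorem isClosed_setOf_eLpNorm_le (p C : ℝ≥0∞) :
    IsClosed {f : L2Scalar d | eLpNorm f p volume ≤ C} := by
  refine IsSeqClosed.isClosed fun f g hf hg => ?_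
  obtain ⟨ns, hns, hlim⟩ := (tendstoInMeasure_of_tendsto_Lp hg).exists_seq_tendsto_ae
  refine (Lp.eLpNorm_lim_le_liminf_eLpNorm (fun n => (Lp.aestronglyMeasurable (f (ns n)))) _ hlim).trans ?_
  calc _ ≤ liminf (fun _ : ℕ => C) atTop := liminf_le_liminf (Eventually.of_forall fun n => hf _)
    _ = C := liminf_const _

/-- Bounds for almost every time become bounds for every time: the set of times where the bound
holds is closed, and a relatively open null subset of `(0, T)` is empty. -/
theorem eLpNorm_extendCurve_le {T : ℝ} (hT : 0 < T) {ρ : ℝ → L2Scalar d}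
    (h : ContinuousOn ρ (Icc 0 T)) {p C : ℝ≥0∞}
    (hC : ∀ᵐ t ∂(volume.restrict (Icc 0 T)), eLpNorm (ρ t) p volume ≤ C) (s : ℝ) :
    eLpNorm (extendCurve hT ρ s) p volume ≤ C := by
  set A : Set ℝ := {t | eLpNorm (extendCurve hT ρ t) p volume ≤ C} with hA
  have hAc : IsClosed A := (isClosed_setOf_eLpNorm_le p C).preimage (continuous_extendCurve hT h)
  have h1 : Ioo 0 T ⊆ A := by
    by_contra hne
    have h2 : (Ioo 0 T \ A).Nonempty := by
      obtain ⟨x, hx, hx'⟩ := not_subset.1 hne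
      exact ⟨x, hx, hx'⟩
    have h3 := ((isOpen_Ioo.sdiff hAc).measure_pos_iff volume).2 h2
    refine h3.ne' ?_
    rw [ae_restrict_iff' measurableSet_Icc] at hC
    refine measure_mono_null ?_ hC
    rintro t ⟨ht, ht'⟩ h4
    apply ht'
    rw [hA, mem_ofPred_eq, extendCurve_eq hT ρ (Ioo_subset_Icc_self ht)]
    exact h4 (Ioo_subset_Icc_self ht)
  have h2 : Icc 0 T ⊆ A := by
    rw [← closure_Ioo hT.ne]
    exact closure_minimal h1 hAc
  have h3 := h2 (projIcc 0 T hT.le s).2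
  rwa [hA, mem_ofPred_eq, extendCurve_eq hT ρ (projIcc 0 T hT.le s).2] at h3

theorem ae_abs_le_of_eLpNorm_top_le {f : RSpace d → ℝ} {C : ℝ} (hC : 0 ≤ C)
    (h : eLpNorm f ∞ volume ≤ ENNReal.ofReal C) : ∀ᵐ x, |f x| ≤ C := by
  rw [eLpNorm_exponent_top] at h
  filter_upwards [ae_le_eLpNormEssSup (f := f) (μ := volume)] with x hx
  have := hx.trans h
  rwa [← ofReal_norm, ENNReal.ofReal_le_ofReal_iff hC] at this

theorem isBoundedCurve_of_eLpNorm_le {u : ℝ → L2Scalar d} (hu : Continuous u) {L B : ℝ}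
    (hL : 0 ≤ L) (hB : 0 ≤ B)
    (h1 : ∀ s, eLpNorm (u s) 1 volume ≤ ENNReal.ofReal L)
    (h2 : ∀ s, eLpNorm (u s) ∞ volume ≤ ENNReal.ofReal B) : IsBoundedCurve L B u where
  continuous := hu
  integrable s := memLp_one_iff_integrable.1
    ⟨Lp.aestronglyMeasurable _, (h1 s).trans_lt ENNReal.ofReal_lt_top⟩
  integral_le s := by
    have hi : Integrable (u s) := memLp_one_iff_integrable.1
      ⟨Lp.aestronglyMeasurable _, (h1 s).trans_lt ENNReal.ofReal_lt_top⟩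
    have h := h1 s
    rw [eLpNorm_one_eq_lintegral_enorm, ← ofReal_integral_norm_eq_lintegral_enorm hi,
      ENNReal.ofReal_le_ofReal_iff hL] at h
    exact h
  bound s := ae_abs_le_of_eLpNorm_top_le hB (h2 s)

variable {E : Type*} [NormedAddCommGroup E] [NormedSpace ℝ E] {u : ℝ → L2Scalar d} {L B : ℝ}

/-- Convergence in `L²` gives convergence almost everywhere only along subsequences. This suffices,
because a limit may be tested on a further subsequence of each sequence. -/
theorem continuousAt_integral_curve (hu : Continuous u) {Θ : ℝ → RSpace d → ℝ → E}
    (hΘ : ∀ᵐ x, Continuous fun p : ℝ × ℝ => Θ p.1 x p.2)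
    (hm : ∀ s, AEStronglyMeasurable (fun x => Θ s x (u s x)) volume) {s₀ : ℝ}
    {g : RSpace d → ℝ} (hg : Integrable g) (hdom : ∀ᶠ s in 𝓝 s₀, ∀ᵐ x, ‖Θ s x (u s x)‖ ≤ g x) :
    ContinuousAt (fun s => ∫ x, Θ s x (u s x)) s₀ := by
  refine tendsto_of_subseq_tendsto fun ns hns => ?_
  have h1 : Tendsto (fun n => u (ns n)) atTop (𝓝 (u s₀)) := (hu.tendsto s₀).comp hns
  obtain ⟨ms, hms, hlim⟩ := (tendstoInMeasure_of_tendsto_Lp h1).exists_seq_tendsto_ae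
  refine ⟨ms, tendsto_integral_filter_of_dominated_convergence g
    (Eventually.of_forall fun n => hm _)
    ((hns.comp hms.tendsto_atTop).eventually hdom) hg ?_⟩
  filter_upwards [hΘ, hlim] with x hx hx'
  have h2 : Tendsto (fun n => (ns (ms n), u (ns (ms n)) x)) atTop (𝓝 (s₀, u s₀ x)) :=
    (hns.comp hms.tendsto_atTop).prodMk_nhds hx'
  exact (hx.tendsto (s₀, u s₀ x)).comp h2

theorem continuous_integral_curve (hu : Continuous u) {Θ : ℝ → RSpace d → ℝ → E}
    (hΘ : ∀ᵐ x, Continuous fun p : ℝ × ℝ => Θ p.1 x p.2)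
    (hm : ∀ s, AEStronglyMeasurable (fun x => Θ s x (u s x)) volume)
    {g : RSpace d → ℝ} (hg : Integrable g) (hdom : ∀ s, ∀ᵐ x, ‖Θ s x (u s x)‖ ≤ g x) :
    Continuous fun s => ∫ x, Θ s x (u s x) :=
  continuous_iff_continuousAt.2 fun _ =>
    continuousAt_integral_curve hu hΘ hm hg (Eventually.of_forall hdom)

theorem IsBoundedCurve.bound_nonneg (hu : IsBoundedCurve L B u) : 0 ≤ B := by
  obtain ⟨x, hx⟩ := (hu.bound 0).exists
  exact (abs_nonneg _).trans hx

theorem IsBoundedCurve.mass_nonneg (hu : IsBoundedCurve L B u) : 0 ≤ L :=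
  (integral_nonneg fun _ => abs_nonneg _).trans (hu.integral_le 0)

theorem IsBoundedCurve.norm_newtonField_le (hd : 2 ≤ d) (hu : IsBoundedCurve L B u) (s : ℝ)
    (x : RSpace d) : ‖newtonField (u s) x‖ ≤ B * newtonMass d + newtonConst d * L :=
  (_root_.norm_newtonField_le hd (hu.integrable s) (hu.bound s) x).trans
    (by have := hu.integral_le s; have := (newtonConst_pos hd).le; gcongr)

/-- The kernel is not integrable at infinity, so dominated convergence applies only after truncation
to a ball of radius `r`. The remainder is at most `newtonConst d * L / r`, uniformly in time, and
uniform limits preserve continuity. -/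
theorem IsBoundedCurve.continuous_newtonField (hd : 2 ≤ d) (hu : IsBoundedCurve L B u)
    (x : RSpace d) : Continuous fun s => newtonField (u s) x := by
  have hL0 := hu.mass_nonneg
  have hB0 := hu.bound_nonneg
  have hc := newtonConst_pos hd
  refine continuous_of_uniform_approx_of_continuous fun U hU => ?_
  obtain ⟨ε, hε, hεU⟩ := Metric.mem_uniformity_dist.1 hU
  obtain ⟨m, hm⟩ := exists_nat_gt (newtonConst d * L / ε)
  set r : ℝ := m + 1
  have hr : 1 ≤ r := by simp [r]
  have hr0 : 0 < r := by linarith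
  have hmr : newtonConst d * r⁻¹ * L < ε := by
    have : newtonConst d * L < ε * r := by
      rw [div_lt_iff₀ hε] at hm
      nlinarith
    calc newtonConst d * r⁻¹ * L = (newtonConst d * L) * r⁻¹ := by ring
      _ < ε * r * r⁻¹ := by gcongr
      _ = ε := by field_simp
  set k : RSpace d → RSpace d := (Metric.ball 0 r).indicator (newtonKernel d)
  have hkm : Measurable k := (measurable_newtonKernel d).indicator Metric.isOpen_ball.measurableSet
  have hkx : AEStronglyMeasurable (fun y => k (x - y)) volume :=
    (hkm.comp (measurable_const.sub measurable_id)).aestronglyMeasurable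
  have hk : Integrable fun y => ‖k (x - y)‖ := by
    refine (integrable_nearKernel hd r x).congr (Eventually.of_forall fun y => ?_)
    simp only [k, norm_indicator_eq_indicator_norm]
  have hd1 : ∀ s, ∀ᵐ y, ‖u s y • k (x - y)‖ ≤ B * ‖k (x - y)‖ := fun s => by
    filter_upwards [hu.bound s] with y hy
    rw [norm_smul, Real.norm_eq_abs]
    gcongr
  have hms : ∀ s, AEStronglyMeasurable (fun y => u s y • k (x - y)) volume := fun s =>
    (hu.integrable s).aestronglyMeasurable.smul hkx
  refine ⟨fun s => ∫ y, u s y • k (x - y), ?_, fun s => hεU ?_⟩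
  · exact continuous_integral_curve (Θ := fun s y r => r • k (x - y)) hu.continuous
      (Eventually.of_forall fun y => continuous_snd.smul continuous_const) hms
      (hk.const_mul B) hd1
  · rw [dist_eq_norm, newtonField, ← integral_sub
      (integrable_newtonIntegrand hd (hu.integrable s) (hu.bound s) x)
      ((hk.const_mul B).mono' (hms s) (hd1 s))]
    refine lt_of_le_of_lt ?_ hmr
    calc _ ≤ ∫ y, newtonConst d * r⁻¹ * |u s y| := by
          refine norm_integral_le_of_norm_le ((hu.integrable s).abs.const_mul _)
            (Eventually.of_forall fun y => ?_)
          rw [← smul_sub, norm_smul, Real.norm_eq_abs, mul_comm]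
          gcongr
          by_cases h : x - y ∈ Metric.ball 0 r
          · simp only [k, indicator_of_mem h, sub_self, norm_zero]; positivity
          · simp only [k, indicator_of_notMem h, sub_zero]
            refine norm_newtonKernel_le_of_one_le hd hr ?_
            simpa using h
      _ ≤ _ := by
          rw [integral_const_mul]
          have := hu.integral_le s
          gcongr

/-- Measurability proper, not just almost everywhere: joint measurability in time and space will be
deduced from continuity in time for every point and measurability in space for every time. -/
theorem stronglyMeasurable_newtonField {f : RSpace d → ℝ} (hf : StronglyMeasurable f) :
    StronglyMeasurable (newtonField f) := by
  refine StronglyMeasurable.integral_prod_right (f := fun x y => f y • newtonKernel d (x - y)) ?_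
  exact (hf.comp_measurable measurable_snd).smul
    ((measurable_newtonKernel d).comp (measurable_fst.sub measurable_snd)).stronglyMeasurable

end Curve

/-! ### From distributional to integrated equations in time -/

theorem contDiff_intervalIntegral {χ : ℝ → ℝ} (hχ : ContDiff ℝ ∞ χ) (T : ℝ) :
    ContDiff ℝ ∞ fun t => ∫ s in T..t, χ s := by
  have hd : ∀ t, HasDerivAt (fun t => ∫ s in T..t, χ s) (χ t) t := fun t =>
    intervalIntegral.integral_hasDerivAt_right (hχ.continuous.intervalIntegrable _ _)
      (hχ.continuous.stronglyMeasurableAtFilter _ _) hχ.continuous.continuousAt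
  rw [contDiff_infty_iff_deriv]
  refine ⟨fun t => (hd t).differentiableAt, ?_⟩
  rwa [show deriv (fun t => ∫ s in T..t, χ s) = χ from funext fun t => (hd t).deriv]

/-- A smooth test function on `(-∞, T)` whose derivative on `[0, T]` is prescribed. -/
theorem exists_test_primitive {T : ℝ} (hT : 0 < T) {χ : ℝ → ℝ} (hχ : ContDiff ℝ ∞ χ)
    (hχc : HasCompactSupport χ) (hχT : tsupport χ ⊆ Ioo 0 T) :
    ∃ θ : ℝ → ℝ, ContDiff ℝ ∞ θ ∧ HasCompactSupport θ ∧ tsupport θ ⊆ Iio T ∧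
      ∀ t ∈ Icc 0 T, HasDerivAt θ (χ t) t := by
  have hd : ∀ t, HasDerivAt (fun t => ∫ s in T..t, χ s) (χ t) t := fun t =>
    intervalIntegral.integral_hasDerivAt_right (hχ.continuous.intervalIntegrable _ _)
      (hχ.continuous.stronglyMeasurableAtFilter _ _) hχ.continuous.continuousAt
  -- The support of `χ` ends before `T`, so the primitive that vanishes at `T` vanishes on all of
  -- `[b, ∞)`.
  obtain ⟨b, hbT, hb⟩ : ∃ b < T, ∀ s, b ≤ s → χ s = 0 := by
    rcases (tsupport χ).eq_empty_or_nonempty with h | h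
    · exact ⟨0, hT, fun s _ => image_eq_zero_of_notMem_tsupport (by simp [h])⟩
    · obtain ⟨m, hm1, hm2⟩ := hχc.isCompact.exists_isGreatest h
      have := hχT hm1
      refine ⟨(m + T) / 2, by linarith [this.2], fun s hs => image_eq_zero_of_notMem_tsupport
        fun h' => ?_⟩
      have := hm2 h'
      linarith [(hχT hm1).2]
  -- For negative times the primitive is in general a nonzero constant. This factor, equal to `1`
  -- around `[0, T]`, makes its support compact.
  let κ : ContDiffBump (0 : ℝ) := ⟨T + 1, T + 2, by linarith, by linarith⟩
  have hz : ∀ t, b ≤ t → ∫ s in T..t, χ s = 0 := fun t ht => by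
    rw [intervalIntegral.integral_congr (g := fun _ => 0), intervalIntegral.integral_zero]
    intro s hs
    exact hb s ((le_min hbT.le ht).trans hs.1)
  refine ⟨fun t => κ t * ∫ s in T..t, χ s, κ.contDiff.mul (contDiff_intervalIntegral hχ T),
    κ.hasCompactSupport.mul_right, ?_, fun t ht => ?_⟩
  · refine (closure_minimal (fun t ht => ?_) isClosed_Iic : _ ⊆ Iic b).trans
      fun t ht => lt_of_le_of_lt ht hbT
    by_contra h
    exact ht (by simp [hz t (not_le.1 h).le])
  · refine (hd t).congr_of_eventuallyEq ?_
    have h1 : ∀ᶠ s in 𝓝 t, s ∈ Metric.ball (0 : ℝ) (T + 1) := by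
      refine Metric.isOpen_ball.mem_nhds ?_
      rw [Metric.mem_ball, dist_zero_right, Real.norm_eq_abs, abs_lt]
      constructor <;> linarith [ht.1, ht.2]
    filter_upwards [h1] with s hs
    rw [κ.one_of_mem_closedBall (Metric.ball_subset_closedBall hs), one_mul]

/-- The lemma of du Bois-Reymond. The test functions need not vanish at `0`, so the initial value
`c` is identified as well, and continuity gives the identity at every time. -/
theorem eq_add_integral_of_weak {T c : ℝ} (hT : 0 < T) {G F : ℝ → ℝ} (hG : Continuous G)
    (hF : Continuous F)
    (h : ∀ θ : ℝ → ℝ, ContDiff ℝ ∞ θ → HasCompactSupport θ → tsupport θ ⊆ Iio T →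
      θ 0 * c + ∫ t in (0 : ℝ)..T, (deriv θ t * G t + θ t * F t) = 0) :
    ∀ t ∈ Icc 0 T, G t = c + ∫ s in (0 : ℝ)..t, F s := by
  set Q : ℝ → ℝ := fun t => ∫ s in (0 : ℝ)..t, F s with hQ
  have hQd : ∀ t, HasDerivAt Q (F t) t := fun t =>
    intervalIntegral.integral_hasDerivAt_right (hF.intervalIntegrable _ _)
      (hF.stronglyMeasurableAtFilter _ _) hF.continuousAt
  have hQc : Continuous Q := continuous_iff_continuousAt.2 fun t => (hQd t).continuousAt
  have hHc : Continuous fun t => G t - c - Q t := (hG.sub continuous_const).sub hQc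
  have hI : ∀ {f : ℝ → ℝ}, Continuous f → IntervalIntegrable f volume 0 T :=
    fun hf => hf.intervalIntegrable _ _
  have key : ∀ χ : ℝ → ℝ, ContDiff ℝ ∞ χ → HasCompactSupport χ → tsupport χ ⊆ Ioo 0 T →
      ∫ t, χ t • (G t - c - Q t) = 0 := by
    intro χ h1 h2 h3
    -- Testing with a primitive of `χ` turns the weak equation into orthogonality of `G - c - Q` to
    -- `χ`.
    obtain ⟨θ, t1, t2, t3, t4⟩ := exists_test_primitive hT h1 h2 h3
    have hθT : θ T = 0 := image_eq_zero_of_notMem_tsupport fun h' => lt_irrefl T (t3 h')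
    have hθd : ∀ t, HasDerivAt θ (deriv θ t) t := fun t =>
      (t1.differentiable (by simp) t).hasDerivAt
    have hθc : Continuous (deriv θ) := t1.continuous_deriv (by simp)
    have e1 : ∫ t in (0 : ℝ)..T, deriv θ t * Q t = -∫ t in (0 : ℝ)..T, θ t * F t := by
      have := intervalIntegral.integral_mul_deriv_eq_deriv_mul (a := 0) (b := T) (u := Q) (v := θ)
        (fun t _ => hQd t) (fun t _ => hθd t) (hI hF) (hI hθc)
      simp only [hθT, mul_zero, hQ, intervalIntegral.integral_same, zero_mul, sub_zero,
        zero_sub] at this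
      simp_rw [mul_comm (deriv θ _), mul_comm (θ _), hQ]
      exact this
    have e2 : ∫ t in (0 : ℝ)..T, deriv θ t * c = -(θ 0 * c) := by
      rw [intervalIntegral.integral_mul_const,
        intervalIntegral.integral_deriv_eq_sub (fun t _ => (hθd t).differentiableAt) (hI hθc), hθT]
      ring
    have e3 := h θ t1 t2 t3
    have e4 : ∫ t, χ t • (G t - c - Q t) = ∫ t in (0 : ℝ)..T, deriv θ t * (G t - c - Q t) := by
      rw [← setIntegral_eq_integral_of_forall_compl_eq_zero (s := Ioc 0 T),
        ← intervalIntegral.integral_of_le hT.le]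
      · refine intervalIntegral.integral_congr fun t ht => ?_
        rw [uIcc_of_le hT.le] at ht
        simp only [smul_eq_mul, (t4 t ht).deriv]
      · intro t ht
        rw [image_eq_zero_of_notMem_tsupport fun h' => ht (Ioo_subset_Ioc_self (h3 h')), zero_smul]
    rw [e4]
    have i1 : IntervalIntegrable (fun t => deriv θ t * G t) volume 0 T := hI (hθc.mul hG)
    have i2 : IntervalIntegrable (fun t => deriv θ t * c) volume 0 T := hI (hθc.mul continuous_const)
    have i3 : IntervalIntegrable (fun t => deriv θ t * Q t) volume 0 T := hI (hθc.mul hQc)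
    have i4 : IntervalIntegrable (fun t => θ t * F t) volume 0 T := hI (t1.continuous.mul hF)
    simp_rw [mul_sub]
    rw [intervalIntegral.integral_sub (i1.sub i2) i3, intervalIntegral.integral_sub i1 i2, e1, e2]
    rw [intervalIntegral.integral_add i1 i4] at e3
    linarith
  have h0 := isOpen_Ioo.ae_eq_zero_of_integral_contDiff_smul_eq_zero (U := Ioo 0 T)
    (hHc.locallyIntegrable (μ := volume) |>.locallyIntegrableOn _) key
  have h1 : EqOn (fun t => G t - c - Q t) (fun _ => 0) (Icc 0 T) := by
    refine Measure.eqOn_Icc_of_ae_eq volume hT.ne ?_ hHc.continuousOn continuousOn_const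
    rw [Measure.restrict_congr_set Ioo_ae_eq_Icc.symm]
    exact (ae_restrict_iff' measurableSet_Ioo).2 h0
  intro t ht
  have := h1 ht
  simp only at this
  linarith

/-! ### The weak equation tested with functions of space -/

section Weak

variable {d : ℕ}

/-- The Laplacian of a function on `ℝ^d`, in coordinates. -/
def coordLaplacian (ψ : RSpace d → ℝ) (x : RSpace d) : ℝ :=
  ∑ i, fderiv ℝ (fun y => fderiv ℝ ψ y (EuclideanSpace.single i 1)) x (EuclideanSpace.single i 1)

theorem ContDiff.coordLaplacian {ψ : RSpace d → ℝ} (hψ : ContDiff ℝ ∞ ψ) :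
    ContDiff ℝ ∞ (coordLaplacian ψ) :=
  ContDiff.sum fun _ _ => _root_.contDiff_fderiv_apply (_root_.contDiff_fderiv_apply hψ _) _

theorem HasCompactSupport.coordLaplacian {ψ : RSpace d → ℝ} (hc : HasCompactSupport ψ) :
    HasCompactSupport (coordLaplacian ψ) := by
  refine HasCompactSupport.intro (K := tsupport ψ) hc fun x hx => ?_
  refine Finset.sum_eq_zero fun i _ => ?_
  refine image_eq_zero_of_notMem_tsupport (f := fun x => fderiv ℝ (fun y => fderiv ℝ ψ y
    (EuclideanSpace.single i 1)) x (EuclideanSpace.single i 1)) fun h => hx ?_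
  exact tsupport_fderiv_apply_subset ℝ _ (tsupport_fderiv_apply_subset ℝ _ h)

/-- The rate of change of `∫ u ψ` along the flow of the equation. -/
def fluxRate (σ₁ σ₂ ν : ℝ) (u ψ : RSpace d → ℝ) : ℝ :=
  ∫ x, (u x * fderiv ℝ ψ x (σ₁ • newtonField u x) + (σ₁ + σ₂) * u x ^ 2 * ψ x
    + ν * (u x * coordLaplacian ψ x))

variable {L B : ℝ} {u : ℝ → L2Scalar d} {ψ : RSpace d → ℝ}

theorem IsBoundedCurve.continuous_integral_mul (hu : IsBoundedCurve L B u) (hψ : Continuous ψ)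
    (hc : HasCompactSupport ψ) : Continuous fun s => ∫ x, u s x * ψ x := by
  refine continuous_integral_curve (Θ := fun s x r => r * ψ x) hu.continuous
    (Eventually.of_forall fun x => continuous_snd.mul continuous_const)
    (fun s => (hu.integrable s).aestronglyMeasurable.mul hψ.aestronglyMeasurable)
    ((hψ.integrable_of_hasCompactSupport hc).norm.const_mul B) fun s => ?_
  filter_upwards [hu.bound s] with x hx
  rw [norm_mul, Real.norm_eq_abs]
  gcongr

theorem IsBoundedCurve.continuous_fluxRate (hd : 2 ≤ d) (hu : IsBoundedCurve L B u)
    (hψ : ContDiff ℝ ∞ ψ) (hc : HasCompactSupport ψ) (σ₁ σ₂ ν : ℝ) :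
    Continuous fun s => fluxRate σ₁ σ₂ ν (u s) ψ := by
  have hD : Continuous (fderiv ℝ ψ) := hψ.continuous_fderiv (by simp)
  set W := B * newtonMass d + newtonConst d * L
  refine continuous_integral_curve (Θ := fun s x r => r * fderiv ℝ ψ x (σ₁ • newtonField (u s) x)
    + (σ₁ + σ₂) * r ^ 2 * ψ x + ν * (r * coordLaplacian ψ x)) hu.continuous
    (Eventually.of_forall fun x => ?_) (fun s => ?_)
    (g := fun x => B * (‖fderiv ℝ ψ x‖ * (|σ₁| * W)) + |σ₁ + σ₂| * B ^ 2 * ‖ψ x‖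
      + |ν| * (B * ‖coordLaplacian ψ x‖)) ?_ fun s => ?_
  · have := (hu.continuous_newtonField hd x).comp (continuous_fst (X := ℝ) (Y := ℝ))
    fun_prop
  · have h1 := (hu.integrable s).aestronglyMeasurable
    have h2 := aestronglyMeasurable_newtonField h1
    exact ((h1.mul ((ContinuousLinearMap.id ℝ (RSpace d →L[ℝ] ℝ)).aestronglyMeasurable_comp₂ hD.aestronglyMeasurable (h2.const_smul σ₁))).add
      (((h1.pow 2).const_mul _).mul hψ.continuous.aestronglyMeasurable)).add
      ((h1.mul hψ.coordLaplacian.continuous.aestronglyMeasurable).const_mul ν)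
  · exact ((((hD.integrable_of_hasCompactSupport (hc.fderiv (𝕜 := ℝ))).norm.mul_const _).const_mul
      _).add ((hψ.continuous.integrable_of_hasCompactSupport hc).norm.const_mul _)).add
      (((hψ.coordLaplacian.continuous.integrable_of_hasCompactSupport
        hc.coordLaplacian).norm.const_mul _).const_mul _)
  · filter_upwards [hu.bound s] with x hx
    have h1 : ‖fderiv ℝ ψ x (σ₁ • newtonField (u s) x)‖ ≤ ‖fderiv ℝ ψ x‖ * (|σ₁| * W) := by
      refine (ContinuousLinearMap.le_opNorm _ _).trans ?_
      rw [norm_smul, Real.norm_eq_abs]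
      have := hu.norm_newtonField_le hd s x
      gcongr
    have hB0 := hu.bound_nonneg
    refine (norm_add₃_le).trans ?_
    simp only [norm_mul, norm_pow, Real.norm_eq_abs] at *
    gcongr

theorem hasWeakGradient_weakGradient {f : L2Scalar d} (h : ∃ g, HasWeakGradient f g) :
    HasWeakGradient f (weakGradient f) := by
  rw [weakGradient, dif_pos h]
  exact h.choose_spec

theorem inner_gradient_eq (ψ : RSpace d → ℝ) (x v : RSpace d) :
    inner ℝ v (gradient ψ x) = fderiv ℝ ψ x v := by
  rw [real_inner_comm, gradient, InnerProductSpace.toDual_symm_apply]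

theorem HasWeakGradient.integral_inner_gradient {f : L2Scalar d} {g : L2Vector d}
    (h : HasWeakGradient f g) (hψ : ContDiff ℝ ∞ ψ) (hc : HasCompactSupport ψ) :
    ∫ x, fderiv ℝ ψ x (g x) = -∫ x, f x * coordLaplacian ψ x := by
  simp_rw [fun x => fderiv_apply_eq_sum (fderiv ℝ ψ x) (g x), coordLaplacian, Finset.mul_sum]
  rw [integral_finsetSum _ fun i _ => integrable_inner_mul_test g _
      (contDiff_fderiv_apply hψ _).continuous (hc.fderiv_apply (𝕜 := ℝ) _),
    integral_finsetSum _ fun i _ => integrable_mul_fderiv_test f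
      (contDiff_fderiv_apply hψ _) (hc.fderiv_apply (𝕜 := ℝ) _) _, ← Finset.sum_neg_distrib]
  refine Finset.sum_congr rfl fun i _ => ?_
  rw [h _ (contDiff_fderiv_apply hψ _) (hc.fderiv_apply (𝕜 := ℝ) _), neg_neg]

theorem integrable_fderiv_apply_vector (g : L2Vector d) (hψ : ContDiff ℝ ∞ ψ)
    (hc : HasCompactSupport ψ) : Integrable fun x => fderiv ℝ ψ x (g x) := by
  simp_rw [fun x => fderiv_apply_eq_sum (fderiv ℝ ψ x) (g x)]
  exact integrable_finsetSum _ fun i _ => integrable_inner_mul_test g _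
      (contDiff_fderiv_apply hψ _).continuous (hc.fderiv_apply (𝕜 := ℝ) _)

theorem IsBoundedCurve.integrable_flux (hd : 2 ≤ d) (hu : IsBoundedCurve L B u)
    (hψ : ContDiff ℝ ∞ ψ) (hc : HasCompactSupport ψ) (σ₁ : ℝ) (s : ℝ) :
    Integrable fun x => u s x * fderiv ℝ ψ x (σ₁ • newtonField (u s) x) := by
  have hD : Continuous (fderiv ℝ ψ) := hψ.continuous_fderiv (by simp)
  have h1 := (hu.integrable s).aestronglyMeasurable
  obtain ⟨A, hA⟩ := (hc.fderiv (𝕜 := ℝ)).exists_bound_of_continuous hD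
  refine (hu.integrable s).mul_bdd
    (c := A * (|σ₁| * (B * newtonMass d + newtonConst d * L)))
    ((ContinuousLinearMap.id ℝ (RSpace d →L[ℝ] ℝ)).aestronglyMeasurable_comp₂
      hD.aestronglyMeasurable ((aestronglyMeasurable_newtonField h1).const_smul σ₁))
    (Eventually.of_forall fun x => ?_)
  refine (ContinuousLinearMap.le_opNorm _ _).trans ?_
  have hA0 : 0 ≤ A := (norm_nonneg _).trans (hA 0)
  rw [norm_smul, Real.norm_eq_abs]
  have := hu.norm_newtonField_le hd s x
  have := hA x
  gcongr

theorem IsBoundedCurve.integrable_sq_mul (hu : IsBoundedCurve L B u) (hψ : Continuous ψ)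
    (hc : HasCompactSupport ψ) (s : ℝ) : Integrable fun x => u s x ^ 2 * ψ x := by
  obtain ⟨A, hA⟩ := hc.exists_bound_of_continuous hψ
  exact (integrable_sq_of_bounded (hu.integrable s) (hu.bound s)).mul_bdd (c := A)
    hψ.aestronglyMeasurable (Eventually.of_forall hA)

theorem fluxRate_eq (hd : 2 ≤ d) (hu : IsBoundedCurve L B u) (hψ : ContDiff ℝ ∞ ψ)
    (hc : HasCompactSupport ψ) (σ₁ σ₂ ν : ℝ) (s : ℝ) :
    fluxRate σ₁ σ₂ ν (u s) ψ = (∫ x, u s x * fderiv ℝ ψ x (σ₁ • newtonField (u s) x))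
      + (σ₁ + σ₂) * (∫ x, u s x ^ 2 * ψ x) + ν * ∫ x, u s x * coordLaplacian ψ x := by
  have i1 := hu.integrable_flux hd hψ hc σ₁ s
  have i2 := (hu.integrable_sq_mul hψ.continuous hc s).const_mul (σ₁ + σ₂)
  have i3 := (integrable_mul_test (u s) hψ.coordLaplacian.continuous hc.coordLaplacian).const_mul ν
  have i12 : Integrable fun x => u s x * fderiv ℝ ψ x (σ₁ • newtonField (u s) x)
    + (σ₁ + σ₂) * (u s x ^ 2 * ψ x) := i1.add i2
  rw [fluxRate, ← integral_const_mul, ← integral_const_mul, ← integral_add i1 i2,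
    ← integral_add i12 i3]
  simp only [mul_assoc]

theorem tensor_test {θ : ℝ → ℝ} (hθ : ContDiff ℝ ∞ θ) (hθc : HasCompactSupport θ)
    (hψ : ContDiff ℝ ∞ ψ) (hc : HasCompactSupport ψ) :
    ContDiff ℝ ∞ (Function.uncurry fun t x => θ t * ψ x) ∧
      HasCompactSupport (Function.uncurry fun t x => θ t * ψ x) ∧
      tsupport (Function.uncurry fun t x => θ t * ψ x) ⊆ tsupport θ ×ˢ univ := by
  have h : Function.support (Function.uncurry fun t x => θ t * ψ x) ⊆ tsupport θ ×ˢ tsupport ψ := by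
    rintro ⟨t, x⟩ h
    exact ⟨subset_tsupport _ (left_ne_zero_of_mul h), subset_tsupport _ (right_ne_zero_of_mul h)⟩
  refine ⟨(hθ.comp contDiff_fst).mul (hψ.comp contDiff_snd),
    HasCompactSupport.of_support_subset_isCompact (hθc.isCompact.prod hc.isCompact) h, ?_⟩
  exact (closure_minimal h ((isClosed_tsupport θ).prod (isClosed_tsupport ψ))).trans
    (prod_mono_right (subset_univ _))

variable {σ₁ σ₂ ν T : ℝ} {ρ₀ : RSpace d → ℝ} {ρ : ℝ → L2Scalar d}

/-- The equation is tested with products `θ(t) ψ(x)`, and the viscous term is moved onto `ψ`, so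
that the rate of change involves no derivative of the solution and is continuous in time. -/
theorem IsWeakSolution.integral_mul_eq (hd : 2 ≤ d) (hν : 0 ≤ ν) (hT : 0 < T)
    (h : IsWeakSolution σ₁ σ₂ ν ρ₀ T ρ) (hu : IsBoundedCurve L B (extendCurve hT ρ))
    (hψ : ContDiff ℝ ∞ ψ) (hc : HasCompactSupport ψ) :
    ∀ t ∈ Icc 0 T, ∫ x, extendCurve hT ρ t x * ψ x = (∫ x, ρ₀ x * ψ x)
      + ∫ s in (0 : ℝ)..t, fluxRate σ₁ σ₂ ν (extendCurve hT ρ s) ψ := by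
  refine eq_add_integral_of_weak hT (hu.continuous_integral_mul hψ.continuous hc)
    (hu.continuous_fluxRate hd hψ hc σ₁ σ₂ ν) fun θ hθ hθc hθT => ?_
  obtain ⟨h1, h2, h3⟩ := tensor_test hθ hθc hψ hc
  have key := h.weakForm _ h1 h2 (h3.trans (prod_mono_left hθT))
  have e0 : ∫ x, ρ₀ x * (θ 0 * ψ x) = θ 0 * ∫ x, ρ₀ x * ψ x := by
    rw [← integral_const_mul]
    exact integral_congr_ae (Eventually.of_forall fun x => by ring)
  rw [e0] at key
  refine Eq.trans ?_ key
  refine congrArg (fun z => θ 0 * (∫ x, ρ₀ x * ψ x) + z) (intervalIntegral.integral_congr_ae ?_)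
  -- Without viscosity a weak gradient need not exist, but then its term has the factor `0`.
  have hg : ∀ᵐ t ∂(volume.restrict (Icc 0 T)), ν = 0 ∨ ∃ g, HasWeakGradient (ρ t) g := by
    rcases hν.eq_or_lt with h0 | h0
    · exact Eventually.of_forall fun _ => Or.inl h0.symm
    · filter_upwards [(h.sobolev h0).1] with t ht using Or.inr ht
  rw [ae_restrict_iff' measurableSet_Icc] at hg
  filter_upwards [hg] with t ht htT
  rw [uIoc_of_le hT.le] at htT
  have htT' := Ioc_subset_Icc_self htT
  have hueq := extendCurve_eq hT ρ htT'
  rw [fluxRate_eq hd hu hψ hc, hueq]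
  have i1 := hu.integrable_flux hd hψ hc σ₁ t
  have i2 := hu.integrable_sq_mul hψ.continuous hc t
  rw [hueq] at i1 i2
  have i3 : Integrable _ volume := integrable_fderiv_apply_vector (weakGradient (ρ t)) hψ hc
  have i4 := integrable_mul_test (ρ t) hψ.continuous hc
  have e1 : ν * ∫ x, ρ t x * coordLaplacian ψ x
      = -(ν * ∫ x, fderiv ℝ ψ x (weakGradient (ρ t) x)) := by
    rcases ht htT' with h0 | h0
    · simp [h0]
    · rw [(hasWeakGradient_weakGradient h0).integral_inner_gradient hψ hc]
      ring
  have e2 : ∀ x, gradient (fun x => θ t * ψ x) x = θ t • gradient ψ x := fun x => by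
    rw [gradient, fderiv_const_mul (hψ.differentiable (by simp) x), map_smul, gradient]
  have e3 : ∀ x, deriv (fun s => θ s * ψ x) t = deriv θ t * ψ x := fun x =>
    deriv_mul_const (hθ.differentiable (by simp) t) _
  have e4 : ∀ x, ρ t x * deriv (fun s => θ s * ψ x) t
      + ρ t x * inner ℝ (velocity σ₁ (ρ t) x) (gradient (fun x => θ t * ψ x) x)
      + (σ₁ + σ₂) * ρ t x ^ 2 * (θ t * ψ x)
      - ν * inner ℝ (weakGradient (ρ t) x) (gradient (fun x => θ t * ψ x) x)
      = deriv θ t * (ρ t x * ψ x) + θ t * (ρ t x * fderiv ℝ ψ x (σ₁ • newtonField (ρ t) x))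
      + θ t * (σ₁ + σ₂) * (ρ t x ^ 2 * ψ x)
      - θ t * ν * fderiv ℝ ψ x (weakGradient (ρ t) x) := fun x => by
    rw [e2, e3, inner_smul_right, inner_smul_right, inner_gradient_eq ψ, inner_gradient_eq ψ,
      velocity_eq_smul_newtonField hd]
    ring
  simp_rw [e4]
  rw [integral_sub (Integrable.fun_add (Integrable.fun_add (i4.const_mul _) (i1.const_mul _))
      (i2.const_mul _)) (i3.const_mul _),
    integral_add (Integrable.fun_add (i4.const_mul _) (i1.const_mul _)) (i2.const_mul _),
    integral_add (i4.const_mul _) (i1.const_mul _), integral_const_mul, integral_const_mul,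
    integral_const_mul, integral_const_mul, mul_add, mul_add, e1]
  ring

end Weak

/-! ### The mollified equation -/

/-- The convolution `f * η`. -/
def smear {d : ℕ} (η f : RSpace d → ℝ) (x : RSpace d) : ℝ := ∫ y, f y * η (x - y)

section Smear

variable {d : ℕ} {η f : RSpace d → ℝ}

theorem contDiff_smear (hη : ContDiff ℝ ∞ η) (hc : HasCompactSupport η) (hf : Integrable f) :
    ContDiff ℝ ∞ (smear η f) :=
  hc.contDiff_convolution_right (ContinuousLinearMap.mul ℝ ℝ) hf.locallyIntegrable hη

theorem fderiv_smear (hη : ContDiff ℝ ∞ η) (hc : HasCompactSupport η) (hf : Integrable f)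
    (x e : RSpace d) : fderiv ℝ (smear η f) x e = smear (fun z => fderiv ℝ η z e) f x := by
  have hD : Continuous (fderiv ℝ η) := hη.continuous_fderiv (by simp)
  have h := hc.hasFDerivAt_convolution_right (ContinuousLinearMap.mul ℝ ℝ) hf.locallyIntegrable
    (hη.of_le (by simp)) x
  have hi := ((hc.fderiv (𝕜 := ℝ)).convolutionExists_right
    ((ContinuousLinearMap.mul ℝ ℝ).precompR (RSpace d)) hf.locallyIntegrable hD) x
  rw [show smear η f = convolution f η (ContinuousLinearMap.mul ℝ ℝ) volume from rfl, h.fderiv,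
    convolution_def, ContinuousLinearMap.integral_apply hi]
  rfl

theorem coordLaplacian_smear (hη : ContDiff ℝ ∞ η) (hc : HasCompactSupport η) (hf : Integrable f)
    (x : RSpace d) : coordLaplacian (smear η f) x = smear (coordLaplacian η) f x := by
  have h1 : ∀ e, (fun y => fderiv ℝ (smear η f) y e) = smear (fun z => fderiv ℝ η z e) f :=
    fun e => funext fun y => fderiv_smear hη hc hf y e
  simp only [coordLaplacian, h1]
  simp_rw [fun i : Fin d => fderiv_smear (contDiff_fderiv_apply hη (EuclideanSpace.single i 1))
    (hc.fderiv_apply (𝕜 := ℝ) _) hf x (EuclideanSpace.single i 1)]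
  simp only [smear]
  rw [← integral_finsetSum _ fun i _ => integrable_mul_mollifier hf
    (contDiff_fderiv_apply (contDiff_fderiv_apply hη _) _).continuous
    ((hc.fderiv_apply (𝕜 := ℝ) _).fderiv_apply (𝕜 := ℝ) _) x]
  simp only [coordLaplacian, Finset.mul_sum]

theorem contDiff_reflect (hη : ContDiff ℝ ∞ η) (x : RSpace d) : ContDiff ℝ ∞ fun y => η (x - y) :=
  hη.comp (contDiff_const.sub contDiff_id)

theorem hasCompactSupport_reflect (hc : HasCompactSupport η) (x : RSpace d) :
    HasCompactSupport fun y => η (x - y) :=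
  hc.comp_homeomorph (Homeomorph.subLeft x)

theorem fderiv_reflect (η : RSpace d → ℝ) (x y e : RSpace d) :
    fderiv ℝ (fun y => η (x - y)) y e = -fderiv ℝ η (x - y) e := by
  have h1 : (fun y => η (x - y)) = fun y => (fun z => η (x + z)) (-y) := by
    simp only [sub_eq_add_neg]
  rw [h1, show (fun y => (fun z => η (x + z)) (-y))
    = (fun z => η (x + z)) ∘ ContinuousLinearEquiv.neg ℝ from rfl,
    ContinuousLinearEquiv.comp_right_fderiv, fderiv_comp_add_left, sub_eq_add_neg]
  simp

theorem coordLaplacian_reflect (η : RSpace d → ℝ) (x y : RSpace d) :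
    coordLaplacian (fun y => η (x - y)) y = coordLaplacian η (x - y) := by
  simp only [coordLaplacian]
  refine Finset.sum_congr rfl fun i _ => ?_
  simp_rw [fderiv_reflect]
  rw [fderiv_fun_neg, _root_.neg_apply,
    fderiv_reflect (fun z => fderiv ℝ η z (EuclideanSpace.single i 1)), neg_neg]

theorem abs_smear_mollifier_le {B : ℝ} (hB : ∀ᵐ y, |f y| ≤ B) (n : ℕ) (x : RSpace d) :
    |smear (mollifier d n) f x| ≤ B := by
  have hη := (contDiff_mollifier (d := d) n)
  have h1 : Integrable fun y => mollifier d n (x - y) :=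
    (contDiff_reflect hη x).continuous.integrable_of_hasCompactSupport
      (hasCompactSupport_reflect (hasCompactSupport_mollifier n) x)
  calc |smear (mollifier d n) f x| ≤ ∫ y, B * mollifier d n (x - y) := by
        rw [smear, ← Real.norm_eq_abs]
        refine norm_integral_le_of_norm_le (h1.const_mul B) ?_
        filter_upwards [hB] with y hy
        rw [norm_mul, Real.norm_eq_abs, Real.norm_eq_abs, abs_of_nonneg (mollifier_nonneg n _)]
        exact mul_le_mul_of_nonneg_right hy (mollifier_nonneg n _)
    _ = B := by
        rw [integral_const_mul, integral_sub_left_eq_self (mollifier d n) volume x, integral_mollifier,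
          mul_one]

/-- The equation for the mollified density. Freezing the field at `x` yields transport of `smear η
f`, and the difference `V(y) - V(x)` yields the commutator. The quadratic term contained in the
commutator reduces `σ₁ + σ₂` to `σ₂`, as in the nonconservative form of the equation. -/
theorem fluxRate_reflect (hd : 2 ≤ d) (hη : ContDiff ℝ ∞ η) (hc : HasCompactSupport η)
    (hf : Integrable f) {B : ℝ} (hB : ∀ᵐ y, |f y| ≤ B) (σ₁ σ₂ ν : ℝ) (x : RSpace d) :
    fluxRate σ₁ σ₂ ν f (fun y => η (x - y))
      = -(σ₁ * fderiv ℝ (smear η f) x (newtonField f x)) - σ₁ * transportCommutator η f f x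
        + σ₂ * smear η (fun y => f y ^ 2) x + ν * coordLaplacian (smear η f) x := by
  have i1 := integrable_commutator_transport hd hη hc hf hB hf x (newtonField f x)
  have i2 : Integrable fun y => f y * fderiv ℝ η (x - y) (newtonField f x) :=
    integrable_mul_mollifier hf (contDiff_fderiv_apply hη _).continuous
      (hc.fderiv_apply (𝕜 := ℝ) _) x
  have i3 := integrable_mul_mollifier (integrable_sq_of_bounded hf hB) hη.continuous hc x
  have i4 := integrable_mul_mollifier hf hη.coordLaplacian.continuous hc.coordLaplacian x
  rw [fderiv_smear hη hc hf, coordLaplacian_smear hη hc hf]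
  have e : ∀ y, f y * fderiv ℝ (fun y => η (x - y)) y (σ₁ • newtonField f y)
      + (σ₁ + σ₂) * f y ^ 2 * η (x - y) + ν * (f y * coordLaplacian (fun y => η (x - y)) y)
      = -(σ₁ * (f y * fderiv ℝ η (x - y) (newtonField f y - newtonField f x)))
        - σ₁ * (f y * fderiv ℝ η (x - y) (newtonField f x))
        + (σ₁ + σ₂) * (f y ^ 2 * η (x - y)) + ν * (f y * coordLaplacian η (x - y)) := fun y => by
    rw [fderiv_reflect, coordLaplacian_reflect, map_smul, map_sub, smul_eq_mul]
    ring
  simp only [fluxRate, e, transportCommutator, smear]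
  rw [integral_add (Integrable.fun_add (Integrable.sub' (i1.const_mul _).fun_neg (i2.const_mul _))
      (i3.const_mul _)) (i4.const_mul _),
    integral_add (Integrable.sub' (i1.const_mul _).fun_neg (i2.const_mul _)) (i3.const_mul _),
    integral_sub (i1.const_mul _).fun_neg (i2.const_mul _), integral_neg, integral_const_mul,
    integral_const_mul, integral_const_mul, integral_const_mul]
  have e2 : ∀ y, f y * f y * η (x - y) = f y ^ 2 * η (x - y) := fun y => by ring
  simp only [e2]
  ring

theorem HasWeakGradient.fderiv_smear {f : L2Scalar d} {g : L2Vector d} (h : HasWeakGradient f g)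
    (hf : Integrable f) (hη : ContDiff ℝ ∞ η) (hc : HasCompactSupport η) (x e : RSpace d) :
    fderiv ℝ (smear η f) x e = smear η (fun y => inner ℝ (g y) e) x := by
  have := h _ (contDiff_reflect hη x) (hasCompactSupport_reflect hc x) e
  simp only [fderiv_reflect, mul_neg, integral_neg, neg_inj] at this
  rw [_root_.fderiv_smear hη hc hf]
  exact this

theorem stronglyMeasurable_fluxRate_reflect (hη : ContDiff ℝ ∞ η) (hf : StronglyMeasurable f)
    (σ₁ σ₂ ν : ℝ) : StronglyMeasurable fun x => fluxRate σ₁ σ₂ ν f (fun y => η (x - y)) := by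
  refine StronglyMeasurable.integral_prod_right (f := fun x y =>
    f y * fderiv ℝ (fun y => η (x - y)) y (σ₁ • newtonField f y)
      + (σ₁ + σ₂) * f y ^ 2 * η (x - y) + ν * (f y * coordLaplacian (fun y => η (x - y)) y)) ?_
  have hD : Continuous (fderiv ℝ η) := hη.continuous_fderiv (by simp)
  have hs : Continuous fun p : RSpace d × RSpace d => p.1 - p.2 := by fun_prop
  have h1 : StronglyMeasurable fun p : RSpace d × RSpace d => f p.2 := hf.comp_measurable measurable_snd
  have h2 : StronglyMeasurable fun p : RSpace d × RSpace d => σ₁ • newtonField f p.2 :=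
    ((stronglyMeasurable_newtonField hf).const_smul σ₁).comp_measurable measurable_snd
  have h3 : StronglyMeasurable fun p : RSpace d × RSpace d =>
      fderiv ℝ η (p.1 - p.2) (σ₁ • newtonField f p.2) :=
    isBoundedBilinearMap_apply.continuous.comp_stronglyMeasurable
      ((hD.comp hs).stronglyMeasurable.prodMk h2)
  have h4 := (hη.continuous.comp hs).stronglyMeasurable
  have h5 := (hη.coordLaplacian.continuous.comp hs).stronglyMeasurable
  simp only [Function.uncurry_def, fderiv_reflect, coordLaplacian_reflect]
  exact ((h1.mul h3.neg).add (((h1.pow 2).const_mul _).mul h4)).add ((h1.mul h5).const_mul _)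

/-- For a fixed mollifier this bound is uniform in time and space. It serves Fubini's theorem only
and is allowed to blow up as the mollifier shrinks. -/
theorem exists_abs_fluxRate_reflect_le (hd : 2 ≤ d) (hη : ContDiff ℝ ∞ η) (hc : HasCompactSupport η)
    {L B : ℝ} {u : ℝ → L2Scalar d} (hu : IsBoundedCurve L B u) (σ₁ σ₂ ν : ℝ) :
    ∃ C, ∀ s x, |fluxRate σ₁ σ₂ ν (u s) (fun y => η (x - y))| ≤ C := by
  have hD : Continuous (fderiv ℝ η) := hη.continuous_fderiv (by simp)
  obtain ⟨A₀, hA₀⟩ := hc.exists_bound_of_continuous hη.continuous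
  obtain ⟨A₁, hA₁⟩ := (hc.fderiv (𝕜 := ℝ)).exists_bound_of_continuous hD
  obtain ⟨A₂, hA₂⟩ := hc.coordLaplacian.exists_bound_of_continuous hη.coordLaplacian.continuous
  have hB0 := hu.bound_nonneg
  have h0 : 0 ≤ A₀ := (norm_nonneg _).trans (hA₀ 0)
  have h1 : 0 ≤ A₁ := (norm_nonneg _).trans (hA₁ 0)
  have h2 : 0 ≤ A₂ := (norm_nonneg _).trans (hA₂ 0)
  have hW : 0 ≤ B * newtonMass d + newtonConst d * L :=
    (norm_nonneg _).trans (hu.norm_newtonField_le hd 0 0)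
  set D := A₁ * (|σ₁| * (B * newtonMass d + newtonConst d * L)) + |σ₁ + σ₂| * B * A₀ + |ν| * A₂
  have hD0 : 0 ≤ D := by positivity
  refine ⟨D * L, fun s x => ?_⟩
  calc _ ≤ ∫ y, D * |u s y| := by
        rw [fluxRate, ← Real.norm_eq_abs]
        refine norm_integral_le_of_norm_le ((hu.integrable s).abs.const_mul D) ?_
        filter_upwards [hu.bound s] with y hy
        have k1 : ‖fderiv ℝ η (x - y) (σ₁ • newtonField (u s) y)‖
            ≤ A₁ * (|σ₁| * (B * newtonMass d + newtonConst d * L)) := by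
          refine (ContinuousLinearMap.le_opNorm _ _).trans ?_
          rw [norm_smul, Real.norm_eq_abs]
          have := hu.norm_newtonField_le hd s y
          have := hA₁ (x - y)
          gcongr
        rw [fderiv_reflect, coordLaplacian_reflect]
        refine norm_add₃_le.trans ?_
        have k2 := hA₀ (x - y)
        have k3 := hA₂ (x - y)
        simp only [norm_mul, norm_neg, norm_pow, Real.norm_eq_abs] at *
        calc _ ≤ |u s y| * (A₁ * (|σ₁| * (B * newtonMass d + newtonConst d * L)))
              + |σ₁ + σ₂| * (B * |u s y|) * A₀ + |ν| * (|u s y| * A₂) := by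
              rw [pow_two]
              gcongr
          _ = D * |u s y| := by simp only [D]; ring
    _ ≤ D * L := by
        rw [integral_const_mul]
        exact mul_le_mul_of_nonneg_left (hu.integral_le s) hD0

end Smear

/-! ### Integration by parts for functions of a smooth density -/

/-- `h` is twice continuously differentiable, with the derivatives `h'` and `h''`. -/
structure HasTwoDerivs (h h' h'' : ℝ → ℝ) : Prop where
  first : ∀ s, HasDerivAt h (h' s) s
  second : ∀ s, HasDerivAt h' (h'' s) s
  continuous : Continuous h''

namespace HasTwoDerivs

variable {h h' h'' : ℝ → ℝ}

theorem continuous_first (hh : HasTwoDerivs h h' h'') : Continuous h' :=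
  continuous_iff_continuousAt.2 fun s => (hh.second s).continuousAt

theorem continuous_zeroth (hh : HasTwoDerivs h h' h'') : Continuous h :=
  continuous_iff_continuousAt.2 fun s => (hh.first s).continuousAt

theorem contDiff_first (hh : HasTwoDerivs h h' h'') : ContDiff ℝ 1 h' :=
  contDiff_one_iff_deriv.2 ⟨fun s => (hh.second s).differentiableAt, by
    rw [show deriv h' = h'' from funext fun s => (hh.second s).deriv]
    exact hh.continuous⟩

theorem contDiff_zeroth (hh : HasTwoDerivs h h' h'') : ContDiff ℝ 1 h :=
  contDiff_one_iff_deriv.2 ⟨fun s => (hh.first s).differentiableAt, by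
    rw [show deriv h = h' from funext fun s => (hh.first s).deriv]
    exact hh.continuous_first⟩

end HasTwoDerivs

/-- The sum of the squares of the partial derivatives. -/
def gradSq {d : ℕ} (m : RSpace d → ℝ) (x : RSpace d) : ℝ :=
  ∑ i, fderiv ℝ m x (EuclideanSpace.single i 1) ^ 2

section Spatial

variable {d : ℕ} {h h' h'' : ℝ → ℝ} {m ψ : RSpace d → ℝ}

theorem fderiv_comp_const_mul {h h' : ℝ → ℝ} (hh : ∀ s, HasDerivAt h (h' s) s)
    (hm : ContDiff ℝ ∞ m) (q : ℝ) (x e : RSpace d) :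
    fderiv ℝ (fun y => h (q * m y)) x e = h' (q * m x) * (q * fderiv ℝ m x e) := by
  have h1 : HasFDerivAt (fun y => q * m y) (q • fderiv ℝ m x) x :=
    ((hm.differentiable (by simp) x).hasFDerivAt).const_mul q
  have h2 : HasFDerivAt (fun y => h (q * m y)) (h' (q * m x) • (q • fderiv ℝ m x)) x :=
    (hh (q * m x)).comp_hasFDerivAt (f := fun y => q * m y) x h1
  rw [h2.fderiv]
  simp

/-- The identity `Δ(h(q m)) = h'(q m) q Δm + h''(q m) q² |∇m|²` with the left-hand side moved onto
`ψ`. The last term is the dissipation. -/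
theorem integral_mul_laplacian_comp (hh : HasTwoDerivs h h' h'') (hm : ContDiff ℝ ∞ m)
    (hψ : ContDiff ℝ ∞ ψ) (hc : HasCompactSupport ψ) (q : ℝ) :
    ∫ x, ψ x * h' (q * m x) * (q * coordLaplacian m x)
      = (∫ x, h (q * m x) * coordLaplacian ψ x)
        - ∫ x, ψ x * h'' (q * m x) * (q ^ 2 * gradSq m x) := by
  have hqm : ContDiff ℝ ∞ fun x => q * m x := contDiff_const.mul hm
  have c0 : ContDiff ℝ 1 fun x => h (q * m x) := hh.contDiff_zeroth.comp (hqm.of_le (by simp))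
  have c1 : ContDiff ℝ 1 fun x => h' (q * m x) := hh.contDiff_first.comp (hqm.of_le (by simp))
  have c2 : Continuous fun x => h'' (q * m x) := hh.continuous.comp hqm.continuous
  have I : ∀ {k g : RSpace d → ℝ}, Continuous k → HasCompactSupport k → Continuous g →
      Integrable fun x => k x * g x := fun hk hkc hg =>
    (hk.mul hg).integrable_of_hasCompactSupport hkc.mul_right
  have key : ∀ e : RSpace d, ∫ x, ψ x * (h' (q * m x) * (q * fderiv ℝ (fun y => fderiv ℝ m y e) x e))
      = (∫ x, fderiv ℝ (fun y => fderiv ℝ ψ y e) x e * h (q * m x))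
        - ∫ x, ψ x * (h'' (q * m x) * (q ^ 2 * fderiv ℝ m x e ^ 2)) := by
    intro e
    have me := contDiff_fderiv_apply hm e
    have pe := contDiff_fderiv_apply hψ e
    have pc := hc.fderiv_apply (𝕜 := ℝ) e
    have mee := (contDiff_fderiv_apply me e).continuous
    have pee := (contDiff_fderiv_apply pe e).continuous
    have pec := pc.fderiv_apply (𝕜 := ℝ) e
    -- The two integrations by parts are two applications of the divergence theorem with a common
    -- term, which the combination `q * d1 - d2` eliminates.
    have d1 := integral_fderiv_apply_eq_zero (w := fun x => ψ x * (h' (q * m x) * fderiv ℝ m x e))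
      ((hψ.of_le (by simp)).mul (c1.mul (me.of_le (by simp)))) hc.mul_right e
    have d2 := integral_fderiv_apply_eq_zero (w := fun x => fderiv ℝ ψ x e * h (q * m x))
      ((pe.of_le (by simp)).mul c0) pc.mul_right e
    have e1 : ∀ x, fderiv ℝ (fun x => ψ x * (h' (q * m x) * fderiv ℝ m x e)) x e
        = fderiv ℝ ψ x e * (h' (q * m x) * fderiv ℝ m x e)
          + ψ x * (h'' (q * m x) * (q * fderiv ℝ m x e ^ 2))
          + ψ x * (h' (q * m x) * fderiv ℝ (fun y => fderiv ℝ m y e) x e) := fun x => by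
      have a1 := (c1.differentiable (by simp) x)
      have a2 := me.differentiable (by simp) x
      rw [fderiv_fun_mul (hψ.differentiable (by simp) x) (a1.fun_mul a2), fderiv_fun_mul a1 a2]
      simp only [_root_.add_apply, _root_.smul_apply, smul_eq_mul,
        fderiv_comp_const_mul hh.second hm q x e]
      ring
    have e2 : ∀ x, fderiv ℝ (fun x => fderiv ℝ ψ x e * h (q * m x)) x e
        = fderiv ℝ (fun y => fderiv ℝ ψ y e) x e * h (q * m x)
          + q * (fderiv ℝ ψ x e * (h' (q * m x) * fderiv ℝ m x e)) := fun x => by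
      rw [fderiv_fun_mul (pe.differentiable (by simp) x) (c0.differentiable (by simp) x)]
      simp only [_root_.add_apply, _root_.smul_apply, smul_eq_mul,
        fderiv_comp_const_mul hh.first hm q x e]
      ring
    have i1 : Integrable fun x => fderiv ℝ ψ x e * (h' (q * m x) * fderiv ℝ m x e) :=
      I pe.continuous pc (c1.continuous.mul me.continuous)
    have i2 : Integrable fun x => ψ x * (h'' (q * m x) * (q * fderiv ℝ m x e ^ 2)) :=
      I hψ.continuous hc (c2.mul (continuous_const.mul (me.continuous.pow 2)))
    have i3 : Integrable fun x =>
        ψ x * (h' (q * m x) * fderiv ℝ (fun y => fderiv ℝ m y e) x e) :=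
      I hψ.continuous hc (c1.continuous.mul mee)
    have i4 := I pee pec c0.continuous
    simp_rw [e1] at d1
    simp_rw [e2] at d2
    rw [integral_add (i1.fun_add i2) i3, integral_add i1 i2] at d1
    rw [integral_add i4 (i1.const_mul q), integral_const_mul] at d2
    have e3 : ∫ x, ψ x * (h' (q * m x) * (q * fderiv ℝ (fun y => fderiv ℝ m y e) x e))
        = q * ∫ x, ψ x * (h' (q * m x) * fderiv ℝ (fun y => fderiv ℝ m y e) x e) := by
      rw [← integral_const_mul]
      exact integral_congr_ae (Eventually.of_forall fun x => by ring)
    have e4 : ∫ x, ψ x * (h'' (q * m x) * (q ^ 2 * fderiv ℝ m x e ^ 2))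
        = q * ∫ x, ψ x * (h'' (q * m x) * (q * fderiv ℝ m x e ^ 2)) := by
      rw [← integral_const_mul]
      exact integral_congr_ae (Eventually.of_forall fun x => by ring)
    rw [e3, e4]
    linear_combination q * d1 - d2
  have s1 : ∀ x, ψ x * h' (q * m x) * (q * coordLaplacian m x)
      = ∑ i, ψ x * (h' (q * m x) * (q * fderiv ℝ (fun y => fderiv ℝ m y (EuclideanSpace.single i 1)) x
        (EuclideanSpace.single i 1))) := fun x => by
    simp only [coordLaplacian, Finset.mul_sum, mul_assoc]
  have s2 : ∀ x, h (q * m x) * coordLaplacian ψ x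
      = ∑ i, fderiv ℝ (fun y => fderiv ℝ ψ y (EuclideanSpace.single i 1)) x
        (EuclideanSpace.single i 1) * h (q * m x) := fun x => by
    rw [mul_comm, coordLaplacian, Finset.sum_mul]
  have s3 : ∀ x, ψ x * h'' (q * m x) * (q ^ 2 * gradSq m x)
      = ∑ i, ψ x * (h'' (q * m x) * (q ^ 2 * fderiv ℝ m x (EuclideanSpace.single i 1) ^ 2)) := fun x => by
    simp only [gradSq, Finset.mul_sum, mul_assoc]
  simp_rw [s1, s2, s3]
  rw [integral_finsetSum, integral_finsetSum, integral_finsetSum, ← Finset.sum_sub_distrib]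
  · exact Finset.sum_congr rfl fun i _ => key _
  · exact fun i _ => I hψ.continuous hc (c2.mul (continuous_const.mul
      ((contDiff_fderiv_apply hm _).continuous.pow 2)))
  · exact fun i _ => I (contDiff_fderiv_apply (contDiff_fderiv_apply hψ _) _).continuous
      ((hc.fderiv_apply (𝕜 := ℝ) _).fderiv_apply (𝕜 := ℝ) _) c0.continuous
  · exact fun i _ => I hψ.continuous hc (c1.continuous.mul (continuous_const.mul
      (contDiff_fderiv_apply (contDiff_fderiv_apply hm _) _).continuous))

theorem integrable_clm_newtonField (hd : 2 ≤ d) {f : RSpace d → ℝ} {B : ℝ} (hf : Integrable f)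
    (hB : ∀ᵐ y, |f y| ≤ B) {A : RSpace d → RSpace d →L[ℝ] ℝ} (hA : Continuous A)
    (hAc : HasCompactSupport A) : Integrable fun x => A x (newtonField f x) := by
  refine ((hA.integrable_of_hasCompactSupport hAc).norm.mul_const
    (B * newtonMass d + newtonConst d * ∫ y, |f y|)).mono'
    ((ContinuousLinearMap.id ℝ (RSpace d →L[ℝ] ℝ)).aestronglyMeasurable_comp₂
      hA.aestronglyMeasurable (aestronglyMeasurable_newtonField hf.aestronglyMeasurable))
    (Eventually.of_forall fun x => ?_)
  refine (ContinuousLinearMap.le_opNorm _ _).trans ?_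
  have := norm_newtonField_le hd hf hB x
  gcongr

/-- The divergence of `V` is `f` in the sense of distributions, tested here with `ψ h(q m)`. The
field of a bounded density need not be differentiable, so the derivative is never put on it. -/
theorem integral_mul_transport_comp (hd : 2 ≤ d) {f : RSpace d → ℝ} {B : ℝ} (hf : Integrable f)
    (hB : ∀ᵐ y, |f y| ≤ B) (hh : HasTwoDerivs h h' h'') (hm : ContDiff ℝ ∞ m)
    (hψ : ContDiff ℝ ∞ ψ) (hc : HasCompactSupport ψ) (q : ℝ) :
    ∫ x, ψ x * h' (q * m x) * (q * fderiv ℝ m x (newtonField f x))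
      = -∫ x, h (q * m x) * (fderiv ℝ ψ x (newtonField f x) + f x * ψ x) := by
  have hqm : ContDiff ℝ ∞ fun x => q * m x := contDiff_const.mul hm
  have c0 : ContDiff ℝ 1 fun x => h (q * m x) := hh.contDiff_zeroth.comp (hqm.of_le (by simp))
  have c1 : ContDiff ℝ 1 fun x => h' (q * m x) := hh.contDiff_first.comp (hqm.of_le (by simp))
  have key := integral_fderiv_newtonField hd hf hB (ζ := fun x => ψ x * h (q * m x))
    ((hψ.of_le (by simp)).mul c0) hc.mul_right
  have e1 : ∀ x, fderiv ℝ (fun x => ψ x * h (q * m x)) x (newtonField f x)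
      = h (q * m x) * fderiv ℝ ψ x (newtonField f x)
        + ψ x * h' (q * m x) * (q * fderiv ℝ m x (newtonField f x)) := fun x => by
    rw [fderiv_fun_mul (hψ.differentiable (by simp) x) (c0.differentiable (by simp) x)]
    simp only [_root_.add_apply, _root_.smul_apply, smul_eq_mul,
      fderiv_comp_const_mul hh.first hm q x]
    ring
  have i1 : Integrable fun x => h (q * m x) * fderiv ℝ ψ x (newtonField f x) :=
    integrable_clm_newtonField hd hf hB (A := fun x => h (q * m x) • fderiv ℝ ψ x)
      (c0.continuous.smul (hψ.continuous_fderiv (by simp)))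
      ((hc.fderiv (𝕜 := ℝ)).smul_left (f := fun x => h (q * m x)))
  have i2 : Integrable fun x => ψ x * h' (q * m x) * (q * fderiv ℝ m x (newtonField f x)) := by
    have k1 : HasCompactSupport fun x => ψ x • ((h' (q * m x) * q) • fderiv ℝ m x) :=
      hc.smul_right
    have k2 : Continuous fun x => ψ x • ((h' (q * m x) * q) • fderiv ℝ m x) :=
      hψ.continuous.smul ((c1.continuous.mul continuous_const).smul (hm.continuous_fderiv (by simp)))
    refine (integrable_clm_newtonField hd hf hB k2 k1).congr (Eventually.of_forall fun x => ?_)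
    simp only [_root_.smul_apply, smul_eq_mul]
    ring
  have i3 : Integrable fun x => h (q * m x) * (f x * ψ x) := by
    have k1 : Continuous fun x => h (q * m x) * ψ x := c0.continuous.mul hψ.continuous
    obtain ⟨A, hA⟩ := (hc.mul_left (f := fun x => h (q * m x))).exists_bound_of_continuous k1
    refine (hf.mul_bdd (c := A) k1.aestronglyMeasurable (Eventually.of_forall hA)).congr
      (Eventually.of_forall fun x => ?_)
    simp only
    ring
  simp_rw [e1] at key
  rw [integral_add i1 i2] at key
  simp_rw [mul_add]
  rw [integral_add i1 i3]
  have e3 : ∫ x, f x * (ψ x * h (q * m x)) = ∫ x, h (q * m x) * (f x * ψ x) :=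
    integral_congr_ae (Eventually.of_forall fun x => by ring)
  rw [e3] at key
  linarith

end Spatial

/-! ### Renormalization of the mollified density -/

/-- The integrand in the evolution of `∫ h(q ρ) ψ`, as a function of the values `r` and `p` of `ρ`
and `ρ²`. -/
def renormTerm {d : ℕ} (σ₁ σ₂ ν : ℝ) (h h' : ℝ → ℝ) (q q' : ℝ) (ψ f : RSpace d → ℝ)
    (r p : ℝ) (x : RSpace d) : ℝ :=
  h (q * r) * (σ₁ * (fderiv ℝ ψ x (newtonField f x) + f x * ψ x))
    + ψ x * h' (q * r) * (q' * r + q * (σ₂ * p)) + ν * (h (q * r) * coordLaplacian ψ x)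

section Mollified

variable {d : ℕ} {h h' h'' : ℝ → ℝ} {a f η ψ : RSpace d → ℝ} {L B σ₁ σ₂ ν : ℝ}
  {u : ℝ → L2Scalar d}

/-- The commutator is controlled in `L¹` of balls only, so it is always paired with bounded
functions supported in a ball. -/
theorem integrable_mul_commutator (hd : 2 ≤ d) (ha : IsRadialCutoff a) (hf : Integrable f)
    (hB : ∀ᵐ y, |f y| ≤ B) (n : ℕ) {χ : RSpace d → ℝ} (hχ : Continuous χ) {S C : ℝ}
    (hχC : ∀ x, |χ x| ≤ C) (hχS : ∀ x, x ∉ Metric.ball 0 S → χ x = 0) :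
    Integrable (fun x => χ x * transportCommutator (mollifier d n) f f x) ∧
      |∫ x, χ x * transportCommutator (mollifier d n) f f x|
        ≤ C * (∫⁻ x in Metric.ball 0 S, ‖transportCommutator (mollifier d n) f f x‖ₑ).toReal := by
  have hB0 : 0 ≤ B := by
    obtain ⟨x, hx⟩ := hB.exists
    exact (abs_nonneg _).trans hx
  have hC0 : 0 ≤ C := (abs_nonneg _).trans (hχC 0)
  set R := transportCommutator (mollifier d n) f f with hR
  have hRm : AEStronglyMeasurable R volume :=
    aestronglyMeasurable_commutator hf.aestronglyMeasurable hf.aestronglyMeasurable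
      (contDiff_mollifier n)
  have hfin : ∫⁻ x in Metric.ball 0 S, ‖R x‖ₑ ≠ ⊤ :=
    ((lintegral_commutator_le_left hd ha hf hB hf.aestronglyMeasurable hB hB0 n S).trans_lt
      ENNReal.ofReal_lt_top).ne
  have hRi : IntegrableOn R (Metric.ball 0 S) := ⟨hRm.restrict, hfin.lt_top⟩
  have hsupp : Function.support (fun x => χ x * R x) ⊆ Metric.ball 0 S := fun x hx => by
    by_contra h
    exact hx (by simp [hχS x h])
  have hi : IntegrableOn (fun x => χ x * R x) (Metric.ball 0 S) :=
    hRi.bdd_mul (c := C) hχ.aestronglyMeasurable (Eventually.of_forall hχC)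
  refine ⟨(integrableOn_iff_integrable_of_support_subset hsupp).1 hi, ?_⟩
  rw [← setIntegral_eq_integral_of_forall_compl_eq_zero (s := Metric.ball 0 S)
    (fun x hx => by rw [hχS x hx, zero_mul]), ← integral_norm_eq_lintegral_enorm hRm.restrict,
    ← integral_const_mul, ← Real.norm_eq_abs]
  refine norm_integral_le_of_norm_le (hRi.norm.const_mul C) (Eventually.of_forall fun x => ?_)
  rw [norm_mul]
  exact mul_le_mul_of_nonneg_right (hχC x) (norm_nonneg _)

theorem abs_smear_le {A : ℝ} (hf : Integrable f) (hA : ∀ x, |η x| ≤ A) (x : RSpace d) :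
    |smear η f x| ≤ A * ∫ y, |f y| := by
  rw [smear, ← integral_const_mul, ← Real.norm_eq_abs]
  refine norm_integral_le_of_norm_le (hf.abs.const_mul A) (Eventually.of_forall fun y => ?_)
  rw [norm_mul, mul_comm]
  exact mul_le_mul_of_nonneg_right (hA _) (norm_nonneg _)

theorem integrable_prod_mul {k : ℝ → RSpace d → ℝ} (hk : ∀ x, Continuous fun s => k s x)
    (hkm : ∀ s, StronglyMeasurable (k s)) {t C : ℝ} (hC : ∀ s ∈ uIoc 0 t, ∀ x, |k s x| ≤ C)
    (hψ : Integrable ψ) :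
    Integrable (Function.uncurry fun s x => ψ x * k s x)
      ((volume.restrict (uIoc 0 t)).prod volume) := by
  have h1 : StronglyMeasurable (Function.uncurry k) :=
    stronglyMeasurable_uncurry_of_continuous_of_stronglyMeasurable hk hkm
  have hfin : IsFiniteMeasure (volume.restrict (uIoc 0 t)) := by
    rw [uIoc]; infer_instance
  have h2 : Integrable (fun z : ℝ × RSpace d => ψ z.2) ((volume.restrict (uIoc 0 t)).prod volume) :=
    hψ.comp_snd _
  refine h2.mul_bdd (c := C) h1.aestronglyMeasurable ?_
  change ∀ᵐ z ∂((volume.restrict (uIoc 0 t)).prod volume), ‖Function.uncurry k z‖ ≤ C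
  have h3 : MeasurableSet {z : ℝ × RSpace d | ‖Function.uncurry k z‖ ≤ C} :=
    h1.norm.measurable measurableSet_Iic
  rw [Measure.ae_prod_iff_ae_ae h3]
  filter_upwards [ae_restrict_mem measurableSet_uIoc] with s hs
  exact Eventually.of_forall fun x => hC s hs x

theorem intervalIntegrable_integral_mul {k : ℝ → RSpace d → ℝ} (hk : ∀ x, Continuous fun s => k s x)
    (hkm : ∀ s, StronglyMeasurable (k s)) {t C : ℝ} (hC : ∀ s ∈ uIoc 0 t, ∀ x, |k s x| ≤ C)
    (hψ : Integrable ψ) : IntervalIntegrable (fun s => ∫ x, ψ x * k s x) volume 0 t := by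
  rw [intervalIntegrable_iff]
  exact (integrable_prod_mul hk hkm hC hψ).integral_prod_left

theorem exists_bound_on_Icc {g : ℝ → ℝ} (hg : Continuous g) (A : ℝ) :
    ∃ C, ∀ s, |s| ≤ A → |g s| ≤ C := by
  obtain ⟨C, hC⟩ := (isCompact_Icc (a := -A) (b := A)).exists_bound_of_continuousOn hg.continuousOn
  exact ⟨C, fun s hs => hC s (abs_le.1 hs)⟩

theorem IsBoundedCurve.continuous_smear (hu : IsBoundedCurve L B u) (hη : Continuous η)
    (hc : HasCompactSupport η) (x : RSpace d) : Continuous fun s => smear η (u s) x :=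
  hu.continuous_integral_mul (hη.comp (continuous_const.sub continuous_id))
    (hasCompactSupport_reflect hc x)

/-- The mollified equation is multiplied by `ψ h'(q m)`, and all derivatives of `m` are moved away.
What remains is the formal rate of change, the commutator, and the dissipation with the factor
`h''`. -/
theorem IsBoundedCurve.integral_renorm_eq (hd : 2 ≤ d) (ha : IsRadialCutoff a)
    (hu : IsBoundedCurve L B u) (hh : HasTwoDerivs h h' h'') (hψ : ContDiff ℝ ∞ ψ)
    (hc : HasCompactSupport ψ) (n : ℕ) (q q' s : ℝ) :
    ∫ x, ψ x * (h' (q * smear (mollifier d n) (u s) x) * (q' * smear (mollifier d n) (u s) x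
        + q * fluxRate σ₁ σ₂ ν (u s) fun y => mollifier d n (x - y)))
      = (∫ x, renormTerm σ₁ σ₂ ν h h' q q' ψ (u s) (smear (mollifier d n) (u s) x)
            (smear (mollifier d n) (fun y => u s y ^ 2) x) x)
        - σ₁ * q * (∫ x, ψ x * h' (q * smear (mollifier d n) (u s) x)
            * transportCommutator (mollifier d n) (u s) (u s) x)
        - ν * ∫ x, ψ x * h'' (q * smear (mollifier d n) (u s) x)
            * (q ^ 2 * gradSq (smear (mollifier d n) (u s)) x) := by
  have hf := hu.integrable s
  have hB := hu.bound s
  have hη := contDiff_mollifier (d := d) n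
  have hηc := hasCompactSupport_mollifier (d := d) n
  set m := smear (mollifier d n) (u s) with hm_def
  set p := smear (mollifier d n) (fun y => u s y ^ 2) with hp_def
  set R := transportCommutator (mollifier d n) (u s) (u s) with hR_def
  have hm : ContDiff ℝ ∞ m := contDiff_smear hη hηc hf
  have hp : Continuous p :=
    (contDiff_smear hη hηc (integrable_sq_of_bounded hf hB)).continuous
  have hDm := hm.continuous_fderiv (by simp)
  have c0 : Continuous fun x => h (q * m x) := hh.continuous_zeroth.comp (continuous_const.mul hm.continuous)
  have c1 : Continuous fun x => h' (q * m x) := hh.continuous_first.comp (continuous_const.mul hm.continuous)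
  have cχ : Continuous fun x => ψ x * h' (q * m x) := hψ.continuous.mul c1
  have sχ : HasCompactSupport fun x => ψ x * h' (q * m x) := hc.mul_right
  obtain ⟨A, hA⟩ := sχ.exists_bound_of_continuous cχ
  obtain ⟨S, hS⟩ := hc.isCompact.isBounded.subset_ball (0 : RSpace d)
  have I : ∀ {k : RSpace d → ℝ}, Continuous k → Integrable fun x => ψ x * h' (q * m x) * k x :=
    fun hk => (cχ.mul hk).integrable_of_hasCompactSupport sχ.mul_right
  have iR : Integrable fun x => ψ x * h' (q * m x) * R x :=
    (integrable_mul_commutator hd ha hf hB n cχ hA fun x hx => by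
      rw [image_eq_zero_of_notMem_tsupport fun h' => hx (hS h'), zero_mul]).1
  have iV : Integrable fun x => ψ x * h' (q * m x) * (q * fderiv ℝ m x (newtonField (u s) x)) := by
    have k1 : HasCompactSupport fun x => (ψ x * h' (q * m x)) • (q • fderiv ℝ m x) := sχ.smul_right
    have k2 : Continuous fun x => (ψ x * h' (q * m x)) • (q • fderiv ℝ m x) :=
      cχ.smul (hDm.const_smul q)
    refine (integrable_clm_newtonField hd hf hB k2 k1).congr (Eventually.of_forall fun x => ?_)
    simp only [_root_.smul_apply, smul_eq_mul]
  have iL : Integrable fun x => ψ x * h' (q * m x) * (q * coordLaplacian m x) :=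
    I (continuous_const.mul hm.coordLaplacian.continuous)
  have iM : Integrable fun x => ψ x * h' (q * m x) * (q' * m x + q * (σ₂ * p x)) :=
    I ((continuous_const.mul hm.continuous).add (continuous_const.mul (continuous_const.mul hp)))
  have iH : Integrable fun x => h (q * m x) * (fderiv ℝ ψ x (newtonField (u s) x) + u s x * ψ x) := by
    have k1 : HasCompactSupport fun x => h (q * m x) • fderiv ℝ ψ x :=
      (hc.fderiv (𝕜 := ℝ)).smul_left (f := fun x => h (q * m x))
    have k2 : Continuous fun x => h (q * m x) • fderiv ℝ ψ x :=
      c0.smul (hψ.continuous_fderiv (by simp))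
    have k3 : Integrable fun x => u s x * (h (q * m x) * ψ x) := integrable_mul_test (u s) (c0.mul hψ.continuous)
      (hc.mul_left (f := fun x => h (q * m x)))
    refine ((integrable_clm_newtonField hd hf hB k2 k1).add k3).congr
      (Eventually.of_forall fun x => ?_)
    simp only [Pi.add_apply, _root_.smul_apply, smul_eq_mul]
    ring
  have iE : Integrable fun x => h (q * m x) * coordLaplacian ψ x :=
    (c0.mul hψ.coordLaplacian.continuous).integrable_of_hasCompactSupport
      (hc.coordLaplacian.mul_left (f := fun x => h (q * m x)))
  have e1 : ∀ x, ψ x * (h' (q * m x) * (q' * m x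
      + q * fluxRate σ₁ σ₂ ν (u s) fun y => mollifier d n (x - y)))
      = ψ x * h' (q * m x) * (q' * m x + q * (σ₂ * p x))
        - σ₁ * (ψ x * h' (q * m x) * (q * fderiv ℝ m x (newtonField (u s) x)))
        - σ₁ * q * (ψ x * h' (q * m x) * R x)
        + ν * (ψ x * h' (q * m x) * (q * coordLaplacian m x)) := fun x => by
    rw [fluxRate_reflect hd hη hηc hf hB]
    ring
  have e2 : ∀ x, renormTerm σ₁ σ₂ ν h h' q q' ψ (u s) (m x) (p x) x
      = σ₁ * (h (q * m x) * (fderiv ℝ ψ x (newtonField (u s) x) + u s x * ψ x))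
        + ψ x * h' (q * m x) * (q' * m x + q * (σ₂ * p x))
        + ν * (h (q * m x) * coordLaplacian ψ x) := fun x => by
    rw [renormTerm]; ring
  simp_rw [e1, e2]
  rw [integral_add (Integrable.sub' (Integrable.sub' iM (iV.const_mul _)) (iR.const_mul _))
      (iL.const_mul _), integral_sub (Integrable.sub' iM (iV.const_mul _)) (iR.const_mul _),
    integral_sub iM (iV.const_mul _), integral_add ((iH.const_mul _).fun_add iM) (iE.const_mul _),
    integral_add (iH.const_mul _) iM, integral_const_mul, integral_const_mul, integral_const_mul,
    integral_const_mul, integral_const_mul, integral_mul_transport_comp hd hf hB hh hm hψ hc q,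
    integral_mul_laplacian_comp hh hm hψ hc q]
  ring

/-- At each fixed point the mollified density is continuously differentiable in time, so the chain
rule holds pointwise, and Fubini's theorem integrates it in space. -/
theorem IsBoundedCurve.integral_comp_smear_eq (hd : 2 ≤ d)
    (hu : IsBoundedCurve L B u) (hh : HasTwoDerivs h h' h'') (hψ : ContDiff ℝ ∞ ψ)
    (hc : HasCompactSupport ψ) (n : ℕ) {q q' : ℝ → ℝ} (hq : ∀ s, HasDerivAt q (q' s) s)
    (hq' : Continuous q') {T : ℝ}
    (hw : ∀ φ : RSpace d → ℝ, ContDiff ℝ ∞ φ → HasCompactSupport φ → ∀ t ∈ Icc 0 T,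
      ∫ x, u t x * φ x = (∫ x, u 0 x * φ x) + ∫ s in (0 : ℝ)..t, fluxRate σ₁ σ₂ ν (u s) φ)
    {t : ℝ} (ht : t ∈ Icc 0 T) :
    IntervalIntegrable (fun s => ∫ x, ψ x * (h' (q s * smear (mollifier d n) (u s) x)
        * (q' s * smear (mollifier d n) (u s) x
          + q s * fluxRate σ₁ σ₂ ν (u s) fun y => mollifier d n (x - y)))) volume 0 t ∧
    ∫ x, ψ x * h (q t * smear (mollifier d n) (u t) x)
      = (∫ x, ψ x * h (q 0 * smear (mollifier d n) (u 0) x))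
        + ∫ s in (0 : ℝ)..t, ∫ x, ψ x * (h' (q s * smear (mollifier d n) (u s) x)
        * (q' s * smear (mollifier d n) (u s) x
          + q s * fluxRate σ₁ σ₂ ν (u s) fun y => mollifier d n (x - y))) := by
  have hη := contDiff_mollifier (d := d) n
  have hηc := hasCompactSupport_mollifier (d := d) n
  have hqc : Continuous q := continuous_iff_continuousAt.2 fun s => (hq s).continuousAt
  set m : ℝ → RSpace d → ℝ := fun s => smear (mollifier d n) (u s) with hm_def
  set F : ℝ → RSpace d → ℝ := fun s x => fluxRate σ₁ σ₂ ν (u s) fun y => mollifier d n (x - y)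
    with hF_def
  have hmc : ∀ x, Continuous fun s => m s x := fun x => hu.continuous_smear hη.continuous hηc x
  have hFc : ∀ x, Continuous fun s => F s x := fun x =>
    hu.continuous_fluxRate hd (contDiff_reflect hη x) (hasCompactSupport_reflect hηc x) σ₁ σ₂ ν
  have hmx : ∀ s, Continuous (m s) := fun s => (contDiff_smear hη hηc (hu.integrable s)).continuous
  obtain ⟨CF, hCF⟩ := exists_abs_fluxRate_reflect_le hd hη hηc hu σ₁ σ₂ ν
  have hmB : ∀ s x, |m s x| ≤ B := fun s x => abs_smear_mollifier_le (hu.bound s) n x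
  set k : ℝ → RSpace d → ℝ := fun s x => h' (q s * m s x) * (q' s * m s x + q s * F s x) with hk_def
  have hB0 := hu.bound_nonneg
  have hCF0 : 0 ≤ CF := (abs_nonneg _).trans (hCF 0 0)
  have hk1 : ∀ x, Continuous fun s => k s x := fun x =>
    (hh.continuous_first.comp (hqc.mul (hmc x))).mul
      ((hq'.mul (hmc x)).add (hqc.mul (hFc x)))
  have hk2 : ∀ s, StronglyMeasurable (k s) := fun s =>
    (hh.continuous_first.comp (continuous_const.mul (hmx s))).stronglyMeasurable.mul
      ((continuous_const.mul (hmx s)).stronglyMeasurable.add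
      ((stronglyMeasurable_fluxRate_reflect hη (Lp.stronglyMeasurable (u s)) σ₁ σ₂ ν).const_mul _))
  obtain ⟨Q, hQ⟩ := isCompact_uIcc.exists_bound_of_continuousOn (hqc.continuousOn (s := uIcc 0 t))
  obtain ⟨Q', hQ'⟩ := isCompact_uIcc.exists_bound_of_continuousOn (hq'.continuousOn (s := uIcc 0 t))
  obtain ⟨C1, hC1⟩ := exists_bound_on_Icc hh.continuous_first (Q * B)
  have hQ0 : 0 ≤ Q := (norm_nonneg _).trans (hQ 0 left_mem_uIcc)
  have hk3 : ∀ s ∈ uIoc 0 t, ∀ x, |k s x| ≤ C1 * (Q' * B + Q * CF) := by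
    intro s hs x
    have g1 := hQ s (uIoc_subset_uIcc hs)
    have g2 := hQ' s (uIoc_subset_uIcc hs)
    have g3 := hmB s x
    have g4 := hCF s x
    rw [Real.norm_eq_abs] at g1 g2
    have g5 := hC1 (q s * m s x) (by rw [abs_mul]; gcongr)
    have hC10 : 0 ≤ C1 := (abs_nonneg _).trans g5
    have hQ'0 : 0 ≤ Q' := (abs_nonneg _).trans g2
    rw [hk_def, abs_mul]
    refine mul_le_mul g5 ((abs_add_le _ _).trans ?_) (abs_nonneg _) hC10
    rw [abs_mul, abs_mul]
    gcongr
  have hψi : Integrable ψ := hψ.continuous.integrable_of_hasCompactSupport hc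
  refine ⟨intervalIntegrable_integral_mul hk1 hk2 hk3 hψi, ?_⟩
  have hswap := intervalIntegral_integral_swap (integrable_prod_mul hk1 hk2 hk3 hψi)
  have hpt : ∀ x, ∫ s in (0 : ℝ)..t, ψ x * k s x = ψ x * h (q t * m t x) - ψ x * h (q 0 * m 0 x) := by
    intro x
    -- `M` is differentiable on the whole line and agrees with the mollified density on `[0, T]`; no
    -- one-sided derivatives arise at the ends.
    set M : ℝ → ℝ := fun s => m 0 x + ∫ r in (0 : ℝ)..s, F r x with hM_def
    have hMd : ∀ s, HasDerivAt M (F s x) s := fun s =>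
      (intervalIntegral.integral_hasDerivAt_right ((hFc x).intervalIntegrable _ _)
        ((hFc x).stronglyMeasurableAtFilter _ _) (hFc x).continuousAt).const_add _
    have hMm : ∀ s ∈ Icc 0 T, m s x = M s := fun s hs =>
      hw _ (contDiff_reflect hη x) (hasCompactSupport_reflect hηc x) s hs
    have hMc : Continuous M := continuous_iff_continuousAt.2 fun s => (hMd s).continuousAt
    have hd1 : ∀ s, HasDerivAt (fun s => h (q s * M s)) (h' (q s * M s) * (q' s * M s + q s * F s x)) s :=
      fun s => (hh.first (q s * M s)).comp s ((hq s).mul (hMd s))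
    have hd2 : Continuous fun s => h' (q s * M s) * (q' s * M s + q s * F s x) :=
      (hh.continuous_first.comp (hqc.mul hMc)).mul ((hq'.mul hMc).add (hqc.mul (hFc x)))
    have hT0 : (0 : ℝ) ∈ Icc 0 T := ⟨le_rfl, ht.1.trans ht.2⟩
    have := intervalIntegral.integral_eq_sub_of_hasDerivAt (a := 0) (b := t) (fun s _ => hd1 s)
      (hd2.intervalIntegrable _ _)
    rw [intervalIntegral.integral_const_mul, hMm t ht, hMm 0 hT0, ← mul_sub, ← this]
    congr 1
    refine intervalIntegral.integral_congr fun s hs => ?_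
    rw [uIcc_of_le ht.1] at hs
    simp only [hk_def, hMm s ⟨hs.1, hs.2.trans ht.2⟩]
  have hi : ∀ s, Integrable fun x => ψ x * h (q s * m s x) := fun s =>
    (hψ.continuous.mul (hh.continuous_zeroth.comp
      (continuous_const.mul (hmx s)))).integrable_of_hasCompactSupport hc.mul_right
  simp_rw [hpt] at hswap
  rw [integral_sub (hi t) (hi 0)] at hswap
  rw [hswap]
  ring

end Mollified

/-! ### Removal of the mollification -/

section Limit

variable {d : ℕ} {h h' h'' : ℝ → ℝ} {a f ψ : RSpace d → ℝ} {L B σ₁ σ₂ ν : ℝ}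
  {u : ℝ → L2Scalar d}

theorem ae_tendsto_smear (hf : LocallyIntegrable f) :
    ∀ᵐ x, Tendsto (fun n => smear (mollifier d n) f x) atTop (𝓝 (f x)) :=
  ae_tendsto_mollify hf

/-- A dominating function for `renormTerm`. -/
def renormBound (σ₁ σ₂ ν W B C Q Q' : ℝ) (ψ : RSpace d → ℝ) (x : RSpace d) : ℝ :=
  C * (|σ₁| * (‖fderiv ℝ ψ x‖ * W + B * |ψ x|)) + |ψ x| * C * (Q' * B + Q * (|σ₂| * B ^ 2))
    + |ν| * (C * |coordLaplacian ψ x|)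

theorem integrable_renormBound (hψ : ContDiff ℝ ∞ ψ) (hc : HasCompactSupport ψ)
    (σ₁ σ₂ ν W B C Q Q' : ℝ) : Integrable (renormBound σ₁ σ₂ ν W B C Q Q' ψ) := by
  have h1 : Integrable fun x => ‖fderiv ℝ ψ x‖ :=
    ((hψ.continuous_fderiv (by simp)).integrable_of_hasCompactSupport (hc.fderiv (𝕜 := ℝ))).norm
  have h2 : Integrable fun x => |ψ x| :=
    (hψ.continuous.integrable_of_hasCompactSupport hc).norm
  have h3 : Integrable fun x => |coordLaplacian ψ x| :=
    (hψ.coordLaplacian.continuous.integrable_of_hasCompactSupport hc.coordLaplacian).norm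
  exact ((((h1.mul_const W).add (h2.const_mul B)).const_mul |σ₁|).const_mul C).add
    ((h2.mul_const C).mul_const _) |>.add ((h3.const_mul C).const_mul |ν|)

theorem abs_renormTerm_le {W C Q Q' q q' r p : ℝ} {x : RSpace d}
    (hC0 : 0 ≤ C) (hB : |f x| ≤ B) (hW : ‖newtonField f x‖ ≤ W) (hr : |r| ≤ B) (hp : |p| ≤ B ^ 2)
    (hq : |q| ≤ Q) (hq' : |q'| ≤ Q') (hC : ∀ s, |s| ≤ Q * B → |h s| ≤ C ∧ |h' s| ≤ C) :
    |renormTerm σ₁ σ₂ ν h h' q q' ψ f r p x| ≤ renormBound σ₁ σ₂ ν W B C Q Q' ψ x := by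
  have hqr : |q * r| ≤ Q * B := by
    rw [abs_mul]
    exact mul_le_mul hq hr (abs_nonneg _) ((abs_nonneg _).trans hq)
  obtain ⟨h1, h2⟩ := hC _ hqr
  have h3 : |fderiv ℝ ψ x (newtonField f x)| ≤ ‖fderiv ℝ ψ x‖ * W :=
    ((fderiv ℝ ψ x).le_opNorm _).trans (by gcongr)
  have hQ0 : 0 ≤ Q := (abs_nonneg _).trans hq
  have hQ'0 : 0 ≤ Q' := (abs_nonneg _).trans hq'
  have hB0 : 0 ≤ B := (abs_nonneg _).trans hr
  have hW0 : 0 ≤ W := (norm_nonneg _).trans hW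
  have k1 : |h (q * r) * (σ₁ * (fderiv ℝ ψ x (newtonField f x) + f x * ψ x))|
      ≤ C * (|σ₁| * (‖fderiv ℝ ψ x‖ * W + B * |ψ x|)) := by
    rw [abs_mul, abs_mul]
    gcongr
    refine (abs_add_le _ _).trans ?_
    rw [abs_mul (f x)]
    gcongr
  have k2 : |ψ x * h' (q * r) * (q' * r + q * (σ₂ * p))|
      ≤ |ψ x| * C * (Q' * B + Q * (|σ₂| * B ^ 2)) := by
    rw [abs_mul, abs_mul]
    gcongr
    refine (abs_add_le _ _).trans ?_
    rw [abs_mul, abs_mul, abs_mul]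
    gcongr
  have k3 : |ν * (h (q * r) * coordLaplacian ψ x)| ≤ |ν| * (C * |coordLaplacian ψ x|) := by
    rw [abs_mul, abs_mul]
    gcongr
  exact (abs_add_three _ _ _).trans (by unfold renormBound; gcongr)

theorem continuous_renormTerm (hh : HasTwoDerivs h h' h'') (q q' : ℝ) (x : RSpace d) :
    Continuous fun z : ℝ × ℝ => renormTerm σ₁ σ₂ ν h h' q q' ψ f z.1 z.2 x := by
  have h1 := hh.continuous_zeroth
  have h2 := hh.continuous_first
  unfold renormTerm
  fun_prop

theorem aestronglyMeasurable_renormTerm (hh : HasTwoDerivs h h' h'') (hψ : ContDiff ℝ ∞ ψ)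
    (hf : AEStronglyMeasurable f volume) (q q' : ℝ) {r p : RSpace d → ℝ}
    (hr : AEStronglyMeasurable r volume) (hp : AEStronglyMeasurable p volume) :
    AEStronglyMeasurable (fun x => renormTerm σ₁ σ₂ ν h h' q q' ψ f (r x) (p x) x) volume := by
  have h1 : AEStronglyMeasurable (fun x => h (q * r x)) volume :=
    hh.continuous_zeroth.comp_aestronglyMeasurable (hr.const_mul q)
  have h2 : AEStronglyMeasurable (fun x => h' (q * r x)) volume :=
    hh.continuous_first.comp_aestronglyMeasurable (hr.const_mul q)
  have h3 : AEStronglyMeasurable (fun x => fderiv ℝ ψ x (newtonField f x)) volume :=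
    (ContinuousLinearMap.id ℝ (RSpace d →L[ℝ] ℝ)).aestronglyMeasurable_comp₂
      (hψ.continuous_fderiv (by simp)).aestronglyMeasurable (aestronglyMeasurable_newtonField hf)
  have h4 := hψ.continuous.aestronglyMeasurable (μ := (volume : Measure (RSpace d)))
  have h5 := hψ.coordLaplacian.continuous.aestronglyMeasurable (μ := (volume : Measure (RSpace d)))
  exact ((h1.mul ((h3.add (hf.mul h4)).const_mul σ₁)).add ((h4.mul h2).mul ((hr.const_mul q').add
    ((hp.const_mul σ₂).const_mul q)))).add ((h1.mul h5).const_mul ν)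

theorem HasTwoDerivs.exists_bound (hh : HasTwoDerivs h h' h'') (A : ℝ) :
    ∃ C, 0 ≤ C ∧ ∀ s, |s| ≤ A → |h s| ≤ C ∧ |h' s| ≤ C := by
  obtain ⟨C1, h1⟩ := exists_bound_on_Icc hh.continuous_zeroth A
  obtain ⟨C2, h2⟩ := exists_bound_on_Icc hh.continuous_first A
  exact ⟨max 0 (max C1 C2), le_max_left _ _, fun s hs =>
    ⟨(h1 s hs).trans ((le_max_left _ _).trans (le_max_right _ _)),
      (h2 s hs).trans ((le_max_right _ _).trans (le_max_right _ _))⟩⟩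

theorem IsBoundedCurve.abs_smear_sq_le (hu : IsBoundedCurve L B u) (n : ℕ) (s : ℝ) (x : RSpace d) :
    |smear (mollifier d n) (fun y => u s y ^ 2) x| ≤ B ^ 2 := by
  refine abs_smear_mollifier_le ?_ n x
  filter_upwards [hu.bound s] with y hy
  rw [abs_pow]
  gcongr

theorem IsBoundedCurve.tendsto_integral_renormTerm (hd : 2 ≤ d) (hu : IsBoundedCurve L B u)
    (hh : HasTwoDerivs h h' h'') (hψ : ContDiff ℝ ∞ ψ) (hc : HasCompactSupport ψ) (q q' s : ℝ) :
    Tendsto (fun n => ∫ x, renormTerm σ₁ σ₂ ν h h' q q' ψ (u s) (smear (mollifier d n) (u s) x)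
            (smear (mollifier d n) (fun y => u s y ^ 2) x) x) atTop
      (𝓝 (∫ x, renormTerm σ₁ σ₂ ν h h' q q' ψ (u s) (u s x) (u s x ^ 2) x)) := by
  obtain ⟨C, hC0, hC⟩ := hh.exists_bound (|q| * B)
  have hf := hu.integrable s
  have hf2 := integrable_sq_of_bounded hf (hu.bound s)
  refine tendsto_integral_of_dominated_convergence
    (renormBound σ₁ σ₂ ν (B * newtonMass d + newtonConst d * L) B C |q| |q'| ψ) (fun n => ?_)
    (integrable_renormBound hψ hc _ _ _ _ _ _ _ _) (fun n => ?_) ?_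
  · exact aestronglyMeasurable_renormTerm hh hψ hf.aestronglyMeasurable q q'
      (contDiff_smear (contDiff_mollifier n)
        (hasCompactSupport_mollifier n) hf).continuous.aestronglyMeasurable
      (contDiff_smear (contDiff_mollifier n)
        (hasCompactSupport_mollifier n) hf2).continuous.aestronglyMeasurable
  · filter_upwards [hu.bound s] with x hx
    exact abs_renormTerm_le hC0 hx (hu.norm_newtonField_le hd s x)
      (abs_smear_mollifier_le (hu.bound s) n x) (hu.abs_smear_sq_le n s x) le_rfl le_rfl hC
  · filter_upwards [ae_tendsto_smear hf.locallyIntegrable, ae_tendsto_smear hf2.locallyIntegrable]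
      with x h1 h2
    exact ((continuous_renormTerm hh q q' x).tendsto (u s x, u s x ^ 2)).comp (h1.prodMk_nhds h2)

theorem IsBoundedCurve.integral_sq_le (hu : IsBoundedCurve L B u) (s : ℝ) :
    ∫ x, u s x ^ 2 ≤ B * L := by
  have hB0 := hu.bound_nonneg
  calc ∫ x, u s x ^ 2 ≤ ∫ x, B * |u s x| := by
        refine integral_mono_ae (integrable_sq_of_bounded (hu.integrable s) (hu.bound s))
          ((hu.integrable s).abs.const_mul B) ?_
        filter_upwards [hu.bound s] with x hx
        rw [← sq_abs, pow_two]
        gcongr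
    _ ≤ B * L := by
        rw [integral_const_mul]
        exact mul_le_mul_of_nonneg_left (hu.integral_le s) hB0

/-- The uniform bound serves dominated convergence in time; for each fixed time the convergence is
that of the commutator in `L¹_loc`, the weight `ψ h'(q m)` being bounded uniformly in `n`. -/
theorem IsBoundedCurve.commutator_term (hd : 2 ≤ d) (ha : IsRadialCutoff a)
    (hu : IsBoundedCurve L B u) (hh : HasTwoDerivs h h' h'') (hψ : ContDiff ℝ ∞ ψ)
    (hc : HasCompactSupport ψ) (Q : ℝ) :
    (∃ C, ∀ n s q, |q| ≤ Q → |∫ x, ψ x * h' (q * smear (mollifier d n) (u s) x)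
            * transportCommutator (mollifier d n) (u s) (u s) x| ≤ C) ∧
    ∀ s q, |q| ≤ Q → Tendsto (fun n => ∫ x, ψ x * h' (q * smear (mollifier d n) (u s) x)
            * transportCommutator (mollifier d n) (u s) (u s) x) atTop (𝓝 0) := by
  have hB0 := hu.bound_nonneg
  have hL0 := hu.mass_nonneg
  obtain ⟨S, hS⟩ := hc.isCompact.isBounded.subset_ball (0 : RSpace d)
  obtain ⟨A, hA⟩ := hc.exists_bound_of_continuous hψ.continuous
  obtain ⟨C, hC0, hC⟩ := hh.exists_bound (Q * B)
  have hA0 : 0 ≤ A := (norm_nonneg _).trans (hA 0)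
  have key : ∀ n s q, |q| ≤ Q → |∫ x, ψ x * h' (q * smear (mollifier d n) (u s) x)
            * transportCommutator (mollifier d n) (u s) (u s) x| ≤ A * C *
      (∫⁻ x in Metric.ball 0 S, ‖transportCommutator (mollifier d n) (u s) (u s) x‖ₑ).toReal := by
    intro n s q hq
    have hm := (contDiff_smear (contDiff_mollifier (d := d) n) (hasCompactSupport_mollifier n)
      (hu.integrable s)).continuous
    refine (integrable_mul_commutator hd ha (hu.integrable s) (hu.bound s) n
      (χ := fun x => ψ x * h' (q * smear (mollifier d n) (u s) x))
      (hψ.continuous.mul (hh.continuous_first.comp (continuous_const.mul hm))) (fun x => ?_)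
      fun x hx => ?_).2
    · rw [abs_mul]
      refine mul_le_mul (hA x) (hC _ ?_).2 (abs_nonneg _) hA0
      rw [abs_mul]
      have := abs_smear_mollifier_le (hu.bound s) n x
      have := (abs_nonneg q).trans hq
      gcongr
    · rw [image_eq_zero_of_notMem_tsupport fun h' => hx (hS h'), zero_mul]
  refine ⟨⟨A * C * (B * (commutatorConst d S * √(B * L) + L)), fun n s q hq =>
    (key n s q hq).trans ?_⟩, fun s q hq => ?_⟩
  · refine mul_le_mul_of_nonneg_left (ENNReal.toReal_le_of_le_ofReal ?_ ?_) (by positivity)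
    · have := commutatorConst_nonneg d S
      positivity
    · refine (lintegral_commutator_le_left hd ha (hu.integrable s) (hu.bound s)
        (hu.integrable s).aestronglyMeasurable (hu.bound s) hB0 n S).trans
        (ENNReal.ofReal_le_ofReal ?_)
      have := commutatorConst_nonneg d S
      have := hu.integral_le s
      have := hu.integral_sq_le s
      gcongr
  · have h1 := tendsto_lintegral_commutator hd ha (hu.integrable s) (hu.bound s)
      (hu.integrable s) (hu.bound s) S
    have h2 := ((ENNReal.tendsto_toReal ENNReal.zero_ne_top).comp h1).const_mul (A * C)
    rw [ENNReal.toReal_zero, mul_zero] at h2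
    exact squeeze_zero_norm (fun n => key n s q hq) h2

theorem IsBoundedCurve.tendsto_integral_comp_smear (hu : IsBoundedCurve L B u)
    (hh : HasTwoDerivs h h' h'') (hψ : Continuous ψ) (hc : HasCompactSupport ψ) (q s : ℝ) :
    Tendsto (fun n => ∫ x, ψ x * h (q * smear (mollifier d n) (u s) x)) atTop
      (𝓝 (∫ x, ψ x * h (q * u s x))) := by
  obtain ⟨C, hC0, hC⟩ := hh.exists_bound (|q| * B)
  have hf := hu.integrable s
  refine tendsto_integral_of_dominated_convergence (fun x => |ψ x| * C) (fun n => ?_)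
    ((hψ.integrable_of_hasCompactSupport hc).norm.mul_const C) (fun n => ?_) ?_
  · exact (hψ.mul (hh.continuous_zeroth.comp (continuous_const.mul (contDiff_smear
      (contDiff_mollifier n) (hasCompactSupport_mollifier n) hf).continuous))).aestronglyMeasurable
  · refine Eventually.of_forall fun x => ?_
    rw [norm_mul]
    refine mul_le_mul_of_nonneg_left (hC _ ?_).1 (norm_nonneg _)
    rw [abs_mul]
    have := abs_smear_mollifier_le (hu.bound s) n x
    gcongr
  · filter_upwards [ae_tendsto_smear hf.locallyIntegrable] with x h1
    exact ((hh.continuous_zeroth.tendsto _).comp (h1.const_mul q)).const_mul (ψ x)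

/-- The gradient of the mollification is the mollification of the weak gradient, which converges
almost everywhere by Lebesgue's differentiation theorem. -/
theorem HasWeakGradient.ae_tendsto_gradSq_smear {f : L2Scalar d} {g : L2Vector d}
    (h : HasWeakGradient f g) (hf : Integrable f) :
    ∀ᵐ x, Tendsto (fun n => gradSq (smear (mollifier d n) f) x) atTop (𝓝 (‖g x‖ ^ 2)) := by
  have h1 : ∀ i : Fin d, ∀ᵐ x, Tendsto (fun n => fderiv ℝ (smear (mollifier d n) f) x
      (EuclideanSpace.single i 1)) atTop (𝓝 (inner ℝ (g x) (EuclideanSpace.single i 1))) := fun i => by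
    have h2 : LocallyIntegrable fun y => inner ℝ (g y) (EuclideanSpace.single i (1 : ℝ)) :=
      ((Lp.memLp g).inner_const _).locallyIntegrable (by norm_num)
    filter_upwards [ae_tendsto_smear h2] with x hx
    simp_rw [fun n => h.fderiv_smear hf (contDiff_mollifier n) (hasCompactSupport_mollifier n) x]
    exact hx
  filter_upwards [ae_all_iff.2 h1] with x hx
  have h3 : ‖g x‖ ^ 2 = ∑ i, inner ℝ (g x) (EuclideanSpace.single i (1 : ℝ)) ^ 2 := by
    rw [EuclideanSpace.real_norm_sq_eq]
    simp [EuclideanSpace.inner_single_right]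
  rw [h3]
  exact tendsto_finsetSum _ fun i _ => (hx i).pow 2

end Limit

/-! ### The renormalized energy inequality -/

section Renormalized

variable {d : ℕ} {h h' h'' : ℝ → ℝ} {a f ψ : RSpace d → ℝ} {L B σ₁ σ₂ ν : ℝ}
  {u : ℝ → L2Scalar d}

theorem gradSq_nonneg (m : RSpace d → ℝ) (x : RSpace d) : 0 ≤ gradSq m x :=
  Finset.sum_nonneg fun _ _ => sq_nonneg _

theorem IsBoundedCurve.gradSq_smear (hu : IsBoundedCurve L B u) (n : ℕ) :
    (∀ x, Continuous fun s => gradSq (smear (mollifier d n) (u s)) x) ∧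
    (∀ s, Continuous (gradSq (smear (mollifier d n) (u s)))) ∧
    ∃ C, ∀ s x, gradSq (smear (mollifier d n) (u s)) x ≤ C := by
  have hη := contDiff_mollifier (d := d) n
  have hηc := hasCompactSupport_mollifier (d := d) n
  have hL0 := hu.mass_nonneg
  obtain ⟨A, hA⟩ := (hηc.fderiv (𝕜 := ℝ)).exists_bound_of_continuous (hη.continuous_fderiv (by simp))
  refine ⟨fun x => ?_, fun s => ?_, ⟨∑ _i : Fin d, (A * L) ^ 2, fun s x => ?_⟩⟩
  · unfold gradSq
    simp_rw [fun s => fderiv_smear hη hηc (hu.integrable s) x]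
    exact continuous_finsetSum _ fun i _ => (hu.continuous_smear
      (contDiff_fderiv_apply hη _).continuous (hηc.fderiv_apply (𝕜 := ℝ) _) x).pow 2
  · exact continuous_finsetSum _ fun i _ => ((contDiff_fderiv_apply
      (contDiff_smear hη hηc (hu.integrable s)) _).continuous).pow 2
  · refine Finset.sum_le_sum fun i _ => ?_
    rw [fderiv_smear hη hηc (hu.integrable s), ← sq_abs]
    have hA0 : 0 ≤ A := (norm_nonneg _).trans (hA 0)
    gcongr
    refine (abs_smear_le (A := A) (hu.integrable s) (fun z => ?_) x).trans ?_
    · refine ((fderiv ℝ (mollifier d n) z).le_opNorm _).trans ?_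
      simpa using hA z
    · have := hu.integral_le s
      gcongr

theorem IsBoundedCurve.gradient_term (hu : IsBoundedCurve L B u) (hh : HasTwoDerivs h h' h'')
    (hψ : ContDiff ℝ ∞ ψ) (hc : HasCompactSupport ψ) (hψ0 : ∀ x, 0 ≤ ψ x) {κ : ℝ}
    (hκ : ∀ s, κ ≤ h'' s) {q : ℝ → ℝ} (hq : Continuous q) (n : ℕ) (t : ℝ) :
    IntervalIntegrable (fun s => ∫ x, ψ x * (q s ^ 2 * gradSq (smear (mollifier d n) (u s)) x))
      volume 0 t ∧
    IntervalIntegrable (fun s => ∫ x, ψ x * h'' (q s * smear (mollifier d n) (u s) x)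
      * (q s ^ 2 * gradSq (smear (mollifier d n) (u s)) x)) volume 0 t ∧
    ∀ s, κ * ∫ x, ψ x * (q s ^ 2 * gradSq (smear (mollifier d n) (u s)) x)
      ≤ ∫ x, ψ x * h'' (q s * smear (mollifier d n) (u s) x)
        * (q s ^ 2 * gradSq (smear (mollifier d n) (u s)) x) := by
  have hη := contDiff_mollifier (d := d) n
  have hηc := hasCompactSupport_mollifier (d := d) n
  obtain ⟨g1, g2, CG, g3⟩ := hu.gradSq_smear n
  have hm1 : ∀ x, Continuous fun s => smear (mollifier d n) (u s) x := fun x =>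
    hu.continuous_smear hη.continuous hηc x
  have hm2 : ∀ s, Continuous (smear (mollifier d n) (u s)) := fun s =>
    (contDiff_smear hη hηc (hu.integrable s)).continuous
  have hψi : Integrable ψ := hψ.continuous.integrable_of_hasCompactSupport hc
  obtain ⟨Q, hQ⟩ := isCompact_uIcc.exists_bound_of_continuousOn (hq.continuousOn (s := uIcc 0 t))
  have hQ0 : 0 ≤ Q := (norm_nonneg _).trans (hQ 0 left_mem_uIcc)
  obtain ⟨C, hC⟩ := exists_bound_on_Icc hh.continuous (Q * B)
  have hCG0 : 0 ≤ CG := (gradSq_nonneg _ _).trans (g3 0 0)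
  have hb : ∀ s ∈ uIoc 0 t, ∀ x, |q s ^ 2 * gradSq (smear (mollifier d n) (u s)) x| ≤ Q ^ 2 * CG := by
    intro s hs x
    have := hQ s (uIoc_subset_uIcc hs)
    rw [Real.norm_eq_abs] at this
    rw [abs_mul, abs_pow, abs_of_nonneg (gradSq_nonneg _ _)]
    have := g3 s x
    gcongr
    exact gradSq_nonneg _ _
  refine ⟨intervalIntegrable_integral_mul
    (k := fun s x => q s ^ 2 * gradSq (smear (mollifier d n) (u s)) x)
    (fun x => (hq.pow 2).mul (g1 x))
    (fun s => (continuous_const.mul (g2 s)).stronglyMeasurable) hb hψi, ?_, fun s => ?_⟩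
  · simp_rw [mul_assoc (ψ _)]
    refine intervalIntegrable_integral_mul (C := C * (Q ^ 2 * CG))
      (k := fun s x => h'' (q s * smear (mollifier d n) (u s) x)
        * (q s ^ 2 * gradSq (smear (mollifier d n) (u s)) x))
      (fun x => (hh.continuous.comp (hq.mul (hm1 x))).mul ((hq.pow 2).mul (g1 x)))
      (fun s => ((hh.continuous.comp (continuous_const.mul (hm2 s))).mul
        (continuous_const.mul (g2 s))).stronglyMeasurable) (fun s hs x => ?_) hψi
    have h1 : |h'' (q s * smear (mollifier d n) (u s) x)| ≤ C := by
      refine hC _ ?_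
      have h2 := hQ s (uIoc_subset_uIcc hs)
      have h3 := abs_smear_mollifier_le (hu.bound s) n x
      rw [Real.norm_eq_abs] at h2
      rw [abs_mul]
      gcongr
    rw [abs_mul]
    exact mul_le_mul h1 (hb s hs x) (abs_nonneg _) ((abs_nonneg _).trans h1)
  · rw [← integral_const_mul]
    have hcG : Continuous fun x => q s ^ 2 * gradSq (smear (mollifier d n) (u s)) x :=
      continuous_const.mul (g2 s)
    have ch : Continuous fun x => h'' (q s * smear (mollifier d n) (u s) x) :=
      hh.continuous.comp (continuous_const.mul (hm2 s))
    refine integral_mono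
      (((hψ.continuous.mul hcG).integrable_of_hasCompactSupport hc.mul_right).const_mul κ)
      (((hψ.continuous.mul ch).mul hcG).integrable_of_hasCompactSupport hc.mul_right.mul_right)
      fun x => ?_
    have h1 : 0 ≤ ψ x * (q s ^ 2 * gradSq (smear (mollifier d n) (u s)) x) :=
      mul_nonneg (hψ0 x) (mul_nonneg (sq_nonneg _) (gradSq_nonneg _ _))
    calc κ * (ψ x * (q s ^ 2 * gradSq (smear (mollifier d n) (u s)) x))
        ≤ h'' (q s * smear (mollifier d n) (u s) x)
          * (ψ x * (q s ^ 2 * gradSq (smear (mollifier d n) (u s)) x)) :=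
          mul_le_mul_of_nonneg_right (hκ _) h1
      _ = _ := by ring

/-- Fatou's lemma in space and then in time. In terms of extended norms the claim needs no
integrability of the left-hand integrand. -/
theorem IsBoundedCurve.enorm_gradient_term_le (hu : IsBoundedCurve L B u)
    (hψ : ContDiff ℝ ∞ ψ) (hc : HasCompactSupport ψ) (hψ0 : ∀ x, 0 ≤ ψ x)
    {q : ℝ → ℝ} (hq : Continuous q) {T : ℝ} {g : ℝ → L2Vector d}
    (hg : ∀ᵐ s ∂(volume.restrict (Icc 0 T)), HasWeakGradient (u s) (g s))
    {t : ℝ} (ht : t ∈ Icc 0 T) :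
    ‖∫ s in (0 : ℝ)..t, q s ^ 2 * ∫ x, ψ x * ‖g s x‖ ^ 2‖ₑ
      ≤ liminf (fun n => ENNReal.ofReal (∫ s in (0 : ℝ)..t,
        ∫ x, ψ x * (q s ^ 2 * gradSq (smear (mollifier d n) (u s)) x))) atTop := by
  set k : ℕ → ℝ → RSpace d → ℝ := fun n s x =>
    ψ x * (q s ^ 2 * gradSq (smear (mollifier d n) (u s)) x) with hk_def
  have hk0 : ∀ n s x, 0 ≤ k n s x := fun n s x =>
    mul_nonneg (hψ0 x) (mul_nonneg (sq_nonneg _) (gradSq_nonneg _ _))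
  have hki : ∀ n s, Continuous (k n s) := fun n s =>
    hψ.continuous.mul (continuous_const.mul ((hu.gradSq_smear n).2.1 s))
  have hkii : ∀ n s, Integrable (k n s) := fun n s =>
    (hki n s).integrable_of_hasCompactSupport hc.mul_right
  have hh0 : HasTwoDerivs (fun _ => 0) (fun _ => 0) (fun _ => (0 : ℝ)) :=
    ⟨fun s => hasDerivAt_const s 0, fun s => hasDerivAt_const s 0, continuous_const⟩
  have hkt : ∀ n, IntegrableOn (fun s => ∫ x, k n s x) (Ioc 0 t) := fun n => by
    have := (hu.gradient_term hh0 hψ hc hψ0 (κ := 0) (fun _ => le_rfl) hq n t).1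
    rwa [intervalIntegrable_iff_integrableOn_Ioc_of_le ht.1] at this
  have hg' : ∀ᵐ s ∂(volume.restrict (Ioc 0 t)), HasWeakGradient (u s) (g s) :=
    ae_restrict_of_ae_restrict_of_subset
      (Ioc_subset_Icc_self.trans (Icc_subset_Icc_right ht.2)) hg
  rw [intervalIntegral.integral_of_le ht.1]
  simp_rw [intervalIntegral.integral_of_le ht.1]
  calc _ ≤ ∫⁻ s in Ioc 0 t, ‖q s ^ 2 * ∫ x, ψ x * ‖g s x‖ ^ 2‖ₑ :=
        enorm_integral_le_lintegral_enorm _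
    _ ≤ ∫⁻ s in Ioc 0 t, liminf (fun n => ENNReal.ofReal (∫ x, k n s x)) atTop := by
        refine lintegral_mono_ae ?_
        filter_upwards [hg'] with s hs
        rw [← integral_const_mul]
        refine (enorm_integral_le_lintegral_enorm _).trans ?_
        simp_rw [fun n => ofReal_integral_eq_lintegral_ofReal (hkii n s)
          (Eventually.of_forall (hk0 n s))]
        refine le_trans (lintegral_mono_ae ?_) (lintegral_liminf_le fun n =>
          (hki n s).measurable.ennreal_ofReal)
        filter_upwards [hs.ae_tendsto_gradSq_smear (hu.integrable s)] with x hx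
        have h1 : Tendsto (fun n => ENNReal.ofReal (k n s x)) atTop
            (𝓝 (ENNReal.ofReal (ψ x * (q s ^ 2 * ‖g s x‖ ^ 2)))) :=
          (ENNReal.continuous_ofReal.tendsto _).comp ((hx.const_mul _).const_mul _)
        rw [h1.liminf_eq, ← ofReal_norm, Real.norm_of_nonneg
          (mul_nonneg (sq_nonneg _) (mul_nonneg (hψ0 x) (sq_nonneg _)))]
        exact ENNReal.ofReal_le_ofReal (le_of_eq (by ring))
    _ ≤ liminf (fun n => ∫⁻ s in Ioc 0 t, ENNReal.ofReal (∫ x, k n s x)) atTop :=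
        lintegral_liminf_le' fun n => (hkt n).aestronglyMeasurable.aemeasurable.ennreal_ofReal
    _ = _ := by
        congr 1
        funext n
        rw [ofReal_integral_eq_lintegral_ofReal (hkt n)
          (Eventually.of_forall fun s => integral_nonneg (hk0 n s))]

/-- The renormalized energy inequality: for convex `h`, the integral `∫ h(q ρ) ψ` grows at most
at the rate given by the formal computation. -/
theorem IsBoundedCurve.renormalized_inequality (hd : 2 ≤ d) (ha : IsRadialCutoff a)
    (hu : IsBoundedCurve L B u) (hh : HasTwoDerivs h h' h'') (hψ : ContDiff ℝ ∞ ψ)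
    (hc : HasCompactSupport ψ) (hψ0 : ∀ x, 0 ≤ ψ x) {κ : ℝ} (hκ0 : 0 ≤ κ) (hκ : ∀ s, κ ≤ h'' s)
    {q q' : ℝ → ℝ} (hq : ∀ s, HasDerivAt q (q' s) s) (hq' : Continuous q') {T : ℝ} (hν : 0 ≤ ν)
    (hw : ∀ φ : RSpace d → ℝ, ContDiff ℝ ∞ φ → HasCompactSupport φ → ∀ t ∈ Icc 0 T,
      ∫ x, u t x * φ x = (∫ x, u 0 x * φ x) + ∫ s in (0 : ℝ)..t, fluxRate σ₁ σ₂ ν (u s) φ)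
    {g : ℝ → L2Vector d}
    (hg : 0 < ν → ∀ᵐ s ∂(volume.restrict (Icc 0 T)), HasWeakGradient (u s) (g s))
    {t : ℝ} (ht : t ∈ Icc 0 T) :
    (∫ x, ψ x * h (q t * u t x)) + ν * κ * ∫ s in (0 : ℝ)..t, q s ^ 2 * ∫ x, ψ x * ‖g s x‖ ^ 2
      ≤ (∫ x, ψ x * h (q 0 * u 0 x)) + ∫ s in (0 : ℝ)..t, ∫ x,
        renormTerm σ₁ σ₂ ν h h' (q s) (q' s) ψ (u s) (u s x) (u s x ^ 2) x := by
  have hqc : Continuous q := continuous_iff_continuousAt.2 fun s => (hq s).continuousAt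
  obtain ⟨Q, hQ⟩ := isCompact_uIcc.exists_bound_of_continuousOn (hqc.continuousOn (s := uIcc 0 t))
  obtain ⟨Q', hQ'⟩ := isCompact_uIcc.exists_bound_of_continuousOn (hq'.continuousOn (s := uIcc 0 t))
  have hQ0 : 0 ≤ Q := (norm_nonneg _).trans (hQ 0 left_mem_uIcc)
  have hB0 := hu.bound_nonneg
  obtain ⟨⟨CR, hCR⟩, hRlim⟩ := hu.commutator_term hd ha hh hψ hc Q
  obtain ⟨C, hC0, hC⟩ := hh.exists_bound (Q * B)
  set D : ℕ → ℝ → ℝ := fun n s => ∫ x, ψ x * (q s ^ 2 * gradSq (smear (mollifier d n) (u s)) x)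
    with hD_def
  set G : ℕ → ℝ → ℝ := fun n s => ∫ x, ψ x * h'' (q s * smear (mollifier d n) (u s) x)
        * (q s ^ 2 * gradSq (smear (mollifier d n) (u s)) x) with hG_def
  set R : ℕ → ℝ → ℝ := fun n s => ∫ x, ψ x * h' (q s * smear (mollifier d n) (u s) x)
            * transportCommutator (mollifier d n) (u s) (u s) x with hR_def
  set I : ℕ → ℝ → ℝ := fun n s => ∫ x, renormTerm σ₁ σ₂ ν h h' (q s) (q' s) ψ (u s)
    (smear (mollifier d n) (u s) x) (smear (mollifier d n) (fun y => u s y ^ 2) x) x with hI_def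
  set J : ℝ → ℝ := fun s => ∫ x,
        renormTerm σ₁ σ₂ ν h h' (q s) (q' s) ψ (u s) (u s x) (u s x ^ 2) x with hJ_def
  set l : ℕ → ℝ → ℝ := fun n s => ∫ x, ψ x * h (q s * smear (mollifier d n) (u s) x) with hl_def
  have hDG := fun n => hu.gradient_term hh hψ hc hψ0 hκ hqc n t
  have hA' : ∀ n, IntervalIntegrable (fun s => I n s - σ₁ * q s * R n s) volume 0 t ∧
      l n t = l n 0 + (∫ s in (0 : ℝ)..t, (I n s - σ₁ * q s * R n s))
        - ν * ∫ s in (0 : ℝ)..t, G n s := by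
    intro n
    obtain ⟨i1, i2⟩ := hu.integral_comp_smear_eq hd hh hψ hc n hq hq' hw ht
    have e1 := fun s => hu.integral_renorm_eq (σ₁ := σ₁) (σ₂ := σ₂) (ν := ν) hd ha hh hψ hc n (q s)
      (q' s) s
    simp_rw [e1] at i1 i2
    have i3 : IntervalIntegrable (fun s => ν * G n s) volume 0 t := (hDG n).2.1.const_mul ν
    have i4 : IntervalIntegrable (fun s => I n s - σ₁ * q s * R n s) volume 0 t := by
      refine (i1.add i3).congr fun s _ => ?_
      simp only [hI_def, hR_def, hG_def]
      ring
    refine ⟨i4, ?_⟩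
    rw [hl_def]
    simp only
    rw [i2, ← intervalIntegral.integral_const_mul, add_sub_assoc,
      ← intervalIntegral.integral_sub i4 i3]
  -- Dominated convergence in time: the bounds are uniform in `n` and in `s`, and the commutator
  -- part tends to `0`.
  have hlimI : Tendsto (fun n => ∫ s in (0 : ℝ)..t, (I n s - σ₁ * q s * R n s)) atTop
      (𝓝 (∫ s in (0 : ℝ)..t, J s)) := by
    refine intervalIntegral.tendsto_integral_filter_of_dominated_convergence
      (fun _ => (∫ x, renormBound σ₁ σ₂ ν (B * newtonMass d + newtonConst d * L) B C Q Q' ψ x)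
        + |σ₁| * Q * CR)
      (Eventually.of_forall fun n => (hA' n).1.def'.aestronglyMeasurable)
      (Eventually.of_forall fun n => Eventually.of_forall fun s hs => ?_)
      intervalIntegrable_const (Eventually.of_forall fun s hs => ?_)
    · have q1 := hQ s (uIoc_subset_uIcc hs)
      have q2 := hQ' s (uIoc_subset_uIcc hs)
      have r1 := hCR n s (q s) q1
      refine (norm_sub_le _ _).trans (add_le_add ?_ ?_)
      · refine norm_integral_le_of_norm_le (integrable_renormBound hψ hc _ _ _ _ _ _ _ _) ?_
        filter_upwards [hu.bound s] with x hx
        exact abs_renormTerm_le hC0 hx (hu.norm_newtonField_le hd s x)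
          (abs_smear_mollifier_le (hu.bound s) n x) (hu.abs_smear_sq_le n s x) q1 q2 hC
      · rw [norm_mul, norm_mul, Real.norm_eq_abs σ₁]
        refine mul_le_mul (by gcongr) r1 (norm_nonneg _) (by positivity)
    · have q1 := hQ s (uIoc_subset_uIcc hs)
      have h1 := hu.tendsto_integral_renormTerm (σ₁ := σ₁) (σ₂ := σ₂) (ν := ν) hd hh hψ hc
        (q s) (q' s) s
      have h2 := (hRlim s (q s) q1).const_mul (σ₁ * q s)
      rw [mul_zero] at h2
      have h3 := h1.sub h2
      rwa [sub_zero] at h3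
  have hlimE : Tendsto (fun n => l n 0 + (∫ s in (0 : ℝ)..t, (I n s - σ₁ * q s * R n s)) - l n t)
      atTop (𝓝 ((∫ x, ψ x * h (q 0 * u 0 x)) + (∫ s in (0 : ℝ)..t, J s)
        - ∫ x, ψ x * h (q t * u t x))) :=
    ((hu.tendsto_integral_comp_smear hh hψ.continuous hc (q 0) 0).add hlimI).sub
      (hu.tendsto_integral_comp_smear hh hψ.continuous hc (q t) t)
  -- The convexity bound `κ ≤ h''` turns the exact identity for the mollified density into an
  -- inequality that can pass to the lower limit.
  have hDE : ∀ n, ν * κ * (∫ s in (0 : ℝ)..t, D n s)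
      ≤ l n 0 + (∫ s in (0 : ℝ)..t, (I n s - σ₁ * q s * R n s)) - l n t := by
    intro n
    rw [(hA' n).2, mul_assoc, ← intervalIntegral.integral_const_mul]
    have h1 : ∫ s in (0 : ℝ)..t, κ * D n s ≤ ∫ s in (0 : ℝ)..t, G n s :=
      intervalIntegral.integral_mono_on ht.1 ((hDG n).1.const_mul κ) (hDG n).2.1
        fun s _ => (hDG n).2.2 s
    have h2 := mul_le_mul_of_nonneg_left h1 hν
    linarith
  have hD0 : ∀ n, 0 ≤ ∫ s in (0 : ℝ)..t, D n s := fun n =>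
    intervalIntegral.integral_nonneg ht.1 fun s _ => integral_nonneg fun x =>
      mul_nonneg (hψ0 x) (mul_nonneg (sq_nonneg _) (gradSq_nonneg _ _))
  -- Nonnegativity of the limit, needed to return from extended nonnegative numbers to real ones.
  have hE0 : 0 ≤ (∫ x, ψ x * h (q 0 * u 0 x)) + (∫ s in (0 : ℝ)..t, J s)
        - ∫ x, ψ x * h (q t * u t x) :=
    ge_of_tendsto hlimE (Eventually.of_forall fun n =>
      (mul_nonneg (mul_nonneg hν hκ0) (hD0 n)).trans (hDE n))
  rcases hν.eq_or_lt with h0 | h0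
  · rw [← h0, zero_mul, zero_mul, add_zero]
    linarith
  · have key : ‖ν * κ * ∫ s in (0 : ℝ)..t, q s ^ 2 * ∫ x, ψ x * ‖g s x‖ ^ 2‖ₑ
        ≤ ENNReal.ofReal ((∫ x, ψ x * h (q 0 * u 0 x)) + (∫ s in (0 : ℝ)..t, J s)
        - ∫ x, ψ x * h (q t * u t x)) := by
      rw [enorm_mul]
      have hνκ : ‖ν * κ‖ₑ = ENNReal.ofReal (ν * κ) := by
        rw [← ofReal_norm, Real.norm_of_nonneg (mul_nonneg hν hκ0)]
      calc _ ≤ ‖ν * κ‖ₑ * liminf (fun n => ENNReal.ofReal (∫ s in (0 : ℝ)..t, D n s)) atTop :=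
            mul_le_mul_right (hu.enorm_gradient_term_le hψ hc hψ0 hqc (hg h0) ht) _
        _ = liminf (fun n => ENNReal.ofReal (ν * κ * ∫ s in (0 : ℝ)..t, D n s)) atTop := by
            rw [hνκ, ← ENNReal.liminf_const_mul_of_ne_top ENNReal.ofReal_ne_top]
            simp_rw [← ENNReal.ofReal_mul (mul_nonneg hν hκ0)]
        _ ≤ liminf (fun n => ENNReal.ofReal (l n 0
              + (∫ s in (0 : ℝ)..t, (I n s - σ₁ * q s * R n s)) - l n t)) atTop :=
            liminf_le_liminf (Eventually.of_forall fun n => ENNReal.ofReal_le_ofReal (hDE n))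
        _ = _ := ((ENNReal.continuous_ofReal.tendsto _).comp hlimE).liminf_eq
    rw [← ofReal_norm, ENNReal.ofReal_le_ofReal_iff hE0] at key
    have := (le_abs_self _).trans key
    linarith

end Renormalized

/-- `N` carries the dissipated energy: being nonnegative it may be dropped inside the integral, and
it is kept on the left at the end. -/
theorem gronwall_integral {y N : ℝ → ℝ} {A b c T : ℝ} (hy : Continuous y)
    (hN : ∀ t ∈ Icc 0 T, 0 ≤ N t) (hb : 0 ≤ b) (hc : 0 ≤ c)
    (h : ∀ t ∈ Icc 0 T, y t + N t ≤ A + ∫ s in (0 : ℝ)..t, (c * y s + b)) :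
    ∀ t ∈ Icc 0 T, y t + N t ≤ (A + b * t) * Real.exp (c * t) := by
  intro t ht
  have hI : ∀ s, ∫ r in (0 : ℝ)..s, (c * y r + b) = c * (∫ r in (0 : ℝ)..s, y r) + b * s := fun s => by
    rw [intervalIntegral.integral_add ((hy.intervalIntegrable _ _).const_mul c)
      (continuous_const.intervalIntegrable _ _), intervalIntegral.integral_const_mul]
    simp [mul_comm]
  -- The source is frozen at its value `b * t` at the final time, so that `Z' = c y ≤ c Z` on `[0,
  -- t]` without a further source.
  set Z : ℝ → ℝ := fun s => A + b * t + c * ∫ r in (0 : ℝ)..s, y r with hZ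
  have hZd : ∀ s, HasDerivAt Z (c * y s) s := fun s =>
    ((intervalIntegral.integral_hasDerivAt_right (hy.intervalIntegrable _ _)
      (hy.stronglyMeasurableAtFilter _ _) hy.continuousAt).const_mul c).const_add _
  have h1 := le_gronwallBound_of_liminf_deriv_right_le (f := Z) (f' := fun s => c * y s)
    (δ := A + b * t) (K := c) (ε := 0) (a := 0) (b := t)
    (fun s _ => (hZd s).continuousAt.continuousWithinAt)
    (fun s _ r hr => (hZd s).hasDerivWithinAt.liminf_right_slope_le hr) (by simp [hZ])
    (fun s hs => by
      have hs' : s ∈ Icc 0 T := ⟨hs.1, hs.2.le.trans ht.2⟩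
      have k1 := h s hs'
      have k2 := hN s hs'
      rw [hI] at k1
      have k3 : b * s ≤ b * t := mul_le_mul_of_nonneg_left hs.2.le hb
      have k4 : y s ≤ Z s := by simp only [hZ]; linarith
      have := mul_le_mul_of_nonneg_left k4 hc
      linarith) t ⟨ht.1, le_rfl⟩
  rw [gronwallBound_ε0, sub_zero] at h1
  refine le_trans ?_ h1
  have := h t ht
  rw [hI] at this
  simp only [hZ]
  linarith

/-! ### Dilated cutoffs -/

section Cutoffs

variable {d : ℕ} {a f ψ : RSpace d → ℝ}

theorem IsRadialCutoff.tendsto_integral_dilate_mul (ha : IsRadialCutoff a) (hf : Integrable f) :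
    Tendsto (fun S => ∫ x, dilate a S x * f x) atTop (𝓝 (∫ x, f x)) := by
  refine tendsto_integral_filter_of_dominated_convergence (fun x => |f x|)
    (Eventually.of_forall fun S =>
      (ha.smooth.dilate S).continuous.aestronglyMeasurable.mul hf.aestronglyMeasurable)
    (Eventually.of_forall fun S => Eventually.of_forall fun x => ?_) hf.abs
    (Eventually.of_forall fun x => ?_)
  · rw [norm_mul, Real.norm_eq_abs, Real.norm_eq_abs, dilate, abs_of_nonneg (ha.nonneg _)]
    exact mul_le_of_le_one_left (abs_nonneg _) (ha.le_one _)
  · refine tendsto_const_nhds.congr' ?_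
    filter_upwards [eventually_gt_atTop (max 0 ‖x‖)] with S hS
    rw [ha.dilate_eq_one ((le_max_left _ _).trans_lt hS) ((le_max_right _ _).trans_lt hS), one_mul]

theorem coordLaplacian_dilate {g : RSpace d → ℝ} (hg : ContDiff ℝ ∞ g) (S : ℝ) (x : RSpace d) :
    coordLaplacian (dilate g S) x = S⁻¹ ^ 2 * coordLaplacian g (S⁻¹ • x) := by
  simp only [coordLaplacian, Finset.mul_sum]
  refine Finset.sum_congr rfl fun i _ => ?_
  have h1 : (fun y => fderiv ℝ (dilate g S) y (EuclideanSpace.single i 1))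
      = fun y => S⁻¹ * dilate (fun z => fderiv ℝ g z (EuclideanSpace.single i 1)) S y := by
    funext y
    rw [fderiv_dilate, _root_.smul_apply, smul_eq_mul, dilate]
  have h2 := (contDiff_fderiv_apply hg (EuclideanSpace.single i 1)).dilate S
  rw [h1, fderiv_const_mul (h2.differentiable (by simp) x), fderiv_dilate]
  simp only [_root_.smul_apply, smul_eq_mul]
  ring

theorem exists_bound_dilate (hψ : ContDiff ℝ ∞ ψ) (hc : HasCompactSupport ψ) :
    ∃ A, 0 ≤ A ∧ ∀ S, 0 < S → ∀ x, ‖fderiv ℝ (dilate ψ S) x‖ ≤ A * S⁻¹ ∧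
      |coordLaplacian (dilate ψ S) x| ≤ A * S⁻¹ ^ 2 := by
  obtain ⟨A1, h1⟩ := (hc.fderiv (𝕜 := ℝ)).exists_bound_of_continuous (hψ.continuous_fderiv (by simp))
  obtain ⟨A2, h2⟩ := hc.coordLaplacian.exists_bound_of_continuous hψ.coordLaplacian.continuous
  refine ⟨max A1 A2, ((norm_nonneg _).trans (h1 0)).trans (le_max_left _ _), fun S hS x => ⟨?_, ?_⟩⟩
  · rw [fderiv_dilate, norm_smul, Real.norm_of_nonneg (inv_nonneg.2 hS.le), mul_comm]
    exact mul_le_mul_of_nonneg_right ((h1 _).trans (le_max_left _ _)) (inv_nonneg.2 hS.le)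
  · rw [coordLaplacian_dilate hψ, abs_mul, abs_of_nonneg (by positivity), mul_comm]
    exact mul_le_mul_of_nonneg_right ((h2 _).trans (le_max_right _ _)) (by positivity)

end Cutoffs

/-! ### Growth of integrals of convex functions of a solution -/

/-- A bounded curve `u` in `L²` that solves the equation, in the sense that the integrals against
test functions evolve at the rate `fluxRate`; for `ν > 0`, `g` is its weak gradient. -/
structure IsBoundedSolution {d : ℕ} (σ₁ σ₂ ν T L B : ℝ) (u : ℝ → L2Scalar d)
    (g : ℝ → L2Vector d) : Prop extends IsBoundedCurve L B u where
  weak : ∀ φ : RSpace d → ℝ, ContDiff ℝ ∞ φ → HasCompactSupport φ → ∀ t ∈ Icc 0 T,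
    ∫ x, u t x * φ x = (∫ x, u 0 x * φ x) + ∫ s in (0 : ℝ)..t, fluxRate σ₁ σ₂ ν (u s) φ
  grad : 0 < ν → ∀ᵐ s ∂(volume.restrict (Icc 0 T)), HasWeakGradient (u s) (g s)

section Estimates

variable {d : ℕ} {h h' h'' : ℝ → ℝ} {a f ψ : RSpace d → ℝ} {L B σ₁ σ₂ ν T : ℝ}
  {u : ℝ → L2Scalar d} {g : ℝ → L2Vector d}

theorem IsBoundedCurve.integrable_renormTerm (hd : 2 ≤ d) (hu : IsBoundedCurve L B u)
    (hh : HasTwoDerivs h h' h'') (hψ : ContDiff ℝ ∞ ψ) (hc : HasCompactSupport ψ) (q q' s : ℝ) :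
    Integrable fun x => renormTerm σ₁ σ₂ ν h h' q q' ψ (u s) (u s x) (u s x ^ 2) x := by
  obtain ⟨C, hC0, hC⟩ := hh.exists_bound (|q| * B)
  have hm := (hu.integrable s).aestronglyMeasurable
  refine (integrable_renormBound hψ hc σ₁ σ₂ ν (B * newtonMass d + newtonConst d * L) B C |q|
    |q'|).mono' (aestronglyMeasurable_renormTerm hh hψ hm q q' hm (hm.pow 2)) ?_
  filter_upwards [hu.bound s] with x hx
  exact abs_renormTerm_le hC0 hx (hu.norm_newtonField_le hd s x) hx
    (by rw [abs_pow]; gcongr) le_rfl le_rfl hC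

theorem IsBoundedCurve.continuous_integral_renormTerm (hd : 2 ≤ d) (hu : IsBoundedCurve L B u)
    (hh : HasTwoDerivs h h' h'') (hψ : ContDiff ℝ ∞ ψ) (hc : HasCompactSupport ψ)
    {q q' : ℝ → ℝ} (hq : Continuous q) (hq' : Continuous q') :
    Continuous fun s => ∫ x,
      renormTerm σ₁ σ₂ ν h h' (q s) (q' s) ψ (u s) (u s x) (u s x ^ 2) x := by
  rw [continuous_iff_continuousAt]
  intro s₀
  obtain ⟨C, hC0, hC⟩ := hh.exists_bound ((|q s₀| + 1) * B)
  refine continuousAt_integral_curve (Θ := fun s x r =>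
    h (q s * r) * (σ₁ * (fderiv ℝ ψ x (newtonField (u s) x) + r * ψ x))
    + ψ x * h' (q s * r) * (q' s * r + q s * (σ₂ * r ^ 2)) + ν * (h (q s * r) * coordLaplacian ψ x))
    hu.continuous (Eventually.of_forall fun x => ?_)
    (fun s => aestronglyMeasurable_renormTerm (f := u s) hh hψ (hu.integrable s).aestronglyMeasurable
      (q s) (q' s) (hu.integrable s).aestronglyMeasurable
      ((hu.integrable s).aestronglyMeasurable.pow 2))
    (integrable_renormBound hψ hc σ₁ σ₂ ν (B * newtonMass d + newtonConst d * L) B C (|q s₀| + 1)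
      (|q' s₀| + 1)) ?_
  · have h1 := (hu.continuous_newtonField hd x).comp (continuous_fst (X := ℝ) (Y := ℝ))
    have h2 := hh.continuous_zeroth
    have h3 := hh.continuous_first
    fun_prop
  · have e1 : ∀ᶠ s in 𝓝 s₀, |q s| < |q s₀| + 1 :=
      (hq.abs.tendsto s₀).eventually_lt_const (lt_add_one _)
    have e2 : ∀ᶠ s in 𝓝 s₀, |q' s| < |q' s₀| + 1 :=
      (hq'.abs.tendsto s₀).eventually_lt_const (lt_add_one _)
    filter_upwards [e1, e2] with s h1 h2
    filter_upwards [hu.bound s] with x hx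
    exact abs_renormTerm_le hC0 hx (hu.norm_newtonField_le hd s x) hx
      (by rw [abs_pow]; gcongr) h1.le h2.le hC

theorem IsBoundedCurve.continuous_integral_mul_comp (hu : IsBoundedCurve L B u)
    (hh : HasTwoDerivs h h' h'') (hψ : Continuous ψ) (hc : HasCompactSupport ψ)
    {q : ℝ → ℝ} (hq : Continuous q) : Continuous fun s => ∫ x, ψ x * h (q s * u s x) := by
  rw [continuous_iff_continuousAt]
  intro s₀
  obtain ⟨C, hC0, hC⟩ := hh.exists_bound ((|q s₀| + 1) * B)
  have h2 := hh.continuous_zeroth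
  refine continuousAt_integral_curve (Θ := fun s x r => ψ x * h (q s * r))
    hu.continuous (Eventually.of_forall fun x => ?_)
    (fun s => hψ.aestronglyMeasurable.mul (h2.comp_aestronglyMeasurable
      ((hu.integrable s).aestronglyMeasurable.const_mul _)))
    ((hψ.integrable_of_hasCompactSupport hc).norm.mul_const C) ?_
  · fun_prop
  · have e1 : ∀ᶠ s in 𝓝 s₀, |q s| < |q s₀| + 1 :=
      (hq.abs.tendsto s₀).eventually_lt_const (lt_add_one _)
    filter_upwards [e1] with s h1
    filter_upwards [hu.bound s] with x hx
    rw [norm_mul]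
    refine mul_le_mul_of_nonneg_left (hC _ ?_).1 (norm_nonneg _)
    rw [abs_mul]
    gcongr

theorem IsBoundedCurve.integrable_comp (hu : IsBoundedCurve L B u) (hh : Continuous h)
    (hh0 : ∀ s, 0 ≤ h s) {q H s : ℝ} (hH : ∀ r, |r| ≤ B → h (q * r) ≤ H * |r|) :
    Integrable fun x => h (q * u s x) := by
  refine ((hu.integrable s).abs.const_mul H).mono' (hh.comp_aestronglyMeasurable
      ((hu.integrable s).aestronglyMeasurable.const_mul _)) ?_
  filter_upwards [hu.bound s] with x hx
  rw [Real.norm_of_nonneg (hh0 _)]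
  exact hH _ hx

/-- Integrals of convex functions of a solution grow at most exponentially. -/
theorem IsBoundedSolution.integral_convex_le (hd : 2 ≤ d) (ha : IsRadialCutoff a) (hν : 0 ≤ ν)
    (hu : IsBoundedSolution σ₁ σ₂ ν T L B u g) (hh : HasTwoDerivs h h' h'')
    (hh0 : ∀ s, 0 ≤ h s) (hκ : ∀ s, 0 ≤ h'' s)
    {q q' : ℝ → ℝ} (hq : ∀ s, HasDerivAt q (q' s) s) (hq' : Continuous q') {c H : ℝ} (hc0 : 0 ≤ c)
    (hH : ∀ s ∈ Icc 0 T, ∀ r, |r| ≤ B → h (q s * r) ≤ H * |r|)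
    (hdiss : ∀ s ∈ Icc 0 T, ∀ r, |r| ≤ B →
      h' (q s * r) * (q' s * r + q s * (σ₂ * r ^ 2)) ≤ c * h (q s * r))
    {t : ℝ} (ht : t ∈ Icc 0 T) :
    ∫ x, h (q t * u t x) ≤ (∫ x, h (q 0 * u 0 x)) * Real.exp ((|σ₁| * B + c) * t) := by
  have hqc : Continuous q := continuous_iff_continuousAt.2 fun s => (hq s).continuousAt
  have hT0 : (0 : ℝ) ∈ Icc 0 T := ⟨le_rfl, ht.1.trans ht.2⟩
  have hB0 := hu.bound_nonneg
  have hL0 := hu.mass_nonneg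
  have hHB : ∀ s ∈ Icc 0 T, ∀ r, |r| ≤ B → h (q s * r) ≤ |H| * |r| := fun s hs r hr =>
    (hH s hs r hr).trans (mul_le_mul_of_nonneg_right (le_abs_self H) (abs_nonneg r))
  have hhi : ∀ s ∈ Icc 0 T, Integrable fun x => h (q s * u s x) := fun s hs =>
    hu.integrable_comp hh.continuous_zeroth hh0 (hHB s hs)
  have hhL : ∀ s ∈ Icc 0 T, ∫ x, h (q s * u s x) ≤ |H| * L := fun s hs => by
    calc _ ≤ ∫ x, |H| * |u s x| := by
          refine integral_mono_ae (hhi s hs) ((hu.integrable s).abs.const_mul |H|) ?_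
          filter_upwards [hu.bound s] with x hx using hHB s hs _ hx
      _ ≤ _ := by
          rw [integral_const_mul]
          exact mul_le_mul_of_nonneg_left (hu.integral_le s) (abs_nonneg _)
  obtain ⟨A, hA0, hA⟩ := exists_bound_dilate ha.smooth ha.hasCompactSupport
  set W := B * newtonMass d + newtonConst d * L
  have hW0 : 0 ≤ W := (norm_nonneg _).trans (hu.norm_newtonField_le hd 0 0)
  -- The cutoff at radius `S` makes the test function admissible. Its derivatives cost `O(S⁻¹)`
  -- times `∫ h(q u)`, which is finite because `h(q r) ≤ |H| |r|`. The rate `|σ₁| * B` comes from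
  -- the compression `div v = σ₁ u`, the rate `c` from the reaction.
  have key : ∀ S, 1 ≤ S → (∫ x, dilate a S x * h (q t * u t x))
      ≤ ((∫ x, dilate a S x * h (q 0 * u 0 x))
        + (A * S⁻¹ * (|σ₁| * W + ν) * (|H| * L)) * t) * Real.exp ((|σ₁| * B + c) * t) := by
    intro S hS
    have hS0 : 0 < S := by linarith
    have hψ := ha.smooth.dilate S
    have hψc := ha.hasCompactSupport.dilate hS0
    have hψ0 : ∀ x, 0 ≤ dilate a S x := fun x => ha.nonneg _
    have hψi : ∀ s, Integrable fun x => dilate a S x * h (q s * u s x) := fun s => by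
      obtain ⟨C, hC0, hC⟩ := hh.exists_bound (|q s| * B)
      refine (hψ.continuous.integrable_of_hasCompactSupport hψc).mul_bdd (c := C)
        (hh.continuous_zeroth.comp_aestronglyMeasurable
          ((hu.integrable s).aestronglyMeasurable.const_mul _)) ?_
      filter_upwards [hu.bound s] with x hx
      refine (hC _ ?_).1
      rw [abs_mul]
      gcongr
    have hyc := hu.continuous_integral_mul_comp hh hψ.continuous hψc hqc
    have := gronwall_integral (y := fun s => ∫ x, dilate a S x * h (q s * u s x)) (N := fun _ => 0)
      (A := ∫ x, dilate a S x * h (q 0 * u 0 x)) (b := A * S⁻¹ * (|σ₁| * W + ν) * (|H| * L))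
      (c := |σ₁| * B + c) (T := T) hyc (fun _ _ => le_rfl) (by positivity) (by positivity) ?_ t ht
    · simpa using this
    intro r hr
    have h1 := hu.renormalized_inequality hd ha hh hψ hψc hψ0 le_rfl hκ hq hq' hν hu.weak hu.grad hr
    rw [mul_zero, zero_mul] at h1
    refine h1.trans (add_le_add_right ?_ _)
    refine intervalIntegral.integral_mono_on hr.1
      ((hu.continuous_integral_renormTerm hd hh hψ hψc hqc hq').intervalIntegrable _ _)
      (((continuous_const.mul hyc).add continuous_const).intervalIntegrable _ _) fun s hs => ?_
    have hs' : s ∈ Icc 0 T := ⟨hs.1, hs.2.trans hr.2⟩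
    calc _ ≤ ∫ x, ((|σ₁| * B + c) * (dilate a S x * h (q s * u s x))
            + A * S⁻¹ * (|σ₁| * W + ν) * h (q s * u s x)) := by
          refine integral_mono_ae (hu.integrable_renormTerm hd hh hψ hψc _ _ s)
            (((hψi s).const_mul _).fun_add ((hhi s hs').const_mul _)) ?_
          filter_upwards [hu.bound s] with x hx
          obtain ⟨a1, a2⟩ := hA S hS0 x
          have hD := hh0 (q s * u s x)
          have hdis := mul_le_mul_of_nonneg_left (hdiss s hs' _ hx) (hψ0 x)
          have hV := hu.norm_newtonField_le hd s x
          have hSi : (0 : ℝ) < S⁻¹ := inv_pos.2 hS0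
          have hS1 : S⁻¹ ^ 2 ≤ S⁻¹ := pow_le_of_le_one hSi.le (inv_le_one_of_one_le₀ hS) two_ne_zero
          have b1 : σ₁ * fderiv ℝ (dilate a S) x (newtonField (u s) x) ≤ |σ₁| * (A * S⁻¹ * W) := by
            refine (le_abs_self _).trans ?_
            rw [abs_mul]
            refine mul_le_mul_of_nonneg_left ?_ (abs_nonneg _)
            exact ((fderiv ℝ (dilate a S) x).le_opNorm _).trans (by gcongr)
          have b2 : σ₁ * u s x ≤ |σ₁| * B := by
            refine (le_abs_self _).trans ?_
            rw [abs_mul]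
            gcongr
          have b3 : coordLaplacian (dilate a S) x ≤ A * S⁻¹ :=
            (le_abs_self _).trans (a2.trans (mul_le_mul_of_nonneg_left hS1 hA0))
          have c1 := mul_le_mul_of_nonneg_left b1 hD
          have c2 := mul_le_mul_of_nonneg_left b2 (mul_nonneg hD (hψ0 x))
          have c3 := mul_le_mul_of_nonneg_left b3 (mul_nonneg hν hD)
          simp only [renormTerm]
          linarith
      _ ≤ _ := by
          rw [integral_add ((hψi s).const_mul _) ((hhi s hs').const_mul _), integral_const_mul,
            integral_const_mul]
          have := hhL s hs'
          gcongr
  have hlim : Tendsto (fun S : ℝ => ((∫ x, dilate a S x * h (q 0 * u 0 x))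
        + (A * S⁻¹ * (|σ₁| * W + ν) * (|H| * L)) * t) * Real.exp ((|σ₁| * B + c) * t)) atTop
      (𝓝 (((∫ x, h (q 0 * u 0 x)) + (A * 0 * (|σ₁| * W + ν) * (|H| * L)) * t)
        * Real.exp ((|σ₁| * B + c) * t))) :=
    ((ha.tendsto_integral_dilate_mul (hhi 0 hT0)).add
      ((((tendsto_inv_atTop_zero.const_mul A).mul_const _).mul_const _).mul_const t)).mul_const _
  rw [mul_zero, zero_mul, zero_mul, zero_mul, add_zero] at hlim
  refine le_of_tendsto_of_tendsto (ha.tendsto_integral_dilate_mul (hhi t ht)) hlim ?_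
  filter_upwards [eventually_ge_atTop 1] with S hS using key S hS

end Estimates

/-! ### The convex functions for the a priori bounds -/

theorem hasDerivAt_max_zero_pow (k : ℕ) (z : ℝ) :
    HasDerivAt (fun z : ℝ => max z 0 ^ (k + 2)) ((k + 2 : ℕ) * max z 0 ^ (k + 1)) z := by
  rcases lt_trichotomy z 0 with h | h | h
  · rw [max_eq_right h.le, zero_pow (by omega), mul_zero]
    refine (hasDerivAt_const z (0 : ℝ)).congr_of_eventuallyEq ?_
    filter_upwards [Iio_mem_nhds h] with w hw
    rw [max_eq_right (le_of_lt hw), zero_pow (by omega)]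
  · subst h
    rw [max_self, zero_pow (by omega), mul_zero]
    have h1 : (fun z : ℝ => max z 0 ^ (k + 2)) =O[𝓝 0] fun z => ‖z - 0‖ ^ (k + 2) := by
      refine Asymptotics.IsBigO.of_bound 1 (Eventually.of_forall fun z => ?_)
      rw [norm_pow, norm_pow, norm_norm, one_mul, sub_zero]
      gcongr
      rw [Real.norm_of_nonneg (le_max_right _ _), Real.norm_eq_abs]
      exact max_le (le_abs_self z) (abs_nonneg z)
    have h2 := (h1.hasFDerivAt (𝕜 := ℝ) (by omega)).hasDerivAt
    simpa using h2
  · rw [max_eq_left h.le]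
    have h1 := hasDerivAt_pow (k + 2) z
    refine (h1.congr_of_eventuallyEq ?_)
    filter_upwards [Ioi_mem_nhds h] with w hw
    rw [max_eq_left (le_of_lt hw)]

/-- A nonnegative convex function that vanishes exactly on `[-1, 1]` and so measures the excess of
`|s|` over `1`. The third power makes it twice continuously differentiable. -/
theorem hasTwoDerivs_excess : HasTwoDerivs (fun s => max (s ^ 2 - 1) 0 ^ 3)
    (fun s => 6 * s * max (s ^ 2 - 1) 0 ^ 2)
    (fun s => 6 * max (s ^ 2 - 1) 0 ^ 2 + 24 * s ^ 2 * max (s ^ 2 - 1) 0) where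
  first s := by
    have h1 : HasDerivAt (fun s : ℝ => s ^ 2 - 1) (2 * s) s := by
      simpa using (hasDerivAt_pow 2 s).sub_const 1
    have h2 : HasDerivAt (fun s : ℝ => max (s ^ 2 - 1) 0 ^ 3)
        ((1 + 2 : ℕ) * max (s ^ 2 - 1) 0 ^ 2 * (2 * s)) s := by
      have h0 := (hasDerivAt_max_zero_pow 1 (s ^ 2 - 1)).comp s h1
      exact h0
    exact h2.congr_deriv (by push_cast; ring)
  second s := by
    have h1 : HasDerivAt (fun s : ℝ => s ^ 2 - 1) (2 * s) s := by
      simpa using (hasDerivAt_pow 2 s).sub_const 1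
    have h2 : HasDerivAt (fun s : ℝ => 6 * s) 6 s := by
      simpa using (hasDerivAt_id s).const_mul (6 : ℝ)
    have h3 : HasDerivAt (fun s : ℝ => max (s ^ 2 - 1) 0 ^ 2)
        ((0 + 2 : ℕ) * max (s ^ 2 - 1) 0 ^ 1 * (2 * s)) s := by
      have h0 := (hasDerivAt_max_zero_pow 0 (s ^ 2 - 1)).comp s h1
      exact h0
    exact (h2.mul h3).congr_deriv (by push_cast; ring)
  continuous := by fun_prop

/-- A smooth convex substitute for `|s|`, which lies between `0` and `|s|` and tends to `|s|` as `δ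
→ 0`. Subtracting `δ` makes it vanish at `0`, hence integrable along the solution. -/
theorem hasTwoDerivs_smoothAbs {δ : ℝ} (hδ : 0 < δ) :
    HasTwoDerivs (fun s => √(s ^ 2 + δ ^ 2) - δ) (fun s => s / √(s ^ 2 + δ ^ 2))
      (fun s => (√(s ^ 2 + δ ^ 2) - s * (s / √(s ^ 2 + δ ^ 2))) / √(s ^ 2 + δ ^ 2) ^ 2) := by
  have hp : ∀ s : ℝ, 0 < s ^ 2 + δ ^ 2 := fun s => by positivity
  have hp' : ∀ s : ℝ, √(s ^ 2 + δ ^ 2) ≠ 0 := fun s => (Real.sqrt_pos.2 (hp s)).ne'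
  have h1 : ∀ s : ℝ, HasDerivAt (fun s : ℝ => √(s ^ 2 + δ ^ 2)) (s / √(s ^ 2 + δ ^ 2)) s := fun s => by
    have h2 : HasDerivAt (fun s : ℝ => s ^ 2 + δ ^ 2) (2 * s) s := by
      simpa using (hasDerivAt_pow 2 s).add_const (δ ^ 2)
    convert h2.sqrt (hp s).ne' using 1
    have := hp' s
    field_simp
  refine ⟨fun s => (h1 s).sub_const δ, fun s => ?_, ?_⟩
  · exact ((hasDerivAt_id s).div (h1 s) (hp' s)).congr_deriv (by rw [one_mul]; rfl)
  · have hc : Continuous fun s : ℝ => √(s ^ 2 + δ ^ 2) := by fun_prop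
    exact (hc.sub (continuous_id.mul (continuous_id.div hc hp'))).div (hc.pow 2)
      fun s => pow_ne_zero 2 (hp' s)

/-! ### A priori bounds in `L^∞` and `L¹` -/

section Bounds

variable {d : ℕ} {a : RSpace d → ℝ} {L B σ₁ σ₂ ν T : ℝ}
  {u : ℝ → L2Scalar d} {g : ℝ → L2Vector d}

/-- The a priori bound in `L^∞` within the guaranteed time of existence. -/
theorem IsBoundedSolution.abs_le (hd : 2 ≤ d) (ha : IsRadialCutoff a) (hν : 0 ≤ ν)
    (hu : IsBoundedSolution σ₁ σ₂ ν T L B u g) {M : ℝ} (hM : 0 < M)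
    (h0 : ∀ᵐ x, |u 0 x| ≤ M) (hσ : |σ₂| * T < M⁻¹) {t : ℝ} (ht : t ∈ Icc 0 T) :
    ∀ᵐ x, |u t x| ≤ (M⁻¹ - |σ₂| * T)⁻¹ := by
  have hB0 := hu.bound_nonneg
  have hMi : 0 < M⁻¹ := inv_pos.2 hM
  set e := M⁻¹ - |σ₂| * T with he
  have he0 : 0 < e := by linarith
  have hq : ∀ s ∈ Icc 0 T, e ≤ M⁻¹ - |σ₂| * s ∧ M⁻¹ - |σ₂| * s ≤ M⁻¹ := fun s hs => by
    have h1 := mul_le_mul_of_nonneg_left hs.2 (abs_nonneg σ₂)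
    have h2 := mul_nonneg (abs_nonneg σ₂) hs.1
    constructor <;> linarith
  have hz : ∀ s ∈ Icc 0 T, ∀ r, |r| ≤ B → |(M⁻¹ - |σ₂| * s) * r| ≤ M⁻¹ * |r| ∧
      |(M⁻¹ - |σ₂| * s) * r| ≤ M⁻¹ * B := fun s hs r hr => by
    obtain ⟨h1, h2⟩ := hq s hs
    have h3 : |(M⁻¹ - |σ₂| * s) * r| ≤ M⁻¹ * |r| := by
      rw [abs_mul, abs_of_pos (he0.trans_le h1)]
      gcongr
    exact ⟨h3, h3.trans (by gcongr)⟩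
  -- One of the six factors `|z|` is kept, so that the excess is integrable along a curve in `L¹`.
  have hH : ∀ s ∈ Icc 0 T, ∀ r, |r| ≤ B →
      max (((M⁻¹ - |σ₂| * s) * r) ^ 2 - 1) 0 ^ 3 ≤ ((M⁻¹ * B) ^ 5 * M⁻¹) * |r| := fun s hs r hr => by
    obtain ⟨h1, h2⟩ := hz s hs r hr
    set z := (M⁻¹ - |σ₂| * s) * r
    have h3 : max (z ^ 2 - 1) 0 ≤ |z| ^ 2 := by
      rw [sq_abs]
      exact max_le (by linarith) (sq_nonneg _)
    calc max (z ^ 2 - 1) 0 ^ 3 ≤ (|z| ^ 2) ^ 3 := by gcongr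
      _ = |z| ^ 5 * |z| := by ring
      _ ≤ (M⁻¹ * B) ^ 5 * (M⁻¹ * |r|) := by gcongr
      _ = _ := by ring
  -- `1 / q` solves the comparison equation `y' = |σ₂| y²` with `y(0) = M`. The bound `|u| ≤ 1 / q`
  -- says that the excess of `q u` over `1` vanishes; it vanishes at time `0`, and its integral
  -- obeys a Grönwall inequality without source.
  have key := hu.integral_convex_le hd ha hν hasTwoDerivs_excess (fun s => by positivity)
    (fun s => by positivity) (q := fun s => M⁻¹ - |σ₂| * s) (q' := fun _ => -|σ₂|)
    (fun s => by simpa using ((hasDerivAt_id s).const_mul |σ₂|).const_sub M⁻¹) continuous_const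
    (c := 6 * |σ₂| * (M⁻¹ * B) ^ 2 * e⁻¹) (by positivity) hH (fun s hs r hr => ?_) ht
  · have h1 : ∫ x, max (((M⁻¹ - |σ₂| * 0) * u 0 x) ^ 2 - 1) 0 ^ 3 = 0 := by
      refine integral_eq_zero_of_ae ?_
      filter_upwards [h0] with x hx
      have h2 : |(M⁻¹ - |σ₂| * 0) * u 0 x| ≤ 1 := by
        rw [mul_zero, sub_zero, abs_mul, abs_of_pos hMi, inv_mul_le_iff₀ hM, mul_one]
        exact hx
      rw [max_eq_right (by linarith [(sq_le_one_iff_abs_le_one _).2 h2]), zero_pow (by norm_num),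
        Pi.zero_apply]
    rw [h1, zero_mul] at key
    have hnn : ∀ x, 0 ≤ max (((M⁻¹ - |σ₂| * t) * u t x) ^ 2 - 1) 0 ^ 3 := fun x => by positivity
    have h2 := (integral_eq_zero_iff_of_nonneg hnn
      (hu.integrable_comp (h := fun s => max (s ^ 2 - 1) 0 ^ 3)
        hasTwoDerivs_excess.continuous_zeroth (fun s => by positivity)
        (hH t ht))).1 (le_antisymm key (integral_nonneg hnn))
    filter_upwards [h2] with x hx
    have h3 : ((M⁻¹ - |σ₂| * t) * u t x) ^ 2 ≤ 1 := by
      have := pow_eq_zero_iff (three_ne_zero) |>.1 hx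
      have := le_max_left (((M⁻¹ - |σ₂| * t) * u t x) ^ 2 - 1) 0
      linarith
    obtain ⟨h4, -⟩ := hq t ht
    rw [sq_le_one_iff_abs_le_one, abs_mul, abs_of_pos (he0.trans_le h4)] at h3
    rw [← one_div, le_div_iff₀ he0]
    calc |u t x| * e ≤ |u t x| * (M⁻¹ - |σ₂| * t) := by gcongr
      _ ≤ 1 := by linarith
  · obtain ⟨-, h2⟩ := hz s hs r hr
    obtain ⟨h3, -⟩ := hq s hs
    have hq0 := he0.trans_le h3
    set q := M⁻¹ - |σ₂| * s
    set z := q * r with hz_def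
    set P := max (z ^ 2 - 1) 0 with hP_def
    have hP0 : 0 ≤ P := le_max_right _ _
    -- Beyond the threshold the growth relative to the comparison equation is at most `|σ₂| (|z| -
    -- 1)`. This supplies a third factor `P`, so the rate is bounded by a multiple of the convex
    -- function itself.
    have hP : |z| - 1 ≤ P := by
      rcases le_total |z| 1 with h | h
      · linarith
      · have h5 : z ^ 2 - 1 ≤ P := le_max_left _ _
        nlinarith [sq_abs z]
    have e1 : q * (6 * z * P ^ 2 * (-|σ₂| * r + q * (σ₂ * r ^ 2)))
        = 6 * P ^ 2 * z ^ 2 * (-|σ₂| + σ₂ * z) := by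
      rw [hz_def]; ring
    have e2 : -|σ₂| + σ₂ * z ≤ |σ₂| * P := by
      have : σ₂ * z ≤ |σ₂| * |z| := (le_abs_self _).trans_eq (abs_mul _ _)
      have := mul_le_mul_of_nonneg_left hP (abs_nonneg σ₂)
      linarith
    have e3 : z ^ 2 ≤ (M⁻¹ * B) ^ 2 := by
      rw [← sq_abs z]
      gcongr
    have e4 : q * (6 * z * P ^ 2 * (-|σ₂| * r + q * (σ₂ * r ^ 2)))
        ≤ 6 * |σ₂| * (M⁻¹ * B) ^ 2 * P ^ 3 := by
      rw [e1]
      calc 6 * P ^ 2 * z ^ 2 * (-|σ₂| + σ₂ * z) ≤ 6 * P ^ 2 * z ^ 2 * (|σ₂| * P) := by gcongr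
        _ ≤ 6 * P ^ 2 * (M⁻¹ * B) ^ 2 * (|σ₂| * P) := by gcongr
        _ = _ := by ring
    have e5 : q⁻¹ ≤ e⁻¹ := inv_anti₀ he0 h3
    calc 6 * z * P ^ 2 * (-|σ₂| * r + q * (σ₂ * r ^ 2))
        = q⁻¹ * (q * (6 * z * P ^ 2 * (-|σ₂| * r + q * (σ₂ * r ^ 2)))) := by
          field_simp
      _ ≤ q⁻¹ * (6 * |σ₂| * (M⁻¹ * B) ^ 2 * P ^ 3) := by gcongr
      _ ≤ e⁻¹ * (6 * |σ₂| * (M⁻¹ * B) ^ 2 * P ^ 3) := by gcongr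
      _ = _ := by ring

/-- The a priori bound in `L¹`. -/
theorem IsBoundedSolution.integral_abs_le (hd : 2 ≤ d) (ha : IsRadialCutoff a) (hν : 0 ≤ ν)
    (hu : IsBoundedSolution σ₁ σ₂ ν T L B u g) {t : ℝ} (ht : t ∈ Icc 0 T) :
    ∫ x, |u t x| ≤ (∫ x, |u 0 x|) * Real.exp ((|σ₁| * B + 2 * |σ₂| * B) * t) := by
  have hB0 := hu.bound_nonneg
  have hle : ∀ δ : ℝ, 0 < δ → ∀ r : ℝ, √(r ^ 2 + δ ^ 2) - δ ≤ |r| := fun δ hδ r => by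
    rw [sub_le_iff_le_add, Real.sqrt_le_left (by positivity)]
    have := abs_nonneg r
    nlinarith [sq_abs r]
  have hge : ∀ δ : ℝ, 0 < δ → ∀ r : ℝ, δ ≤ √(r ^ 2 + δ ^ 2) := fun δ hδ r =>
    Real.le_sqrt_of_sq_le (by nlinarith [sq_nonneg r])
  have hi : ∀ δ : ℝ, 0 < δ → ∀ s, Integrable fun x => √(u s x ^ 2 + δ ^ 2) - δ := fun δ hδ s => by
    have := hu.integrable_comp (q := 1) (H := 1) (s := s) (hasTwoDerivs_smoothAbs hδ).continuous_zeroth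
      (fun s => by linarith [hge δ hδ s]) fun r _ => by rw [one_mul, one_mul]; exact hle δ hδ r
    simpa only [one_mul] using this
  have key : ∀ δ : ℝ, 0 < δ → ∫ x, (√(u t x ^ 2 + δ ^ 2) - δ)
      ≤ (∫ x, |u 0 x|) * Real.exp ((|σ₁| * B + 2 * |σ₂| * B) * t) := by
    intro δ hδ
    have h1 := hu.integral_convex_le hd ha hν (hasTwoDerivs_smoothAbs hδ)
      (fun s => by linarith [hge δ hδ s]) (fun s => ?_) (q := fun _ => 1) (q' := fun _ => 0)
      (fun s => hasDerivAt_const s 1) continuous_const (c := 2 * |σ₂| * B) (by positivity) (H := 1)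
      (fun s _ r _ => by rw [one_mul, one_mul]; exact hle δ hδ r) (fun s _ r hr => ?_) ht
    · simp only [one_mul] at h1
      refine h1.trans ?_
      exact mul_le_mul_of_nonneg_right (integral_mono (hi δ hδ 0) (hu.integrable 0).abs
        fun x => hle δ hδ _) (Real.exp_pos _).le
    · have hw : 0 < √(s ^ 2 + δ ^ 2) := hδ.trans_le (hge δ hδ s)
      refine div_nonneg ?_ (by positivity)
      rw [sub_nonneg, mul_div_assoc', div_le_iff₀ hw, Real.mul_self_sqrt (by positivity)]
      nlinarith
    · simp only [one_mul, zero_mul, zero_add]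
      set w := √(r ^ 2 + δ ^ 2) with hw_def
      have hw1 : δ ≤ w := hge δ hδ r
      have hw2 : w ^ 2 = r ^ 2 + δ ^ 2 := Real.sq_sqrt (by positivity)
      have hw0 : 0 < w := hδ.trans_le hw1
      -- Here `r² = (w - δ) (w + δ)` and `w + δ ≤ 2 w`.
      have h2 : r ^ 2 / w ≤ 2 * (w - δ) := by
        rw [div_le_iff₀ hw0]
        nlinarith
      have h3 : σ₂ * r ≤ |σ₂| * B := by
        refine (le_abs_self _).trans ?_
        rw [abs_mul]
        gcongr
      calc r / w * (σ₂ * r ^ 2) = r ^ 2 / w * (σ₂ * r) := by ring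
        _ ≤ r ^ 2 / w * (|σ₂| * B) := by gcongr
        _ ≤ 2 * (w - δ) * (|σ₂| * B) := by gcongr
        _ = _ := by ring
  have hlim : Tendsto (fun δ : ℝ => ∫ x, (√(u t x ^ 2 + δ ^ 2) - δ)) (𝓝[>] 0) (𝓝 (∫ x, |u t x|)) := by
    refine tendsto_integral_filter_of_dominated_convergence (fun x => |u t x|) ?_ ?_
      (hu.integrable t).abs (Eventually.of_forall fun x => ?_)
    · filter_upwards [self_mem_nhdsWithin] with δ hδ using (hi δ hδ t).aestronglyMeasurable
    · filter_upwards [self_mem_nhdsWithin] with δ hδ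
      refine Eventually.of_forall fun x => ?_
      rw [Real.norm_of_nonneg (by linarith [hge δ hδ (u t x)])]
      exact hle δ hδ _
    · have hc : Continuous fun δ : ℝ => √(u t x ^ 2 + δ ^ 2) - δ := by fun_prop
      have := hc.tendsto 0
      simp only [ne_eq, OfNat.ofNat_ne_zero, not_false_eq_true, zero_pow, add_zero, sub_zero,
        Real.sqrt_sq_eq_abs] at this
      exact this.mono_left nhdsWithin_le_nhds
  refine le_of_tendsto hlim ?_
  filter_upwards [self_mem_nhdsWithin] with δ hδ using key δ hδ

end Bounds

/-! ### Weighted norms of vector fields -/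

section WeightedNorm

variable {d : ℕ} {χ : RSpace d → ℝ} {C : ℝ}

theorem integral_norm_sq_eq (G : L2Vector d) : ∫ x, ‖G x‖ ^ 2 = ‖G‖ ^ 2 := by
  rw [← real_inner_self_eq_norm_sq, L2.inner_def]
  simp only [real_inner_self_eq_norm_sq]

theorem integrable_norm_sq (G : L2Vector d) : Integrable fun x => ‖G x‖ ^ 2 :=
  (Lp.memLp G).integrable_norm_pow two_ne_zero

/-- Continuity on `L²` makes the weighted norm of the gradient measurable in time, since the
gradient itself is measurable with values in `L²`. -/
theorem continuous_integral_mul_norm_sq (hχ : AEStronglyMeasurable χ volume)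
    (hC : ∀ x, |χ x| ≤ C) : Continuous fun G : L2Vector d => ∫ x, χ x * ‖G x‖ ^ 2 := by
  have hC0 : 0 ≤ C := (abs_nonneg _).trans (hC 0)
  have hi : ∀ G : L2Vector d, Integrable fun x => χ x * ‖G x‖ ^ 2 := fun G =>
    (integrable_norm_sq G).bdd_mul (c := C) hχ (Eventually.of_forall hC)
  have key : ∀ G G' : L2Vector d, |(∫ x, χ x * ‖G' x‖ ^ 2) - ∫ x, χ x * ‖G x‖ ^ 2|
      ≤ C * (‖G' - G‖ * √(2 * (‖G'‖ ^ 2 + ‖G‖ ^ 2))) := by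
    intro G G'
    have m1 : MemLp (fun x => ‖(G' - G) x‖) 2 volume := (Lp.memLp (G' - G)).norm
    have m2 : MemLp (fun x => ‖G' x‖ + ‖G x‖) 2 volume := (Lp.memLp G').norm.add (Lp.memLp G).norm
    rw [← integral_sub (hi G') (hi G), ← Real.norm_eq_abs]
    calc _ ≤ ∫ x, C * (‖(G' - G) x‖ * (‖G' x‖ + ‖G x‖)) := by
          refine norm_integral_le_of_norm_le ((m1.integrable_mul m2).const_mul C) ?_
          filter_upwards [Lp.coeFn_sub G' G] with x hx
          rw [hx, Pi.sub_apply, ← mul_sub, norm_mul]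
          refine mul_le_mul (hC x) ?_ (norm_nonneg _) hC0
          rw [sq_sub_sq, norm_mul, mul_comm, Real.norm_of_nonneg (by positivity : (0:ℝ) ≤ ‖G' x‖ + ‖G x‖)]
          exact mul_le_mul_of_nonneg_right (abs_norm_sub_norm_le _ _) (by positivity)
      _ ≤ _ := by
          rw [integral_const_mul]
          have hcs := cauchy_schwarz_integral m1 m2
          simp only [abs_of_nonneg (norm_nonneg _),
            abs_of_nonneg (add_nonneg (norm_nonneg _) (norm_nonneg _))] at hcs
          refine mul_le_mul_of_nonneg_left (hcs.trans ?_) hC0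
          rw [integral_norm_sq_eq, Real.sqrt_sq (norm_nonneg _)]
          refine mul_le_mul_of_nonneg_left (Real.sqrt_le_sqrt ?_) (norm_nonneg _)
          rw [← integral_norm_sq_eq, ← integral_norm_sq_eq, ← integral_add (integrable_norm_sq _)
            (integrable_norm_sq _), ← integral_const_mul]
          refine integral_mono m2.integrable_sq (((integrable_norm_sq _).add
            (integrable_norm_sq _)).const_mul 2) fun x => ?_
          simp only
          nlinarith [sq_nonneg (‖G' x‖ - ‖G x‖)]
  rw [continuous_iff_continuousAt]
  intro G
  rw [ContinuousAt, tendsto_iff_norm_sub_tendsto_zero]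
  have hlim : Tendsto (fun G' : L2Vector d => C * (‖G' - G‖ * √(2 * (‖G'‖ ^ 2 + ‖G‖ ^ 2)))) (𝓝 G)
      (𝓝 (C * (‖G - G‖ * √(2 * (‖G‖ ^ 2 + ‖G‖ ^ 2))))) := by
    have : Continuous fun G' : L2Vector d => C * (‖G' - G‖ * √(2 * (‖G'‖ ^ 2 + ‖G‖ ^ 2))) := by
      fun_prop
    exact this.tendsto G
  rw [sub_self, norm_zero, zero_mul, mul_zero] at hlim
  exact squeeze_zero_norm (fun G' => by rw [norm_norm]; exact key G G') hlim

end WeightedNorm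

/-! ### The energy inequality for the tails -/

section Tail

variable {d : ℕ} {a : RSpace d → ℝ} {L B σ₁ σ₂ ν T R : ℝ}
  {u : ℝ → L2Scalar d} {g : ℝ → L2Vector d}

/-- `1 - (1 - a)²`. -/
def headCutoff (a : RSpace d → ℝ) (x : RSpace d) : ℝ := 2 * a x - a x ^ 2

theorem contDiff_headCutoff (ha : IsRadialCutoff a) : ContDiff ℝ ∞ (headCutoff a) :=
  (contDiff_const.mul ha.smooth).sub (ha.smooth.pow 2)

theorem hasCompactSupport_headCutoff (ha : IsRadialCutoff a) : HasCompactSupport (headCutoff a) := by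
  refine ha.hasCompactSupport.mono fun x hx => ?_
  intro h
  exact hx (by simp [headCutoff, h])

theorem tailCutoff_eq (a : RSpace d → ℝ) (R : ℝ) (x : RSpace d) :
    tailCutoff a R x = 1 - dilate a R x := rfl

theorem IsRadialCutoff.tailCutoff_mem (ha : IsRadialCutoff a) (R : ℝ) (x : RSpace d) :
    tailCutoff a R x ∈ Icc (0 : ℝ) 1 :=
  ⟨sub_nonneg.2 (ha.le_one _), sub_le_self _ (ha.nonneg _)⟩

/-- The test function `a_S b_R²` written as a difference of compactly supported cutoffs: where `b_R
≠ 1` one has `|x| < 2R ≤ S` and so `a_S = 1`. The derivatives at the scales `S` and `R` can then be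
estimated separately. -/
theorem IsRadialCutoff.dilate_sub_head (ha : IsRadialCutoff a) (hR : 0 < R) {S : ℝ} (hS : 2 * R ≤ S)
    (x : RSpace d) :
    dilate a S x - dilate (headCutoff a) R x = dilate a S x * tailCutoff a R x ^ 2 := by
  have hS0 : 0 < S := by linarith
  have e : dilate (headCutoff a) R x = 2 * dilate a R x - dilate a R x ^ 2 := rfl
  rw [e, tailCutoff_eq]
  rcases lt_or_ge ‖x‖ S with h | h
  · rw [ha.dilate_eq_one hS0 h]
    ring
  · rw [ha.dilate_eq_zero hR (hS.trans h)]
    ring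

theorem contDiff_tailCutoff (ha : IsRadialCutoff a) (R : ℝ) : ContDiff ℝ ∞ (tailCutoff a R) :=
  contDiff_const.sub (ha.smooth.dilate R)

theorem hasTwoDerivs_sq : HasTwoDerivs (fun s => s ^ 2) (fun s => 2 * s) (fun _ => 2) where
  first s := by simpa using hasDerivAt_pow 2 s
  second s := by simpa using (hasDerivAt_id s).const_mul (2 : ℝ)
  continuous := continuous_const

theorem IsBoundedCurve.integrable_sq_mul_of_bounded (hu : IsBoundedCurve L B u) {β : RSpace d → ℝ}
    (hβ : Continuous β) {C : ℝ} (hC : ∀ x, |β x| ≤ C) (s : ℝ) :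
    Integrable fun x => u s x ^ 2 * β x :=
  (integrable_sq_of_bounded (hu.integrable s) (hu.bound s)).mul_bdd (c := C)
    hβ.aestronglyMeasurable (Eventually.of_forall hC)

/-- The energy inequality for the tails, where the contributions of the derivatives of the cutoff
are controlled by a weight `β`. -/
theorem IsBoundedSolution.tail_le (hd : 2 ≤ d) (ha : IsRadialCutoff a) (hν : 0 ≤ ν)
    (hu : IsBoundedSolution σ₁ σ₂ ν T L B u g)
    (hg : 0 < ν → MemLp g 2 (volume.restrict (Icc 0 T))) (hR : 0 < R) {l b : ℝ} (hl : 0 ≤ l)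
    (hb : 0 ≤ b) {β : RSpace d → ℝ} (hβ : Continuous β) {Cβ : ℝ} (hCβ : ∀ x, |β x| ≤ Cβ)
    (hpt : ∀ S, 2 * R ≤ S → ∀ x,
      |σ₁| * (B * newtonMass d + newtonConst d * L) * ‖fderiv ℝ (dilate (headCutoff a) R) x‖
        + ν * |coordLaplacian (dilate (headCutoff a) R) x|
        ≤ l * (dilate a S x * tailCutoff a R x ^ 2) + β x)
    (hint : ∀ s ∈ Icc 0 T, ∫ x, u s x ^ 2 * β x ≤ b) {t : ℝ} (ht : t ∈ Icc 0 T) :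
    l2NormSq (fun x => tailCutoff a R x * u t x)
      + ν * ∫ s in (0 : ℝ)..t, l2NormSq (fun x => tailCutoff a R x • g s x)
      ≤ (l2NormSq (fun x => tailCutoff a R x * u 0 x) + b * t)
        * Real.exp (((|σ₁| + 2 * |σ₂|) * B + l) * t) := by
  have hB0 := hu.bound_nonneg
  have hL0 := hu.mass_nonneg
  obtain ⟨A, hA0, hA⟩ := exists_bound_dilate ha.smooth ha.hasCompactSupport
  set W := B * newtonMass d + newtonConst d * L with hW
  have hW0 : 0 ≤ W := (norm_nonneg _).trans (hu.norm_newtonField_le hd 0 0)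
  set c := (|σ₁| + 2 * |σ₂|) * B + l with hc
  have hc0 : 0 ≤ c := by positivity
  set χ : RSpace d → ℝ := fun x => tailCutoff a R x ^ 2 with hχ
  have hχc : Continuous χ := (contDiff_tailCutoff ha R).continuous.pow 2
  have hχ1 : ∀ x, |χ x| ≤ 1 := fun x => by
    obtain ⟨h1, h2⟩ := ha.tailCutoff_mem R x
    rw [hχ, abs_of_nonneg (by positivity)]
    exact pow_le_one₀ h1 h2
  have hdS : ∀ S x, |dilate a S x| ≤ 1 := fun S x => by
    rw [dilate, abs_of_nonneg (ha.nonneg _)]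
    exact ha.le_one _
  have hhead := contDiff_headCutoff ha
  have hheadc := hasCompactSupport_headCutoff ha
  -- The renormalized inequality with `h(s) = s²` and `q = 1`. The outer cutoff contributes `O(S⁻¹)`
  -- times `∫ u² ≤ B * L`; the inner one is split by `hpt` into a multiple of the tail, which joins
  -- the Grönwall rate, and the source weighted by `β`.
  have key : ∀ S, 1 ≤ S → 2 * R ≤ S →
      (∫ x, dilate a S x * (χ x * u t x ^ 2))
        + ν * 2 * ∫ s in (0 : ℝ)..t, ∫ x, dilate a S x * (χ x * ‖g s x‖ ^ 2)
      ≤ ((∫ x, dilate a S x * (χ x * u 0 x ^ 2))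
        + (b + A * S⁻¹ * (|σ₁| * W + ν) * (B * L)) * t) * Real.exp (c * t) := by
    intro S hS hSR
    have hS0 : 0 < S := by linarith
    set ψ : RSpace d → ℝ := fun x => dilate a S x - dilate (headCutoff a) R x with hψ_def
    have hψe : ∀ x, ψ x = dilate a S x * χ x := fun x => ha.dilate_sub_head hR hSR x
    have s1 := ha.smooth.dilate S
    have s2 := hhead.dilate R
    have hψ : ContDiff ℝ ∞ ψ := s1.sub s2
    have hψc : HasCompactSupport ψ := (ha.hasCompactSupport.dilate hS0).sub (hheadc.dilate hR)
    have hψ0 : ∀ x, 0 ≤ ψ x := fun x => by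
      rw [hψe]
      exact mul_nonneg (ha.nonneg _) (sq_nonneg _)
    have hDψ : ∀ x, fderiv ℝ ψ x = fderiv ℝ (dilate a S) x - fderiv ℝ (dilate (headCutoff a) R) x :=
      fun x => fderiv_fun_sub (s1.differentiable (by simp) x) (s2.differentiable (by simp) x)
    have hLψ : ∀ x, coordLaplacian ψ x
        = coordLaplacian (dilate a S) x - coordLaplacian (dilate (headCutoff a) R) x := fun x => by
      simp only [coordLaplacian, hDψ, _root_.sub_apply, ← Finset.sum_sub_distrib]
      refine Finset.sum_congr rfl fun i _ => ?_
      rw [fderiv_fun_sub ((contDiff_fderiv_apply s1 _).differentiable (by simp) x)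
        ((contDiff_fderiv_apply s2 _).differentiable (by simp) x), _root_.sub_apply]
    have hyc := hu.continuous_integral_mul_comp hasTwoDerivs_sq hψ.continuous hψc
      (q := fun _ => 1) continuous_const
    have hi1 : ∀ s, Integrable fun x => ψ x * (1 * u s x) ^ 2 := fun s => by
      refine (hu.integrable_sq_mul hψ.continuous hψc s).congr (Eventually.of_forall fun x => ?_)
      simp only
      ring
    have hi2 := fun s => hu.integrable_sq_mul_of_bounded hβ hCβ s
    have hi3 := fun s => integrable_sq_of_bounded (hu.integrable s) (hu.bound s)
    have h1 := gronwall_integral (y := fun s => ∫ x, ψ x * (1 * u s x) ^ 2)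
      (N := fun t => ν * 2 * ∫ s in (0 : ℝ)..t, (1 : ℝ) ^ 2 * ∫ x, ψ x * ‖g s x‖ ^ 2)
      (A := ∫ x, ψ x * (1 * u 0 x) ^ 2) (b := b + A * S⁻¹ * (|σ₁| * W + ν) * (B * L))
      (c := c) (T := T) hyc (fun r hr => ?_) (by positivity) hc0 (fun r hr => ?_) t ht
    · simp only [one_mul, one_pow, hψe, mul_assoc] at h1
      simp only [mul_assoc]
      exact h1
    · refine mul_nonneg (by positivity) (intervalIntegral.integral_nonneg hr.1 fun s _ => ?_)
      exact mul_nonneg (by norm_num) (integral_nonneg fun x => mul_nonneg (hψ0 x) (sq_nonneg _))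
    have h2 := hu.renormalized_inequality hd ha hasTwoDerivs_sq hψ hψc hψ0 (κ := 2) (by norm_num)
      (fun _ => le_rfl) (q := fun _ => 1) (q' := fun _ => 0) (fun s => hasDerivAt_const s 1)
      continuous_const hν hu.weak hu.grad hr
    refine h2.trans (add_le_add_right ?_ _)
    refine intervalIntegral.integral_mono_on hr.1
      ((hu.continuous_integral_renormTerm hd hasTwoDerivs_sq hψ hψc (q := fun _ => 1)
        (q' := fun _ => 0) continuous_const continuous_const).intervalIntegrable _ _)
      (((continuous_const.mul hyc).add continuous_const).intervalIntegrable _ _) fun s hs => ?_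
    have hs' : s ∈ Icc 0 T := ⟨hs.1, hs.2.trans hr.2⟩
    calc _ ≤ ∫ x, (c * (ψ x * (1 * u s x) ^ 2) + u s x ^ 2 * β x
            + A * S⁻¹ * (|σ₁| * W + ν) * u s x ^ 2) := by
          refine integral_mono_ae (hu.integrable_renormTerm hd hasTwoDerivs_sq hψ hψc _ _ s)
            ((((hi1 s).const_mul _).fun_add (hi2 s)).fun_add ((hi3 s).const_mul _)) ?_
          filter_upwards [hu.bound s] with x hx
          obtain ⟨a1, a2⟩ := hA S hS0 x
          have hV := hu.norm_newtonField_le hd s x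
          have hSi : (0 : ℝ) < S⁻¹ := inv_pos.2 hS0
          have hS1 : S⁻¹ ^ 2 ≤ S⁻¹ := pow_le_of_le_one hSi.le (inv_le_one_of_one_le₀ hS) two_ne_zero
          have hp := hpt S hSR x
          rw [show tailCutoff a R x ^ 2 = χ x from rfl, ← hψe] at hp
          have b1 : σ₁ * fderiv ℝ ψ x (newtonField (u s) x)
              ≤ |σ₁| * (A * S⁻¹ * W) + |σ₁| * W * ‖fderiv ℝ (dilate (headCutoff a) R) x‖ := by
            refine (le_abs_self _).trans ?_
            rw [abs_mul]
            calc |σ₁| * |fderiv ℝ ψ x (newtonField (u s) x)|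
                ≤ |σ₁| * ((A * S⁻¹ + ‖fderiv ℝ (dilate (headCutoff a) R) x‖) * W) := by
                  refine mul_le_mul_of_nonneg_left ?_ (abs_nonneg _)
                  refine ((fderiv ℝ ψ x).le_opNorm _).trans ?_
                  rw [hDψ]
                  refine mul_le_mul ((norm_sub_le _ _).trans (by gcongr)) hV (norm_nonneg _)
                    (by positivity)
              _ = _ := by ring
          have b2 : σ₁ * u s x ≤ |σ₁| * B := by
            refine (le_abs_self _).trans ?_
            rw [abs_mul]
            gcongr
          have b3 : σ₂ * u s x ≤ |σ₂| * B := by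
            refine (le_abs_self _).trans ?_
            rw [abs_mul]
            gcongr
          have b4 : ν * coordLaplacian ψ x
              ≤ ν * (A * S⁻¹) + ν * |coordLaplacian (dilate (headCutoff a) R) x| := by
            rw [← mul_add, hLψ]
            refine mul_le_mul_of_nonneg_left ?_ hν
            have k1 : coordLaplacian (dilate a S) x ≤ A * S⁻¹ :=
              (le_abs_self _).trans (a2.trans (mul_le_mul_of_nonneg_left hS1 hA0))
            have k2 := neg_abs_le (coordLaplacian (dilate (headCutoff a) R) x)
            linarith
          have hr2 : 0 ≤ u s x ^ 2 := sq_nonneg _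
          have c1 := mul_le_mul_of_nonneg_left b1 hr2
          have c2 := mul_le_mul_of_nonneg_left b2 (mul_nonneg hr2 (hψ0 x))
          have c3 := mul_le_mul_of_nonneg_left b3 (mul_nonneg hr2 (hψ0 x))
          have c4 := mul_le_mul_of_nonneg_left b4 hr2
          have c5 := mul_le_mul_of_nonneg_left hp hr2
          simp only [renormTerm, hc]
          linarith
      _ ≤ _ := by
          rw [integral_add (((hi1 s).const_mul _).fun_add (hi2 s)) ((hi3 s).const_mul _),
            integral_add ((hi1 s).const_mul _) (hi2 s), integral_const_mul, integral_const_mul,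
            add_assoc]
          have k1 := hint s hs'
          have k2 := hu.integral_sq_le s
          gcongr
  have hf1 : ∀ s, Integrable fun x => χ x * u s x ^ 2 := fun s =>
    (integrable_sq_of_bounded (hu.integrable s) (hu.bound s)).bdd_mul (c := 1)
      hχc.aestronglyMeasurable (Eventually.of_forall hχ1)
  have hf2 : ∀ s, Integrable fun x => χ x * ‖g s x‖ ^ 2 := fun s =>
    (integrable_norm_sq (g s)).bdd_mul (c := 1) hχc.aestronglyMeasurable (Eventually.of_forall hχ1)
  -- For `ν = 0` nothing is known about `g`, but its term vanishes. For `ν > 0` the integral `∫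
  -- |g|²` is integrable in time and dominates.
  have hlimG : Tendsto (fun S => ν * 2 * ∫ s in (0 : ℝ)..t, ∫ x, dilate a S x * (χ x * ‖g s x‖ ^ 2))
      atTop (𝓝 (ν * 2 * ∫ s in (0 : ℝ)..t, ∫ x, χ x * ‖g s x‖ ^ 2)) := by
    rcases hν.eq_or_lt with h0 | h0
    · simp only [← h0, zero_mul]
      exact tendsto_const_nhds
    refine Tendsto.const_mul _ ?_
    have hsub : uIoc 0 t ⊆ Icc 0 T := by
      rw [uIoc_of_le ht.1]
      exact Ioc_subset_Icc_self.trans (Icc_subset_Icc_right ht.2)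
    have hgi : IntegrableOn (fun s => ‖g s‖ ^ 2) (Icc 0 T) := (hg h0).integrable_norm_pow two_ne_zero
    refine intervalIntegral.tendsto_integral_filter_of_dominated_convergence (fun s => ‖g s‖ ^ 2)
      (Eventually.of_forall fun S => ?_) (Eventually.of_forall fun S => Eventually.of_forall
        fun s _ => ?_) ?_ (Eventually.of_forall fun s _ => ha.tendsto_integral_dilate_mul (hf2 s))
    · have h1 := continuous_integral_mul_norm_sq (χ := fun x => dilate a S x * χ x) (C := 1)
        (((ha.smooth.dilate S).continuous.mul hχc).aestronglyMeasurable) fun x => by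
          rw [abs_mul]
          exact mul_le_one₀ (hdS S x) (abs_nonneg _) (hχ1 x)
      simp only [mul_assoc] at h1
      exact h1.comp_aestronglyMeasurable ((hg h0).1.mono_measure (Measure.restrict_mono hsub le_rfl))
    · rw [← integral_norm_sq_eq]
      refine norm_integral_le_of_norm_le (integrable_norm_sq _) (Eventually.of_forall fun x => ?_)
      rw [norm_mul, norm_mul, Real.norm_of_nonneg (sq_nonneg ‖g s x‖)]
      calc |dilate a S x| * (|χ x| * ‖g s x‖ ^ 2) ≤ 1 * (1 * ‖g s x‖ ^ 2) := by
            gcongr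
            · exact hdS S x
            · exact hχ1 x
        _ = _ := by ring
    · rw [intervalIntegrable_iff]
      exact hgi.mono_set hsub
  have hlim1 := (ha.tendsto_integral_dilate_mul (hf1 t)).add hlimG
  have hlim2 : Tendsto (fun S : ℝ => ((∫ x, dilate a S x * (χ x * u 0 x ^ 2))
        + (b + A * S⁻¹ * (|σ₁| * W + ν) * (B * L)) * t) * Real.exp (c * t)) atTop
      (𝓝 (((∫ x, χ x * u 0 x ^ 2) + (b + A * 0 * (|σ₁| * W + ν) * (B * L)) * t)
        * Real.exp (c * t))) :=
    ((ha.tendsto_integral_dilate_mul (hf1 0)).add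
      ((((tendsto_inv_atTop_zero.const_mul A).mul_const _).mul_const _).const_add b |>.mul_const t)).mul_const _
  rw [mul_zero, zero_mul, zero_mul, add_zero] at hlim2
  have hfin := le_of_tendsto_of_tendsto hlim1 hlim2 (by
    filter_upwards [eventually_ge_atTop 1, eventually_ge_atTop (2 * R)] with S h1 h2
      using key S h1 h2)
  have e1 : ∀ s, l2NormSq (fun x => tailCutoff a R x * u s x) = ∫ x, χ x * u s x ^ 2 := fun s => by
    simp only [l2NormSq, hχ, norm_mul, mul_pow, Real.norm_eq_abs, sq_abs]
  have e2 : ∀ s, l2NormSq (fun x => tailCutoff a R x • g s x) = ∫ x, χ x * ‖g s x‖ ^ 2 := fun s => by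
    simp only [l2NormSq, hχ, norm_smul, mul_pow, Real.norm_eq_abs, sq_abs]
  simp only [e1, e2]
  -- The energy inequality yields `2 ν` in front of the dissipation, and half of it is discarded.
  refine le_trans ?_ hfin
  have h0 : 0 ≤ ∫ s in (0 : ℝ)..t, ∫ x, χ x * ‖g s x‖ ^ 2 :=
    intervalIntegral.integral_nonneg ht.1 fun s _ => integral_nonneg fun x =>
      mul_nonneg (sq_nonneg _) (sq_nonneg _)
  have := mul_nonneg hν h0
  linarith

end Tail

/-! ### Weak solutions and bounds by the data -/

section Solutions

variable {d : ℕ} {a ρ₀ : RSpace d → ℝ} {L B σ₁ σ₂ ν T K R : ℝ} {ρ : ℝ → L2Scalar d}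

theorem IsWeakSolution.extendCurve_zero (hT : 0 < T) (h : IsWeakSolution σ₁ σ₂ ν ρ₀ T ρ) :
    extendCurve hT ρ 0 =ᵐ[volume] ρ₀ := by
  rw [extendCurve_eq hT ρ ⟨le_rfl, hT.le⟩]
  exact h.initial

theorem IsWeakSolution.isBoundedSolution (hd : 2 ≤ d) (hν : 0 ≤ ν) (hT : 0 < T)
    (h : IsWeakSolution σ₁ σ₂ ν ρ₀ T ρ) (hu : IsBoundedCurve L B (extendCurve hT ρ)) :
    IsBoundedSolution σ₁ σ₂ ν T L B (extendCurve hT ρ)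
      (fun s => weakGradient (extendCurve hT ρ s)) where
  toIsBoundedCurve := hu
  weak φ hφ hc t ht := by
    rw [h.integral_mul_eq hd hν hT hu hφ hc t ht]
    congr 1
    refine integral_congr_ae ?_
    filter_upwards [h.extendCurve_zero hT] with x hx
    rw [hx]
  grad hν0 := by
    filter_upwards [(h.sobolev hν0).1, ae_restrict_mem measurableSet_Icc] with s hs hs'
    rw [extendCurve_eq hT ρ hs']
    exact hasWeakGradient_weakGradient hs

theorem IsWeakSolution.memLp_weakGradient_extendCurve (hT : 0 < T)
    (h : IsWeakSolution σ₁ σ₂ ν ρ₀ T ρ) (hν : 0 < ν) :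
    MemLp (fun s => weakGradient (extendCurve hT ρ s)) 2 (volume.restrict (Icc 0 T)) := by
  refine (h.sobolev hν).2.ae_eq ?_
  filter_upwards [ae_restrict_mem measurableSet_Icc] with s hs
  rw [extendCurve_eq hT ρ hs]

theorem IsWeakSolution.exists_isBoundedCurve (hT : 0 < T) (h : IsWeakSolution σ₁ σ₂ ν ρ₀ T ρ) :
    ∃ L B, IsBoundedCurve L B (extendCurve hT ρ) := by
  obtain ⟨b, hb⟩ := h.bounded
  have hb' : ENNReal.ofReal (b : ℝ) = b := ENNReal.ofReal_coe_nnreal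
  refine ⟨b, b, isBoundedCurve_of_eLpNorm_le (continuous_extendCurve hT h.continuousOn) b.2 b.2
    ?_ ?_⟩ <;> rw [hb']
  · exact eLpNorm_extendCurve_le hT h.continuousOn (hb.mono fun t ht => ht.1)
  · exact eLpNorm_extendCurve_le hT h.continuousOn (hb.mono fun t ht => ht.2)

theorem forall_extendCurve (hT : 0 < T) {P : L2Scalar d → Prop}
    (h : ∀ s ∈ Icc 0 T, P (extendCurve hT ρ s)) (s : ℝ) : P (extendCurve hT ρ s) := by
  have h1 := h _ (projIcc 0 T hT.le s).2
  rwa [extendCurve_eq hT ρ (projIcc 0 T hT.le s).2] at h1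

/-- The bounds in `L¹ ∩ L^∞` depend on the data only. -/
theorem exists_uniform_bounds (hd : 2 ≤ d) (ha : IsRadialCutoff a) (hρ₀ : MemLp ρ₀ ∞ volume)
    (hT : 0 < T) (σ₁ σ₂ K : ℝ) :
    ∃ L B, 0 ≤ L ∧ 0 ≤ B ∧ ∀ ν : ℝ, 0 ≤ ν → ∀ ρ : ℝ → L2Scalar d,
      IsWeakSolution σ₁ σ₂ ν ρ₀ T ρ → IsControlled σ₂ ρ₀ T K ρ →
        IsBoundedCurve L B (extendCurve hT ρ) := by
  obtain ⟨B₁, hB₁⟩ : ∃ B₁, |σ₂| * (eLpNorm ρ₀ ∞ volume).toReal * T < 1 →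
      ∀ ν : ℝ, 0 ≤ ν → ∀ ρ : ℝ → L2Scalar d, IsWeakSolution σ₁ σ₂ ν ρ₀ T ρ →
        ∀ s, ∀ᵐ x, |extendCurve hT ρ s x| ≤ B₁ := by
    by_cases hs : |σ₂| * (eLpNorm ρ₀ ∞ volume).toReal * T < 1
    · set m := (eLpNorm ρ₀ ∞ volume).toReal with hm
      have hm0 : 0 ≤ m := ENNReal.toReal_nonneg
      have hmρ : ∀ᵐ x, |ρ₀ x| ≤ m := ae_abs_le_of_eLpNorm_top_le hm0 <| by
        rw [hm, ENNReal.ofReal_toReal hρ₀.2.ne]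
      have hσT : 0 ≤ |σ₂| * T := by positivity
      -- The comparison needs a positive bound for `ρ₀`. If `ρ₀ = 0`, the value `(|σ₂| * T + 1)⁻¹`
      -- is small enough for the comparison solution to survive until `T`.
      obtain ⟨M, hM0, hMm, hM⟩ : ∃ M, 0 < M ∧ m ≤ M ∧ |σ₂| * T < M⁻¹ := by
        rcases hm0.eq_or_lt with h | h
        · refine ⟨(|σ₂| * T + 1)⁻¹, by positivity, by rw [← h]; positivity, ?_⟩
          rw [inv_inv]
          linarith
        · refine ⟨m, h, le_rfl, ?_⟩
          rw [← one_div, lt_div_iff₀ h]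
          linarith
      refine ⟨(M⁻¹ - |σ₂| * T)⁻¹, fun _ ν hν ρ h => ?_⟩
      -- The bounds of the individual solution are used qualitatively only and do not enter the
      -- conclusion.
      obtain ⟨L, B, hu⟩ := h.exists_isBoundedCurve hT
      refine forall_extendCurve (P := fun f => ∀ᵐ x, |f x| ≤ _) hT fun s hs' => ?_
      refine (h.isBoundedSolution hd hν hT hu).abs_le hd ha hν hM0 ?_ hM hs'
      filter_upwards [hmρ, h.extendCurve_zero hT] with x h1 h2
      rw [h2]
      exact h1.trans hMm
    · exact ⟨0, fun h => absurd h hs⟩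
  -- One constant for both alternatives in `IsControlled`.
  set B := max (max K 0) B₁ with hB
  have hB0 : 0 ≤ B := (le_max_right K 0).trans (le_max_left _ _)
  refine ⟨(∫ x, |ρ₀ x|) * Real.exp ((|σ₁| * B + 2 * |σ₂| * B) * T), B, by positivity, hB0,
    fun ν hν ρ h hc => ?_⟩
  have hbd : ∀ s, ∀ᵐ x, |extendCurve hT ρ s x| ≤ B := fun s => by
    rcases hc with hc | hc
    · filter_upwards [hB₁ hc ν hν ρ h s] with x hx
      exact hx.trans (le_max_right _ _)
    · have h1 := ae_abs_le_of_eLpNorm_top_le (le_max_right K 0)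
        ((eLpNorm_extendCurve_le hT h.continuousOn hc s).trans
          (ENNReal.ofReal_le_ofReal (le_max_left K 0)))
      filter_upwards [h1] with x hx
      exact hx.trans (le_max_left _ _)
  obtain ⟨L', B', hu⟩ := h.exists_isBoundedCurve hT
  -- The uniform bound replaces `B'` before the `L¹` estimate is applied, because the exponent there
  -- contains it.
  have hu' : IsBoundedCurve L' B (extendCurve hT ρ) := ⟨hu.1, hu.2, hu.3, hbd⟩
  refine ⟨hu.1, hu.2, ?_, hbd⟩
  refine forall_extendCurve (P := fun f => ∫ x, |f x| ≤ _) hT fun s hs => ?_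
  refine ((h.isBoundedSolution hd hν hT hu').integral_abs_le hd ha hν hs).trans ?_
  have e : ∫ x, |extendCurve hT ρ 0 x| = ∫ x, |ρ₀ x| := by
    refine integral_congr_ae ?_
    filter_upwards [h.extendCurve_zero hT] with x hx
    rw [hx]
  rw [e]
  gcongr
  exact hs.2

theorem tailEnergy_eq_extendCurve (hT : 0 < T) {t : ℝ} (ht : t ∈ Icc 0 T) :
    tailEnergy a ν R ρ t = l2NormSq (fun x => tailCutoff a R x * extendCurve hT ρ t x)
      + ν * ∫ s in (0 : ℝ)..t,
        l2NormSq (fun x => tailCutoff a R x • weakGradient (extendCurve hT ρ s) x) := by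
  rw [tailEnergy, extendCurve_eq hT ρ ht]
  congr 2
  refine intervalIntegral.integral_congr fun s hs => ?_
  rw [uIcc_of_le ht.1] at hs
  simp only [extendCurve_eq hT ρ ⟨hs.1, hs.2.trans ht.2⟩]

theorem IsWeakSolution.l2NormSq_initial (hT : 0 < T) (h : IsWeakSolution σ₁ σ₂ ν ρ₀ T ρ) :
    l2NormSq (fun x => tailCutoff a R x * extendCurve hT ρ 0 x)
      = l2NormSq (fun x => tailCutoff a R x * ρ₀ x) := by
  refine integral_congr_ae ?_
  filter_upwards [h.extendCurve_zero hT] with x hx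
  rw [hx]

end Solutions

/-! ### Derivatives of the tail cutoff -/

section Cutoff

variable {d : ℕ} {a : RSpace d → ℝ} {R : ℝ}

theorem fderiv_dilate_headCutoff (ha : IsRadialCutoff a) (R : ℝ) (x : RSpace d) :
    fderiv ℝ (dilate (headCutoff a) R) x = (2 * tailCutoff a R x) • fderiv ℝ (dilate a R) x := by
  have h1 := ((ha.smooth.dilate R).differentiable (by simp) x).hasFDerivAt
  have h2 := (h1.const_mul 2).sub (h1.pow 2)
  have e : dilate (headCutoff a) R = fun y => 2 * dilate a R y - dilate a R y ^ 2 := rfl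
  rw [e]
  refine (HasFDerivAt.fderiv h2).trans ?_
  rw [tailCutoff_eq]
  ext v
  simp
  ring

/-- The cutoff attains its minimum `0` at such points, the sphere of radius `2R` included. -/
theorem IsRadialCutoff.fderiv_dilate_eq_zero (ha : IsRadialCutoff a) (hR : 0 < R) {x : RSpace d}
    (hx : 2 * R ≤ ‖x‖) : fderiv ℝ (dilate a R) x = 0 := by
  refine IsLocalMin.fderiv_eq_zero (Eventually.of_forall fun y => ?_)
  rw [ha.dilate_eq_zero hR hx]
  exact ha.nonneg _

theorem IsRadialCutoff.dilate_headCutoff_eq_one (ha : IsRadialCutoff a) (hR : 0 < R) {x : RSpace d}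
    (hx : ‖x‖ < R) : dilate (headCutoff a) R x = 1 := by
  have e : dilate (headCutoff a) R x = 2 * dilate a R x - dilate a R x ^ 2 := rfl
  rw [e, ha.dilate_eq_one hR hx]
  norm_num

theorem coordLaplacian_eq_zero_of_eqOn_ball {g : RSpace d → ℝ} {c r : ℝ}
    (h : ∀ x, ‖x‖ < r → g x = c) {x : RSpace d} (hx : ‖x‖ < r) : coordLaplacian g x = 0 := by
  refine Finset.sum_eq_zero fun i _ => ?_
  rw [fderiv_eq_zero_of_eqOn_ball (c := 0) (fun y hy => ?_) hx]
  · rfl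
  · rw [fderiv_eq_zero_of_eqOn_ball h hy]
    rfl

/-- Young's inequality `2 b_R |∇a_R| ≤ b_R² + |∇a_R|²` splits the gradient term into a part absorbed
by the tail and a part of order `R⁻²`. A bound by `|∇a_R|` alone would give only `R⁻¹`. -/
theorem IsRadialCutoff.head_bound_const (ha : IsRadialCutoff a) {A A' : ℝ}
    (hA : ∀ R, 0 < R → ∀ x, ‖fderiv ℝ (dilate a R) x‖ ≤ A * R⁻¹)
    (hA' : ∀ R, 0 < R → ∀ x, |coordLaplacian (dilate (headCutoff a) R) x| ≤ A' * R⁻¹ ^ 2)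
    (hR : 0 < R) {w ν S : ℝ} (hw : 0 ≤ w) (hν : 0 ≤ ν) (hS : 2 * R ≤ S) (x : RSpace d) :
    w * ‖fderiv ℝ (dilate (headCutoff a) R) x‖ + ν * |coordLaplacian (dilate (headCutoff a) R) x|
      ≤ w * (dilate a S x * tailCutoff a R x ^ 2) + (w * A ^ 2 + ν * A') * R⁻¹ ^ 2 := by
  have hb := (ha.tailCutoff_mem R x).1
  have hS0 : 0 < S := by linarith
  have h1 : ‖fderiv ℝ (dilate (headCutoff a) R) x‖
      ≤ dilate a S x * tailCutoff a R x ^ 2 + A ^ 2 * R⁻¹ ^ 2 := by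
    rw [fderiv_dilate_headCutoff ha, norm_smul, Real.norm_of_nonneg (by positivity)]
    rcases le_or_gt (2 * R) ‖x‖ with h | h
    · rw [ha.fderiv_dilate_eq_zero hR h, norm_zero, mul_zero]
      have : 0 ≤ dilate a S x := ha.nonneg _
      positivity
    · rw [ha.dilate_eq_one hS0 (h.trans_le hS), one_mul]
      have h2 := mul_le_mul_of_nonneg_left (hA R hR x) hb
      nlinarith [sq_nonneg (tailCutoff a R x - A * R⁻¹)]
  have h2 := mul_le_mul_of_nonneg_left h1 hw
  have h3 := mul_le_mul_of_nonneg_left (hA' R hR x) hν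
  linarith

/-- The derivatives vanish for `|x| < R`, and for `|x| ≥ R` the cutoff `b_{R/2}` equals `1`, so it
can be inserted as a weight. The gradient gives `R⁻¹`, and the Laplacian gives `ν R⁻² ≤ R⁻¹`. -/
theorem IsRadialCutoff.head_bound_tail (ha : IsRadialCutoff a) {A A' : ℝ}
    (hA : ∀ R, 0 < R → ∀ x, ‖fderiv ℝ (dilate a R) x‖ ≤ A * R⁻¹)
    (hA' : ∀ R, 0 < R → ∀ x, |coordLaplacian (dilate (headCutoff a) R) x| ≤ A' * R⁻¹ ^ 2)
    (hA'0 : 0 ≤ A') (hR : 0 < R) {w ν : ℝ} (hw : 0 ≤ w) (hνR : ν ≤ R) (x : RSpace d) :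
    w * ‖fderiv ℝ (dilate (headCutoff a) R) x‖ + ν * |coordLaplacian (dilate (headCutoff a) R) x|
      ≤ (2 * w * A + A') * R⁻¹ * tailCutoff a (R / 2) x ^ 2 := by
  have hb := ha.tailCutoff_mem R x
  rcases lt_or_ge ‖x‖ R with h | h
  · have h0 : ∀ y : RSpace d, ‖y‖ < R → dilate (headCutoff a) R y = 1 := fun y hy =>
      ha.dilate_headCutoff_eq_one hR hy
    rw [fderiv_eq_zero_of_eqOn_ball h0 h, coordLaplacian_eq_zero_of_eqOn_ball h0 h, norm_zero,
      abs_zero, mul_zero, mul_zero, add_zero]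
    have : 0 ≤ A * R⁻¹ := (norm_nonneg _).trans (hA R hR 0)
    have h1 : (2 * w * A + A') * R⁻¹ = 2 * w * (A * R⁻¹) + A' * R⁻¹ := by ring
    rw [h1]
    positivity
  · have e : tailCutoff a (R / 2) x = 1 := by
      rw [tailCutoff_eq, ha.dilate_eq_zero (by positivity) (by linarith), sub_zero]
    rw [e, fderiv_dilate_headCutoff ha, norm_smul, Real.norm_of_nonneg (by linarith [hb.1])]
    have h1 : 2 * tailCutoff a R x * ‖fderiv ℝ (dilate a R) x‖ ≤ 2 * (A * R⁻¹) := by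
      rw [mul_assoc]
      exact mul_le_mul_of_nonneg_left
        ((mul_le_of_le_one_left (norm_nonneg _) hb.2).trans (hA R hR x)) zero_le_two
    have h2 := mul_le_mul_of_nonneg_left h1 hw
    have h3 : ν * |coordLaplacian (dilate (headCutoff a) R) x| ≤ A' * R⁻¹ := by
      calc _ ≤ R * (A' * R⁻¹ ^ 2) :=
            mul_le_mul hνR (hA' R hR x) (abs_nonneg _) hR.le
        _ = _ := by field_simp
    linarith

end Cutoff

/-! ### Decay of the tails -/

section TailDecay

variable {d : ℕ} {a ρ₀ : RSpace d → ℝ} {L B σ₁ σ₂ T : ℝ} {F : ℝ → (ℝ → L2Scalar d) → Prop}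

theorem isTimeConstant_const {c : ℝ} (hc : 0 < c) : IsTimeConstant fun _ => c :=
  ⟨fun _ _ => hc, continuousOn_const, monotoneOn_const⟩

theorem l2NormSq_nonneg {E : Type} [NormedAddCommGroup E] (f : RSpace d → E) : 0 ≤ l2NormSq f :=
  integral_nonneg fun _ => by positivity

theorem l2NormSq_le_tailEnergy {ν R : ℝ} (hν : 0 ≤ ν) {ρ : ℝ → L2Scalar d} {t : ℝ} (ht : 0 ≤ t) :
    l2NormSq (fun x => tailCutoff a R x * ρ t x) ≤ tailEnergy a ν R ρ t :=
  le_add_of_nonneg_right <| mul_nonneg hν <|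
    intervalIntegral.integral_nonneg ht fun _ _ => l2NormSq_nonneg _

/-- Far from the origin, the tail energy is bounded with the factor `R⁻²`. -/
theorem exists_tailEnergy_le (hd : 2 ≤ d) (ha : IsRadialCutoff a) (hT : 0 < T) (hL : 0 ≤ L)
    (hB : 0 ≤ B) (hF : ∀ ν, 0 ≤ ν → ∀ ρ, F ν ρ →
      IsWeakSolution σ₁ σ₂ ν ρ₀ T ρ ∧ IsBoundedCurve L B (extendCurve hT ρ)) :
    ∃ b c, 0 ≤ b ∧ 0 ≤ c ∧ ∀ ν, 0 ≤ ν → ∀ ρ, F ν ρ → ∀ R, 0 < R → ∀ t ∈ Icc 0 T,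
      tailEnergy a ν R ρ t ≤ (l2NormSq (fun x => tailCutoff a R x * ρ₀ x)
        + b * (ν + 1) * (R ^ 2)⁻¹ * t) * Real.exp (c * t) := by
  obtain ⟨A, hA0, hA⟩ := exists_bound_dilate ha.smooth ha.hasCompactSupport
  obtain ⟨A', hA'0, hA'⟩ := exists_bound_dilate (contDiff_headCutoff ha)
    (hasCompactSupport_headCutoff ha)
  set w := |σ₁| * (B * newtonMass d + newtonConst d * L) with hw
  have hw0 : 0 ≤ w := by
    have := newtonMass_nonneg d
    have := newtonConst_pos hd
    positivity
  -- The source has the constant weight of `IsRadialCutoff.head_bound_const` times `∫ u² ≤ B * L`;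
  -- the rate gains `w`, the multiple of the tail absorbed there.
  refine ⟨(w * A ^ 2 + A') * (B * L), (|σ₁| + 2 * |σ₂|) * B + w, by positivity, by positivity,
    fun ν hν ρ hρ R hR t ht => ?_⟩
  obtain ⟨h, hu⟩ := hF ν hν ρ hρ
  set β := (w * A ^ 2 + ν * A') * R⁻¹ ^ 2 with hβ
  have hβ0 : 0 ≤ β := by positivity
  have key := (h.isBoundedSolution hd hν hT hu).tail_le hd ha hν
    (h.memLp_weakGradient_extendCurve hT) hR (l := w) (b := β * (B * L)) hw0 (by positivity)
    (β := fun _ => β) continuous_const (fun _ => le_rfl)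
    (fun S hS x => ha.head_bound_const (fun R hR x => (hA R hR x).1) (fun R hR x => (hA' R hR x).2)
      hR hw0 hν hS x)
    (fun s _ => by
      rw [integral_mul_const, mul_comm]
      exact mul_le_mul_of_nonneg_left (hu.integral_sq_le s) hβ0) ht
  rw [← tailEnergy_eq_extendCurve hT ht, h.l2NormSq_initial hT] at key
  refine key.trans (mul_le_mul_of_nonneg_right (add_le_add_right
    (mul_le_mul_of_nonneg_right ?_ ht.1) _) (Real.exp_pos _).le)
  have h1 : w * A ^ 2 + ν * A' ≤ (w * A ^ 2 + A') * (ν + 1) := by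
    have : 0 ≤ w * A ^ 2 * ν := by positivity
    nlinarith
  calc β * (B * L) ≤ (w * A ^ 2 + A') * (ν + 1) * R⁻¹ ^ 2 * (B * L) := by
        rw [hβ]
        gcongr
    _ = _ := by rw [inv_pow]; ring

/-- Decay of the tails of order `R⁻ᵏ` bounds the growth of the tail energy with the factor
`R⁻ᵏ⁻¹`. -/
theorem exists_tailEnergy_le_of_decay (hd : 2 ≤ d) (ha : IsRadialCutoff a) (hT : 0 < T)
    (hL : 0 ≤ L) (hB : 0 ≤ B) (hF : ∀ ν, 0 ≤ ν → ∀ ρ, F ν ρ →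
      IsWeakSolution σ₁ σ₂ ν ρ₀ T ρ ∧ IsBoundedCurve L B (extendCurve hT ρ)) {k : ℕ} {D : ℝ}
    (hD : 0 ≤ D) (h : ∀ M, ∀ᶠ R : ℝ in atTop, ∀ ν, 0 ≤ ν → ν ≤ M → ∀ ρ, F ν ρ → ∀ t ∈ Icc 0 T,
      l2NormSq (fun x => tailCutoff a R x * ρ t x) ≤ D * (R ^ k)⁻¹) :
    ∃ D', 0 ≤ D' ∧ ∀ M, ∀ᶠ R : ℝ in atTop, ∀ ν, 0 ≤ ν → ν ≤ M → ∀ ρ, F ν ρ → ∀ t ∈ Icc 0 T,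
      tailEnergy a ν R ρ t ≤ (l2NormSq (fun x => tailCutoff a R x * ρ₀ x)
        + D' * (R ^ (k + 1))⁻¹ * t) * Real.exp ((|σ₁| + 2 * |σ₂|) * B * t) := by
  obtain ⟨A, hA0, hA⟩ := exists_bound_dilate ha.smooth ha.hasCompactSupport
  obtain ⟨A', hA'0, hA'⟩ := exists_bound_dilate (contDiff_headCutoff ha)
    (hasCompactSupport_headCutoff ha)
  set w := |σ₁| * (B * newtonMass d + newtonConst d * L) with hw
  have hw0 : 0 ≤ w := by
    have := newtonMass_nonneg d
    have := newtonConst_pos hd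
    positivity
  set E := 2 * w * A + A' with hE
  have hE0 : 0 ≤ E := by positivity
  -- The factor `2 ^ k` comes from applying the decay hypothesis at radius `R / 2`. No `ν` appears,
  -- because it has been absorbed by `R ≥ M ≥ ν`.
  refine ⟨E * D * 2 ^ k, by positivity, fun M => ?_⟩
  filter_upwards [(tendsto_id.atTop_div_const (zero_lt_two' ℝ)).eventually (h M),
    eventually_ge_atTop M, eventually_gt_atTop 0] with R hR hMR hR0 ν hν hνM ρ hρ t ht
  obtain ⟨hsol, hu⟩ := hF ν hν ρ hρ
  have hχ := fun x => ha.tailCutoff_mem (R / 2) x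
  have hχ2 : ∀ x, tailCutoff a (R / 2) x ^ 2 ≤ 1 := fun x => pow_le_one₀ (hχ x).1 (hχ x).2
  have key := (hsol.isBoundedSolution hd hν hT hu).tail_le hd ha hν
    (hsol.memLp_weakGradient_extendCurve hT) hR0 (l := 0) (b := E * D * 2 ^ k * (R ^ (k + 1))⁻¹)
    le_rfl (by positivity) (β := fun x => E * R⁻¹ * tailCutoff a (R / 2) x ^ 2) (Cβ := E * R⁻¹)
    (continuous_const.mul ((contDiff_tailCutoff ha _).continuous.pow 2))
    (fun x => by
      rw [abs_of_nonneg (by positivity)]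
      exact mul_le_of_le_one_right (by positivity) (hχ2 x))
    (fun S hS x => by
      rw [zero_mul, zero_add]
      exact ha.head_bound_tail (fun R hR x => (hA R hR x).1) (fun R hR x => (hA' R hR x).2)
        hA'0 hR0 hw0 (hνM.trans hMR) x)
    (fun s hs => by
      have h1 := hR ν hν hνM ρ hρ s hs
      have h2 : ∫ x, extendCurve hT ρ s x ^ 2 * (E * R⁻¹ * tailCutoff a (R / 2) x ^ 2)
          = E * R⁻¹ * l2NormSq (fun x => tailCutoff a (R / 2) x * ρ s x) := by
        rw [extendCurve_eq hT ρ hs, l2NormSq, ← integral_const_mul]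
        refine integral_congr_ae (Eventually.of_forall fun x => ?_)
        simp only [norm_mul, mul_pow, Real.norm_eq_abs, sq_abs]
        ring
      rw [h2]
      refine (mul_le_mul_of_nonneg_left h1 (by positivity)).trans_eq ?_
      rw [id, div_pow, inv_div, pow_succ]
      field_simp) ht
  rwa [← tailEnergy_eq_extendCurve hT ht, hsol.l2NormSq_initial hT, add_zero] at key

/-- Induction on the order, starting from the bound `∫ ρ² ≤ B * L`; each step gains one power of `R`
until the decay of the initial tail is exhausted. The predicate `F` selects a class of solutions
with common bounds, so `D` is the same for the whole class. -/
theorem exists_tail_decay (hd : 2 ≤ d) (ha : IsRadialCutoff a) (hT : 0 < T) (hL : 0 ≤ L)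
    (hB : 0 ≤ B) (hF : ∀ ν, 0 ≤ ν → ∀ ρ, F ν ρ →
      IsWeakSolution σ₁ σ₂ ν ρ₀ T ρ ∧ IsBoundedCurve L B (extendCurve hT ρ)) {N : ℕ} {C : ℝ}
    (hC : 0 ≤ C)
    (h₀ : ∀ᶠ R : ℝ in atTop, l2NormSq (fun x => tailCutoff a R x * ρ₀ x) ≤ C * (R ^ N)⁻¹)
    {k : ℕ} (hk : k ≤ N) :
    ∃ D, 0 ≤ D ∧ ∀ M, ∀ᶠ R : ℝ in atTop, ∀ ν, 0 ≤ ν → ν ≤ M → ∀ ρ, F ν ρ → ∀ t ∈ Icc 0 T,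
      l2NormSq (fun x => tailCutoff a R x * ρ t x) ≤ D * (R ^ k)⁻¹ := by
  induction k with
  | zero =>
    refine ⟨B * L, by positivity, fun M => Eventually.of_forall fun R ν hν _ ρ hρ t ht => ?_⟩
    have hu := (hF ν hν ρ hρ).2
    rw [pow_zero, inv_one, mul_one, ← extendCurve_eq hT ρ ht]
    refine le_trans (integral_mono_of_nonneg (Eventually.of_forall fun x => by positivity)
      (integrable_sq_of_bounded (hu.integrable t) (hu.bound t))
      (Eventually.of_forall fun x => ?_)) (hu.integral_sq_le t)
    simp only [norm_mul, mul_pow, Real.norm_eq_abs, sq_abs]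
    obtain ⟨h1, h2⟩ := ha.tailCutoff_mem R x
    exact mul_le_of_le_one_left (sq_nonneg _) (pow_le_one₀ h1 h2)
  | succ k ih =>
    obtain ⟨D, hD, h⟩ := ih (by omega)
    obtain ⟨D', hD', h'⟩ := exists_tailEnergy_le_of_decay hd ha hT hL hB hF hD h
    refine ⟨(C + D' * T) * Real.exp ((|σ₁| + 2 * |σ₂|) * B * T), by positivity, fun M => ?_⟩
    filter_upwards [h' M, h₀, eventually_ge_atTop 1] with R h1 h2 hR ν hν hνM ρ hρ t ht
    have hRk : (R ^ N)⁻¹ ≤ (R ^ (k + 1))⁻¹ :=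
      inv_anti₀ (by positivity) (pow_le_pow_right₀ hR hk)
    calc _ ≤ (C * (R ^ (k + 1))⁻¹ + D' * (R ^ (k + 1))⁻¹ * T)
            * Real.exp ((|σ₁| + 2 * |σ₂|) * B * T) := by
          refine (l2NormSq_le_tailEnergy hν ht.1).trans ((h1 ν hν hνM ρ hρ t ht).trans ?_)
          have h3 := h2.trans (mul_le_mul_of_nonneg_left hRk hC)
          have := ht.1
          have := ht.2
          gcongr
      _ = _ := by ring

end TailDecay

end

theorem propositionP (d : ℕ) (hd : 2 ≤ d) (σ₁ σ₂ : ℝ) (hσ₁ : σ₁ ≠ 0)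
    (a : RSpace d → ℝ) (ha : IsRadialCutoff a)
    (ρ₀ : RSpace d → ℝ) (hρ₀ : MemLp ρ₀ 1 volume) (hρ₀' : MemLp ρ₀ ∞ volume)
    (T : ℝ) (hT : 0 < T) (K : ℝ) :
    (∃ C₀ : ℝ → ℝ, IsTimeConstant C₀ ∧
      ∀ ν : ℝ, 0 ≤ ν → ∀ ρ : ℝ → L2Scalar d, IsWeakSolution σ₁ σ₂ ν ρ₀ T ρ →
        IsControlled σ₂ ρ₀ T K ρ → ∀ R : ℝ, 0 < R → ∀ t ∈ Icc 0 T,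
          tailEnergy a ν R ρ t
            ≤ (l2NormSq (fun x => tailCutoff a R x * ρ₀ x)
                + C₀ t * t * (ν + 1) * (R ^ 2)⁻¹) * Real.exp (C₀ t * t)) ∧
    (∀ N : ℕ, 2 ≤ N → ∀ C : ℝ,
      (∀ᶠ R : ℝ in atTop, l2NormSq (fun x => tailCutoff a R x * ρ₀ x) ≤ C * (R ^ N)⁻¹) →
      ∃ C₀ : ℝ → ℝ, IsTimeConstant C₀ ∧
        ∀ M : ℝ, ∀ᶠ R : ℝ in atTop, ∀ ν : ℝ, 0 ≤ ν → ν ≤ M →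
          ∀ ρ : ℝ → L2Scalar d, IsWeakSolution σ₁ σ₂ ν ρ₀ T ρ →
            IsControlled σ₂ ρ₀ T K ρ → ∀ t ∈ Icc 0 T,
              tailEnergy a ν R ρ t
                ≤ (C + C₀ t * t * (ν + 1) ^ 2) * (R ^ N)⁻¹ * Real.exp (C₀ t * t)) := by
  obtain ⟨L, B, hL, hB, hLB⟩ := exists_uniform_bounds hd ha hρ₀' hT σ₁ σ₂ K
  have hF : ∀ ν, 0 ≤ ν → ∀ ρ : ℝ → L2Scalar d,
      (IsWeakSolution σ₁ σ₂ ν ρ₀ T ρ ∧ IsControlled σ₂ ρ₀ T K ρ) →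
      IsWeakSolution σ₁ σ₂ ν ρ₀ T ρ ∧ IsBoundedCurve L B (extendCurve hT ρ) :=
    fun ν hν ρ h => ⟨h.1, hLB ν hν ρ h.1 h.2⟩
  constructor
  · obtain ⟨b, c, hb, hc, h⟩ := exists_tailEnergy_le hd ha hT hL hB hF
    -- One constant dominates both the source and the exponent; the summand `1` makes it positive.
    refine ⟨fun _ => b + c + 1, isTimeConstant_const (by positivity),
      fun ν hν ρ hρ hK R hR t ht => (h ν hν ρ ⟨hρ, hK⟩ R hR t ht).trans ?_⟩
    have ht0 := ht.1
    have h0 := l2NormSq_nonneg fun x => tailCutoff a R x * ρ₀ x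
    calc _ ≤ (l2NormSq (fun x => tailCutoff a R x * ρ₀ x)
          + (b + c + 1) * (ν + 1) * (R ^ 2)⁻¹ * t) * Real.exp ((b + c + 1) * t) := by
          gcongr <;> linarith
      _ = _ := by ring
  · intro N hN C h₀
    -- The hypothesis itself forces this, since it holds for some positive `R`.
    have hC : 0 ≤ C := by
      obtain ⟨R, hR, hR0⟩ := (h₀.and (eventually_gt_atTop 0)).exists
      exact nonneg_of_mul_nonneg_left ((l2NormSq_nonneg _).trans hR) (by positivity)
    -- Decay of order `N - 1` is enough, as the energy estimate gains the last power. Using that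
    -- estimate once more, and not only the decay of order `N`, keeps the constant `C` of the
    -- initial tail intact and includes the dissipation.
    obtain ⟨D, hD, h⟩ := exists_tail_decay hd ha hT hL hB hF hC h₀ (Nat.sub_le N 1)
    obtain ⟨D', hD', h'⟩ := exists_tailEnergy_le_of_decay hd ha hT hL hB hF hD h
    rw [Nat.sub_add_cancel (by omega)] at h'
    set c := (|σ₁| + 2 * |σ₂|) * B with hc
    have hc0 : 0 ≤ c := by positivity
    refine ⟨fun _ => D' + c + 1, isTimeConstant_const (by positivity), fun M => ?_⟩
    filter_upwards [h' M, h₀, eventually_gt_atTop 0] with R h1 h2 hR ν hν hνM ρ hρ hK t ht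
    refine (h1 ν hν hνM ρ ⟨hρ, hK⟩ t ht).trans ?_
    have ht0 := ht.1
    -- The bound obtained is uniform in `ν` once `R ≥ M`, so the factor `(ν + 1) ^ 2` is merely
    -- inserted.
    have hν1 : D' * 1 ≤ (D' + c + 1) * (ν + 1) ^ 2 :=
      mul_le_mul (by linarith) (one_le_pow₀ (by linarith)) zero_le_one (by positivity)
    calc _ ≤ (C * (R ^ N)⁻¹ + (D' + c + 1) * (ν + 1) ^ 2 * (R ^ N)⁻¹ * t)
          * Real.exp ((D' + c + 1) * t) := by
          gcongr <;> linarith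
      _ = _ := by ring
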